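/- **Setting.** Let $n\ge 2$, $\varrho>0$, $\mathbb T^{n-1}=\mathbb R^{n-1}/2\pi\mathbb Z^{n-1}$. Put $B_r=\{(y,z_2)\in\mathbb C^{n-1}\times\mathbb C: |\mathrm{Re}(y,z_2)|\le r,\ |\mathrm{Im}\,y_i|\le r,\ |\mathrm{Im}\,z_2|\le r\}$. Let $H_0(y,z_2)$ be analytic on $B_{3\varrho}$ and let $H_1(x,y,z)$, $z=(z_1,z_2)$, be analytic for $|\mathrm{Im}\,x_j|\le 3\varrho$, $|\mathrm{Im}\,z_1|\le 3\varrho$, $(y,z_2)\in B_{3\varrho}$, and $2\pi$-periodic in each $x_j$ and in $z_1$; assume both are bounded on these sets. Let $\omega\in\mathbb R^{n-1}$ satisfy $\nabla_yH_0(0,0)=\omega$, $\partial_{z_2}H_0(0,0)=0$, and the Diophantine condition $\omega\cdot s\neq0$, $|\omega\cdot s|^{-1}\le c_0|s|^{n}$ for all $s\in\mathbb Z^{n-1}\setminus\{0\}$, for some constant $c_0$. Put $H=H_0+\varepsilon H_1$ with $\varepsilon\in\mathbb R$, $S_0=\partial_y^2H_0(0,0)$, $t_0=\nabla_y\partial_{z_2}H_0(0,0)$,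 $K_0=S_0-t_0\otimes t_0$, $J=\begin{pmatrix}0&1\\-1&0\end{pmatrix}$, $\Omega=\mathrm{diag}(-k,1)$, $e_1=(1,0)^\top$, $\partial=\omega\cdot\nabla_\xi$, and $\overline f=(2\pi)^{1-n}\int_{\mathbb T^{n-1}}f\,d\xi$. The parameters $(\alpha,k)$ range over $\Sigma_\varrho=\{(\alpha,k)\in\mathbb C^2:|\mathrm{Im}\,\alpha|\le\varrho,\ \mathrm{Re}\,k\in[0,1],\ |\mathrm{Im}\,k|\le\varrho\}$. For $s\in[0,1]$ and an integer $d\ge0$ let $\mathcal A_{s,d}$ be the space of $2\pi$-periodic functions on the closed strip $\{|\mathrm{Im}\,\xi_j|\le s\varrho,\ 1\le j\le n-1\}\subset\mathbb C^{n-1}$ that are holomorphic in its interior and whose partial derivatives of order at most $d$ are continuous on the closed strip (for $s=0$: the $C^d$ functions on $\mathbb T^{n-1}$), with the norm $\|f\|_{s,d}=\max_{|j|\le d}\sup|\partial^jf|$; norms of tuples are maxima of the norms of the components. **Coefficients.** For $\varphi=(\beta,\varphi_0,u,w,W_{11},W_{12},W_{21})\in\mathbb C^{n-1}\times\mathcal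 A_{\sigma,d}\times\mathcal A_{\sigma,d}^{n-1}\times\mathcal A_{\sigma,d}^2\times\mathcal A_{\sigma,d}^3$ put $(u')_{ij}=\partial_{\xi_j}u_i$, $V=(I+u')^{-\top}$, $v=\beta+V(\nabla\varphi_0-w_2\nabla w_1)$, $W=(W_{ab})$ with $W_{22}=(1+W_{12}W_{21})/W_{11}$, $\Lambda=-V(w')^\top JW$, $R_i=-\sum_kV_{ik}(\partial_{\xi_k}W^\top)JW$. All derivatives of $H$ are evaluated at $(\xi+u,v,w)$; $(G_{zy})_{pj}=\partial^2G/\partial z_p\partial y_j$, and similarly for $G_{yy}$, $G_{zz}$. Put $$Z=W^\top H_{zy}+\Lambda^\top H_{yy},\qquad T=ZV,\qquad S=V^\top H_{yy}V,$$ and, for a function $G$, $$\mathcal Q[G]=\sum_i\tfrac{\partial G}{\partial y_i}R_i+\Lambda^\top G_{yy}\Lambda+W^\top G_{zy}\Lambda+(W^\top G_{zy}\Lambda)^\top+W^\top G_{zz}W .$$ With $(R_{(i)})_{lq}=(R_l)_{iq}$, define the symmetric $2\times2$ matrices $$U_{ij}=(Te_j)(Je_i)^\top+(Je_i)(Te_j)^\top,\qquad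 E_i=\sum_lV_{li}\,\mathcal Q[\partial_{y_l}H],$$ $$K_i=ZR_{(i)}+(ZR_{(i)})^\top+\sum_l\Lambda_{li}\,\mathcal Q[\partial_{y_l}H]+\sum_pW_{pi}\,\mathcal Q[\partial_{z_p}H].$$ (These are the coefficients of $\partial_{\xi_j}\lambda_i$, $\mu_i$, $\lambda_i$ in the linearization at $\varphi$ of the quadratic form $\mathcal Q[H]$.) Let $\varphi_0(\alpha)=(0,0,0,\alpha e_1,1,0,0)$. **Approximate linear problem.** Given $F=(F_1,F_2,F_3,F_4,f_5)$, find $(\psi_0,\lambda,\chi,\Gamma,\delta\beta,q,p,\delta M)$ such that, with $\mu=\nabla\psi_0+\delta\beta$ and $\delta\mathbf M=\mathrm{diag}(\delta M,0)$, $$\partial\psi_0+q+p(w_1-\alpha)+\tfrac12\delta M(w_1-\alpha)^2=F_1,$$ $$J\partial\lambda+\Omega\lambda+T\mu+pW^\top e_1+\delta M(w_1-\alpha)W^\top e_1=F_2,$$ $$-\partial\chi+S\mu+T^\top\lambda=F_3,$$ $$\partial(J\Gamma)+\Omega\Gamma+(\Omega\Gamma)^\top+\sum_{i,j}U_{ij}\,\partial_{\xi_j}\lambda_i+\sum_i\mu_iE_i+\sum_i\lambda_iK_i+W^\top\delta\mathbf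 M\,W=F_4,\qquad\Gamma_{11}=-\Gamma_{22},$$ $$\overline{(W\lambda)_1+\chi\cdot\nabla w_1}=f_5,\quad\overline{\psi_0-\delta\beta\cdot u+w_2(W\lambda)_1}=0,\quad\overline{V^{-\top}\chi}=0,\quad\overline{(W\Gamma)_{12}}=0.\qquad(\ast)$$ Solutions are classical: $\psi_0,\lambda,\chi,\Gamma$ are $C^1$ on $\mathbb T^{n-1}$ (automatic if they are analytic in a strip of positive width), and the differential equations hold on $\mathbb T^{n-1}$ and in the interior of the strip under consideration. **Theorem.** Let $\sigma\in[1/4,1]$ and $d\ge2$ be fixed and assume $\det K_0\ne0$. Then there are $c>0$, $\varepsilon_0>0$ and $r_0>0$ with the following property. For all real $|\varepsilon|\le\varepsilon_0$, all $(\alpha,k)\in\Sigma_\varrho$, all $\varphi$ as above with $\|\varphi-\varphi_0(\alpha)\|_{\sigma,d}\le r_0$, all $\sigma_0,\sigma_1$ with $0\le\sigma_0<\sigma_1\le\sigma$ and $\sigma_1\ge1/4$, and all $F=(F_1,F_2,F_3,F_4,f_5)\in\mathcal A_{\sigma_1,0}\times\mathcal A_{\sigma_1,0}^2\times\mathcal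 A_{\sigma_1,0}^{n-1}\times\mathcal A_{\sigma_1,0}^4\times\mathbb C$ with $F_4$ symmetric, problem $(\ast)$ has a unique solution $$(\psi_0,\lambda,\chi,\Gamma,\delta\beta,q,p,\delta M)\in\mathcal A_{\sigma_0,0}\times\mathcal A_{\sigma_0,0}^2\times\mathcal A_{\sigma_0,0}^{n-1}\times\mathcal A_{\sigma_0,0}^4\times\mathbb C^{n-1}\times\mathbb C^3,$$ and this solution satisfies $$\|(\psi_0,\lambda,\chi,\Gamma)\|_{\sigma_0,0}+|(\delta\beta,q,p,\delta M)|\le c\,(\sigma_1-\sigma_0)^{-8n-12}\,\|F\|_{\sigma_1,0}.$$ In particular $c$ does not depend on $\varepsilon,\alpha,k,\varphi,\sigma_0,\sigma_1,F$, nor on how small $\varepsilon_0,r_0$ are chosen. -/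

import Mathlib

open scoped ENNReal Matrix

noncomputable section

namespace LowDimTori

/-! ## Periodic analytic functions on complex strips -/

/-- Scalar functions of `m` complex angle variables (only the values on a strip matter). -/
abbrev CFun (m : ℕ) := (Fin m → ℂ) → ℂ

/-- The closed strip `|Im ξ_j| ≤ r`; for `r = 0` it is the real torus (its universal cover). -/
def strip (m : ℕ) (r : ℝ) : Set (Fin m → ℂ) := {ξ | ∀ j, |(ξ j).im| ≤ r}

/-- The open strip `|Im ξ_j| < r`. -/
def openStrip (m : ℕ) (r : ℝ) : Set (Fin m → ℂ) := {ξ | ∀ j, |(ξ j).im| < r}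

variable {m : ℕ}

/-- `∂f/∂ξ_j`, taken along the real direction `e_j`. This makes sense at every point of a closed
strip (real translations preserve it), and is the complex partial derivative wherever `f` is
holomorphic. -/
def pd (j : Fin m) (f : CFun m) : CFun m := fun ξ => lineDeriv ℝ f ξ (Pi.single j 1)

/-- Iterated partial derivative along a list of coordinate directions. -/
def iterPd : List (Fin m) → CFun m → CFun m
  | [], f => f
  | j :: l, f => pd j (iterPd l f)

/-- The derivative `ω · ∇_ξ` in the direction of the frequency vector. -/
def dirD (ω : Fin m → ℝ) (f : CFun m) : CFun m := fun ξ => ∑ j, (ω j : ℂ) * pd j f ξ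

/-- Membership in the space of `2π`-periodic functions on the closed strip of half-width `r` that
are holomorphic inside and whose partial derivatives up to order `d` exist and are continuous on
the closed strip. For `r = 0` these are the `C^d` functions on the torus. -/
structure MemA (r : ℝ) (d : ℕ) (f : CFun m) : Prop where
  periodic : ∀ ξ ∈ strip m r, ∀ j, f (ξ + Pi.single j ((2 * Real.pi : ℝ) : ℂ)) = f ξ
  holomorphic : DifferentiableOn ℂ f (openStrip m r)
  differentiable : ∀ l : List (Fin m), l.length < d → ∀ ξ ∈ strip m r, ∀ j,
    LineDifferentiableAt ℝ (iterPd l f) ξ (Pi.single j 1)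
  continuous : ∀ l : List (Fin m), l.length ≤ d → ContinuousOn (iterPd l f) (strip m r)

/-- The norm `max_{|k| ≤ d} sup |∂^k f|` over the closed strip. -/
def normA (r : ℝ) (d : ℕ) (f : CFun m) : ℝ≥0∞ :=
  ⨆ (l : List (Fin m)) (_ : l.length ≤ d) (ξ : Fin m → ℂ) (_ : ξ ∈ strip m r), ‖iterPd l f ξ‖ₑ

/-- The mean value `(2π)^{-m} ∫_{𝕋^m} f dξ`. -/
def mean (f : CFun m) : ℂ :=
  (((2 * Real.pi) ^ m : ℝ) : ℂ)⁻¹ *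
    ∫ x in Set.Icc (0 : Fin m → ℝ) (fun _ => 2 * Real.pi), f (fun j => (x j : ℂ))

/-! ## The Hamiltonian -/

/-- Points `(x, y, z)`. The indices `0, 1 : Fin 2` stand for the components `z_1, z_2`. -/
abbrev Phase (m : ℕ) := (Fin m → ℂ) × (Fin m → ℂ) × (Fin 2 → ℂ)

/-- The complex ball of the variables `(y, z_2)`. -/
def ballB (m : ℕ) (r : ℝ) : Set ((Fin m → ℂ) × ℂ) :=
  {p | Real.sqrt ((∑ i, (p.1 i).re ^ 2) + p.2.re ^ 2) ≤ r ∧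
    (∀ i, |(p.1 i).im| ≤ r) ∧ |p.2.im| ≤ r}

/-- The product of the strip of the angles `(x, z_1)` and the ball of the variables `(y, z_2)`. -/
def phaseDomain (m : ℕ) (r : ℝ) : Set (Phase m) :=
  {P | (∀ j, |(P.1 j).im| ≤ r) ∧ |(P.2.2 0).im| ≤ r ∧ (P.2.1, P.2.2 1) ∈ ballB m r}

/-- Condition (H.1): analyticity, periodicity and boundedness. -/
structure CondH1 (ρ : ℝ) (H₀ : (Fin m → ℂ) × ℂ → ℂ) (H₁ : Phase m → ℂ) : Prop where
  analytic₀ : AnalyticOnNhd ℂ H₀ (ballB m (3 * ρ))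
  analytic₁ : AnalyticOnNhd ℂ H₁ (phaseDomain m (3 * ρ))
  periodic_x : ∀ P ∈ phaseDomain m (3 * ρ), ∀ j,
    H₁ (P.1 + Pi.single j ((2 * Real.pi : ℝ) : ℂ), P.2) = H₁ P
  periodic_z : ∀ P ∈ phaseDomain m (3 * ρ),
    H₁ (P.1, P.2.1, P.2.2 + Pi.single 0 ((2 * Real.pi : ℝ) : ℂ)) = H₁ P
  bounded : ∃ c : ℝ, (∀ p ∈ ballB m (3 * ρ), ‖H₀ p‖ ≤ c) ∧
    (∀ P ∈ phaseDomain m (3 * ρ), ‖H₁ P‖ ≤ c)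

/-- Condition (H.2), with `m = n - 1`: the frequencies are those of the unperturbed torus and
satisfy the Diophantine condition `|ω·s|⁻¹ ≤ c₀ |s|^n` (with `ω·s ≠ 0`) for integer `s ≠ 0`. -/
structure CondH2 (ω : Fin m → ℝ) (H₀ : (Fin m → ℂ) × ℂ → ℂ) : Prop where
  grad_y : ∀ i, lineDeriv ℂ H₀ (0, 0) (Pi.single i 1, 0) = (ω i : ℂ)
  grad_z : lineDeriv ℂ H₀ (0, 0) (0, 1) = 0
  diophantine : ∃ c₀ : ℝ, ∀ s : Fin m → ℤ, s ≠ 0 →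
    (∑ i, ω i * (s i : ℝ)) ≠ 0 ∧
    |∑ i, ω i * (s i : ℝ)|⁻¹ ≤ c₀ * Real.sqrt (∑ i, (s i : ℝ) ^ 2) ^ (m + 1)

/-- `S₀ = ∂²H₀/∂y²(0,0)`. -/
def S₀ (H₀ : (Fin m → ℂ) × ℂ → ℂ) : Matrix (Fin m) (Fin m) ℂ :=
  Matrix.of fun i j =>
    lineDeriv ℂ (fun p => lineDeriv ℂ H₀ p (Pi.single j 1, 0)) (0, 0) (Pi.single i 1, 0)

/-- `t₀ = ∇_y ∂H₀/∂z₂ (0,0)`. -/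
def t₀ (H₀ : (Fin m → ℂ) × ℂ → ℂ) : Fin m → ℂ := fun i =>
  lineDeriv ℂ (fun p => lineDeriv ℂ H₀ p (0, 1)) (0, 0) (Pi.single i 1, 0)

/-- `K₀ = S₀ - t₀ ⊗ t₀`. -/
def K₀ (H₀ : (Fin m → ℂ) × ℂ → ℂ) : Matrix (Fin m) (Fin m) ℂ :=
  S₀ H₀ - Matrix.vecMulVec (t₀ H₀) (t₀ H₀)

/-- `H(x, y, z) = H₀(y, z₂) + ε H₁(x, y, z)`. -/
def hamiltonian (H₀ : (Fin m → ℂ) × ℂ → ℂ) (H₁ : Phase m → ℂ) (ε : ℝ) : Phase m → ℂ :=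
  fun P => H₀ (P.2.1, P.2.2 1) + (ε : ℂ) * H₁ P

/-- The direction of `y_i` in the phase space. -/
def eY (i : Fin m) : Phase m := (0, Pi.single i 1, 0)

/-- The direction of `z_p` in the phase space. -/
def eZ (p : Fin 2) : Phase m := (0, 0, Pi.single p 1)

/-- Derivative of a function on the phase space along `e`. -/
def phD (G : Phase m → ℂ) (e : Phase m) : Phase m → ℂ := fun P => lineDeriv ℂ G P e

/-- `(∂²G/∂y²)_{ij} = ∂²G/∂y_i∂y_j`. -/
def hessYY (G : Phase m → ℂ) (P : Phase m) : Matrix (Fin m) (Fin m) ℂ :=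
  Matrix.of fun i j => phD (phD G (eY j)) (eY i) P

/-- `(∂²G/∂z∂y)_{pj} = ∂²G/∂z_p∂y_j`. -/
def hessZY (G : Phase m → ℂ) (P : Phase m) : Matrix (Fin 2) (Fin m) ℂ :=
  Matrix.of fun p j => phD (phD G (eY j)) (eZ p) P

/-- `(∂²G/∂z²)_{pq} = ∂²G/∂z_p∂z_q`. -/
def hessZZ (G : Phase m → ℂ) (P : Phase m) : Matrix (Fin 2) (Fin 2) ℂ :=
  Matrix.of fun p q => phD (phD G (eZ q)) (eZ p) P

/-! ## Coordinates of canonical maps and the coefficients they generate -/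

/-- The coordinate vector `φ = (β, φ₀, u, w, W₁₁, W₁₂, W₂₁)`. -/
structure Coord (m : ℕ) where
  β : Fin m → ℂ
  φ₀ : CFun m
  u : Fin m → CFun m
  w : Fin 2 → CFun m
  W₁₁ : CFun m
  W₁₂ : CFun m
  W₂₁ : CFun m

/-- `φ₀(α) = (0, 0, 0, α e₁, 1, 0, 0)`. -/
def Coord.flat (α : ℂ) : Coord m where
  β := 0
  φ₀ := 0
  u := 0
  w := ![fun _ => α, fun _ => 0]
  W₁₁ := fun _ => 1
  W₁₂ := 0
  W₂₁ := 0

/-- Difference of coordinate vectors, componentwise. -/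
def Coord.sub (φ φ' : Coord m) : Coord m where
  β := φ.β - φ'.β
  φ₀ := φ.φ₀ - φ'.φ₀
  u := φ.u - φ'.u
  w := φ.w - φ'.w
  W₁₁ := φ.W₁₁ - φ'.W₁₁
  W₁₂ := φ.W₁₂ - φ'.W₁₂
  W₂₁ := φ.W₂₁ - φ'.W₂₁

/-- All functional components of `φ` belong to the space of analytic functions. -/
structure Coord.Mem (r : ℝ) (d : ℕ) (φ : Coord m) : Prop where
  φ₀ : MemA r d φ.φ₀
  u : ∀ i, MemA r d (φ.u i)
  w : ∀ p, MemA r d (φ.w p)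
  W₁₁ : MemA r d φ.W₁₁
  W₁₂ : MemA r d φ.W₁₂
  W₂₁ : MemA r d φ.W₂₁

/-- The norm of a coordinate vector: the maximum of the norms of its components. -/
def Coord.norm (r : ℝ) (d : ℕ) (φ : Coord m) : ℝ≥0∞ :=
  (⨆ i, ‖φ.β i‖ₑ) ⊔ normA r d φ.φ₀ ⊔ (⨆ i, normA r d (φ.u i)) ⊔ (⨆ p, normA r d (φ.w p)) ⊔
    normA r d φ.W₁₁ ⊔ normA r d φ.W₁₂ ⊔ normA r d φ.W₂₁

/-- The symplectic matrix `J`. -/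
def J : Matrix (Fin 2) (Fin 2) ℂ := !![0, 1; -1, 0]

/-- `Ω = diag(-k, 1)`. -/
def Om (k : ℂ) : Matrix (Fin 2) (Fin 2) ℂ := !![-k, 0; 0, 1]

/-- `e₁ ∈ ℂ²`. -/
def e₁ : Fin 2 → ℂ := ![1, 0]

/-- The Jacobian `(u')_{ij} = ∂u_i/∂ξ_j`. -/
def Coord.jacU (φ : Coord m) (ξ : Fin m → ℂ) : Matrix (Fin m) (Fin m) ℂ :=
  Matrix.of fun i j => pd j (φ.u i) ξ

/-- `V = (I + u')^{-⊤}`. -/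
def Coord.V (φ : Coord m) (ξ : Fin m → ℂ) : Matrix (Fin m) (Fin m) ℂ := ((1 + φ.jacU ξ)⁻¹)ᵀ

/-- The matrix `W`, with `W₂₂` fixed by `det W = 1`. -/
def Coord.W (φ : Coord m) (ξ : Fin m → ℂ) : Matrix (Fin 2) (Fin 2) ℂ :=
  !![φ.W₁₁ ξ, φ.W₁₂ ξ; φ.W₂₁ ξ, (1 + φ.W₁₂ ξ * φ.W₂₁ ξ) / φ.W₁₁ ξ]

/-- `v = β + V (∇φ₀ - w₂ ∇w₁)`. -/
def Coord.v (φ : Coord m) (ξ : Fin m → ℂ) : Fin m → ℂ :=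
  φ.β + φ.V ξ *ᵥ (fun i => pd i φ.φ₀ ξ - φ.w 1 ξ * pd i (φ.w 0) ξ)

/-- `Λ = -V (w')^⊤ J W`. -/
def Coord.Lam (φ : Coord m) (ξ : Fin m → ℂ) : Matrix (Fin m) (Fin 2) ℂ :=
  -(φ.V ξ * (Matrix.of fun i p => pd i (φ.w p) ξ) * J * φ.W ξ)

/-- `R_i = -V_{ik} (∂W^⊤/∂ξ_k) J W`. -/
def Coord.R (φ : Coord m) (i : Fin m) (ξ : Fin m → ℂ) : Matrix (Fin 2) (Fin 2) ℂ :=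
  -∑ k, φ.V ξ i k • ((Matrix.of fun a b => pd k (fun η => φ.W η b a) ξ) * J * φ.W ξ)

/-- The point `(ξ + u, v, w)` of the embedded torus. -/
def Coord.point (φ : Coord m) (ξ : Fin m → ℂ) : Phase m :=
  (fun i => ξ i + φ.u i ξ, φ.v ξ, fun p => φ.w p ξ)

section Coefficients

variable (H : Phase m → ℂ) (φ : Coord m) (ξ : Fin m → ℂ)

/-- `S = V^⊤ (∂²H/∂y²) V`. -/
def coefS : Matrix (Fin m) (Fin m) ℂ := (φ.V ξ)ᵀ * hessYY H (φ.point ξ) * φ.V ξ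

/-- `Z = W^⊤ (∂²H/∂z∂y) + Λ^⊤ (∂²H/∂y²)`. -/
def coefZ : Matrix (Fin 2) (Fin m) ℂ :=
  (φ.W ξ)ᵀ * hessZY H (φ.point ξ) + (φ.Lam ξ)ᵀ * hessYY H (φ.point ξ)

/-- `T = W^⊤ (∂²H/∂z∂y) V + Λ^⊤ (∂²H/∂y²) V`. -/
def coefT : Matrix (Fin 2) (Fin m) ℂ := coefZ H φ ξ * φ.V ξ

/-- The matrix of the quadratic form in `ζ` of the function `G` composed with the canonical map:
`(∂G/∂y_i) R_i + Λ^⊤ G_yy Λ + W^⊤ G_zy Λ + (W^⊤ G_zy Λ)^⊤ + W^⊤ G_zz W`. -/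
def quadForm (G : Phase m → ℂ) : Matrix (Fin 2) (Fin 2) ℂ :=
  (∑ i, phD G (eY i) (φ.point ξ) • φ.R i ξ)
    + (φ.Lam ξ)ᵀ * hessYY G (φ.point ξ) * φ.Lam ξ
    + (φ.W ξ)ᵀ * hessZY G (φ.point ξ) * φ.Lam ξ
    + ((φ.W ξ)ᵀ * hessZY G (φ.point ξ) * φ.Lam ξ)ᵀ
    + (φ.W ξ)ᵀ * hessZZ G (φ.point ξ) * φ.W ξ

/-- The coefficient `U_{ij}` of `∂λ_i/∂ξ_j` in the linearization of the quadratic form: the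
expression `T ∇(Jλ) + (T ∇(Jλ))^⊤` equals `∑ U_{ij} ∂λ_i/∂ξ_j`. -/
def coefU (i : Fin 2) (j : Fin m) : Matrix (Fin 2) (Fin 2) ℂ :=
  (Matrix.of fun a b => coefT H φ ξ a j * J b i)
    + (Matrix.of fun a b => coefT H φ ξ a j * J b i)ᵀ

/-- The coefficient `E_i` of `μ_i` in the linearization of the quadratic form: since
`δy = V μ + ⋯`, it is `V_{li}` times the quadratic form of `∂H/∂y_l`, summed over `l`. -/
def coefE (i : Fin m) : Matrix (Fin 2) (Fin 2) ℂ :=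
  ∑ l, φ.V ξ l i • quadForm φ ξ (phD H (eY l))

/-- The coefficient `K_i` of `λ_i` in the linearization of the quadratic form: the contributions
of `δΛ = λ^⊤ R + ⋯` and of `δy = Λ λ + ⋯`, `δz = W λ + ⋯`. -/
def coefK (i : Fin 2) : Matrix (Fin 2) (Fin 2) ℂ :=
  coefZ H φ ξ * (Matrix.of fun l q => φ.R l ξ i q)
    + (coefZ H φ ξ * (Matrix.of fun l q => φ.R l ξ i q))ᵀ
    + (∑ l, φ.Lam ξ l i • quadForm φ ξ (phD H (eY l)))
    + (∑ p, φ.W ξ p i • quadForm φ ξ (phD H (eZ p)))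

end Coefficients

/-! ## The approximate linear problem -/

/-- Right-hand sides `F = (F₁, F₂, F₃, F₄, f₅)`. -/
structure Rhs (m : ℕ) where
  F₁ : CFun m
  F₂ : Fin 2 → CFun m
  F₃ : Fin m → CFun m
  F₄ : Fin 2 → Fin 2 → CFun m
  f₅ : ℂ

/-- Membership in the space `F_{σ,d}` (strip of half-width `r`): analytic components, `F₄`
symmetric. -/
structure Rhs.Mem (r : ℝ) (d : ℕ) (F : Rhs m) : Prop where
  F₁ : MemA r d F.F₁
  F₂ : ∀ p, MemA r d (F.F₂ p)
  F₃ : ∀ i, MemA r d (F.F₃ i)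
  F₄ : ∀ a b, MemA r d (F.F₄ a b)
  symm : ∀ ξ ∈ strip m r, ∀ a b, F.F₄ a b ξ = F.F₄ b a ξ

/-- The norm of a right-hand side: the maximum of the norms of its components. -/
def Rhs.norm (r : ℝ) (d : ℕ) (F : Rhs m) : ℝ≥0∞ :=
  normA r d F.F₁ ⊔ (⨆ p, normA r d (F.F₂ p)) ⊔ (⨆ i, normA r d (F.F₃ i)) ⊔
    (⨆ a, ⨆ b, normA r d (F.F₄ a b)) ⊔ ‖F.f₅‖ₑ

/-- The unknowns `(ψ₀, λ, χ, Γ, δβ, q, p, δM)`. -/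
structure Unknown (m : ℕ) where
  ψ₀ : CFun m
  lam : Fin 2 → CFun m
  χ : Fin m → CFun m
  Γ : Fin 2 → Fin 2 → CFun m
  δβ : Fin m → ℂ
  q : ℂ
  p : ℂ
  δM : ℂ

/-- The functional components belong to the space of analytic functions. -/
structure Unknown.Mem (r : ℝ) (d : ℕ) (X : Unknown m) : Prop where
  ψ₀ : MemA r d X.ψ₀
  lam : ∀ i, MemA r d (X.lam i)
  χ : ∀ i, MemA r d (X.χ i)
  Γ : ∀ a b, MemA r d (X.Γ a b)

/-- `‖(ψ₀, λ, χ, Γ)‖`, the maximum of the norms of the components. -/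
def Unknown.funNorm (r : ℝ) (d : ℕ) (X : Unknown m) : ℝ≥0∞ :=
  normA r d X.ψ₀ ⊔ (⨆ i, normA r d (X.lam i)) ⊔ (⨆ i, normA r d (X.χ i)) ⊔
    (⨆ a, ⨆ b, normA r d (X.Γ a b))

/-- `|(δβ, q, p, δM)|`, the maximum of the moduli of the components. -/
def Unknown.constNorm (X : Unknown m) : ℝ≥0∞ :=
  (⨆ i, ‖X.δβ i‖ₑ) ⊔ ‖X.q‖ₑ ⊔ ‖X.p‖ₑ ⊔ ‖X.δM‖ₑ

/-- Two unknowns coincide as elements of the space over the closed strip of half-width `r`. -/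
structure Unknown.EqOn (r : ℝ) (X Y : Unknown m) : Prop where
  ψ₀ : Set.EqOn X.ψ₀ Y.ψ₀ (strip m r)
  lam : ∀ i, Set.EqOn (X.lam i) (Y.lam i) (strip m r)
  χ : ∀ i, Set.EqOn (X.χ i) (Y.χ i) (strip m r)
  Γ : ∀ a b, Set.EqOn (X.Γ a b) (Y.Γ a b) (strip m r)
  δβ : X.δβ = Y.δβ
  q : X.q = Y.q
  p : X.p = Y.p
  δM : X.δM = Y.δM

/-- The vector `λ(ξ)`. -/
def Unknown.lamAt (X : Unknown m) (ξ : Fin m → ℂ) : Fin 2 → ℂ := fun i => X.lam i ξ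

/-- The vector `χ(ξ)`. -/
def Unknown.χAt (X : Unknown m) (ξ : Fin m → ℂ) : Fin m → ℂ := fun i => X.χ i ξ

/-- The matrix `Γ(ξ)`. -/
def Unknown.ΓAt (X : Unknown m) (ξ : Fin m → ℂ) : Matrix (Fin 2) (Fin 2) ℂ :=
  Matrix.of fun a b => X.Γ a b ξ

/-- `μ = ∇ψ₀ + δβ`. -/
def Unknown.μ (X : Unknown m) (ξ : Fin m → ℂ) : Fin m → ℂ := fun i => pd i X.ψ₀ ξ + X.δβ i

/-- `X` is a solution, over the strip of half-width `r`, of the approximate linear problem with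
right-hand side `F`. The unknown functions are analytic over the strip and `C¹` on the real torus
(the latter is automatic for `r > 0`); the differential equations hold at all points of the open
strip and of the real torus. -/
structure IsSolution (H : Phase m → ℂ) (ω : Fin m → ℝ) (α k : ℂ) (φ : Coord m) (F : Rhs m)
    (r : ℝ) (X : Unknown m) : Prop where
  mem : X.Mem r 0
  mem_C1 : X.Mem 0 1
  eq_a : ∀ ξ ∈ openStrip m r ∪ strip m 0,
    dirD ω X.ψ₀ ξ + X.q + X.p * (φ.w 0 ξ - α) + 1 / 2 * X.δM * (φ.w 0 ξ - α) ^ 2 = F.F₁ ξ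
  eq_b : ∀ ξ ∈ openStrip m r ∪ strip m 0,
    J *ᵥ (fun i => dirD ω (X.lam i) ξ) + Om k *ᵥ X.lamAt ξ + coefT H φ ξ *ᵥ X.μ ξ
      + X.p • ((φ.W ξ)ᵀ *ᵥ e₁) + (X.δM * (φ.w 0 ξ - α)) • ((φ.W ξ)ᵀ *ᵥ e₁)
      = fun i => F.F₂ i ξ
  eq_c : ∀ ξ ∈ openStrip m r ∪ strip m 0,
    -(fun i => dirD ω (X.χ i) ξ) + coefS H φ ξ *ᵥ X.μ ξ + (coefT H φ ξ)ᵀ *ᵥ X.lamAt ξ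
      = fun i => F.F₃ i ξ
  eq_d : ∀ ξ ∈ openStrip m r ∪ strip m 0,
    (Matrix.of fun a b => dirD ω (fun η => (J * X.ΓAt η) a b) ξ)
      + Om k * X.ΓAt ξ + (Om k * X.ΓAt ξ)ᵀ
      + (∑ i, ∑ j, pd j (X.lam i) ξ • coefU H φ ξ i j)
      + (∑ i, X.μ ξ i • coefE H φ ξ i) + (∑ i, X.lam i ξ • coefK H φ ξ i)
      + (φ.W ξ)ᵀ * !![X.δM, 0; 0, 0] * φ.W ξ
      = Matrix.of fun a b => F.F₄ a b ξ
  trace : ∀ ξ ∈ strip m r, X.Γ 0 0 ξ = -X.Γ 1 1 ξ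
  mean_w : mean (fun ξ => (φ.W ξ *ᵥ X.lamAt ξ) 0 + ∑ i, X.χ i ξ * pd i (φ.w 0) ξ) = F.f₅
  mean_ψ : mean (fun ξ =>
    X.ψ₀ ξ - (∑ i, X.δβ i * φ.u i ξ) + φ.w 1 ξ * (φ.W ξ *ᵥ X.lamAt ξ) 0) = 0
  mean_χ : ∀ i, mean (fun ξ => (((φ.V ξ)⁻¹)ᵀ *ᵥ X.χAt ξ) i) = 0
  mean_Γ : mean (fun ξ => (φ.W ξ * X.ΓAt ξ) 0 1) = 0

/-- The slab of parameters `(α, k)`: `|Im α| ≤ ρ`, `Re k ∈ [0,1]`, `|Im k| ≤ ρ`. -/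
def slab (ρ : ℝ) : Set (ℂ × ℂ) :=
  {f | |f.1.im| ≤ ρ ∧ f.2.re ∈ Set.Icc (0 : ℝ) 1 ∧ |f.2.im| ≤ ρ}

end LowDimTori

end

/-! The system is triangular: its differential equations determine ψ₀, then λ, then χ, then Γ. On a
Fourier mode e^{is·ξ} with s ≠ 0, write ν = ω·s and m = n − 1. Solving these equations with the
coupling terms moved to the right means dividing by ν for ψ₀, by ν² + k for λ, by ν for χ and by
ν(ν² + 4k) for Γ. Since Re k ≥ 0, the quadratic divisors have modulus at least ν². The Diophantine
condition therefore bounds every inverse by a power of |s|, uniformly in k down to k = 0. On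
functions analytic in a strip, a multiplier of growth |s|^a costs δ^{-(a+m/2)} when the half-width
shrinks by δ (`exists_multiplier`; the proof is a Bessel inequality on shifted tori and
Cauchy–Schwarz). With θ = (σ₁ − σ₀)^{-1/2}, the longest chain is ∇ψ₀, ∇λ, Γ. It costs θ^{15m+16},
which is less than the power in the theorem.

The zero modes are finite-dimensional. The free constants are δβ, p, δM and the mean a of λ₁; the
last one is free because the zero-mode divisor k may vanish. For the unperturbed torus, T has rows 0
and t₀, S = S₀, W = I and w₁ = α. The second λ equation then gives λ₂ = −t₀·δβ + known, so the
average of the χ equation is K₀ δβ = known; this is where det K₀ ≠ 0 enters. The condition with f₅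
gives a, the first λ equation gives p = k a + known, and the Γ equation gives δM.

Near that torus the coefficients differ from these constants by at most η (`Jet.eventually_bd`). If
N measures the free constants and M the right-hand side, one gets N ≤ B(M + ηN), and the last term
is absorbed for small η (`exists_const_bound`). This is done on the fixed strip of half-width ρ/4,
which lies in every admissible strip because σ₁ ≥ 1/4; so the required smallness does not depend on
σ₁ − σ₀. Once the constants are bounded by M, the chain is run again with the true loss of width
(`exists_bound`).

Existence is a dimension count. For any prescribed free constants the system can be solved up to
residual constants, which form a space of the same dimension (`Lin.Bd.exists_residual`). The pairs
(free, residual) occurring for zero data form a linear relation. By the a priori estimate a zero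
residual forces zero free constants, so every residual is attained and can be cancelled
(`Lin.Bd.exists_sol`). Uniqueness is the estimate applied to a difference of solutions.

The a priori analysis concerns C¹ solutions on the real torus, compared with holomorphic functions
through Fourier coefficients. The identity theorem (`eqOn_openStrip`) carries equations and
uniqueness to the strip. Uniformity of constants is organised by families: `UB` and `CB` assert one
constant for a whole index set, and they are applied to the family of all admissible problems at
once. -/

noncomputable section

namespace LowDimTori

open MeasureTheory Set Filter Topology
open scoped Pointwise

variable {m : ℕ}

/-! ## Fourier coefficients on the torus -/

/-- The real point `x` as a point of `ℂ^m`. -/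
def ofR (x : Fin m → ℝ) : Fin m → ℂ := fun j => (x j : ℂ)

lemma ofR_mem_strip (x : Fin m → ℝ) : ofR x ∈ strip m 0 := fun j => by simp [ofR]

lemma exists_ofR {ξ : Fin m → ℂ} (h : ξ ∈ strip m 0) : ∃ x, ξ = ofR x := by
  refine ⟨fun j => (ξ j).re, funext fun j => ?_⟩
  have : (ξ j).im = 0 := abs_nonpos_iff.mp (h j)
  exact Complex.ext (by simp [ofR]) (by simp [ofR, this])

lemma ofR_add (x y : Fin m → ℝ) : ofR (x + y) = ofR x + ofR y := by
  ext j; simp [ofR]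

lemma ofR_single (j : Fin m) (t : ℝ) : ofR (Pi.single j t) = Pi.single j (t : ℂ) := by
  ext i
  by_cases h : i = j
  · subst h; simp [ofR]
  · simp [ofR, h]

lemma continuous_ofR : Continuous (ofR (m := m)) :=
  continuous_pi fun j => Complex.continuous_ofReal.comp (continuous_apply j)

/-- Functions whose restriction to the real torus is well defined and continuous. -/
structure TorusCont (f : CFun m) : Prop where
  periodic : ∀ x j, f (ofR (x + Pi.single j (2 * Real.pi))) = f (ofR x)
  cont : Continuous fun x => f (ofR x)

namespace TorusCont

variable {f g : CFun m}

lemma const (c : ℂ) : TorusCont (fun _ : Fin m → ℂ => c) := ⟨fun _ _ => rfl, continuous_const⟩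

lemma add (hf : TorusCont f) (hg : TorusCont g) : TorusCont (fun ξ => f ξ + g ξ) :=
  ⟨fun x j => by rw [hf.periodic, hg.periodic], hf.cont.add hg.cont⟩

lemma mul (hf : TorusCont f) (hg : TorusCont g) : TorusCont (fun ξ => f ξ * g ξ) :=
  ⟨fun x j => by rw [hf.periodic, hg.periodic], hf.cont.mul hg.cont⟩

lemma const_mul (hf : TorusCont f) (c : ℂ) : TorusCont (fun ξ => c * f ξ) := (const c).mul hf

lemma neg (hf : TorusCont f) : TorusCont (fun ξ => -f ξ) :=
  ⟨fun x j => by rw [hf.periodic], hf.cont.neg⟩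

lemma sub (hf : TorusCont f) (hg : TorusCont g) : TorusCont (fun ξ => f ξ - g ξ) :=
  ⟨fun x j => by rw [hf.periodic, hg.periodic], hf.cont.sub hg.cont⟩

lemma sum {ι : Type*} {s : Finset ι} {f : ι → CFun m} (hf : ∀ i ∈ s, TorusCont (f i)) :
    TorusCont (fun ξ => ∑ i ∈ s, f i ξ) :=
  ⟨fun x j => Finset.sum_congr rfl fun i hi => (hf i hi).periodic x j,
    continuous_finsetSum _ fun i hi => (hf i hi).cont⟩

lemma periodic_int (hf : TorusCont f) (x : Fin m → ℝ) (k : Fin m → ℤ) :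
    f (ofR (fun j => x j + k j * (2 * Real.pi))) = f (ofR x) := by
  have one : ∀ (j : Fin m) (n : ℕ) (x : Fin m → ℝ),
      f (ofR (x + Pi.single j (n * (2 * Real.pi)))) = f (ofR x) := by
    intro j n
    induction n with
    | zero => intro x; simp
    | succ n ih =>
      intro x
      have : x + Pi.single j (((n + 1 : ℕ) : ℝ) * (2 * Real.pi))
          = (x + Pi.single j (n * (2 * Real.pi))) + Pi.single j (2 * Real.pi) := by
        rw [add_assoc, ← Pi.single_add]; push_cast; ring_nf
      rw [this, hf.periodic, ih]
  have onez : ∀ (j : Fin m) (n : ℤ) (x : Fin m → ℝ),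
      f (ofR (x + Pi.single j (n * (2 * Real.pi)))) = f (ofR x) := by
    intro j n x
    obtain ⟨k, rfl | rfl⟩ := n.eq_nat_or_neg
    · exact_mod_cast one j k x
    · have := one j k (x + Pi.single j (((-(k : ℤ) : ℤ) : ℝ) * (2 * Real.pi)))
      rw [add_assoc, ← Pi.single_add] at this
      simpa using this.symm
  have many : ∀ (s : Finset (Fin m)),
      f (ofR (x + ∑ j ∈ s, Pi.single j (k j * (2 * Real.pi)))) = f (ofR x) := by
    intro s
    induction s using Finset.induction_on with
    | empty => simp
    | insert a s ha ih =>
      rw [Finset.sum_insert ha, add_comm (Pi.single a _), ← add_assoc, onez, ih]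
  have := many Finset.univ
  rw [Finset.univ_sum_single (fun j => (k j : ℝ) * (2 * Real.pi))] at this
  exact this

end TorusCont

/-- The function on the unit torus obtained from a `2π`-periodic function. -/
def onTorus (f : CFun m) : UnitAddTorus (Fin m) → ℂ := fun t =>
  f (ofR fun j => 2 * Real.pi * (AddCircle.equivIoc 1 0 (t j) : ℝ))

lemma TorusCont.onTorus_coe {f : CFun m} (hf : TorusCont f) (y : Fin m → ℝ) :
    onTorus f (fun j => (y j : UnitAddCircle)) = f (ofR fun j => 2 * Real.pi * y j) := by
  have : ∀ j, ∃ k : ℤ, ((AddCircle.equivIoc 1 0 (y j : UnitAddCircle) : ℝ)) = y j + k := by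
    intro j
    have h : (((AddCircle.equivIoc 1 0 (y j : UnitAddCircle) : ℝ)) : UnitAddCircle) = y j :=
      AddCircle.coe_equivIoc
    rw [← sub_eq_zero, ← AddCircle.coe_sub, AddCircle.coe_eq_zero_iff] at h
    obtain ⟨n, hn⟩ := h
    exact ⟨n, by rw [zsmul_one] at hn; linarith⟩
  choose k hk using this
  rw [onTorus, ← hf.periodic_int (fun j => 2 * Real.pi * y j) k]
  congr 2
  funext j
  rw [hk]; ring

/-- The chosen representatives jump, so continuity is checked after composing with the open quotient
map from ℝ^m, where periodicity removes the choice. -/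
lemma TorusCont.continuous_onTorus {f : CFun m} (hf : TorusCont f) : Continuous (onTorus f) := by
  have hq : IsOpenQuotientMap (Pi.map fun (_ : Fin m) (y : ℝ) => (y : UnitAddCircle)) :=
    IsOpenQuotientMap.piMap fun _ => QuotientAddGroup.isOpenQuotientMap_mk
  rw [← hq.continuous_comp_iff]
  have : onTorus f ∘ (Pi.map fun (_ : Fin m) (y : ℝ) => (y : UnitAddCircle))
      = fun y => f (ofR fun j => 2 * Real.pi * y j) := by
    funext y; exact hf.onTorus_coe y
  rw [this]
  exact hf.cont.comp (by fun_prop)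

-- The circle carries its Haar probability measure, so that `mean` becomes an integral over the
-- torus without a normalizing factor.
local instance : MeasureSpace UnitAddCircle := ⟨AddCircle.haarAddCircle⟩

local instance : Measure.IsAddHaarMeasure (volume : Measure UnitAddCircle) :=
  inferInstanceAs (Measure.IsAddHaarMeasure AddCircle.haarAddCircle)

local instance : IsProbabilityMeasure (volume : Measure UnitAddCircle) :=
  inferInstanceAs (IsProbabilityMeasure AddCircle.haarAddCircle)

/-- Substitution x = 2πt; the half-open and the closed unit cube differ by a null set. -/
lemma TorusCont.mean_eq {f : CFun m} (hf : TorusCont f) : mean f = ∫ t, onTorus f t := by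
  rw [UnitAddTorus.integral_preimage (onTorus f) 0]
  simp_rw [hf.onTorus_coe]
  have hs : {x : Fin m → ℝ | ∀ i, x i ∈ Ioc ((0 : Fin m → ℝ) i) ((0 : Fin m → ℝ) i + 1)}
      =ᵐ[volume] Set.Icc (0 : Fin m → ℝ) (fun _ => 1) := by
    have : {x : Fin m → ℝ | ∀ i, x i ∈ Ioc ((0 : Fin m → ℝ) i) ((0 : Fin m → ℝ) i + 1)}
      = Set.univ.pi fun i => Ioc ((0 : Fin m → ℝ) i) ((fun _ => 1 : Fin m → ℝ) i) := by
      ext x; simp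
    rw [this]
    exact Measure.univ_pi_Ioc_ae_eq_Icc
  rw [setIntegral_congr_set hs, mean]
  have h2 : (0 : ℝ) < 2 * Real.pi := by positivity
  have key := Measure.setIntegral_comp_smul_of_pos (volume : Measure (Fin m → ℝ))
    (fun x => f (ofR x)) (Set.Icc (0 : Fin m → ℝ) (fun _ => 1)) h2
  have e1 : (2 * Real.pi) • (Set.Icc (0 : Fin m → ℝ) (fun _ => 1))
      = Set.Icc (0 : Fin m → ℝ) (fun _ => 2 * Real.pi) := by
    ext x
    rw [Set.mem_smul_set_iff_inv_smul_mem₀ h2.ne']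
    simp only [Set.mem_Icc, Pi.le_def, Pi.smul_apply, smul_eq_mul, Pi.zero_apply]
    refine and_congr (forall_congr' fun i => ?_) (forall_congr' fun i => ?_)
    · rw [inv_mul_eq_div, le_div_iff₀ h2, zero_mul]
    · rw [inv_mul_eq_div, div_le_one h2]
  rw [e1] at key
  have e2 : ∀ x : Fin m → ℝ, f (ofR fun j => 2 * Real.pi * x j) = f (ofR ((2 * Real.pi) • x)) :=
    fun x => rfl
  simp_rw [e2]
  rw [key]
  simp only [Module.finrank_fintype_fun_eq_card, Fintype.card_fin]
  rw [Complex.real_smul, Complex.ofReal_inv]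
  rfl


/-- The exponential `e^{i s·ξ}`. -/
def cexpo (s : Fin m → ℤ) : CFun m := fun ξ => Complex.exp (Complex.I * ∑ j, (s j : ℂ) * ξ j)

lemma cexpo_add (s : Fin m → ℤ) (ξ η : Fin m → ℂ) : cexpo s (ξ + η) = cexpo s ξ * cexpo s η := by
  simp only [cexpo, Pi.add_apply, ← Complex.exp_add, mul_add, Finset.sum_add_distrib]

lemma cexpo_add_index (s t : Fin m → ℤ) (ξ : Fin m → ℂ) :
    cexpo (s + t) ξ = cexpo s ξ * cexpo t ξ := by
  simp only [cexpo, Pi.add_apply, ← Complex.exp_add, ← mul_add, ← Finset.sum_add_distrib,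
    Int.cast_add, add_mul]

lemma cexpo_zero (ξ : Fin m → ℂ) : cexpo 0 ξ = 1 := by simp [cexpo]

lemma norm_cexpo (s : Fin m → ℤ) (ξ : Fin m → ℂ) :
    ‖cexpo s ξ‖ = Real.exp (-∑ j, (s j : ℝ) * (ξ j).im) := by
  rw [cexpo, Complex.norm_exp]
  congr 1
  simp [Complex.mul_re, Complex.im_sum, Complex.mul_im]

lemma cexpo_single (s : Fin m → ℤ) (j : Fin m) (t : ℂ) :
    cexpo s (Pi.single j t) = Complex.exp (Complex.I * (s j * t)) := by
  rw [cexpo, Finset.sum_eq_single j] <;> simp +contextual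

lemma cexpo_period (s : Fin m → ℤ) (ξ : Fin m → ℂ) (j : Fin m) :
    cexpo s (ξ + Pi.single j ((2 * Real.pi : ℝ) : ℂ)) = cexpo s ξ := by
  rw [cexpo_add, cexpo_single]
  have : Complex.I * (s j * ((2 * Real.pi : ℝ) : ℂ)) = s j * (2 * Real.pi * Complex.I) := by
    push_cast; ring
  rw [this, Complex.exp_int_mul_two_pi_mul_I, mul_one]

lemma continuous_cexpo (s : Fin m → ℤ) : Continuous (cexpo s) := by
  unfold cexpo; fun_prop

lemma TorusCont.cexpo (s : Fin m → ℤ) : TorusCont (cexpo (m := m) s) :=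
  ⟨fun x j => by rw [ofR_add, ofR_single, cexpo_period],
    (continuous_cexpo s).comp continuous_ofR⟩

/-- The Fourier coefficient `(2π)^{-m} ∫ f e^{-i s·ξ}`. -/
def fc (f : CFun m) (s : Fin m → ℤ) : ℂ := mean fun ξ => cexpo (-s) ξ * f ξ

lemma mean_congr {f g : CFun m} (h : ∀ ξ ∈ strip m 0, f ξ = g ξ) : mean f = mean g := by
  unfold mean
  congr 1
  refine integral_congr_ae (Eventually.of_forall fun x => h _ (ofR_mem_strip x))

lemma fc_congr {f g : CFun m} (h : ∀ ξ ∈ strip m 0, f ξ = g ξ) (s : Fin m → ℤ) :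
    fc f s = fc g s := mean_congr fun ξ hξ => by rw [h ξ hξ]

lemma fc_zero_index (f : CFun m) : fc f 0 = mean f := by
  simp [fc, cexpo_zero]

lemma mean_const_mul (c : ℂ) (f : CFun m) : mean (fun ξ => c * f ξ) = c * mean f := by
  unfold mean
  rw [integral_const_mul]; ring

lemma fc_const_mul (c : ℂ) (f : CFun m) (s : Fin m → ℤ) : fc (fun ξ => c * f ξ) s = c * fc f s := by
  unfold fc
  rw [← mean_const_mul]
  congr 1; funext ξ; ring

lemma TorusCont.integrableOn {f : CFun m} (hf : TorusCont f) :
    IntegrableOn (fun x => f (ofR x)) (Set.Icc (0 : Fin m → ℝ) (fun _ => 2 * Real.pi)) :=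
  hf.cont.continuousOn.integrableOn_compact isCompact_Icc

lemma mean_add {f g : CFun m} (hf : TorusCont f) (hg : TorusCont g) :
    mean (fun ξ => f ξ + g ξ) = mean f + mean g := by
  unfold mean
  rw [← mul_add]
  congr 1
  exact integral_add hf.integrableOn hg.integrableOn

lemma mean_neg (f : CFun m) : mean (fun ξ => -f ξ) = -mean f := by
  have := mean_const_mul (-1) f
  simpa using this

lemma mean_sub {f g : CFun m} (hf : TorusCont f) (hg : TorusCont g) :
    mean (fun ξ => f ξ - g ξ) = mean f - mean g := by
  simp only [sub_eq_add_neg]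
  rw [mean_add hf hg.neg, mean_neg]

lemma fc_add {f g : CFun m} (hf : TorusCont f) (hg : TorusCont g) (s : Fin m → ℤ) :
    fc (fun ξ => f ξ + g ξ) s = fc f s + fc g s := by
  unfold fc
  rw [← mean_add ((TorusCont.cexpo _).mul hf) ((TorusCont.cexpo _).mul hg)]
  congr 1; funext ξ; ring

lemma fc_neg (f : CFun m) (s : Fin m → ℤ) : fc (fun ξ => -f ξ) s = -fc f s := by
  have := fc_const_mul (-1) f s
  simpa using this

lemma fc_sub {f g : CFun m} (hf : TorusCont f) (hg : TorusCont g) (s : Fin m → ℤ) :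
    fc (fun ξ => f ξ - g ξ) s = fc f s - fc g s := by
  simp only [sub_eq_add_neg]
  rw [fc_add hf hg.neg, fc_neg]

lemma mean_const (c : ℂ) : mean (fun _ : Fin m → ℂ => c) = c := by
  rw [(TorusCont.const c).mean_eq]
  simp [onTorus]

lemma norm_mean_le {f : CFun m} (hf : TorusCont f) {M : ℝ} (h : ∀ ξ ∈ strip m 0, ‖f ξ‖ ≤ M) :
    ‖mean f‖ ≤ M := by
  rw [hf.mean_eq]
  refine (norm_integral_le_of_norm_le_const (Eventually.of_forall fun t => h _ (ofR_mem_strip _))).trans ?_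
  simp

lemma onTorus_mFourier (s : Fin m → ℤ) (t : UnitAddTorus (Fin m)) :
    onTorus (cexpo s) t = UnitAddTorus.mFourier s t := by
  have ht : t = fun j => (((AddCircle.equivIoc 1 0 (t j) : ℝ)) : UnitAddCircle) := by
    funext j; exact AddCircle.coe_equivIoc.symm
  conv_rhs => rw [ht]
  simp only [onTorus, UnitAddTorus.mFourier, ContinuousMap.coe_mk, fourier_coe_apply, cexpo, ofR]
  rw [← Complex.exp_sum, Finset.mul_sum]
  congr 1
  refine Finset.sum_congr rfl fun j _ => ?_
  push_cast; ring

lemma TorusCont.mFourierCoeff_eq {f : CFun m} (hf : TorusCont f) (s : Fin m → ℤ) :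
    UnitAddTorus.mFourierCoeff (onTorus f) s = fc f s := by
  rw [fc, ((TorusCont.cexpo _).mul hf).mean_eq, UnitAddTorus.mFourierCoeff]
  congr 1
  funext t
  rw [← onTorus_mFourier]
  rfl

/-- The lift to the torus as a bundled continuous map. -/
def TorusCont.lift {f : CFun m} (hf : TorusCont f) : C(UnitAddTorus (Fin m), ℂ) :=
  ⟨onTorus f, hf.continuous_onTorus⟩

lemma TorusCont.coe_lift {f : CFun m} (hf : TorusCont f) : ⇑hf.lift = onTorus f := rfl

/-- The difference has vanishing coefficients. Its Fourier series is then trivially summable, hence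
represents the continuous function pointwise. All equations on the torus are verified by comparing
coefficients through this lemma. -/
lemma TorusCont.eqOn_of_fc_eq {f g : CFun m} (hf : TorusCont f) (hg : TorusCont g)
    (h : ∀ s, fc f s = fc g s) : ∀ ξ ∈ strip m 0, f ξ = g ξ := by
  have hd := hf.sub hg
  have h0 : UnitAddTorus.mFourierCoeff hd.lift = 0 := by
    funext s
    rw [hd.coe_lift, hd.mFourierCoeff_eq, fc_sub hf hg, h, sub_self]
    rfl
  intro ξ hξ
  obtain ⟨x, rfl⟩ := exists_ofR hξ
  have hs := UnitAddTorus.hasSum_mFourier_series_apply_of_summable (f := hd.lift)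
    (by rw [h0]; exact summable_zero) (fun j => ((x j / (2 * Real.pi) : ℝ) : UnitAddCircle))
  rw [h0] at hs
  simp only [Pi.zero_apply, zero_smul] at hs
  have h1 := hs.unique hasSum_zero
  rw [hd.coe_lift, hd.onTorus_coe] at h1
  have : (fun j => 2 * Real.pi * (x j / (2 * Real.pi))) = x := by
    funext j; field_simp
  rw [this] at h1
  exact sub_eq_zero.mp h1

/-- Parseval on a probability space: the L² norm is at most the supremum. -/
lemma TorusCont.bessel {f : CFun m} (hf : TorusCont f) {M : ℝ}
    (h : ∀ ξ ∈ strip m 0, ‖f ξ‖ ≤ M) (F : Finset (Fin m → ℤ)) :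
    ∑ s ∈ F, ‖fc f s‖ ^ 2 ≤ M ^ 2 := by
  have hs := UnitAddTorus.hasSum_sq_mFourierCoeff (hf.lift.toLp 2 volume ℂ)
  simp only [UnitAddTorus.mFourierCoeff_toLp] at hs
  simp only [hf.coe_lift, hf.mFourierCoeff_eq] at hs
  refine (sum_le_hasSum F (fun _ _ => by positivity) hs).trans ?_
  have hM : 0 ≤ M := (norm_nonneg _).trans (h _ (ofR_mem_strip 0))
  have hae : (fun t => ‖(hf.lift.toLp 2 volume ℂ) t‖ ^ 2) =ᵐ[volume] fun t => ‖onTorus f t‖ ^ 2 := by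
    filter_upwards [hf.lift.coeFn_toLp (p := 2) (𝕜 := ℂ) volume] with t ht
    rw [ht]; rfl
  rw [integral_congr_ae hae]
  have : ‖∫ t, ‖onTorus f t‖ ^ 2‖ ≤ M ^ 2 * (volume : Measure (UnitAddTorus (Fin m))).real univ := by
    refine norm_integral_le_of_norm_le_const (Eventually.of_forall fun t => ?_)
    rw [Real.norm_of_nonneg (by positivity)]
    exact pow_le_pow_left₀ (norm_nonneg _) (h _ (ofR_mem_strip _)) 2
  simp only [probReal_univ, mul_one] at this
  exact (le_abs_self _).trans this

lemma TorusCont.translate {f : CFun m} (hf : TorusCont f) (a : Fin m → ℝ) :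
    TorusCont (fun ξ => f (ξ + ofR a)) :=
  ⟨fun x j => by
    rw [← ofR_add, ← ofR_add, show x + Pi.single j (2 * Real.pi) + a
      = (x + a) + Pi.single j (2 * Real.pi) by abel, hf.periodic],
   by
    have : (fun x => f (ofR x + ofR a)) = fun x => f (ofR (x + a)) := by
      funext x; rw [ofR_add]
    rw [this]
    exact hf.cont.comp (by fun_prop)⟩

lemma mean_translate {f : CFun m} (hf : TorusCont f) (a : Fin m → ℝ) :
    mean (fun ξ => f (ξ + ofR a)) = mean f := by
  rw [(hf.translate a).mean_eq, hf.mean_eq]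
  rw [← integral_add_right_eq_self (μ := (volume : Measure (UnitAddTorus (Fin m)))) (onTorus f)
    (fun j => ((a j / (2 * Real.pi) : ℝ) : UnitAddCircle))]
  congr 1
  funext t
  have ht : t = fun j => (((AddCircle.equivIoc 1 0 (t j) : ℝ)) : UnitAddCircle) := by
    funext j; exact AddCircle.coe_equivIoc.symm
  have h2 : t + (fun j => ((a j / (2 * Real.pi) : ℝ) : UnitAddCircle)) =
      fun j => (((AddCircle.equivIoc 1 0 (t j) : ℝ) + a j / (2 * Real.pi) : ℝ) : UnitAddCircle) := by
    conv_lhs => rw [ht]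
    funext j; rfl
  rw [h2, hf.onTorus_coe, onTorus, ← ofR_add]
  congr 2
  funext j
  simp only [Pi.add_apply]
  field_simp

/-- Translation by π/s_j in a coordinate with s_j ≠ 0 changes the sign of the exponential but not
its mean. -/
lemma mean_cexpo (s : Fin m → ℤ) (hs : s ≠ 0) : mean (cexpo (m := m) s) = 0 := by
  obtain ⟨j, hj⟩ := Function.ne_iff.mp hs
  have hj' : (s j : ℂ) ≠ 0 := by exact_mod_cast hj
  have h := mean_translate (TorusCont.cexpo s) (Pi.single j (Real.pi / s j))
  have e : (fun ξ => cexpo s (ξ + ofR (Pi.single j (Real.pi / (s j : ℝ))))) = fun ξ => (-1) * cexpo s ξ := by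
    funext ξ
    rw [cexpo_add, ofR_single, cexpo_single]
    have : Complex.I * ((s j : ℂ) * ((Real.pi / (s j : ℝ) : ℝ) : ℂ)) = Real.pi * Complex.I := by
      push_cast; field_simp
    rw [this, Complex.exp_pi_mul_I]; ring
  rw [e, mean_const_mul] at h
  have : (2 : ℂ) * mean (cexpo (m := m) s) = 0 := by linear_combination -h
  simpa using this

lemma fc_const (c : ℂ) (s : Fin m → ℤ) : fc (fun _ => c) s = if s = 0 then c else 0 := by
  split_ifs with h
  · rw [h, fc_zero_index, mean_const]
  · have : fc (fun _ => c) s = mean fun ξ => c * cexpo (-s) ξ := by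
      unfold fc; congr 1; funext ξ; ring
    rw [this, mean_const_mul, mean_cexpo _ (neg_ne_zero.mpr h), mul_zero]

/-! ## `C¹` functions on the torus -/

/-- `C¹` functions on the real torus. -/
structure TorusC1 (f : CFun m) : Prop where
  toCont : TorusCont f
  diff : ∀ x j, LineDifferentiableAt ℝ f (ofR x) (Pi.single j 1)
  pd : ∀ j, TorusCont (pd j f)

lemma pd_congr {f g : CFun m} (h : ∀ ξ ∈ strip m 0, f ξ = g ξ) (j : Fin m) :
    ∀ ξ ∈ strip m 0, pd j f ξ = pd j g ξ := by
  intro ξ hξ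
  unfold pd lineDeriv
  congr 1
  funext t
  refine h _ fun i => ?_
  have := hξ i
  by_cases hi : i = j
  · subst hi; simpa using this
  · simpa [hi] using this

namespace TorusC1

variable {f g : CFun m}

lemma hasDerivAt (hf : TorusC1 f) (x : Fin m → ℝ) (j : Fin m) (t : ℝ) :
    HasDerivAt (fun t : ℝ => f (ofR x + ofR (Pi.single j t)))
      (LowDimTori.pd j f (ofR x + ofR (Pi.single j t))) t := by
  have h := (hf.diff (x + Pi.single j t) j).hasLineDerivAt
  unfold HasLineDerivAt at h
  have h2 := HasDerivAt.comp_sub_const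
    (f := fun u : ℝ => f (ofR (x + Pi.single j t) + u • (Pi.single j (1 : ℂ) : Fin m → ℂ)))
    t t (by rw [sub_self]; exact h)
  have e : (fun u : ℝ => f (ofR x + ofR (Pi.single j u))) =
      fun u : ℝ => f (ofR (x + Pi.single j t) + (u - t) • (Pi.single j (1 : ℂ) : Fin m → ℂ)) := by
    funext u
    congr 1
    rw [ofR_add, ofR_single, ofR_single, add_assoc]
    congr 1
    ext i
    by_cases hi : i = j
    · subst hi; simp
    · simp [hi]
  rw [e, ← ofR_add]
  exact h2

/-- The integral of the translate of f by t in direction j does not depend on t; differentiate it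
under the integral at t = 0. -/
lemma mean_pd (hf : TorusC1 f) (j : Fin m) : mean (LowDimTori.pd j f) = 0 := by
  obtain ⟨C, hC⟩ : ∃ C, ∀ ξ ∈ strip m 0, ‖LowDimTori.pd j f ξ‖ ≤ C := by
    obtain ⟨C, hC⟩ := (isCompact_univ (X := UnitAddTorus (Fin m))).exists_bound_of_continuousOn
      (hf.pd j).continuous_onTorus.continuousOn
    refine ⟨C, fun ξ hξ => ?_⟩
    obtain ⟨x, rfl⟩ := exists_ofR hξ
    have := hC (fun j => ((x j / (2 * Real.pi) : ℝ) : UnitAddCircle)) trivial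
    rw [(hf.pd j).onTorus_coe] at this
    have e : (fun j => 2 * Real.pi * (x j / (2 * Real.pi))) = x := by
      funext j; field_simp
    rwa [e] at this
  have key := hasDerivAt_integral_of_dominated_loc_of_deriv_le
    (μ := volume.restrict (Set.Icc (0 : Fin m → ℝ) (fun _ => 2 * Real.pi)))
    (F := fun (t : ℝ) x => f (ofR x + ofR (Pi.single j t)))
    (F' := fun (t : ℝ) x => LowDimTori.pd j f (ofR x + ofR (Pi.single j t)))
    (x₀ := (0 : ℝ)) (s := univ) (bound := fun _ => C) univ_mem
    (Eventually.of_forall fun t => (hf.toCont.translate _).cont.aestronglyMeasurable)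
    (hf.toCont.translate _).integrableOn
    ((hf.pd j).translate _).cont.aestronglyMeasurable
    (Eventually.of_forall fun x t _ => hC _ (by rw [← ofR_add]; exact ofR_mem_strip _))
    (integrableOn_const isCompact_Icc.measure_lt_top.ne)
    (Eventually.of_forall fun x t _ => hf.hasDerivAt x j t)
  have hconst : (fun t : ℝ => ∫ x in Set.Icc (0 : Fin m → ℝ) (fun _ => 2 * Real.pi),
      f (ofR x + ofR (Pi.single j t))) = fun _ => ∫ x in Set.Icc (0 : Fin m → ℝ) (fun _ => 2 * Real.pi),
      f (ofR x) := by
    funext t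
    have := mean_translate hf.toCont (Pi.single j t)
    unfold mean at this
    exact mul_left_cancel₀ (inv_ne_zero (by exact_mod_cast (by positivity : (2 * Real.pi) ^ m ≠ 0))) this
  have h2 := key.2
  rw [hconst] at h2
  have h3 := h2.unique (hasDerivAt_const _ _)
  have h4 : (fun x : Fin m → ℝ => LowDimTori.pd j f (ofR x + ofR (Pi.single j 0))) =
    fun x => LowDimTori.pd j f (ofR x) := by
    funext x
    rw [Pi.single_zero]
    congr 1
    ext i; simp [ofR]
  rw [h4] at h3
  unfold mean
  rw [show (∫ x in Set.Icc (0 : Fin m → ℝ) (fun _ => 2 * Real.pi), LowDimTori.pd j f fun j => (x j : ℂ)) = 0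
    from h3, mul_zero]

lemma add (hf : TorusC1 f) (hg : TorusC1 g) : TorusC1 (fun ξ => f ξ + g ξ) ∧
    ∀ j, ∀ ξ ∈ strip m 0, LowDimTori.pd j (fun ξ => f ξ + g ξ) ξ = LowDimTori.pd j f ξ + LowDimTori.pd j g ξ := by
  have h : ∀ x j, HasLineDerivAt ℝ (fun ξ => f ξ + g ξ) (LowDimTori.pd j f (ofR x) + LowDimTori.pd j g (ofR x))
      (ofR x) (Pi.single j 1) := fun x j =>
    HasDerivAt.add (hf.diff x j).hasLineDerivAt (hg.diff x j).hasLineDerivAt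
  have h2 : ∀ j, ∀ ξ ∈ strip m 0,
      LowDimTori.pd j (fun ξ => f ξ + g ξ) ξ = LowDimTori.pd j f ξ + LowDimTori.pd j g ξ := by
    intro j ξ hξ
    obtain ⟨x, rfl⟩ := exists_ofR hξ
    exact (h x j).lineDeriv
  refine ⟨⟨hf.toCont.add hg.toCont, fun x j => (h x j).lineDifferentiableAt, fun j => ?_⟩, h2⟩
  have := (hf.pd j).add (hg.pd j)
  exact ⟨fun x i => by rw [h2 j _ (ofR_mem_strip _), h2 j _ (ofR_mem_strip _)]; exact this.periodic x i,
    this.cont.congr fun x => (h2 j _ (ofR_mem_strip _)).symm⟩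

lemma mul (hf : TorusC1 f) (hg : TorusC1 g) : TorusC1 (fun ξ => f ξ * g ξ) ∧
    ∀ j, ∀ ξ ∈ strip m 0, LowDimTori.pd j (fun ξ => f ξ * g ξ) ξ =
      LowDimTori.pd j f ξ * g ξ + f ξ * LowDimTori.pd j g ξ := by
  have h : ∀ x j, HasLineDerivAt ℝ (fun ξ => f ξ * g ξ)
      (LowDimTori.pd j f (ofR x) * g (ofR x) + f (ofR x) * LowDimTori.pd j g (ofR x))
      (ofR x) (Pi.single j 1) := fun x j => by
    have := HasDerivAt.mul (hf.diff x j).hasLineDerivAt (hg.diff x j).hasLineDerivAt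
    simp only [zero_smul, add_zero] at this
    exact this
  have h2 : ∀ j, ∀ ξ ∈ strip m 0,
      LowDimTori.pd j (fun ξ => f ξ * g ξ) ξ = LowDimTori.pd j f ξ * g ξ + f ξ * LowDimTori.pd j g ξ := by
    intro j ξ hξ
    obtain ⟨x, rfl⟩ := exists_ofR hξ
    exact (h x j).lineDeriv
  refine ⟨⟨hf.toCont.mul hg.toCont, fun x j => (h x j).lineDifferentiableAt, fun j => ?_⟩, h2⟩
  have := ((hf.pd j).mul hg.toCont).add (hf.toCont.mul (hg.pd j))
  exact ⟨fun x i => by rw [h2 j _ (ofR_mem_strip _), h2 j _ (ofR_mem_strip _)]; exact this.periodic x i,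
    this.cont.congr fun x => (h2 j _ (ofR_mem_strip _)).symm⟩

lemma const (c : ℂ) : TorusC1 (fun _ : Fin m → ℂ => c) ∧
    ∀ j, ∀ ξ, LowDimTori.pd j (fun _ : Fin m → ℂ => c) ξ = 0 := by
  have h : ∀ ξ j, HasLineDerivAt ℝ (fun _ : Fin m → ℂ => c) 0 ξ (Pi.single j 1) := fun ξ j =>
    hasDerivAt_const _ _
  have h2 : ∀ j, ∀ ξ, LowDimTori.pd j (fun _ : Fin m → ℂ => c) ξ = 0 := fun j ξ => (h ξ j).lineDeriv
  refine ⟨⟨TorusCont.const c, fun x j => (h _ j).lineDifferentiableAt, fun j => ?_⟩, h2⟩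
  rw [show LowDimTori.pd j (fun _ : Fin m → ℂ => c) = fun _ => 0 from funext (h2 j)]
  exact TorusCont.const 0

lemma congr (hf : TorusC1 f) (h : ∀ ξ ∈ strip m 0, f ξ = g ξ) : TorusC1 g := by
  have hp := fun j => pd_congr h j
  refine ⟨⟨fun x j => ?_, hf.toCont.cont.congr fun x => h _ (ofR_mem_strip _)⟩, fun x j => ?_, fun j =>
    ⟨fun x i => ?_, (hf.pd j).cont.congr fun x => hp j _ (ofR_mem_strip _)⟩⟩
  · rw [← h _ (ofR_mem_strip _), ← h _ (ofR_mem_strip _)]; exact hf.toCont.periodic x j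
  · have := hf.diff x j
    unfold LineDifferentiableAt at this ⊢
    convert this using 1
    funext t
    refine (h _ fun i => ?_).symm
    by_cases hi : i = j
    · subst hi; simp [ofR]
    · simp [ofR, hi]
  · rw [← hp j _ (ofR_mem_strip _), ← hp j _ (ofR_mem_strip _)]; exact (hf.pd j).periodic x i

end TorusC1

lemma hasLineDerivAt_cexpo (s : Fin m → ℤ) (j : Fin m) (ξ : Fin m → ℂ) :
    HasLineDerivAt ℝ (cexpo s) (Complex.I * s j * cexpo s ξ) ξ (Pi.single j 1) := by
  unfold HasLineDerivAt
  have h : (fun t : ℝ => cexpo s (ξ + t • (Pi.single j (1 : ℂ) : Fin m → ℂ))) =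
      fun t : ℝ => cexpo s ξ * Complex.exp (Complex.I * s j * t) := by
    funext t
    have e : t • (Pi.single j (1 : ℂ) : Fin m → ℂ) = Pi.single j (t : ℂ) := by
      ext i
      by_cases hi : i = j
      · subst hi; simp
      · simp [hi]
    rw [cexpo_add, e, cexpo_single]
    congr 2
    ring
  rw [h]
  have h1 : HasDerivAt (fun t : ℝ => Complex.I * s j * (t : ℂ)) (Complex.I * s j) 0 := by
    simpa using (Complex.ofRealCLM.hasDerivAt (x := (0 : ℝ))).const_mul (Complex.I * (s j : ℂ))
  exact (h1.cexp.const_mul (cexpo s ξ)).congr_deriv (by simp; ring)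

lemma TorusC1.cexpo (s : Fin m → ℤ) : TorusC1 (cexpo (m := m) s) :=
  ⟨TorusCont.cexpo s, fun x j => (hasLineDerivAt_cexpo s j _).lineDifferentiableAt, fun j => by
    have : LowDimTori.pd j (LowDimTori.cexpo s) = fun ξ => Complex.I * s j * LowDimTori.cexpo s ξ :=
      funext fun ξ => (hasLineDerivAt_cexpo s j ξ).lineDeriv
    rw [this]
    exact (TorusCont.cexpo s).const_mul _⟩

/-- Integration by parts: the derivative of e^{-is·ξ} f has mean zero. -/
lemma TorusC1.fc_pd {f : CFun m} (hf : TorusC1 f) (j : Fin m) (s : Fin m → ℤ) :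
    fc (LowDimTori.pd j f) s = Complex.I * s j * fc f s := by
  have h := (TorusC1.cexpo (-s)).mul hf
  have h1 := h.1.mean_pd j
  rw [mean_congr (h.2 j)] at h1
  simp only [show ∀ ξ, LowDimTori.pd j (LowDimTori.cexpo (-s)) ξ
    = Complex.I * (-s) j * LowDimTori.cexpo (-s) ξ from fun ξ => by
      rw [(hasLineDerivAt_cexpo (-s) j ξ).lineDeriv.symm]; rfl] at h1
  rw [mean_add ((((TorusCont.cexpo _).const_mul _)).mul hf.toCont) ((TorusCont.cexpo _).mul (hf.pd j))] at h1
  simp only [mul_assoc] at h1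
  rw [mean_const_mul, mean_const_mul] at h1
  simp only [Pi.neg_apply, Int.cast_neg] at h1
  unfold fc
  linear_combination h1

end LowDimTori

end

noncomputable section

namespace LowDimTori

open MeasureTheory Set Filter Topology

variable {m : ℕ}

/-! ## Bounded periodic holomorphic functions on open strips -/

/-- `f` is `2π`-periodic, holomorphic and bounded by `M` on the open strip of half-width `r`. -/
structure HPB (r : ℝ) (f : CFun m) (M : ℝ) : Prop where
  periodic : ∀ ξ ∈ openStrip m r, ∀ j, f (ξ + Pi.single j ((2 * Real.pi : ℝ) : ℂ)) = f ξ
  diff : DifferentiableOn ℂ f (openStrip m r)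
  bound : ∀ ξ ∈ openStrip m r, ‖f ξ‖ ≤ M

lemma isOpen_openStrip (r : ℝ) : IsOpen (openStrip m r) := by
  have : openStrip m r = ⋂ j, {ξ | |(ξ j).im| < r} := by ext; simp [openStrip]
  rw [this]
  exact isOpen_iInter_of_finite fun j => isOpen_lt (by fun_prop) continuous_const

lemma convex_openStrip (r : ℝ) : Convex ℝ (openStrip m r) := by
  intro x hx y hy a b ha hb hab j
  have h1 := hx j
  have h2 := hy j
  have e : ((a • x + b • y) j).im = a * (x j).im + b * (y j).im := by simp
  rw [e]
  rw [abs_lt] at *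
  rcases ha.eq_or_lt with rfl | ha'
  · have : b = 1 := by linarith
    subst this; constructor <;> linarith
  · constructor <;> nlinarith

lemma openStrip_mono {r r' : ℝ} (h : r' ≤ r) : openStrip m r' ⊆ openStrip m r :=
  fun _ hξ j => (hξ j).trans_le h

lemma strip_subset_openStrip {r r' : ℝ} (h : r' < r) : strip m r' ⊆ openStrip m r :=
  fun _ hξ j => (hξ j).trans_lt h

lemma ofR_mem_openStrip {r : ℝ} (hr : 0 < r) (x : Fin m → ℝ) : ofR x ∈ openStrip m r :=
  strip_subset_openStrip hr (ofR_mem_strip x)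

lemma add_mem_openStrip {r : ℝ} {ξ : Fin m → ℂ} (hξ : ξ ∈ openStrip m r) (x : Fin m → ℝ) :
    ξ + ofR x ∈ openStrip m r := fun j => by simpa [ofR] using hξ j

lemma add_period_mem_openStrip {r : ℝ} {ξ : Fin m → ℂ} (hξ : ξ ∈ openStrip m r) (j : Fin m) :
    ξ + Pi.single j ((2 * Real.pi : ℝ) : ℂ) ∈ openStrip m r := by
  rw [← ofR_single]; exact add_mem_openStrip hξ _

namespace HPB

variable {r : ℝ} {f g : CFun m} {M N : ℝ}

lemma nonneg (hf : HPB r f M) (hr : 0 < r) : 0 ≤ M :=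
  (norm_nonneg _).trans (hf.bound _ (ofR_mem_openStrip hr 0))

lemma mono (hf : HPB r f M) {r' : ℝ} (h : r' ≤ r) : HPB r' f M :=
  ⟨fun ξ hξ => hf.periodic ξ (openStrip_mono h hξ), hf.diff.mono (openStrip_mono h),
    fun ξ hξ => hf.bound ξ (openStrip_mono h hξ)⟩

lemma of_bound (hf : HPB r f M) (h : ∀ ξ ∈ openStrip m r, ‖f ξ‖ ≤ N) : HPB r f N :=
  ⟨hf.periodic, hf.diff, h⟩

lemma mono_bound (hf : HPB r f M) (h : M ≤ N) : HPB r f N :=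
  hf.of_bound fun ξ hξ => (hf.bound ξ hξ).trans h

lemma congr (hf : HPB r f M) (h : ∀ ξ ∈ openStrip m r, g ξ = f ξ) : HPB r g M :=
  ⟨fun ξ hξ j => by rw [h _ hξ, h _ (add_period_mem_openStrip hξ j)]; exact hf.periodic ξ hξ j,
    hf.diff.congr h, fun ξ hξ => by rw [h _ hξ]; exact hf.bound ξ hξ⟩

lemma const (c : ℂ) : HPB r (fun _ : Fin m → ℂ => c) ‖c‖ :=
  ⟨fun _ _ _ => rfl, differentiableOn_const c, fun _ _ => le_rfl⟩

lemma add (hf : HPB r f M) (hg : HPB r g N) : HPB r (fun ξ => f ξ + g ξ) (M + N) :=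
  ⟨fun ξ hξ j => by rw [hf.periodic ξ hξ, hg.periodic ξ hξ], hf.diff.add hg.diff,
    fun ξ hξ => (norm_add_le _ _).trans (add_le_add (hf.bound ξ hξ) (hg.bound ξ hξ))⟩

lemma neg (hf : HPB r f M) : HPB r (fun ξ => -f ξ) M :=
  ⟨fun ξ hξ j => by rw [hf.periodic ξ hξ], hf.diff.neg,
    fun ξ hξ => by rw [norm_neg]; exact hf.bound ξ hξ⟩

lemma sub (hf : HPB r f M) (hg : HPB r g N) : HPB r (fun ξ => f ξ - g ξ) (M + N) := by
  simp only [sub_eq_add_neg]; exact hf.add hg.neg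

lemma mul (hf : HPB r f M) (hg : HPB r g N) : HPB r (fun ξ => f ξ * g ξ) (M * N) :=
  ⟨fun ξ hξ j => by rw [hf.periodic ξ hξ, hg.periodic ξ hξ], hf.diff.mul hg.diff,
    fun ξ hξ => by
      rw [norm_mul]
      exact mul_le_mul (hf.bound ξ hξ) (hg.bound ξ hξ) (norm_nonneg _)
        ((norm_nonneg _).trans (hf.bound ξ hξ))⟩

lemma const_mul (hf : HPB r f M) (c : ℂ) : HPB r (fun ξ => c * f ξ) (‖c‖ * M) := (const c).mul hf

lemma sum {ι : Type*} {s : Finset ι} {f : ι → CFun m} {M : ι → ℝ}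
    (hf : ∀ i ∈ s, HPB r (f i) (M i)) : HPB r (fun ξ => ∑ i ∈ s, f i ξ) (∑ i ∈ s, M i) :=
  ⟨fun ξ hξ j => Finset.sum_congr rfl fun i hi => (hf i hi).periodic ξ hξ j,
    DifferentiableOn.fun_sum fun i hi => (hf i hi).diff,
    fun ξ hξ => (norm_sum_le _ _).trans (Finset.sum_le_sum fun i hi => (hf i hi).bound ξ hξ)⟩

lemma torusCont (hf : HPB r f M) (hr : 0 < r) : TorusCont f :=
  ⟨fun x j => by rw [ofR_add, ofR_single]; exact hf.periodic _ (ofR_mem_openStrip hr x) j,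
    hf.diff.continuousOn.comp_continuous continuous_ofR (ofR_mem_openStrip hr)⟩

lemma hasLineDerivAt (hf : HPB r f M) {ξ : Fin m → ℂ} (hξ : ξ ∈ openStrip m r) (j : Fin m) :
    HasLineDerivAt ℝ f (fderiv ℂ f ξ (Pi.single j 1)) ξ (Pi.single j 1) :=
  ((hf.diff.differentiableAt ((isOpen_openStrip r).mem_nhds hξ)).hasFDerivAt.restrictScalars
    ℝ).hasLineDerivAt _

end HPB

/-- Two holomorphic functions on a strip which coincide on the real torus are equal. -/
lemma eqOn_openStrip {f g : CFun m} {r : ℝ} (hf : DifferentiableOn ℂ f (openStrip m r))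
    (hg : DifferentiableOn ℂ g (openStrip m r)) (h : ∀ ξ ∈ strip m 0, f ξ = g ξ) :
    ∀ ξ ∈ openStrip m r, f ξ = g ξ := by
  intro ξ hξ
  set x : Fin m → ℝ := fun j => (ξ j).re
  set y : Fin m → ℝ := fun j => (ξ j).im
  -- A complex line that is real for real τ and passes through ξ at τ = i; it reduces the claim to
  -- the identity theorem in one variable.
  let ℓ : ℂ → (Fin m → ℂ) := fun τ => ofR x + τ • ofR y
  have hℓ : Differentiable ℂ ℓ := by fun_prop
  have hℓI : ℓ Complex.I = ξ := by
    ext j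
    simp only [ℓ, ofR, x, y, Pi.add_apply, Pi.smul_apply, smul_eq_mul]
    rw [mul_comm]; exact Complex.re_add_im _
  let U : Set ℂ := ℓ ⁻¹' openStrip m r
  have hU : IsOpen U := (isOpen_openStrip r).preimage hℓ.continuous
  have hUc : Convex ℝ U := by
    intro a ha b hb s t hs ht hst
    have : ℓ (s • a + t • b) = s • ℓ a + t • ℓ b := by
      simp only [ℓ]
      ext j
      simp only [Pi.add_apply, Pi.smul_apply, smul_eq_mul, Complex.real_smul]
      have hst' : (s : ℂ) + t = 1 := by exact_mod_cast hst
      linear_combination -ofR x j * hst'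
    change ℓ _ ∈ openStrip m r
    rw [this]
    exact convex_openStrip r ha hb hs ht hst
  have hreal : ∀ t : ℝ, ℓ t ∈ strip m 0 := fun t j => by simp [ℓ, ofR]
  have hr : ∀ t : ℝ, (t : ℂ) ∈ U := fun t j => by
    refine lt_of_le_of_lt ?_ (lt_of_le_of_lt (abs_nonneg _) (hξ j))
    exact hreal t j
  have hfa : AnalyticOnNhd ℂ (f ∘ ℓ) U :=
    (hf.comp hℓ.differentiableOn (fun _ h => h)).analyticOnNhd hU
  have hga : AnalyticOnNhd ℂ (g ∘ ℓ) U :=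
    (hg.comp hℓ.differentiableOn (fun _ h => h)).analyticOnNhd hU
  have hfreq : ∃ᶠ z in 𝓝[≠] (0 : ℂ), (f ∘ ℓ) z = (g ∘ ℓ) z := by
    have ht : Tendsto (fun t : ℝ => (t : ℂ)) (𝓝[≠] 0) (𝓝[≠] 0) := by
      refine tendsto_nhdsWithin_iff.mpr ⟨?_, ?_⟩
      · exact (Complex.continuous_ofReal.tendsto' 0 0 (by simp)).mono_left nhdsWithin_le_nhds
      · filter_upwards [self_mem_nhdsWithin] with t ht
        simpa using ht
    exact ht.frequently (Frequently.of_forall fun t => h _ (hreal t))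
  have := hfa.eqOn_of_preconnected_of_frequently_eq hga hUc.isPreconnected (by simpa using hr 0) hfreq
    (show Complex.I ∈ U by simpa [U, hℓI] using hξ)
  simpa [hℓI] using this

lemma HPB.eqOn {f g : CFun m} {r M N : ℝ} (hf : HPB r f M) (hg : HPB r g N)
    (h : ∀ ξ ∈ strip m 0, f ξ = g ξ) : ∀ ξ ∈ openStrip m r, f ξ = g ξ :=
  eqOn_openStrip hf.diff hg.diff h

/-- The mean over the torus shifted by τη is holomorphic in τ. For real τ it is constant by
translation invariance, so it keeps that value at τ = i. -/
lemma mean_shift {r : ℝ} {g : CFun m} {M : ℝ} (hg : HPB r g M) {η : Fin m → ℝ}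
    (hη : ∀ j, |η j| < r) : mean (fun ξ => g (ξ + Complex.I • ofR η)) = mean g := by
  -- Without variables the bound on η gives no positivity of r, and the claim is trivial.
  rcases isEmpty_or_nonempty (Fin m) with hm | hm
  · congr 1; funext ξ; congr 1; exact Subsingleton.elim _ _
  have hr : 0 < r := (abs_nonneg _).trans_lt (hη (Classical.arbitrary _))
  let U : Set ℂ := (fun τ : ℂ => τ • ofR η) ⁻¹' openStrip m r
  have hU : IsOpen U := (isOpen_openStrip r).preimage (by fun_prop)
  have hUc : Convex ℝ U := by
    intro a ha b hb s t hs ht hst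
    have : (s • a + t • b) • ofR η = s • (a • ofR η) + t • (b • ofR η) := by
      rw [add_smul]
      ext j
      simp [mul_assoc]
    change (s • a + t • b) • ofR η ∈ openStrip m r
    rw [this]
    exact convex_openStrip r ha hb hs ht hst
  have hUadd : ∀ τ ∈ U, ∀ x : Fin m → ℝ, ofR x + τ • ofR η ∈ openStrip m r := by
    intro τ hτ x
    rw [add_comm]
    exact add_mem_openStrip hτ x
  have hreal : ∀ t : ℝ, (t : ℂ) ∈ U := fun t j => by simpa [ofR] using hr
  let B := Set.Icc (0 : Fin m → ℝ) (fun _ => 2 * Real.pi)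
  let Φ : ℂ → ℂ := fun τ => ∫ x in B, g (ofR x + τ • ofR η)
  have hcont : ∀ τ ∈ U, Continuous fun x : Fin m → ℝ => g (ofR x + τ • ofR η) := fun τ hτ =>
    hg.diff.continuousOn.comp_continuous (continuous_ofR.add continuous_const) (hUadd τ hτ)
  have hΦ : DifferentiableOn ℂ Φ U := by
    intro τ₀ hτ₀
    obtain ⟨δ, hδ, hball⟩ := Metric.isOpen_iff.mp hU τ₀ hτ₀
    have hline : ∀ x : Fin m → ℝ, ∀ τ ∈ U, HasDerivAt (fun τ => g (ofR x + τ • ofR η))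
        (fderiv ℂ g (ofR x + τ • ofR η) (ofR η)) τ := by
      intro x τ hτ
      have h1 := (hg.diff.differentiableAt ((isOpen_openStrip r).mem_nhds (hUadd τ hτ x))).hasFDerivAt
      have h2 : HasDerivAt (fun τ : ℂ => ofR x + τ • ofR η) (ofR η) τ := by
        simpa using ((hasDerivAt_id τ).smul_const (ofR η)).const_add (ofR x)
      exact h1.comp_hasDerivAt τ h2
    -- The dominating constant is the Cauchy estimate on discs of radius δ/4, which stay in U when
    -- their centre is within δ/2 of τ₀.
    have key := hasDerivAt_integral_of_dominated_loc_of_deriv_le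
      (μ := volume.restrict B) (F := fun (τ : ℂ) x => g (ofR x + τ • ofR η))
      (F' := fun (τ : ℂ) x => fderiv ℂ g (ofR x + τ • ofR η) (ofR η))
      (x₀ := τ₀) (s := Metric.ball τ₀ (δ / 2)) (bound := fun _ => M / (δ / 4))
      (Metric.ball_mem_nhds _ (by positivity))
      (by
        filter_upwards [hU.mem_nhds hτ₀] with τ hτ
        exact (hcont τ hτ).aestronglyMeasurable)
      ((hcont τ₀ hτ₀).continuousOn.integrableOn_compact isCompact_Icc)
      ((measurable_fderiv_apply_const ℂ g (ofR η)).comp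
        (by exact (continuous_ofR.add continuous_const).measurable)).aestronglyMeasurable
      (Eventually.of_forall fun x τ hτ => by
        have hsub : Metric.closedBall τ (δ / 4) ⊆ U := fun z hz => hball (by
          rw [Metric.mem_ball] at hτ ⊢
          rw [Metric.mem_closedBall] at hz
          linarith [dist_triangle z τ τ₀])
        rw [← (hline x τ (hsub (Metric.mem_closedBall_self (by positivity)))).deriv]
        refine Complex.norm_deriv_le_of_forall_mem_sphere_norm_le (by positivity) ?_ fun z hz => ?_
        · refine DifferentiableOn.diffContOnCl ?_
          rw [closure_ball _ (by positivity)]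
          intro z hz
          exact (hline x z (hsub hz)).differentiableAt.differentiableWithinAt
        · exact hg.bound _ (hUadd z (hsub (Metric.sphere_subset_closedBall hz)) x))
      (integrableOn_const isCompact_Icc.measure_lt_top.ne)
      (Eventually.of_forall fun x τ hτ => hline x τ (hball (Metric.ball_subset_ball (by linarith) hτ)))
    exact key.2.differentiableAt.differentiableWithinAt
  have hfreq : ∃ᶠ z in 𝓝[≠] (0 : ℂ), Φ z = (fun _ => Φ 0) z := by
    have ht : Tendsto (fun t : ℝ => (t : ℂ)) (𝓝[≠] 0) (𝓝[≠] 0) := by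
      refine tendsto_nhdsWithin_iff.mpr ⟨?_, ?_⟩
      · exact (Complex.continuous_ofReal.tendsto' 0 0 (by simp)).mono_left nhdsWithin_le_nhds
      · filter_upwards [self_mem_nhdsWithin] with t ht
        simpa using ht
    refine ht.frequently (Frequently.of_forall fun t => ?_)
    have h0 := mean_translate (hg.torusCont hr) (t • η)
    unfold mean at h0
    have h1 := mul_left_cancel₀ (inv_ne_zero (by exact_mod_cast (by positivity : (2 * Real.pi) ^ m ≠ 0))) h0
    have e1 : ofR (t • η) = (t : ℂ) • ofR η := by ext j; simp [ofR]
    rw [e1] at h1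
    simp only [Φ, zero_smul, add_zero]
    exact h1
  have h := (hΦ.analyticOnNhd hU).eqOn_of_preconnected_of_frequently_eq
    (differentiableOn_const (Φ 0) |>.analyticOnNhd hU) hUc.isPreconnected
    (by simpa using hreal 0) hfreq (show Complex.I ∈ U from fun j => by simpa [ofR] using hη j)
  unfold mean
  congr 1
  simp only [Φ, zero_smul, add_zero] at h
  exact h

lemma fc_shift {r : ℝ} {f : CFun m} {M : ℝ} (hf : HPB r f M) {η : Fin m → ℝ}
    (hη : ∀ j, |η j| < r) (s : Fin m → ℤ) :
    fc (fun ξ => f (ξ + Complex.I • ofR η)) s = Real.exp (-∑ j, (s j : ℝ) * η j) * fc f s := by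
  have hbd : HPB r (cexpo (m := m) (-s)) (Real.exp (∑ j, |(s j : ℝ)| * r)) := by
    refine ⟨fun ξ _ j => cexpo_period _ ξ j, ?_, fun ξ hξ => ?_⟩
    · unfold cexpo
      fun_prop
    · rw [norm_cexpo]
      refine Real.exp_le_exp.mpr ?_
      rw [← Finset.sum_neg_distrib]
      refine Finset.sum_le_sum fun j _ => ?_
      have h1 := (hξ j).le
      calc -(((-s) j : ℤ) * (ξ j).im : ℝ) ≤ |(s j : ℝ) * (ξ j).im| := by
            simp only [Pi.neg_apply, Int.cast_neg]
            rw [neg_mul, neg_neg]; exact le_abs_self _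
        _ ≤ _ := by rw [abs_mul]; gcongr
  have h := mean_shift (hbd.mul hf) hη
  rw [fc, fc, ← h, ← mean_const_mul]
  congr 1
  funext ξ
  rw [cexpo_add]
  have : cexpo (-s) (Complex.I • ofR η) = Real.exp (∑ j, (s j : ℝ) * η j) := by
    rw [cexpo, Complex.ofReal_exp]
    congr 1
    push_cast
    rw [Finset.mul_sum]
    refine Finset.sum_congr rfl fun j _ => ?_
    simp only [Pi.neg_apply, Pi.smul_apply, smul_eq_mul, ofR, Int.cast_neg]
    linear_combination -(s j : ℂ) * η j * Complex.I_mul_I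
  have e : (Real.exp (-∑ j, (s j : ℝ) * η j) : ℂ) * Real.exp (∑ j, (s j : ℝ) * η j) = 1 := by
    rw [← Complex.ofReal_mul, ← Real.exp_add]; simp
  rw [this]
  linear_combination -(cexpo (-s) ξ * f (ξ + Complex.I • ofR η)) * e

/-! ### Decay of Fourier coefficients and Fourier multipliers on strips -/

/-- The `ℓ¹` size of an integer vector. -/
def wt (s : Fin m → ℤ) : ℝ := ∑ j, |(s j : ℝ)|

lemma wt_nonneg (s : Fin m → ℤ) : 0 ≤ wt s := Finset.sum_nonneg fun _ _ => abs_nonneg _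

lemma norm_cexpo_le {r : ℝ} {ξ : Fin m → ℂ} (hξ : ξ ∈ openStrip m r) (s : Fin m → ℤ) :
    ‖cexpo s ξ‖ ≤ Real.exp (r * wt s) := by
  rw [norm_cexpo, wt, Finset.mul_sum, ← Finset.sum_neg_distrib]
  refine Real.exp_le_exp.mpr (Finset.sum_le_sum fun j _ => ?_)
  calc -((s j : ℝ) * (ξ j).im) ≤ |(s j : ℝ) * (ξ j).im| := neg_le_abs _
    _ ≤ r * |(s j : ℝ)| := by rw [abs_mul, mul_comm]; gcongr; exact (hξ j).le

/-- Bessel is applied on the 2^m tori with imaginary parts (±r', …, ±r'), where the coefficients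
acquire the factors e^{-s·η}. For each s one choice of signs gives the full weight e^{r'|s|}, and
summing over all choices costs only 2^m. -/
lemma HPB.weighted_bessel {r : ℝ} {f : CFun m} {M : ℝ} (hf : HPB r f M) {r' : ℝ} (h0 : 0 ≤ r')
    (hr : r' < r) (F : Finset (Fin m → ℤ)) :
    ∑ s ∈ F, (‖fc f s‖ * Real.exp (r' * wt s)) ^ 2 ≤ 2 ^ m * M ^ 2 := by
  have hr0 : 0 < r := h0.trans_lt hr
  let η : (Fin m → Bool) → Fin m → ℝ := fun b j => if b j then r' else -r'
  have hη : ∀ b j, |η b j| < r := fun b j => by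
    simp only [η]; split_ifs <;> simpa [abs_of_nonneg h0] using hr
  have key : ∀ b, ∑ s ∈ F, (‖fc f s‖ * Real.exp (-∑ j, (s j : ℝ) * η b j)) ^ 2 ≤ M ^ 2 := by
    intro b
    have hmem : ∀ ξ ∈ strip m 0, ξ + Complex.I • ofR (η b) ∈ openStrip m r := by
      intro ξ hξ j
      obtain ⟨x, rfl⟩ := exists_ofR hξ
      simpa [ofR] using hη b j
    have htc : TorusCont (fun ξ => f (ξ + Complex.I • ofR (η b))) := by
      refine ⟨fun x j => ?_, ?_⟩
      · rw [ofR_add, ofR_single, add_right_comm]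
        exact hf.periodic _ (hmem _ (ofR_mem_strip x)) j
      · exact hf.diff.continuousOn.comp_continuous (continuous_ofR.add continuous_const)
          fun x => hmem _ (ofR_mem_strip x)
    have := htc.bessel (fun ξ hξ => hf.bound _ (hmem ξ hξ)) F
    refine le_of_eq_of_le (Finset.sum_congr rfl fun s _ => ?_) this
    rw [fc_shift hf (hη b), norm_mul, Complex.norm_real, Real.norm_of_nonneg (Real.exp_nonneg _),
      mul_comm]
  calc ∑ s ∈ F, (‖fc f s‖ * Real.exp (r' * wt s)) ^ 2
      ≤ ∑ s ∈ F, ∑ b : Fin m → Bool, (‖fc f s‖ * Real.exp (-∑ j, (s j : ℝ) * η b j)) ^ 2 := by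
        refine Finset.sum_le_sum fun s _ => ?_
        have : r' * wt s = -∑ j, (s j : ℝ) * η (fun j => decide (s j < 0)) j := by
          rw [wt, Finset.mul_sum, ← Finset.sum_neg_distrib]
          refine Finset.sum_congr rfl fun j _ => ?_
          simp only [η, decide_eq_true_eq]
          split_ifs with h
          · rw [abs_of_neg (by exact_mod_cast h)]; ring
          · rw [abs_of_nonneg (by exact_mod_cast not_lt.mp h)]; ring
        rw [this]
        exact Finset.single_le_sum (f := fun b => (‖fc f s‖ * Real.exp (-∑ j, (s j : ℝ) * η b j)) ^ 2)
          (fun _ _ => by positivity) (Finset.mem_univ _)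
    _ = ∑ b : Fin m → Bool, ∑ s ∈ F, (‖fc f s‖ * Real.exp (-∑ j, (s j : ℝ) * η b j)) ^ 2 :=
        Finset.sum_comm
    _ ≤ ∑ b : Fin m → Bool, M ^ 2 := Finset.sum_le_sum fun b _ => key b
    _ = 2 ^ m * M ^ 2 := by simp

lemma sum_exp_neg_abs_le {δ : ℝ} (hδ : 0 < δ) (F : Finset ℤ) :
    ∑ k ∈ F, Real.exp (-δ * |(k : ℝ)|) ≤ 2 * (1 + δ) / δ := by
  have hq : Real.exp (-δ) < 1 := by simpa using hδ
  have g := hasSum_geometric_of_lt_one (Real.exp_nonneg (-δ)) hq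
  have h1 : HasSum (fun n : ℕ => Real.exp (-δ * |((n : ℤ) : ℝ)|)) (1 - Real.exp (-δ))⁻¹ := by
    convert! g using 2 with n
    rw [← Real.exp_nat_mul]; congr 1; simp; ring
  have h2 : HasSum (fun n : ℕ => Real.exp (-δ * |((-(n + 1 : ℤ) : ℤ) : ℝ)|))
      (Real.exp (-δ) * (1 - Real.exp (-δ))⁻¹) := by
    have e : (fun n : ℕ => Real.exp (-δ * |((-(n + 1 : ℤ) : ℤ) : ℝ)|)) =
        fun n => Real.exp (-δ) * Real.exp (-δ) ^ n := by
      funext n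
      rw [← Real.exp_nat_mul, ← Real.exp_add]; congr 1
      push_cast
      rw [abs_neg, abs_of_nonneg (by positivity)]; ring
    rw [e]
    exact g.mul_left _
  have h := HasSum.of_nat_of_neg_add_one (f := fun k : ℤ => Real.exp (-δ * |(k : ℝ)|)) h1 h2
  refine (sum_le_hasSum F (fun _ _ => by positivity) h).trans ?_
  have h3 : Real.exp (-δ) ≤ (1 + δ)⁻¹ := by
    rw [Real.exp_neg]
    exact inv_anti₀ (by positivity) (by linarith [Real.add_one_le_exp δ])
  have h4 : δ / (1 + δ) ≤ 1 - Real.exp (-δ) := by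
    have : δ / (1 + δ) = 1 - (1 + δ)⁻¹ := by field_simp; ring
    linarith
  have h5 : (1 - Real.exp (-δ))⁻¹ ≤ (1 + δ) / δ := by
    rw [← inv_div]; exact inv_anti₀ (by positivity) h4
  have h6 : 0 ≤ (1 - Real.exp (-δ))⁻¹ := by
    refine inv_nonneg.mpr (by linarith)
  calc (1 - Real.exp (-δ))⁻¹ + Real.exp (-δ) * (1 - Real.exp (-δ))⁻¹
      ≤ (1 - Real.exp (-δ))⁻¹ + 1 * (1 - Real.exp (-δ))⁻¹ := by gcongr
    _ ≤ 2 * (1 + δ) / δ := by rw [mul_div_assoc]; linarith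

/-- Enlarge the finite set to a box; the sum then factors into one-dimensional geometric sums. -/
lemma sum_exp_neg_wt_le {δ : ℝ} (hδ : 0 < δ) (F : Finset (Fin m → ℤ)) :
    ∑ s ∈ F, Real.exp (-δ * wt s) ≤ (2 * (1 + δ) / δ) ^ m := by
  classical
  let G : Finset ℤ := F.biUnion fun s => Finset.univ.image s
  have hsub : F ⊆ Fintype.piFinset fun _ : Fin m => G := by
    intro s hs
    rw [Fintype.mem_piFinset]
    intro j
    exact Finset.mem_biUnion.mpr ⟨s, hs, Finset.mem_image_of_mem _ (Finset.mem_univ j)⟩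
  calc ∑ s ∈ F, Real.exp (-δ * wt s)
      ≤ ∑ s ∈ Fintype.piFinset fun _ : Fin m => G, Real.exp (-δ * wt s) :=
        Finset.sum_le_sum_of_subset_of_nonneg hsub fun _ _ _ => by positivity
    _ = ∑ s ∈ Fintype.piFinset fun _ : Fin m => G, ∏ j, Real.exp (-δ * |(s j : ℝ)|) := by
        refine Finset.sum_congr rfl fun s _ => ?_
        rw [← Real.exp_sum, wt, Finset.mul_sum]
    _ = ∏ _j : Fin m, ∑ k ∈ G, Real.exp (-δ * |(k : ℝ)|) := by
        rw [Finset.prod_univ_sum]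
    _ ≤ ∏ _j : Fin m, (2 * (1 + δ) / δ) :=
        Finset.prod_le_prod (fun _ _ => Finset.sum_nonneg fun _ _ => by positivity)
          fun _ _ => sum_exp_neg_abs_le hδ G
    _ = _ := by rw [Finset.prod_const, Finset.card_univ, Fintype.card_fin]

/-- Fourier multipliers of polynomial growth: the loss of half-width `κ/θ²` costs `θ^{2a+m}`. -/
lemma multiplier_sum_le (m : ℕ) {κ : ℝ} (hκ : 0 < κ) (a : ℕ) : ∃ C : ℝ, 0 < C ∧
    ∀ θ : ℝ, 1 ≤ θ → ∀ r : ℝ, κ / θ ^ 2 < r → ∀ (f : CFun m) (M : ℝ), HPB r f M →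
    ∀ (c : (Fin m → ℤ) → ℂ) (A : ℝ), (∀ s, ‖c s‖ ≤ A * (1 + wt s) ^ a) →
    ∀ F : Finset (Fin m → ℤ), ∑ s ∈ F, ‖c s * fc f s‖ * Real.exp ((r - κ / θ ^ 2) * wt s) ≤
      C * A * M * θ ^ (2 * a + m) := by
  set D : ℝ := 2 ^ m * (((2 * a).factorial : ℝ) * (2 / κ) ^ (2 * a) * Real.exp (κ / 2)
    * (4 * (1 + κ) / κ) ^ m) with hD
  have hDpos : 0 < D := by positivity
  refine ⟨Real.sqrt D, Real.sqrt_pos.mpr hDpos, ?_⟩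
  intro θ hθ r hr f M hf c A hc F
  have hθ0 : 0 < θ := by linarith
  set δ := κ / θ ^ 2 with hδ
  have hδ0 : 0 < δ := by positivity
  have hδκ : δ ≤ κ := div_le_self hκ.le (one_le_pow₀ hθ)
  have hA : 0 ≤ A := by
    have := (norm_nonneg _).trans (hc 0)
    simpa [wt] using this
  have hM : 0 ≤ M := hf.nonneg (hδ0.trans hr)
  -- One half of the loss δ is spent on the weighted Bessel inequality, the other on summing the
  -- polynomial weights. Cauchy–Schwarz combines the two.
  have h1 := hf.weighted_bessel (r' := r - δ / 2) (by linarith) (by linarith) F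
  have h2 : ∑ s ∈ F, ((1 + wt s) ^ a * Real.exp (-(δ / 2) * wt s)) ^ 2 ≤
      ((2 * a).factorial : ℝ) * (2 / δ) ^ (2 * a) * Real.exp (κ / 2) * (4 * (1 + κ) / δ) ^ m := by
    calc ∑ s ∈ F, ((1 + wt s) ^ a * Real.exp (-(δ / 2) * wt s)) ^ 2
        ≤ ∑ s ∈ F, ((2 * a).factorial : ℝ) * (2 / δ) ^ (2 * a) * Real.exp (κ / 2)
            * Real.exp (-(δ / 2) * wt s) := by
          refine Finset.sum_le_sum fun s _ => ?_
          have hw := wt_nonneg s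
          -- A single term of the exponential series dominates the polynomial. It consumes one of
          -- the two factors e^{-δ|s|/2} in the square and leaves the other for summation over s.
          have h3 := Real.pow_div_factorial_le_exp (δ / 2 * (1 + wt s)) (by positivity) (2 * a)
          rw [div_le_iff₀ (by positivity), mul_pow] at h3
          have h4 : (1 + wt s) ^ (2 * a) ≤
              (2 * a).factorial * (2 / δ) ^ (2 * a) * Real.exp (δ / 2 * (1 + wt s)) := by
            calc (1 + wt s) ^ (2 * a) = (2 / δ) ^ (2 * a) * ((δ / 2) ^ (2 * a) * (1 + wt s) ^ (2 * a)) := by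
                  rw [← mul_assoc, ← mul_pow]
                  have : 2 / δ * (δ / 2) = 1 := by field_simp
                  rw [this]; ring
              _ ≤ (2 / δ) ^ (2 * a) * (Real.exp (δ / 2 * (1 + wt s)) * (2 * a).factorial) := by gcongr
              _ = _ := by ring
          calc ((1 + wt s) ^ a * Real.exp (-(δ / 2) * wt s)) ^ 2
              = (1 + wt s) ^ (2 * a) * (Real.exp (-(δ / 2) * wt s) * Real.exp (-(δ / 2) * wt s)) := by
                ring
            _ ≤ ((2 * a).factorial * (2 / δ) ^ (2 * a) * Real.exp (δ / 2 * (1 + wt s)))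
                * (Real.exp (-(δ / 2) * wt s) * Real.exp (-(δ / 2) * wt s)) := by gcongr
            _ = (2 * a).factorial * (2 / δ) ^ (2 * a) * Real.exp (δ / 2)
                * Real.exp (-(δ / 2) * wt s) := by
                have : Real.exp (δ / 2 * (1 + wt s)) * Real.exp (-(δ / 2) * wt s) = Real.exp (δ / 2) := by
                  rw [← Real.exp_add]; congr 1; ring
                rw [← this]; ring
            _ ≤ _ := by gcongr
      _ = ((2 * a).factorial : ℝ) * (2 / δ) ^ (2 * a) * Real.exp (κ / 2)
            * ∑ s ∈ F, Real.exp (-(δ / 2) * wt s) := by rw [Finset.mul_sum]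
      _ ≤ _ := by
          gcongr
          refine (sum_exp_neg_wt_le (by positivity) F).trans ?_
          have : 2 * (1 + δ / 2) / (δ / 2) = 4 * (1 + δ / 2) / δ := by field_simp; ring
          rw [this]
          gcongr
          linarith
  have hcs := Real.sum_mul_le_sqrt_mul_sqrt F (fun s => ‖fc f s‖ * Real.exp ((r - δ / 2) * wt s))
    (fun s => (1 + wt s) ^ a * Real.exp (-(δ / 2) * wt s))
  calc ∑ s ∈ F, ‖c s * fc f s‖ * Real.exp ((r - δ) * wt s)
      ≤ ∑ s ∈ F, A * ((‖fc f s‖ * Real.exp ((r - δ / 2) * wt s)) *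
          ((1 + wt s) ^ a * Real.exp (-(δ / 2) * wt s))) := by
        refine Finset.sum_le_sum fun s _ => ?_
        have e : Real.exp ((r - δ) * wt s) =
            Real.exp ((r - δ / 2) * wt s) * Real.exp (-(δ / 2) * wt s) := by
          rw [← Real.exp_add]; congr 1; ring
        rw [norm_mul, e]
        calc ‖c s‖ * ‖fc f s‖ * (Real.exp ((r - δ / 2) * wt s) * Real.exp (-(δ / 2) * wt s))
            ≤ (A * (1 + wt s) ^ a) * ‖fc f s‖ *
              (Real.exp ((r - δ / 2) * wt s) * Real.exp (-(δ / 2) * wt s)) := by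
              gcongr; exact hc s
          _ = _ := by ring
    _ = A * ∑ s ∈ F, (‖fc f s‖ * Real.exp ((r - δ / 2) * wt s)) *
          ((1 + wt s) ^ a * Real.exp (-(δ / 2) * wt s)) := by rw [Finset.mul_sum]
    _ ≤ A * (Real.sqrt (2 ^ m * M ^ 2) * Real.sqrt (((2 * a).factorial : ℝ) * (2 / δ) ^ (2 * a)
          * Real.exp (κ / 2) * (4 * (1 + κ) / δ) ^ m)) := by
        gcongr
        refine hcs.trans ?_
        gcongr
    -- Each 1/δ equals θ²/κ; there are 2a of them from the polynomial and m from the lattice sum,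
    -- and the square root halves the resulting power θ^{2(2a+m)}.
    _ = A * Real.sqrt (D * (M * θ ^ (2 * a + m)) ^ 2) := by
        rw [← Real.sqrt_mul (by positivity)]
        congr 2
        have e1 : 2 / δ = 2 / κ * θ ^ 2 := by rw [hδ]; field_simp
        have e2 : 4 * (1 + κ) / δ = 4 * (1 + κ) / κ * θ ^ 2 := by rw [hδ]; field_simp
        rw [e1, e2, hD, mul_pow, mul_pow (4 * (1 + κ) / κ)]
        ring
    _ = _ := by
        rw [Real.sqrt_mul hDpos.le, Real.sqrt_sq (by positivity)]; ring


/-- The function with Fourier coefficients `b`. -/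
def fseries (b : (Fin m → ℤ) → ℂ) : CFun m := fun ξ => ∑' s, b s * cexpo s ξ

lemma exists_lt_mem_openStrip {R : ℝ} {ξ : Fin m → ℂ} (hξ : ξ ∈ openStrip m R) (hR : 0 < R) :
    ∃ R', 0 < R' ∧ R' < R ∧ ξ ∈ openStrip m R' := by
  have h : ‖fun j => (ξ j).im‖ < R := by
    rw [pi_norm_lt_iff hR]; exact hξ
  have h0 := norm_nonneg fun j => (ξ j).im
  refine ⟨(R + ‖fun j => (ξ j).im‖) / 2, by linarith, by linarith, fun j => ?_⟩
  have := norm_le_pi_norm (fun j => (ξ j).im) j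
  rw [Real.norm_eq_abs] at this
  linarith

/-- The differential of `e^{i s·ξ}`. -/
lemma hasFDerivAt_cexpo (s : Fin m → ℤ) (ξ : Fin m → ℂ) :
    HasFDerivAt (cexpo s) ((cexpo s ξ * Complex.I) •
      ∑ j, (s j : ℂ) • (ContinuousLinearMap.proj j : (Fin m → ℂ) →L[ℂ] ℂ)) ξ := by
  have h1 : HasFDerivAt (fun ξ : Fin m → ℂ => Complex.I * ∑ j, (s j : ℂ) * ξ j)
      (Complex.I • ∑ j, (s j : ℂ) • (ContinuousLinearMap.proj j : (Fin m → ℂ) →L[ℂ] ℂ)) ξ := by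
    refine HasFDerivAt.const_mul (HasFDerivAt.fun_sum fun j _ => ?_) _
    exact (ContinuousLinearMap.proj (R := ℂ) (φ := fun _ : Fin m => ℂ) j).hasFDerivAt.const_mul _
  have := h1.cexp
  rwa [smul_smul] at this

/-! ### Absolutely convergent Fourier series on strips -/

section Series

variable {b : (Fin m → ℤ) → ℂ} {R B : ℝ}

lemma summable_of_sum_exp_le (h : ∀ F : Finset (Fin m → ℤ), ∑ s ∈ F, ‖b s‖ * Real.exp (R * wt s) ≤ B) :
    Summable fun s => ‖b s‖ * Real.exp (R * wt s) :=
  summable_of_sum_le (fun _ => by positivity) h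

lemma norm_term_le {ξ : Fin m → ℂ} (hξ : ξ ∈ openStrip m R) (s : Fin m → ℤ) :
    ‖b s * cexpo s ξ‖ ≤ ‖b s‖ * Real.exp (R * wt s) := by
  rw [norm_mul]
  exact mul_le_mul_of_nonneg_left (norm_cexpo_le hξ s) (norm_nonneg _)

/-- On a slightly narrower strip |ξ_im| < R' the extra factor |s| of the termwise differential is at
most e^{(R−R')|s|}/(R−R'), so the differentiated series has the same majorant up to a constant. -/
lemma hasFDerivAt_fseries (hR : 0 < R)
    (h : ∀ F : Finset (Fin m → ℤ), ∑ s ∈ F, ‖b s‖ * Real.exp (R * wt s) ≤ B) {ξ : Fin m → ℂ}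
    (hξ : ξ ∈ openStrip m R) :
    ∃ f' : (Fin m → ℂ) →L[ℂ] ℂ, HasFDerivAt (fseries b) f' ξ ∧
      ∀ j, f' (Pi.single j 1) = fseries (fun s => Complex.I * s j * b s) ξ := by
  obtain ⟨R', hR', hlt, hξ'⟩ := exists_lt_mem_openStrip hξ hR
  have hs := summable_of_sum_exp_le h
  let f' : (Fin m → ℤ) → (Fin m → ℂ) → (Fin m → ℂ) →L[ℂ] ℂ := fun s ξ =>
    b s • ((cexpo s ξ * Complex.I) •
      ∑ j, (s j : ℂ) • (ContinuousLinearMap.proj j : (Fin m → ℂ) →L[ℂ] ℂ))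
  have hbound : ∀ s, ∀ ξ ∈ openStrip m R', ‖f' s ξ‖ ≤
      (R - R')⁻¹ * (‖b s‖ * Real.exp (R * wt s)) := by
    intro s ξ hξ
    have hd : 0 < R - R' := by linarith
    have h1 : ‖∑ j, (s j : ℂ) • (ContinuousLinearMap.proj j : (Fin m → ℂ) →L[ℂ] ℂ)‖ ≤ wt s := by
      refine (norm_sum_le _ _).trans (Finset.sum_le_sum fun j _ => ?_)
      rw [norm_smul]
      have : ‖(ContinuousLinearMap.proj j : (Fin m → ℂ) →L[ℂ] ℂ)‖ ≤ 1 :=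
        ContinuousLinearMap.opNorm_le_bound _ zero_le_one fun v => by
          rw [one_mul]; exact norm_le_pi_norm v j
      calc ‖(s j : ℂ)‖ * _ ≤ ‖(s j : ℂ)‖ * 1 := by gcongr
        _ = |(s j : ℝ)| := by rw [mul_one, Complex.norm_intCast]
    have h2 : wt s * Real.exp (R' * wt s) ≤ (R - R')⁻¹ * Real.exp (R * wt s) := by
      have h3 : (R - R') * wt s ≤ Real.exp ((R - R') * wt s) := by
        linarith [Real.add_one_le_exp ((R - R') * wt s)]
      have h4 : Real.exp (R * wt s) = Real.exp ((R - R') * wt s) * Real.exp (R' * wt s) := by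
        rw [← Real.exp_add]; congr 1; ring
      rw [h4, ← mul_assoc]
      refine mul_le_mul_of_nonneg_right ?_ (Real.exp_nonneg _)
      rw [inv_mul_eq_div, le_div_iff₀ hd]
      linarith
    calc ‖f' s ξ‖ = ‖b s‖ * (‖cexpo s ξ‖ *
          ‖∑ j, (s j : ℂ) • (ContinuousLinearMap.proj j : (Fin m → ℂ) →L[ℂ] ℂ)‖) := by
          simp only [f', norm_smul, norm_mul, Complex.norm_I, mul_one]
      _ ≤ ‖b s‖ * (Real.exp (R' * wt s) * wt s) := by
          gcongr
          exact norm_cexpo_le hξ s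
      _ ≤ ‖b s‖ * ((R - R')⁻¹ * Real.exp (R * wt s)) := by
          exact mul_le_mul_of_nonneg_left (by linarith) (norm_nonneg _)
      _ = _ := by ring
  have hu := hs.mul_left (R - R')⁻¹
  have hsum : Summable fun s => f' s ξ := Summable.of_norm_bounded hu fun s => hbound s ξ hξ'
  refine ⟨∑' s, f' s ξ, ?_, fun j => ?_⟩
  · refine hasFDerivAt_tsum_of_isPreconnected hu (isOpen_openStrip R')
      (convex_openStrip R').isPreconnected (fun s η _ => ?_) hbound hξ' ?_ hξ'
    · exact (hasFDerivAt_cexpo s η).const_mul (b s)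
    · exact Summable.of_norm_bounded hs fun s => norm_term_le hξ s
  · have e := (ContinuousLinearMap.apply ℂ ℂ (Pi.single j (1 : ℂ) : Fin m → ℂ)).map_tsum hsum
    simp only [ContinuousLinearMap.apply_apply] at e
    rw [e, fseries]
    congr 1
    funext s
    simp only [f', smul_apply, sum_apply, smul_eq_mul,
      ContinuousLinearMap.proj_apply, Pi.single_apply]
    simp
    ring

lemma hpb_fseries (hR : 0 < R)
    (h : ∀ F : Finset (Fin m → ℤ), ∑ s ∈ F, ‖b s‖ * Real.exp (R * wt s) ≤ B) :
    HPB R (fseries b) B := by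
  have hs := summable_of_sum_exp_le h
  refine ⟨fun ξ _ j => ?_, fun ξ hξ => ?_, fun ξ hξ => ?_⟩
  · simp only [fseries, cexpo_period]
  · obtain ⟨f', hf', -⟩ := hasFDerivAt_fseries hR h hξ
    exact hf'.differentiableAt.differentiableWithinAt
  · refine (tsum_of_norm_bounded hs.hasSum fun s => norm_term_le hξ s).trans ?_
    exact hs.tsum_le_of_sum_le h

lemma pd_fseries (hR : 0 < R)
    (h : ∀ F : Finset (Fin m → ℤ), ∑ s ∈ F, ‖b s‖ * Real.exp (R * wt s) ≤ B) {ξ : Fin m → ℂ}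
    (hξ : ξ ∈ openStrip m R) (j : Fin m) :
    pd j (fseries b) ξ = fseries (fun s => Complex.I * s j * b s) ξ := by
  obtain ⟨f', hf', hj⟩ := hasFDerivAt_fseries hR h hξ
  rw [← hj]
  exact ((hf'.restrictScalars ℝ).hasLineDerivAt (Pi.single j 1)).lineDeriv

/-- Termwise integration, justified by absolute convergence, and orthogonality of the exponentials.
-/
lemma fc_fseries (hR : 0 < R)
    (h : ∀ F : Finset (Fin m → ℤ), ∑ s ∈ F, ‖b s‖ * Real.exp (R * wt s) ≤ B) (t : Fin m → ℤ) :
    fc (fseries b) t = b t := by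
  have hs := summable_of_sum_exp_le h
  let I := Set.Icc (0 : Fin m → ℝ) (fun _ => 2 * Real.pi)
  have hle : ∀ s x, ‖cexpo (-t) (ofR x) * (b s * cexpo s (ofR x))‖ ≤ ‖b s‖ * Real.exp (R * wt s) := by
    intro s x
    rw [norm_mul]
    have : ‖cexpo (-t) (ofR x)‖ = 1 := by rw [norm_cexpo]; simp [ofR]
    rw [this, one_mul]
    exact norm_term_le (ofR_mem_openStrip hR x) s
  have hint : ∀ s, Integrable (fun x => cexpo (-t) (ofR x) * (b s * cexpo s (ofR x)))
      (volume.restrict I) := fun s =>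
    ((TorusCont.cexpo (-t)).mul ((TorusCont.cexpo s).const_mul (b s))).integrableOn
  have hfin : (volume I) ≠ ⊤ := isCompact_Icc.measure_lt_top.ne
  have key := hasSum_integral_of_summable_integral_norm
    (F := fun s x => cexpo (-t) (ofR x) * (b s * cexpo s (ofR x))) (μ := volume.restrict I) hint (by
      refine Summable.of_nonneg_of_le (fun s => integral_nonneg fun _ => norm_nonneg _) (fun s => ?_)
        (hs.mul_right (volume.real I))
      have : ∫ x in I, ‖cexpo (-t) (ofR x) * (b s * cexpo s (ofR x))‖ ≤
          ∫ _ in I, ‖b s‖ * Real.exp (R * wt s) :=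
        integral_mono (hint s).norm (integrableOn_const hfin) fun x => hle s x
      refine this.trans (le_of_eq ?_)
      rw [setIntegral_const, smul_eq_mul, mul_comm])
  have h1 : ∀ x, ∑' s, cexpo (-t) (ofR x) * (b s * cexpo s (ofR x)) =
      cexpo (-t) (ofR x) * fseries b (ofR x) := fun x => by rw [fseries, tsum_mul_left]
  simp only [h1] at key
  have key2 := key.mul_left ((((2 * Real.pi) ^ m : ℝ) : ℂ)⁻¹)
  have h2 : ∀ s, (((2 * Real.pi) ^ m : ℝ) : ℂ)⁻¹ *
      ∫ x in I, cexpo (-t) (ofR x) * (b s * cexpo s (ofR x)) = if s = t then b t else 0 := by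
    intro s
    change mean (fun ξ => cexpo (-t) ξ * (b s * cexpo s ξ)) = _
    have : (fun ξ => cexpo (m := m) (-t) ξ * (b s * cexpo s ξ)) = fun ξ => b s * cexpo (s - t) ξ := by
      funext ξ
      rw [sub_eq_add_neg, cexpo_add_index]; ring
    rw [this, mean_const_mul]
    split_ifs with hst
    · subst hst
      rw [sub_self, show cexpo (m := m) 0 = fun _ => 1 from funext cexpo_zero, mean_const, mul_one]
    · rw [mean_cexpo _ (sub_ne_zero.mpr hst), mul_zero]
  simp only [h2] at key2
  have h3 := key2.unique (hasSum_ite_eq t (b t))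
  exact h3

end Series

lemma abs_apply_le_wt (s : Fin m → ℤ) (j : Fin m) : |(s j : ℝ)| ≤ wt s :=
  Finset.single_le_sum (f := fun j => |(s j : ℝ)|) (fun _ _ => abs_nonneg _) (Finset.mem_univ j)

/-- Existence of the image of `f` under a Fourier multiplier of polynomial growth, with bounds for
the function and for its gradient. -/
theorem exists_multiplier (m : ℕ) {κ : ℝ} (hκ : 0 < κ) (a : ℕ) : ∃ C : ℝ, 0 < C ∧
    ∀ θ : ℝ, 1 ≤ θ → ∀ r : ℝ, κ / θ ^ 2 < r → ∀ (f : CFun m) (M : ℝ), HPB r f M →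
    ∀ (c : (Fin m → ℤ) → ℂ) (A : ℝ), (∀ s, ‖c s‖ ≤ A * (1 + wt s) ^ a) →
    ∃ g : CFun m, HPB (r - κ / θ ^ 2) g (C * A * M * θ ^ (2 * a + m)) ∧
      (∀ j, HPB (r - κ / θ ^ 2) (pd j g) (C * A * M * θ ^ (2 * (a + 1) + m))) ∧
      ∀ s, fc g s = c s * fc f s := by
  obtain ⟨C₁, hC₁, h₁⟩ := multiplier_sum_le m hκ a
  obtain ⟨C₂, hC₂, h₂⟩ := multiplier_sum_le m hκ (a + 1)
  refine ⟨max C₁ C₂, lt_max_of_lt_left hC₁, ?_⟩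
  intro θ hθ r hr f M hf c A hc
  have hθ0 : 0 < θ := by linarith
  have hR : 0 < r - κ / θ ^ 2 := by linarith
  have hA : 0 ≤ A := by
    have := (norm_nonneg _).trans (hc 0)
    simpa [wt] using this
  have hM : 0 ≤ M := hf.nonneg ((by positivity : 0 < κ / θ ^ 2).trans hr)
  have b₁ := h₁ θ hθ r hr f M hf c A hc
  -- A partial derivative is again a multiplier, with one more power of |s|; this is the extra θ² in
  -- the gradient bound.
  have hc₂ : ∀ j s, ‖Complex.I * s j * c s‖ ≤ A * (1 + wt s) ^ (a + 1) := by
    intro j s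
    have hw := wt_nonneg s
    rw [norm_mul, norm_mul, Complex.norm_I, one_mul, Complex.norm_intCast, pow_succ]
    calc |(s j : ℝ)| * ‖c s‖ ≤ (1 + wt s) * (A * (1 + wt s) ^ a) := by
          gcongr
          · linarith [abs_apply_le_wt s j]
          · exact hc s
      _ = _ := by ring
  have b₂ := fun j => h₂ θ hθ r hr f M hf (fun s => Complex.I * s j * c s) A (hc₂ j)
  refine ⟨fseries fun s => c s * fc f s, (hpb_fseries hR b₁).mono_bound ?_, fun j => ?_, fun s =>
    fc_fseries hR b₁ s⟩
  · gcongr; exact le_max_left _ _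
  · have := hpb_fseries hR (b₂ j)
    refine (this.congr fun ξ hξ => ?_).mono_bound ?_
    · rw [pd_fseries hR b₁ hξ]
      congr 1
      funext s; ring
    · gcongr; exact le_max_right _ _

/-- Partial derivatives of bounded periodic holomorphic functions are holomorphic. -/
lemma HPB.differentiableOn_pd {r : ℝ} {f : CFun m} {M : ℝ} (hf : HPB r f M) (j : Fin m) :
    DifferentiableOn ℂ (pd j f) (openStrip m r) := by
  intro ξ hξ
  have hr : 0 < r := (abs_nonneg _).trans_lt (hξ j)
  obtain ⟨R', hR', hlt, hξ'⟩ := exists_lt_mem_openStrip hξ hr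
  -- The trivial multiplier c = 1 rewrites f on the narrower strip R' (κ = r − R', θ = 1) as a
  -- Fourier series, whose partial derivatives are already known to be holomorphic.
  obtain ⟨C, -, hC⟩ := exists_multiplier m (sub_pos.mpr hlt) 0
  obtain ⟨g, hg, hpg, hfc⟩ := hC 1 le_rfl r (by simpa using hR') f M hf (fun _ => 1) 1 (by simp)
  simp only [one_pow, div_one, sub_sub_cancel] at hg hpg
  have heq := (hf.mono hlt.le).eqOn hg
    (((hf.torusCont hr).eqOn_of_fc_eq (hg.torusCont hR') fun s => by rw [hfc, one_mul]))
  have hpd : ∀ η ∈ openStrip m R', pd j f η = pd j g η := by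
    intro η hη
    rw [pd, pd, ((hf.mono hlt.le).hasLineDerivAt hη j).lineDeriv, (hg.hasLineDerivAt hη j).lineDeriv]
    have : f =ᶠ[𝓝 η] g := by
      filter_upwards [(isOpen_openStrip R').mem_nhds hη] with ζ hζ using heq ζ hζ
    rw [this.fderiv_eq]
  have h1 := ((hpg j).diff.congr hpd).differentiableAt ((isOpen_openStrip R').mem_nhds hξ')
  exact h1.differentiableWithinAt

lemma HPB.pd {r : ℝ} {f : CFun m} {M N : ℝ} (hf : HPB r f M) (j : Fin m)
    (h : ∀ ξ ∈ openStrip m r, ‖pd j f ξ‖ ≤ N) : HPB r (pd j f) N := by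
  refine ⟨fun ξ hξ i => ?_, hf.differentiableOn_pd j, h⟩
  unfold LowDimTori.pd lineDeriv
  congr 1
  funext t
  have e : ξ + Pi.single i ((2 * Real.pi : ℝ) : ℂ) + t • (Pi.single j 1 : Fin m → ℂ) =
      ξ + t • (Pi.single j 1 : Fin m → ℂ) + Pi.single i ((2 * Real.pi : ℝ) : ℂ) := by abel
  rw [e]
  refine hf.periodic _ (fun k => ?_) i
  have := hξ k
  by_cases hk : k = j
  · subst hk; simpa using this
  · simpa [hk] using this

/-- Again f is replaced by its own Fourier series through the trivial multiplier, at the loss of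
half the width. -/
lemma HPB.torusC1 {r : ℝ} {f : CFun m} {M : ℝ} (hf : HPB r f M) (hr : 0 < r) : TorusC1 f := by
  refine ⟨hf.torusCont hr, fun x j =>
    (hf.hasLineDerivAt (ofR_mem_openStrip hr x) j).lineDifferentiableAt, fun j => ?_⟩
  obtain ⟨C, -, hC⟩ := exists_multiplier m (half_pos hr) 0
  obtain ⟨g, hg, hpg, hfc⟩ := hC 1 le_rfl r (by simpa using by linarith) f M hf (fun _ => 1) 1 (by simp)
  simp only [one_pow, div_one] at hg hpg
  have hr2 : 0 < r - r / 2 := by linarith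
  have heq := (hf.torusCont hr).eqOn_of_fc_eq (hg.torusCont hr2) fun s => by rw [hfc, one_mul]
  have hp := (hpg j).torusCont hr2
  have hpd := pd_congr heq j
  exact ⟨fun x i => by rw [hpd _ (ofR_mem_strip _), hpd _ (ofR_mem_strip _)]; exact hp.periodic x i,
    hp.cont.congr fun x => (hpd _ (ofR_mem_strip _)).symm⟩

end LowDimTori

end

noncomputable section

namespace LowDimTori

open MeasureTheory Set Filter Topology

variable {m : ℕ}

/-! ## Constant coefficient equations on the torus -/

lemma TorusC1.const_mul {f : CFun m} (hf : TorusC1 f) (c : ℂ) : TorusC1 (fun ξ => c * f ξ) ∧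
    ∀ j, ∀ ξ ∈ strip m 0, LowDimTori.pd j (fun ξ => c * f ξ) ξ = c * LowDimTori.pd j f ξ := by
  have h := (TorusC1.const (m := m) c).1.mul hf
  refine ⟨h.1, fun j ξ hξ => ?_⟩
  rw [h.2 j ξ hξ, (TorusC1.const (m := m) c).2, zero_mul, zero_add]

lemma TorusC1.sub {f g : CFun m} (hf : TorusC1 f) (hg : TorusC1 g) : TorusC1 (fun ξ => f ξ - g ξ) ∧
    ∀ j, ∀ ξ ∈ strip m 0,
      LowDimTori.pd j (fun ξ => f ξ - g ξ) ξ = LowDimTori.pd j f ξ - LowDimTori.pd j g ξ := by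
  have h1 := hg.const_mul (-1)
  have h := hf.add h1.1
  have e : (fun ξ => f ξ - g ξ) = fun ξ => f ξ + -1 * g ξ := by funext ξ; ring
  rw [e]
  refine ⟨h.1, fun j ξ hξ => ?_⟩
  rw [h.2 j ξ hξ, h1.2 j ξ hξ]; ring

section DirD

variable {ω : Fin m → ℝ} {f g : CFun m}

lemma TorusC1.dirD (hf : TorusC1 f) : TorusCont (dirD ω f) :=
  TorusCont.sum fun j _ => (hf.pd j).const_mul _

lemma dirD_add (hf : TorusC1 f) (hg : TorusC1 g) {ξ : Fin m → ℂ} (hξ : ξ ∈ strip m 0) :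
    dirD ω (fun ξ => f ξ + g ξ) ξ = dirD ω f ξ + dirD ω g ξ := by
  simp only [dirD, ← Finset.sum_add_distrib]
  exact Finset.sum_congr rfl fun j _ => by rw [(hf.add hg).2 j ξ hξ]; ring

lemma dirD_sub (hf : TorusC1 f) (hg : TorusC1 g) {ξ : Fin m → ℂ} (hξ : ξ ∈ strip m 0) :
    dirD ω (fun ξ => f ξ - g ξ) ξ = dirD ω f ξ - dirD ω g ξ := by
  simp only [dirD, ← Finset.sum_sub_distrib]
  exact Finset.sum_congr rfl fun j _ => by rw [(hf.sub hg).2 j ξ hξ]; ring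

lemma dirD_const_mul (hf : TorusC1 f) (c : ℂ) {ξ : Fin m → ℂ} (hξ : ξ ∈ strip m 0) :
    dirD ω (fun ξ => c * f ξ) ξ = c * dirD ω f ξ := by
  simp only [dirD, Finset.mul_sum]
  exact Finset.sum_congr rfl fun j _ => by rw [(hf.const_mul c).2 j ξ hξ]; ring

lemma dirD_add_const (hf : TorusC1 f) (c : ℂ) {ξ : Fin m → ℂ} (hξ : ξ ∈ strip m 0) :
    dirD ω (fun ξ => f ξ + c) ξ = dirD ω f ξ := by
  rw [dirD_add hf (TorusC1.const c).1 hξ]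
  simp [dirD, (TorusC1.const (m := m) c).2]

lemma dirD_congr (h : ∀ ξ ∈ strip m 0, f ξ = g ξ) {ξ : Fin m → ℂ} (hξ : ξ ∈ strip m 0) :
    dirD ω f ξ = dirD ω g ξ :=
  Finset.sum_congr rfl fun j _ => by rw [pd_congr h j ξ hξ]

/-- The frequency `ω · s`. -/
def freq (ω : Fin m → ℝ) (s : Fin m → ℤ) : ℝ := ∑ j, ω j * (s j : ℝ)

lemma fc_sum {ι : Type*} (F : Finset ι) {f : ι → CFun m} (hf : ∀ i ∈ F, TorusCont (f i))
    (s : Fin m → ℤ) : fc (fun ξ => ∑ i ∈ F, f i ξ) s = ∑ i ∈ F, fc (f i) s := by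
  classical
  induction F using Finset.induction_on with
  | empty => simp [fc_const]
  | insert a F ha ih =>
    simp only [Finset.sum_insert ha]
    rw [fc_add (hf a (Finset.mem_insert_self a F))
      (TorusCont.sum fun i hi => hf i (Finset.mem_insert_of_mem hi)),
      ih fun i hi => hf i (Finset.mem_insert_of_mem hi)]

lemma fc_dirD (hf : TorusC1 f) (s : Fin m → ℤ) :
    fc (dirD ω f) s = Complex.I * freq ω s * fc f s := by
  unfold dirD
  rw [fc_sum _ fun j _ => (hf.pd j).const_mul _]
  simp only [fc_const_mul, hf.fc_pd, freq]
  push_cast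
  rw [Finset.mul_sum, Finset.sum_mul]
  exact Finset.sum_congr rfl fun j _ => by ring

lemma freq_zero : freq ω 0 = 0 := by simp [freq]

end DirD

/-- The Diophantine condition with all constants collected in one, in terms of the weight `wt`. -/
def Dioph (ω : Fin m → ℝ) (A : ℝ) : Prop :=
  1 ≤ A ∧ (∀ s, |freq ω s| ≤ A * (1 + wt s)) ∧
    ∀ s, s ≠ 0 → freq ω s ≠ 0 ∧ |freq ω s|⁻¹ ≤ A * (1 + wt s) ^ (m + 1)

lemma exists_dioph {ω : Fin m → ℝ} {c₀ : ℝ} (h : ∀ s : Fin m → ℤ, s ≠ 0 →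
    (∑ i, ω i * (s i : ℝ)) ≠ 0 ∧
    |∑ i, ω i * (s i : ℝ)|⁻¹ ≤ c₀ * Real.sqrt (∑ i, (s i : ℝ) ^ 2) ^ (m + 1)) :
    ∃ A, Dioph ω A := by
  refine ⟨1 + |c₀| + ∑ j, |ω j|, ?_, fun s => ?_, fun s hs => ⟨(h s hs).1, (h s hs).2.trans ?_⟩⟩
  · have : 0 ≤ ∑ j, |ω j| := Finset.sum_nonneg fun _ _ => abs_nonneg _
    linarith [abs_nonneg c₀]
  · have h0 : 0 ≤ ∑ j, |ω j| := Finset.sum_nonneg fun _ _ => abs_nonneg _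
    have hw := wt_nonneg s
    calc |freq ω s| ≤ ∑ j, |ω j * (s j : ℝ)| := Finset.abs_sum_le_sum_abs _ _
      _ ≤ ∑ j, |ω j| * (1 + wt s) := by
        refine Finset.sum_le_sum fun j _ => ?_
        rw [abs_mul]
        gcongr
        linarith [abs_apply_le_wt s j]
      _ = (∑ j, |ω j|) * (1 + wt s) := by rw [Finset.sum_mul]
      _ ≤ _ := by gcongr; linarith [abs_nonneg c₀]
  · have h0 : 0 ≤ ∑ j, |ω j| := Finset.sum_nonneg fun _ _ => abs_nonneg _
    have hw := wt_nonneg s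
    have h1 : Real.sqrt (∑ i, (s i : ℝ) ^ 2) ≤ 1 + wt s := by
      refine Real.sqrt_le_iff.mpr ⟨by linarith, ?_⟩
      have : ∑ i, (s i : ℝ) ^ 2 ≤ (wt s) ^ 2 := by
        simp only [← sq_abs (s _ : ℝ)]
        exact Finset.sum_sq_le_sq_sum_of_nonneg fun _ _ => abs_nonneg _
      nlinarith
    calc c₀ * Real.sqrt (∑ i, (s i : ℝ) ^ 2) ^ (m + 1)
        ≤ |c₀| * Real.sqrt (∑ i, (s i : ℝ) ^ 2) ^ (m + 1) := by gcongr; exact le_abs_self _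
      _ ≤ _ := by gcongr; linarith

section Solve

variable {ω : Fin m → ℝ} {A : ℝ}

/-- Several multipliers at once. -/
lemma exists_multiplier_sum (m : ℕ) (ι : Type) [Fintype ι] [Nonempty ι] {κ : ℝ} (hκ : 0 < κ) (a : ℕ) (A : ℝ) :
    ∃ C : ℝ, 0 < C ∧
    ∀ θ : ℝ, 1 ≤ θ → ∀ r : ℝ, κ / θ ^ 2 < r → ∀ (f : ι → CFun m) (M : ℝ), (∀ i, HPB r (f i) M) →
    ∀ (c : ι → (Fin m → ℤ) → ℂ), (∀ i s, ‖c i s‖ ≤ A * (1 + wt s) ^ a) →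
    ∃ g : CFun m, HPB (r - κ / θ ^ 2) g (C * M * θ ^ (2 * a + m)) ∧
      (∀ j, HPB (r - κ / θ ^ 2) (pd j g) (C * M * θ ^ (2 * (a + 1) + m))) ∧
      ∀ s, fc g s = ∑ i, c i s * fc (f i) s := by
  obtain ⟨C, hC, h⟩ := exists_multiplier m hκ a
  refine ⟨(Fintype.card ι + 1) * (C * (|A| + 1)), by positivity, ?_⟩
  intro θ hθ r hr f M hf c hc
  have hθ0 : 0 < θ := by linarith
  have hR : 0 < r - κ / θ ^ 2 := by linarith
  have hM : 0 ≤ M := (hf (Classical.arbitrary ι)).nonneg ((by positivity : 0 < κ / θ ^ 2).trans hr)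
  choose g hg hpg hfc using fun i => h θ hθ r hr (f i) M (hf i) (c i) (|A| + 1) (fun s => by
    refine (hc i s).trans ?_
    have := wt_nonneg s
    gcongr
    linarith [le_abs_self A])
  refine ⟨fun ξ => ∑ i, g i ξ, (HPB.sum fun i _ => hg i).mono_bound ?_, fun j => ?_, fun s => ?_⟩
  · rw [Finset.sum_const, Finset.card_univ, nsmul_eq_mul]
    have : 0 ≤ C * (|A| + 1) * M * θ ^ (2 * a + m) := by positivity
    nlinarith
  · have hpd : ∀ ξ ∈ openStrip m (r - κ / θ ^ 2), pd j (fun ξ => ∑ i, g i ξ) ξ = ∑ i, pd j (g i) ξ := by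
      intro ξ hξ
      have : HasLineDerivAt ℝ (fun ξ => ∑ i, g i ξ) (∑ i, pd j (g i) ξ) ξ (Pi.single j 1) := by
        refine HasDerivAt.fun_sum fun i _ => ?_
        exact ((hg i).hasLineDerivAt hξ j).lineDifferentiableAt.hasLineDerivAt
      exact this.lineDeriv
    refine ((HPB.sum fun i _ => hpg i j).congr hpd).mono_bound ?_
    rw [Finset.sum_const, Finset.card_univ, nsmul_eq_mul]
    have : 0 ≤ C * (|A| + 1) * M * θ ^ (2 * (a + 1) + m) := by positivity
    nlinarith
  · rw [fc_sum _ fun i _ => (hg i).torusCont hR]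
    exact Finset.sum_congr rfl fun i _ => hfc i s

/-- A nonnegative real part of k only enlarges the real part. This is what makes all divisors
bounded below uniformly in k, including k = 0. -/
lemma norm_sq_le_norm_add {ν : ℝ} {k : ℂ} (hk : 0 ≤ k.re) : ν ^ 2 ≤ ‖(ν : ℂ) ^ 2 + k‖ := by
  refine le_trans ?_ (Complex.re_le_norm _)
  have : ((ν : ℂ) ^ 2 + k).re = ν ^ 2 + k.re := by
    rw [Complex.add_re, ← Complex.ofReal_pow, Complex.ofReal_re]
  rw [this]; linarith

lemma sq_add_ne_zero {ν : ℝ} {k : ℂ} (hν : ν ≠ 0) (hk : 0 ≤ k.re) : (ν : ℂ) ^ 2 + k ≠ 0 := by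
  have h := norm_sq_le_norm_add (ν := ν) hk
  have : 0 < ν ^ 2 := by positivity
  exact norm_pos_iff.mp (this.trans_le h)

/-- The inverse of `ω · ∇` on functions of mean zero. -/
theorem exists_primitive (hω : Dioph ω A) {κ : ℝ} (hκ : 0 < κ) : ∃ C : ℝ, 0 < C ∧
    ∀ θ : ℝ, 1 ≤ θ → ∀ r : ℝ, κ / θ ^ 2 < r → ∀ (G : CFun m) (M : ℝ), HPB r G M →
    ∃ ψ : CFun m, HPB (r - κ / θ ^ 2) ψ (C * M * θ ^ (2 * (m + 1) + m)) ∧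
      (∀ j, HPB (r - κ / θ ^ 2) (pd j ψ) (C * M * θ ^ (2 * (m + 2) + m))) ∧
      mean ψ = 0 ∧ ∀ ξ ∈ strip m 0, dirD ω ψ ξ = G ξ - mean G := by
  obtain ⟨C, hC, h⟩ := exists_multiplier_sum m Unit hκ (m + 1) A
  refine ⟨C, hC, fun θ hθ r hr G M hG => ?_⟩
  have hR : 0 < r - κ / θ ^ 2 := by linarith
  have hr0 : 0 < r := (by positivity : 0 < κ / θ ^ 2).trans hr
  obtain ⟨ψ, h1, h2, h3⟩ := h θ hθ r hr (fun _ => G) M (fun _ => hG)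
    -- The value at s = 0 is a choice of additive constant; zero makes the mean of ψ vanish.
    (fun _ s => if s = 0 then 0 else (Complex.I * freq ω s)⁻¹) (fun _ s => by
      have := wt_nonneg s
      have hA := hω.1
      split_ifs with hs
      · rw [norm_zero]; positivity
      · rw [norm_inv, norm_mul, Complex.norm_I, one_mul, Complex.norm_real, Real.norm_eq_abs]
        exact (hω.2.2 s hs).2)
  have hψ := h1.torusC1 hR
  have hGc := hG.torusCont hr0
  refine ⟨ψ, h1, h2, ?_, ?_⟩
  · rw [← fc_zero_index, h3]; simp
  · refine hψ.dirD.eqOn_of_fc_eq (hGc.sub (TorusCont.const _)) fun s => ?_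
    rw [fc_dirD hψ, h3, fc_sub hGc (TorusCont.const _), fc_const]
    by_cases hs : s = 0
    · subst hs; simp [fc_zero_index]
    · have : (freq ω s : ℂ) ≠ 0 := by exact_mod_cast (hω.2.2 s hs).1
      simp only [hs, if_false, Finset.univ_unique, Finset.sum_singleton, sub_zero]
      field_simp

lemma eq_mean_of_dirD_eq_zero (hω : Dioph ω A) {ψ : CFun m} (hψ : TorusC1 ψ) {c : ℂ}
    (h : ∀ ξ ∈ strip m 0, dirD ω ψ ξ + c = 0) : c = 0 ∧ ∀ ξ ∈ strip m 0, ψ ξ = mean ψ := by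
  have hfc : ∀ s, fc (dirD ω ψ) s + (if s = 0 then c else 0) = 0 := fun s => by
    rw [← fc_const c, ← fc_add hψ.dirD (TorusCont.const c), fc_congr h, fc_const]; simp
  refine ⟨?_, hψ.toCont.eqOn_of_fc_eq (TorusCont.const _) fun s => ?_⟩
  · have := hfc 0
    rw [fc_dirD hψ, freq_zero] at this
    simpa using this
  · rw [fc_const]
    split_ifs with hs
    · rw [hs, fc_zero_index]
    · have := hfc s
      rw [fc_dirD hψ, if_neg hs, add_zero] at this
      have h1 : (freq ω s : ℂ) ≠ 0 := by exact_mod_cast (hω.2.2 s hs).1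
      simpa [h1] using this

lemma norm_inv_sq_le (hω : Dioph ω A) {s : Fin m → ℤ} (hs : s ≠ 0) {k : ℂ} (hk : 0 ≤ k.re) :
    ‖((freq ω s : ℂ) ^ 2 + k)⁻¹‖ ≤ (|freq ω s|⁻¹) ^ 2 := by
  have hν := (hω.2.2 s hs).1
  rw [norm_inv, inv_pow, sq_abs]
  exact inv_anti₀ (by positivity) (norm_sq_le_norm_add hk)

/-- The equation for `λ`: `J ∂λ + Ω λ = G`, solved up to the mean of the first component. -/
theorem exists_lambda (hω : Dioph ω A) {κ : ℝ} (hκ : 0 < κ) (K : ℝ) : ∃ C : ℝ, 0 < C ∧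
    ∀ k : ℂ, 0 ≤ k.re → ‖k‖ ≤ K →
    ∀ θ : ℝ, 1 ≤ θ → ∀ r : ℝ, κ / θ ^ 2 < r → ∀ (G : Fin 2 → CFun m) (M : ℝ), (∀ i, HPB r (G i) M) →
    ∃ l : Fin 2 → CFun m, (∀ i, HPB (r - κ / θ ^ 2) (l i) (C * M * θ ^ (2 * (2 * (m + 1)) + m))) ∧
      (∀ i j, HPB (r - κ / θ ^ 2) (pd j (l i)) (C * M * θ ^ (2 * (2 * (m + 1) + 1) + m))) ∧
      mean (l 0) = 0 ∧ (∀ ξ ∈ strip m 0, dirD ω (l 1) ξ - k * l 0 ξ = G 0 ξ - mean (G 0)) ∧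
      ∀ ξ ∈ strip m 0, -dirD ω (l 0) ξ + l 1 ξ = G 1 ξ := by
  have hA := hω.1
  -- With ν = ω·s the mode s is a 2 × 2 system of determinant −(ν² + k). Its inverse costs two small
  -- divisors, hence the growth 2(m + 1); the factor 1 + |K| covers the entry k/(ν² + k).
  obtain ⟨C, hC, h⟩ := exists_multiplier_sum m (Fin 2) hκ (2 * (m + 1)) (A ^ 2 * (1 + |K|))
  refine ⟨C, hC, fun k hk hkK θ hθ r hr G M hG => ?_⟩
  have hR : 0 < r - κ / θ ^ 2 := by linarith
  have hr0 : 0 < r := (by positivity : 0 < κ / θ ^ 2).trans hr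
  have hkK' : ‖k‖ ≤ |K| := hkK.trans (le_abs_self K)
  -- the common bound for all the multipliers
  have hb : ∀ s : Fin m → ℤ, ∀ x : ℝ, 0 ≤ x → x ≤ 1 + |K| →
      x * ((A * (1 + wt s) ^ (m + 1)) ^ 2) ≤ A ^ 2 * (1 + |K|) * (1 + wt s) ^ (2 * (m + 1)) := by
    intro s x hx0 hx
    have := wt_nonneg s
    calc x * ((A * (1 + wt s) ^ (m + 1)) ^ 2) ≤ (1 + |K|) * ((A * (1 + wt s) ^ (m + 1)) ^ 2) := by gcongr
      _ = _ := by ring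
  have hone : ∀ s : Fin m → ℤ, 1 ≤ A * (1 + wt s) ^ (m + 1) := fun s => by
    have := wt_nonneg s
    have h1 : (1 : ℝ) ≤ (1 + wt s) ^ (m + 1) := one_le_pow₀ (by linarith)
    nlinarith
  have hinv : ∀ s : Fin m → ℤ, s ≠ 0 → ‖((freq ω s : ℂ) ^ 2 + k)⁻¹‖ ≤ (A * (1 + wt s) ^ (m + 1)) ^ 2 := by
    intro s hs
    refine (norm_inv_sq_le hω hs hk).trans ?_
    have := (hω.2.2 s hs).2
    gcongr
  have hν : ∀ s : Fin m → ℤ, s ≠ 0 →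
      ‖Complex.I * freq ω s * ((freq ω s : ℂ) ^ 2 + k)⁻¹‖ ≤ (A * (1 + wt s) ^ (m + 1)) ^ 2 := by
    intro s hs
    have h0 := (hω.2.2 s hs).1
    rw [norm_mul, norm_mul, Complex.norm_I, one_mul, Complex.norm_real, Real.norm_eq_abs]
    calc |freq ω s| * ‖((freq ω s : ℂ) ^ 2 + k)⁻¹‖ ≤ |freq ω s| * (|freq ω s|⁻¹) ^ 2 := by
          gcongr; exact norm_inv_sq_le hω hs hk
      _ = |freq ω s|⁻¹ := by
          have : |freq ω s| ≠ 0 := abs_ne_zero.mpr h0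
          field_simp
      _ ≤ A * (1 + wt s) ^ (m + 1) := (hω.2.2 s hs).2
      _ ≤ _ := by nlinarith [hone s]
  -- Cramer's rule for s ≠ 0. For s = 0 the divisor is k, which may vanish, so the mean of l₀ is set
  -- to zero and the mean of G₀ is left unsolved, while l₁ takes the mean of G₁.
  obtain ⟨l₀, a1, a2, a3⟩ := h θ hθ r hr G M hG
    ![fun s => if s = 0 then 0 else -((freq ω s : ℂ) ^ 2 + k)⁻¹,
      fun s => if s = 0 then 0 else Complex.I * freq ω s * ((freq ω s : ℂ) ^ 2 + k)⁻¹] (by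
    intro i s
    have hw := wt_nonneg s
    fin_cases i
    · simp only [Fin.zero_eta, Matrix.cons_val_zero]
      split_ifs with hs
      · rw [norm_zero]; positivity
      · rw [norm_neg]
        exact ((hinv s hs).trans (by linarith)).trans (hb s 1 zero_le_one (by linarith [abs_nonneg K]))
    · simp only [Fin.mk_one, Matrix.cons_val_one, Matrix.cons_val_fin_one]
      split_ifs with hs
      · rw [norm_zero]; positivity
      · exact ((hν s hs).trans (by linarith)).trans (hb s 1 zero_le_one (by linarith [abs_nonneg K])))
  obtain ⟨l₁, b1, b2, b3⟩ := h θ hθ r hr G M hG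
    ![fun s => if s = 0 then 0 else -(Complex.I * freq ω s * ((freq ω s : ℂ) ^ 2 + k)⁻¹),
      fun s => if s = 0 then 1 else k * ((freq ω s : ℂ) ^ 2 + k)⁻¹] (by
    intro i s
    have hw := wt_nonneg s
    fin_cases i
    · simp only [Fin.zero_eta, Matrix.cons_val_zero]
      split_ifs with hs
      · rw [norm_zero]; positivity
      · rw [norm_neg]
        exact ((hν s hs).trans (by linarith)).trans (hb s 1 zero_le_one (by linarith [abs_nonneg K]))
    · simp only [Fin.mk_one, Matrix.cons_val_one, Matrix.cons_val_fin_one]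
      split_ifs with hs
      · rw [norm_one]
        exact (by nlinarith [hone s] : (1 : ℝ) ≤ 1 * (A * (1 + wt s) ^ (m + 1)) ^ 2).trans
          (hb s 1 zero_le_one (by linarith [abs_nonneg K]))
      · rw [norm_mul]
        exact (mul_le_mul_of_nonneg_left (hinv s hs) (norm_nonneg k)).trans
          (hb s ‖k‖ (norm_nonneg k) (by linarith)))
  simp only [Fin.sum_univ_two, Matrix.cons_val_zero, Matrix.cons_val_one] at a3 b3
  have h0 := a1.torusC1 hR
  have h1 := b1.torusC1 hR
  have hG0 := (hG 0).torusCont hr0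
  refine ⟨![l₀, l₁], Fin.forall_fin_two.mpr ⟨a1, b1⟩, Fin.forall_fin_two.mpr ⟨a2, b2⟩, ?_, ?_, ?_⟩
  · simp [← fc_zero_index, a3]
  · simp only [Matrix.cons_val_zero, Matrix.cons_val_one]
    refine (h1.dirD.sub (h0.toCont.const_mul k)).eqOn_of_fc_eq (hG0.sub (TorusCont.const _)) fun s => ?_
    rw [fc_sub h1.dirD (h0.toCont.const_mul k), fc_const_mul, fc_dirD h1, a3, b3,
      fc_sub hG0 (TorusCont.const _), fc_const]
    by_cases hs : s = 0
    · subst hs; simp [fc_zero_index, freq_zero]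
    · have h2 := sq_add_ne_zero (hω.2.2 s hs).1 hk
      simp only [hs, if_false, sub_zero]
      field_simp
      linear_combination (-(freq ω s : ℂ) ^ 2 * fc (G 0) s) * Complex.I_sq
  · simp only [Matrix.cons_val_zero, Matrix.cons_val_one]
    refine (h0.dirD.neg.add h1.toCont).eqOn_of_fc_eq ((hG 1).torusCont hr0) fun s => ?_
    rw [fc_add h0.dirD.neg h1.toCont, fc_neg, fc_dirD h0, a3, b3]
    by_cases hs : s = 0
    · subst hs; simp
    · have h2 := sq_add_ne_zero (hω.2.2 s hs).1 hk
      simp only [hs, if_false]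
      field_simp
      linear_combination (-(freq ω s : ℂ) ^ 2 * fc (G 1) s) * Complex.I_sq

/-- For s ≠ 0 the determinant ν² + k is nonzero and kills the mode. The zero mode leaves the mean of
l₀ free and ties the constant c to it. -/
lemma lambda_unique (hω : Dioph ω A) {k : ℂ} (hk : 0 ≤ k.re) {l₀ l₁ : CFun m} (h₀ : TorusC1 l₀)
    (h₁ : TorusC1 l₁) {c : ℂ} (e₀ : ∀ ξ ∈ strip m 0, dirD ω l₁ ξ - k * l₀ ξ + c = 0)
    (e₁ : ∀ ξ ∈ strip m 0, -dirD ω l₀ ξ + l₁ ξ = 0) :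
    c = k * mean l₀ ∧ (∀ ξ ∈ strip m 0, l₀ ξ = mean l₀) ∧ ∀ ξ ∈ strip m 0, l₁ ξ = 0 := by
  have f₀ : ∀ s, Complex.I * freq ω s * fc l₁ s - k * fc l₀ s + (if s = 0 then c else 0) = 0 := by
    intro s
    rw [← fc_const c, ← fc_dirD h₁, ← fc_const_mul, ← fc_sub h₁.dirD (h₀.toCont.const_mul k),
      ← fc_add (h₁.dirD.sub (h₀.toCont.const_mul k)) (TorusCont.const c), fc_congr e₀, fc_const]
    simp
  have f₁ : ∀ s, fc l₁ s = Complex.I * freq ω s * fc l₀ s := by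
    intro s
    have : -fc (dirD ω l₀) s + fc l₁ s = 0 := by
      rw [← fc_neg, ← fc_add h₀.dirD.neg h₁.toCont, fc_congr e₁, fc_const]; simp
    rw [fc_dirD h₀] at this
    linear_combination this
  have g₀ : ∀ s, s ≠ 0 → fc l₀ s = 0 := by
    intro s hs
    have h2 := sq_add_ne_zero (hω.2.2 s hs).1 hk
    have := f₀ s
    rw [f₁, if_neg hs] at this
    have h3 : ((freq ω s : ℂ) ^ 2 + k) * fc l₀ s = 0 := by
      linear_combination -this + (freq ω s : ℂ) ^ 2 * fc l₀ s * Complex.I_sq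
    exact (mul_eq_zero.mp h3).resolve_left h2
  refine ⟨?_, h₀.toCont.eqOn_of_fc_eq (TorusCont.const _) fun s => ?_,
    h₁.toCont.eqOn_of_fc_eq (TorusCont.const 0) fun s => ?_⟩
  · have := f₀ 0
    rw [freq_zero, fc_zero_index l₀, if_pos rfl, Complex.ofReal_zero] at this
    linear_combination this
  · rw [fc_const]
    split_ifs with hs
    · rw [hs, fc_zero_index]
    · exact g₀ s hs
  · rw [fc_const, f₁]
    by_cases hs : s = 0
    · simp [hs, freq_zero]
    · simp [g₀ s hs]

/-- The equation for `Γ`, solved up to the mean of `Γ₁₂`; here `a = Γ₁₁ = -Γ₂₂`, `b = Γ₁₂`,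
`c = Γ₂₁`. -/
theorem exists_gamma (hω : Dioph ω A) {κ : ℝ} (hκ : 0 < κ) (K : ℝ) : ∃ C : ℝ, 0 < C ∧
    ∀ k : ℂ, 0 ≤ k.re → ‖k‖ ≤ K →
    ∀ θ : ℝ, 1 ≤ θ → ∀ r : ℝ, κ / θ ^ 2 < r → ∀ (g : Fin 3 → CFun m) (M : ℝ), (∀ i, HPB r (g i) M) →
    ∃ a b c : CFun m, HPB (r - κ / θ ^ 2) a (C * M * θ ^ (2 * (3 * (m + 1)) + m)) ∧
      HPB (r - κ / θ ^ 2) b (C * M * θ ^ (2 * (3 * (m + 1)) + m)) ∧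
      HPB (r - κ / θ ^ 2) c (C * M * θ ^ (2 * (3 * (m + 1)) + m)) ∧
      mean b = 0 ∧
      (∀ ξ ∈ strip m 0, dirD ω c ξ - 2 * k * a ξ = g 0 ξ - (mean (g 0) - k * mean (g 2))) ∧
      (∀ ξ ∈ strip m 0, -dirD ω a ξ - k * b ξ + c ξ = g 1 ξ) ∧
      ∀ ξ ∈ strip m 0, -dirD ω b ξ - 2 * a ξ = g 2 ξ := by
  have hA := hω.1
  -- Eliminating a and c leaves the divisor ν(ν² + 4k), three small divisors in all. Below, P and Q
  -- are the reciprocals of iν and ν² + 4k.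
  obtain ⟨C, hC, h⟩ := exists_multiplier_sum m (Fin 3) hκ (3 * (m + 1)) (A ^ 3 * (2 * (1 + |K|) ^ 2))
  refine ⟨C, hC, fun k hk hkK θ hθ r hr G M hG => ?_⟩
  have hR : 0 < r - κ / θ ^ 2 := by linarith
  have hr0 : 0 < r := (by positivity : 0 < κ / θ ^ 2).trans hr
  have hkK' : ‖k‖ ≤ |K| := hkK.trans (le_abs_self K)
  have hK0 := abs_nonneg K
  let X : (Fin m → ℤ) → ℝ := fun s => A * (1 + wt s) ^ (m + 1)
  let P : (Fin m → ℤ) → ℂ := fun s => (Complex.I * freq ω s)⁻¹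
  let Q : (Fin m → ℤ) → ℂ := fun s => ((freq ω s : ℂ) ^ 2 + 4 * k)⁻¹
  have h4k : 0 ≤ (4 * k).re := by simpa using hk
  have hX : ∀ s, 1 ≤ X s := fun s => by
    have := wt_nonneg s
    have h1 : (1 : ℝ) ≤ (1 + wt s) ^ (m + 1) := one_le_pow₀ (by linarith)
    simp only [X]; nlinarith
  have hP : ∀ s, s ≠ 0 → ‖P s‖ ≤ X s := fun s hs => by
    simp only [P]
    rw [norm_inv, norm_mul, Complex.norm_I, one_mul, Complex.norm_real, Real.norm_eq_abs]
    exact (hω.2.2 s hs).2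
  have hQ' : ∀ s, s ≠ 0 → ‖Q s‖ ≤ (|freq ω s|⁻¹) ^ 2 := fun s hs => norm_inv_sq_le hω hs h4k
  have hQ : ∀ s, s ≠ 0 → ‖Q s‖ ≤ X s ^ 2 := fun s hs => (hQ' s hs).trans (by
    have := (hω.2.2 s hs).2
    simp only [X]; gcongr)
  have hνQ : ∀ s, s ≠ 0 → ‖Complex.I * freq ω s * Q s‖ ≤ X s := fun s hs => by
    have h0 : |freq ω s| ≠ 0 := abs_ne_zero.mpr (hω.2.2 s hs).1
    rw [norm_mul, norm_mul, Complex.norm_I, one_mul, Complex.norm_real, Real.norm_eq_abs]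
    calc |freq ω s| * ‖Q s‖ ≤ |freq ω s| * (|freq ω s|⁻¹) ^ 2 := by gcongr; exact hQ' s hs
      _ = |freq ω s|⁻¹ := by field_simp
      _ ≤ X s := (hω.2.2 s hs).2
  have hX3 : ∀ s, X s ^ 3 * (2 * (1 + |K|) ^ 2) =
      A ^ 3 * (2 * (1 + |K|) ^ 2) * (1 + wt s) ^ (3 * (m + 1)) := fun s => by
    simp only [X]; ring
  have one_le : ∀ s, 1 ≤ X s ^ 3 * (2 * (1 + |K|) ^ 2) := fun s => by
    have h1 : 1 ≤ X s ^ 3 := one_le_pow₀ (hX s)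
    have h2 : 1 ≤ 2 * (1 + |K|) ^ 2 := by nlinarith
    nlinarith
  have X1 : ∀ s, X s ≤ X s ^ 3 := fun s => le_self_pow₀ (hX s) (by norm_num)
  have X2 : ∀ s, X s ^ 2 ≤ X s ^ 3 := fun s => pow_le_pow_right₀ (hX s) (by norm_num)
  have hbd : ∀ s, ∀ x : ℂ, ‖x‖ ≤ 2 * (1 + |K|) ^ 2 * X s ^ 3 →
      ‖x‖ ≤ A ^ 3 * (2 * (1 + |K|) ^ 2) * (1 + wt s) ^ (3 * (m + 1)) := fun s x hx => by
    rw [← hX3]; linarith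
  have hKpow : 1 + 2 * |K| ≤ 2 * (1 + |K|) ^ 2 := by nlinarith
  have hK2 : 2 * |K| ^ 2 ≤ 2 * (1 + |K|) ^ 2 := by nlinarith
  have hX3' : ∀ s, 0 ≤ X s ^ 3 := fun s => by have := hX s; positivity
  have bPQ : ∀ s, s ≠ 0 → ∀ c : ℂ, ‖c‖ ≤ 2 * (1 + |K|) ^ 2 →
      ‖c * (P s * Q s)‖ ≤ 2 * (1 + |K|) ^ 2 * X s ^ 3 := fun s hs c hc => by
    rw [norm_mul, norm_mul]
    have h1 := hX s
    calc ‖c‖ * (‖P s‖ * ‖Q s‖) ≤ 2 * (1 + |K|) ^ 2 * (X s * X s ^ 2) := by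
          gcongr
          · exact hP s hs
          · exact hQ s hs
      _ = _ := by ring
  have bQ : ∀ s, s ≠ 0 → ∀ c : ℂ, ‖c‖ ≤ 2 * (1 + |K|) ^ 2 →
      ‖c * Q s‖ ≤ 2 * (1 + |K|) ^ 2 * X s ^ 3 := fun s hs c hc => by
    rw [norm_mul]
    have h1 := hX s
    gcongr
    exact (hQ s hs).trans (X2 s)
  have bP : ∀ s, s ≠ 0 → ‖P s * (1 - 2 * k * Q s)‖ ≤ 2 * (1 + |K|) ^ 2 * X s ^ 3 := fun s hs => by
    rw [norm_mul]
    have h1 := hX s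
    have h2 : ‖1 - 2 * k * Q s‖ ≤ (1 + 2 * |K|) * X s ^ 2 := by
      calc ‖1 - 2 * k * Q s‖ ≤ 1 + 2 * ‖k‖ * ‖Q s‖ := by
            refine (norm_sub_le _ _).trans ?_
            rw [norm_one, norm_mul, norm_mul, Complex.norm_ofNat]
        _ ≤ X s ^ 2 + 2 * |K| * X s ^ 2 := by
            gcongr
            · exact one_le_pow₀ h1
            · exact hQ s hs
        _ = _ := by ring
    calc ‖P s‖ * ‖1 - 2 * k * Q s‖ ≤ X s * ((1 + 2 * |K|) * X s ^ 2) := by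
          gcongr
          exact hP s hs
      _ = (1 + 2 * |K|) * X s ^ 3 := by ring
      _ ≤ _ := by gcongr
  have n2 : ‖(2 : ℂ)‖ ≤ 2 * (1 + |K|) ^ 2 := by rw [Complex.norm_ofNat]; nlinarith
  have n1 : ‖(1 : ℂ)‖ ≤ 2 * (1 + |K|) ^ 2 := by rw [norm_one]; nlinarith
  have nk : ‖k‖ ≤ 2 * (1 + |K|) ^ 2 := by nlinarith
  have n2k : ‖2 * k‖ ≤ 2 * (1 + |K|) ^ 2 := by rw [norm_mul, Complex.norm_ofNat]; nlinarith
  have n2k2 : ‖2 * k ^ 2‖ ≤ 2 * (1 + |K|) ^ 2 := by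
    rw [norm_mul, Complex.norm_ofNat, norm_pow]
    have : ‖k‖ ^ 2 ≤ |K| ^ 2 := by gcongr
    linarith
  have hz : ∀ s, ‖(0 : ℂ)‖ ≤ 2 * (1 + |K|) ^ 2 * X s ^ 3 := fun s => by
    rw [norm_zero]; have := hX3' s; positivity
  have ho : ∀ s, ‖(1 : ℂ)‖ ≤ 2 * (1 + |K|) ^ 2 * X s ^ 3 := fun s => by
    rw [norm_one]; linarith [one_le s]
  have hh : ∀ s, ‖-(1 / 2 : ℂ)‖ ≤ 2 * (1 + |K|) ^ 2 * X s ^ 3 := fun s => by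
    rw [norm_neg]
    refine le_trans ?_ (ho s)
    norm_num
  -- For s = 0 the third equation forces a = −g₂/2, which is the value −1/2; b = 0 is a choice and
  -- then c = g₁. The first equation is left with the defect mean g₀ − k mean g₂.
  obtain ⟨a, a1, -, a3⟩ := h θ hθ r hr G M hG
    ![fun s => if s = 0 then 0 else -(1 * Q s),
      fun s => if s = 0 then 0 else Complex.I * freq ω s * Q s,
      fun s => if s = 0 then -(1 / 2) else -(k * Q s)] (by
    refine Fin.forall_fin_succ.mpr ⟨fun s => hbd s _ ?_, Fin.forall_fin_two.mpr
      ⟨fun s => hbd s _ ?_, fun s => hbd s _ ?_⟩⟩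
    · change ‖if s = 0 then (0 : ℂ) else -(1 * Q s)‖ ≤ _
      split_ifs with hs
      · exact hz s
      · rw [norm_neg]; exact bQ s hs 1 n1
    · change ‖if s = 0 then (0 : ℂ) else Complex.I * freq ω s * Q s‖ ≤ _
      split_ifs with hs
      · exact hz s
      · refine ((hνQ s hs).trans (X1 s)).trans ?_
        have := hX3' s
        have h2 : 1 ≤ 2 * (1 + |K|) ^ 2 := by nlinarith
        nlinarith
    · change ‖if s = 0 then (-(1 / 2) : ℂ) else -(k * Q s)‖ ≤ _
      split_ifs with hs
      · exact hh s
      · rw [norm_neg]; exact bQ s hs k nk)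
  obtain ⟨b, b1, -, b3⟩ := h θ hθ r hr G M hG
    ![fun s => if s = 0 then 0 else 2 * (P s * Q s), fun s => if s = 0 then 0 else -(2 * Q s),
      fun s => if s = 0 then 0 else -(P s * (1 - 2 * k * Q s))] (by
    refine Fin.forall_fin_succ.mpr ⟨fun s => hbd s _ ?_, Fin.forall_fin_two.mpr
      ⟨fun s => hbd s _ ?_, fun s => hbd s _ ?_⟩⟩
    · change ‖if s = 0 then (0 : ℂ) else 2 * (P s * Q s)‖ ≤ _
      split_ifs with hs
      · exact hz s
      · exact bPQ s hs 2 n2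
    · change ‖if s = 0 then (0 : ℂ) else -(2 * Q s)‖ ≤ _
      split_ifs with hs
      · exact hz s
      · rw [norm_neg]; exact bQ s hs 2 n2
    · change ‖if s = 0 then (0 : ℂ) else -(P s * (1 - 2 * k * Q s))‖ ≤ _
      split_ifs with hs
      · exact hz s
      · rw [norm_neg]; exact bP s hs)
  obtain ⟨c, c1, -, c3⟩ := h θ hθ r hr G M hG
    ![fun s => if s = 0 then 0 else P s * (1 - 2 * k * Q s), fun s => if s = 0 then 1 else 2 * k * Q s,
      fun s => if s = 0 then 0 else -(2 * k ^ 2 * (P s * Q s))] (by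
    refine Fin.forall_fin_succ.mpr ⟨fun s => hbd s _ ?_, Fin.forall_fin_two.mpr
      ⟨fun s => hbd s _ ?_, fun s => hbd s _ ?_⟩⟩
    · change ‖if s = 0 then (0 : ℂ) else P s * (1 - 2 * k * Q s)‖ ≤ _
      split_ifs with hs
      · exact hz s
      · exact bP s hs
    · change ‖if s = 0 then (1 : ℂ) else 2 * k * Q s‖ ≤ _
      split_ifs with hs
      · exact ho s
      · exact bQ s hs _ n2k
    · change ‖if s = 0 then (0 : ℂ) else -(2 * k ^ 2 * (P s * Q s))‖ ≤ _
      split_ifs with hs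
      · exact hz s
      · rw [norm_neg]; exact bPQ s hs _ n2k2)
  simp only [Fin.sum_univ_three, Matrix.cons_val_zero, Matrix.cons_val_one, Matrix.cons_val] at a3 b3 c3
  have ta := a1.torusC1 hR
  have tb := b1.torusC1 hR
  have tc := c1.torusC1 hR
  have hG' := fun i => (hG i).torusCont hr0
  have hPI : ∀ s, s ≠ 0 → Complex.I * freq ω s * P s = 1 := fun s hs => by
    have h1 : (freq ω s : ℂ) ≠ 0 := by exact_mod_cast (hω.2.2 s hs).1
    exact mul_inv_cancel₀ (mul_ne_zero Complex.I_ne_zero h1)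
  have hQD' : ∀ s, s ≠ 0 → (-(Complex.I * freq ω s : ℂ) ^ 2 + 4 * k) * Q s = 1 := fun s hs => by
    rw [mul_pow, Complex.I_sq, neg_one_mul, neg_neg]
    exact mul_inv_cancel₀ (sq_add_ne_zero (hω.2.2 s hs).1 h4k)
  refine ⟨a, b, c, a1, b1, c1, ?_, ?_, ?_, ?_⟩
  · simp [← fc_zero_index, b3]
  · refine (tc.dirD.sub (ta.toCont.const_mul _)).eqOn_of_fc_eq ((hG' 0).sub (TorusCont.const _))
      fun s => ?_
    rw [fc_sub tc.dirD (ta.toCont.const_mul _), fc_const_mul, fc_dirD tc, a3, c3,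
      fc_sub (hG' 0) (TorusCont.const _), fc_const]
    by_cases hs : s = 0
    · subst hs
      simp only [if_true, freq_zero, fc_zero_index, Complex.ofReal_zero]
      ring
    · simp only [hs, if_false, sub_zero]
      linear_combination ((1 - 2 * k * Q s) * fc (G 0) s - 2 * k ^ 2 * Q s * fc (G 2) s) * hPI s hs
  · refine ((ta.dirD.neg.sub (tb.toCont.const_mul _)).add tc.toCont).eqOn_of_fc_eq (hG' 1) fun s => ?_
    rw [fc_add (ta.dirD.neg.sub (tb.toCont.const_mul _)) tc.toCont,
      fc_sub ta.dirD.neg (tb.toCont.const_mul _), fc_neg, fc_const_mul, fc_dirD ta, a3, b3, c3]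
    by_cases hs : s = 0
    · subst hs
      simp only [if_true, freq_zero, fc_zero_index, Complex.ofReal_zero]
      ring
    · simp only [hs, if_false]
      linear_combination (fc (G 1) s - P s * (fc (G 0) s + k * fc (G 2) s)) * hQD' s hs -
        Complex.I * freq ω s * Q s * (fc (G 0) s + k * fc (G 2) s) * hPI s hs
  · refine (tb.dirD.neg.sub (ta.toCont.const_mul _)).eqOn_of_fc_eq (hG' 2) fun s => ?_
    rw [fc_sub tb.dirD.neg (ta.toCont.const_mul _), fc_neg, fc_const_mul, fc_dirD tb, a3, b3]
    by_cases hs : s = 0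
    · subst hs
      simp only [if_true, freq_zero, fc_zero_index, Complex.ofReal_zero]
      ring
    · simp only [hs, if_false]
      linear_combination (-2 * Q s * fc (G 0) s + (1 - 2 * k * Q s) * fc (G 2) s) * hPI s hs

/-- Nonzero modes vanish because ν(ν² + 4k) ≠ 0. In the zero mode only the constant part of b
survives, accompanied by c = k b. -/
lemma gamma_unique (hω : Dioph ω A) {k : ℂ} (hk : 0 ≤ k.re) {a b c : CFun m} (ha : TorusC1 a)
    (hb : TorusC1 b) (hc : TorusC1 c) {d : ℂ}
    (e₀ : ∀ ξ ∈ strip m 0, dirD ω c ξ - 2 * k * a ξ + d = 0)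
    (e₁ : ∀ ξ ∈ strip m 0, -dirD ω a ξ - k * b ξ + c ξ = 0)
    (e₂ : ∀ ξ ∈ strip m 0, -dirD ω b ξ - 2 * a ξ = 0) :
    d = 0 ∧ (∀ ξ ∈ strip m 0, a ξ = 0) ∧ (∀ ξ ∈ strip m 0, b ξ = mean b) ∧
      ∀ ξ ∈ strip m 0, c ξ = k * mean b := by
  have f₀ : ∀ s, Complex.I * freq ω s * fc c s - 2 * k * fc a s + (if s = 0 then d else 0) = 0 := by
    intro s
    rw [← fc_const d, ← fc_dirD hc, ← fc_const_mul (2 * k), ← fc_sub hc.dirD (ha.toCont.const_mul _),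
      ← fc_add (hc.dirD.sub (ha.toCont.const_mul _)) (TorusCont.const d), fc_congr e₀, fc_const]
    simp
  have f₁ : ∀ s, fc c s = Complex.I * freq ω s * fc a s + k * fc b s := by
    intro s
    have : -fc (dirD ω a) s - k * fc b s + fc c s = 0 := by
      rw [← fc_neg, ← fc_const_mul, ← fc_sub ha.dirD.neg (hb.toCont.const_mul _),
        ← fc_add (ha.dirD.neg.sub (hb.toCont.const_mul _)) hc.toCont, fc_congr e₁, fc_const]; simp
    rw [fc_dirD ha] at this
    linear_combination this
  have f₂ : ∀ s, 2 * fc a s = -(Complex.I * freq ω s * fc b s) := by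
    intro s
    have : -fc (dirD ω b) s - 2 * fc a s = 0 := by
      rw [← fc_neg, ← fc_const_mul, ← fc_sub hb.dirD.neg (ha.toCont.const_mul _), fc_congr e₂, fc_const]
      simp
    rw [fc_dirD hb] at this
    linear_combination -this
  have g₀ : ∀ s, s ≠ 0 → fc b s = 0 := by
    intro s hs
    have h1 := (hω.2.2 s hs).1
    have h2 := sq_add_ne_zero h1 (k := 4 * k) (by simpa using hk)
    have h0 := f₀ s
    rw [f₁, if_neg hs] at h0
    have h3 : (freq ω s : ℂ) * (((freq ω s : ℂ) ^ 2 + 4 * k) * fc b s) = 0 := by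
      have e := f₂ s
      linear_combination (-2 * Complex.I) * h0 + (2 * Complex.I * (freq ω s : ℂ) ^ 2 * fc a s) *
        Complex.I_sq - (Complex.I * (freq ω s : ℂ) ^ 2 + 2 * Complex.I * k) * e +
        (4 * freq ω s * k * fc b s + freq ω s ^ 3 * fc b s) * Complex.I_sq
    have h1' : (freq ω s : ℂ) ≠ 0 := by exact_mod_cast h1
    exact (mul_eq_zero.mp ((mul_eq_zero.mp h3).resolve_left h1')).resolve_left h2
  have ga : ∀ s, fc a s = 0 := by
    intro s
    have h2 := f₂ s
    by_cases hs : s = 0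
    · rw [hs, freq_zero] at h2; simpa [hs] using h2
    · rw [g₀ s hs] at h2; simpa using h2
  refine ⟨?_, ha.toCont.eqOn_of_fc_eq (TorusCont.const 0) fun s => ?_,
    hb.toCont.eqOn_of_fc_eq (TorusCont.const _) fun s => ?_,
    hc.toCont.eqOn_of_fc_eq (TorusCont.const _) fun s => ?_⟩
  · have := f₀ 0
    rw [freq_zero, ga, if_pos rfl] at this
    simpa using this
  · rw [fc_const, ga]; simp
  · rw [fc_const]
    split_ifs with hs
    · rw [hs, fc_zero_index]
    · exact g₀ s hs
  · rw [fc_const, f₁, ga, mul_zero, zero_add]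
    split_ifs with hs
    · rw [hs, fc_zero_index]
    · rw [g₀ s hs, mul_zero]

end Solve

end LowDimTori

end

noncomputable section

namespace LowDimTori

open MeasureTheory Set Filter Topology

variable {m : ℕ}

/-! ## Uniform bounds for families -/

section Families

variable {I : Type}

/-- The functions `f i` are bounded periodic holomorphic on the strips of half-width `r i`, with
bounds proportional to `s i`. -/
def UB (r s : I → ℝ) (f : I → CFun m) : Prop := ∃ B, 0 ≤ B ∧ ∀ i, HPB (r i) (f i) (B * s i)

/-- The numbers `c i` are bounded proportionally to `s i`. -/
def CB (s : I → ℝ) (c : I → ℂ) : Prop := ∃ B, 0 ≤ B ∧ ∀ i, ‖c i‖ ≤ B * s i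

variable {r r' s s' t : I → ℝ} {f g : I → CFun m} {c d : I → ℂ}

namespace CB

lemma mono (h : CB s c) (hs : ∀ i, s i ≤ t i) : CB t c := by
  obtain ⟨B, hB, hc⟩ := h
  exact ⟨B, hB, fun i => (hc i).trans (mul_le_mul_of_nonneg_left (hs i) hB)⟩

lemma of_le (h : ∀ i, ‖c i‖ ≤ s i) : CB s c := ⟨1, zero_le_one, fun i => by rw [one_mul]; exact h i⟩

lemma add (hc : CB s c) (hd : CB s d) : CB s (fun i => c i + d i) := by
  obtain ⟨B, hB, hc⟩ := hc
  obtain ⟨B', hB', hd⟩ := hd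
  exact ⟨B + B', by positivity, fun i => (norm_add_le _ _).trans (by linarith [hc i, hd i])⟩

lemma neg (hc : CB s c) : CB s (fun i => -c i) := by
  obtain ⟨B, hB, hc⟩ := hc
  exact ⟨B, hB, fun i => by rw [norm_neg]; exact hc i⟩

lemma sub (hc : CB s c) (hd : CB s d) : CB s (fun i => c i - d i) := by
  simp only [sub_eq_add_neg]; exact hc.add hd.neg

lemma const_mul (a : ℂ) (hc : CB s c) : CB s (fun i => a * c i) := by
  obtain ⟨B, hB, hc⟩ := hc
  refine ⟨‖a‖ * B, by positivity, fun i => ?_⟩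
  rw [norm_mul, mul_assoc]
  exact mul_le_mul_of_nonneg_left (hc i) (norm_nonneg _)

lemma sum {ι : Type*} (F : Finset ι) {c : ι → I → ℂ} (hc : ∀ j ∈ F, CB s (c j)) :
    CB s (fun i => ∑ j ∈ F, c j i) := by
  classical
  induction F using Finset.induction_on with
  | empty => exact ⟨0, le_rfl, fun i => by simp⟩
  | insert a F ha ih =>
    simp only [Finset.sum_insert ha]
    exact (hc a (Finset.mem_insert_self a F)).add (ih fun j hj => hc j (Finset.mem_insert_of_mem hj))

end CB

namespace UB

lemma mono (h : UB r s f) (hs : ∀ i, s i ≤ t i) : UB r t f := by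
  obtain ⟨B, hB, hf⟩ := h
  exact ⟨B, hB, fun i => (hf i).mono_bound (mul_le_mul_of_nonneg_left (hs i) hB)⟩

lemma shrink (h : UB r s f) (hr : ∀ i, r' i ≤ r i) : UB r' s f := by
  obtain ⟨B, hB, hf⟩ := h
  exact ⟨B, hB, fun i => (hf i).mono (hr i)⟩

lemma of_le (h : ∀ i, HPB (r i) (f i) (s i)) : UB r s f :=
  ⟨1, zero_le_one, fun i => by rw [one_mul]; exact h i⟩

lemma const (hc : CB s c) : UB r s (fun i (_ : Fin m → ℂ) => c i) := by
  obtain ⟨B, hB, hc⟩ := hc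
  exact ⟨B, hB, fun i => (HPB.const (c i)).mono_bound (hc i)⟩

lemma add (hf : UB r s f) (hg : UB r s g) : UB r s (fun i ξ => f i ξ + g i ξ) := by
  obtain ⟨B, hB, hf⟩ := hf
  obtain ⟨B', hB', hg⟩ := hg
  exact ⟨B + B', by positivity, fun i => ((hf i).add (hg i)).mono_bound (by rw [add_mul])⟩

lemma neg (hf : UB r s f) : UB r s (fun i ξ => -f i ξ) := by
  obtain ⟨B, hB, hf⟩ := hf
  exact ⟨B, hB, fun i => (hf i).neg⟩

lemma sub (hf : UB r s f) (hg : UB r s g) : UB r s (fun i ξ => f i ξ - g i ξ) := by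
  simp only [sub_eq_add_neg]; exact hf.add hg.neg

lemma mul (hf : UB r s f) (hg : UB r s' g) (h : ∀ i, s i * s' i ≤ t i) :
    UB r t (fun i ξ => f i ξ * g i ξ) := by
  obtain ⟨B, hB, hf⟩ := hf
  obtain ⟨B', hB', hg⟩ := hg
  refine ⟨B * B', by positivity, fun i => ((hf i).mul (hg i)).mono_bound ?_⟩
  calc B * s i * (B' * s' i) = B * B' * (s i * s' i) := by ring
    _ ≤ _ := mul_le_mul_of_nonneg_left (h i) (by positivity)

/-- Multiplication by uniformly bounded coefficients. -/
lemma mul_coef (hg : UB r (fun _ => 1) g) (hf : UB r s f) : UB r s (fun i ξ => g i ξ * f i ξ) :=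
  hg.mul hf fun i => by rw [one_mul]

lemma const_mul (hc : CB s c) (hf : UB r s' f) (h : ∀ i, s i * s' i ≤ t i) :
    UB r t (fun i ξ => c i * f i ξ) := (UB.const hc).mul hf h

lemma sum {ι : Type*} (F : Finset ι) {f : ι → I → CFun m} (hf : ∀ j ∈ F, UB r s (f j)) :
    UB r s (fun i ξ => ∑ j ∈ F, f j i ξ) := by
  classical
  induction F using Finset.induction_on with
  | empty =>
    refine ⟨0, le_rfl, fun i => ?_⟩
    simpa using (HPB.const (m := m) (r := r i) 0)
  | insert a F ha ih =>
    simp only [Finset.sum_insert ha]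
    exact (hf a (Finset.mem_insert_self a F)).add (ih fun j hj => hf j (Finset.mem_insert_of_mem hj))

lemma torusCont (hf : UB r s f) (hr : ∀ i, 0 < r i) (i : I) : TorusCont (f i) := by
  obtain ⟨B, hB, hf⟩ := hf
  exact (hf i).torusCont (hr i)

lemma torusC1 (hf : UB r s f) (hr : ∀ i, 0 < r i) (i : I) : TorusC1 (f i) := by
  obtain ⟨B, hB, hf⟩ := hf
  exact (hf i).torusC1 (hr i)

lemma mean (hf : UB r s f) (hr : ∀ i, 0 < r i) : CB s (fun i => mean (f i)) := by
  obtain ⟨B, hB, hf⟩ := hf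
  exact ⟨B, hB, fun i => norm_mean_le ((hf i).torusCont (hr i)) fun ξ hξ =>
    (hf i).bound ξ (strip_subset_openStrip (hr i) hξ)⟩

end UB

end Families

/-! ## The linear problem with abstract coefficients -/

/-- Coefficients of the linear problem. The last index of `U`, `E`, `K` enumerates the entries
`11`, `12`, `22` of a symmetric `2 × 2` matrix, `W` is the first row of the matrix `W`, and `w`
stands for `w₁ - α`. -/
structure Lin (m : ℕ) where
  T : Fin 2 → Fin m → CFun m
  S : Fin m → Fin m → CFun m
  U : Fin 2 → Fin m → Fin 3 → CFun m
  E : Fin m → Fin 3 → CFun m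
  K : Fin 2 → Fin 3 → CFun m
  W : Fin 2 → CFun m
  w : CFun m
  w₂ : CFun m
  u : Fin m → CFun m

/-- The terms of the last equation which involve `λ` and `μ`. -/
def Lin.Q (L : Lin m) (dl : Fin 2 → Fin m → CFun m) (μ : Fin m → CFun m) (l : Fin 2 → CFun m)
    (c : Fin 3) : CFun m := fun ξ =>
  (∑ i, ∑ j, dl i j ξ * L.U i j c ξ) + (∑ i, μ i ξ * L.E i c ξ) + ∑ i, l i ξ * L.K i c ξ

/-- Bounds for the coefficients: `C` for all of them, and `η` for the distance to the
unperturbed ones. -/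
structure Lin.Bd (L : Lin m) (r C : ℝ) (S₀ : Fin m → Fin m → ℂ) (t : Fin m → ℂ) (η : ℝ) : Prop where
  T : ∀ p j, HPB r (L.T p j) C
  T₀ : ∀ j, HPB r (L.T 0 j) η
  T₁ : ∀ j, HPB r (fun ξ => L.T 1 j ξ - t j) η
  S : ∀ i j, HPB r (L.S i j) C
  S₀ : ∀ i j, HPB r (fun ξ => L.S i j ξ - S₀ i j) η
  U : ∀ i j c, HPB r (L.U i j c) C
  E : ∀ i c, HPB r (L.E i c) C
  K : ∀ i c, HPB r (L.K i c) C
  W : ∀ p, HPB r (L.W p) C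
  W₀ : HPB r (fun ξ => L.W 0 ξ - 1) η
  W₁ : HPB r (L.W 1) η
  w : HPB r L.w η
  dw : ∀ i, HPB r (pd i L.w) η
  w₂ : HPB r L.w₂ C
  u : ∀ i, HPB r (L.u i) C
  du : ∀ i j, HPB r (pd j (L.u i)) C

/-- All components of the right-hand side are holomorphic and bounded by `M`. -/
structure Rhs.Bd (F : Rhs m) (r M : ℝ) : Prop where
  F₁ : HPB r F.F₁ M
  F₂ : ∀ p, HPB r (F.F₂ p) M
  F₃ : ∀ i, HPB r (F.F₃ i) M
  F₄ : ∀ a b, HPB r (F.F₄ a b) M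
  f₅ : ‖F.f₅‖ ≤ M

/-- Solutions of class `C¹` on the real torus. -/
structure Lin.Sol (L : Lin m) (ω : Fin m → ℝ) (k : ℂ) (F : Rhs m) (X : Unknown m) : Prop where
  ψ₀ : TorusC1 X.ψ₀
  lam : ∀ i, TorusC1 (X.lam i)
  χ : ∀ i, TorusC1 (X.χ i)
  Γ : ∀ a b, TorusC1 (X.Γ a b)
  eq₁ : ∀ ξ ∈ strip m 0,
    dirD ω X.ψ₀ ξ + X.q + X.p * L.w ξ + 1 / 2 * X.δM * L.w ξ ^ 2 = F.F₁ ξ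
  eq₂ : ∀ ξ ∈ strip m 0, dirD ω (X.lam 1) ξ - k * X.lam 0 ξ + ∑ j, L.T 0 j ξ * X.μ ξ j
    + X.p * L.W 0 ξ + X.δM * L.w ξ * L.W 0 ξ = F.F₂ 0 ξ
  eq₂' : ∀ ξ ∈ strip m 0, -dirD ω (X.lam 0) ξ + X.lam 1 ξ + ∑ j, L.T 1 j ξ * X.μ ξ j
    + X.p * L.W 1 ξ + X.δM * L.w ξ * L.W 1 ξ = F.F₂ 1 ξ
  eq₃ : ∀ ξ ∈ strip m 0, ∀ i, -dirD ω (X.χ i) ξ + ∑ j, L.S i j ξ * X.μ ξ j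
    + ∑ p, L.T p i ξ * X.lam p ξ = F.F₃ i ξ
  eq₄ : ∀ ξ ∈ strip m 0, dirD ω (X.Γ 1 0) ξ - 2 * k * X.Γ 0 0 ξ
    + L.Q (fun i j => pd j (X.lam i)) (fun i ξ => X.μ ξ i) X.lam 0 ξ + X.δM * L.W 0 ξ ^ 2 = F.F₄ 0 0 ξ
  eq₄' : ∀ ξ ∈ strip m 0, -dirD ω (X.Γ 0 0) ξ - k * X.Γ 0 1 ξ + X.Γ 1 0 ξ
    + L.Q (fun i j => pd j (X.lam i)) (fun i ξ => X.μ ξ i) X.lam 1 ξ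
    + X.δM * (L.W 0 ξ * L.W 1 ξ) = F.F₄ 0 1 ξ
  eq₄'' : ∀ ξ ∈ strip m 0, -dirD ω (X.Γ 0 1) ξ - 2 * X.Γ 0 0 ξ
    + L.Q (fun i j => pd j (X.lam i)) (fun i ξ => X.μ ξ i) X.lam 2 ξ + X.δM * L.W 1 ξ ^ 2 = F.F₄ 1 1 ξ
  trace : ∀ ξ ∈ strip m 0, X.Γ 1 1 ξ = -X.Γ 0 0 ξ
  mean_w : mean (fun ξ => L.W 0 ξ * X.lam 0 ξ + L.W 1 ξ * X.lam 1 ξ + ∑ i, X.χ i ξ * pd i L.w ξ) = F.f₅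
  mean_ψ : mean (fun ξ => X.ψ₀ ξ - (∑ i, X.δβ i * L.u i ξ)
    + L.w₂ ξ * (L.W 0 ξ * X.lam 0 ξ + L.W 1 ξ * X.lam 1 ξ)) = 0
  mean_χ : ∀ i, mean (fun ξ => X.χ i ξ + ∑ j, pd j (L.u i) ξ * X.χ j ξ) = 0
  mean_Γ : mean (fun ξ => L.W 0 ξ * X.Γ 0 1 ξ + L.W 1 ξ * X.Γ 1 1 ξ) = 0

/-- A family of solutions, with its parameters. -/
structure Family (m : ℕ) (I : Type) where
  k : I → ℂ
  θ : I → ℝ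
  r : I → ℝ
  η : I → ℝ
  M : I → ℝ
  N : I → ℝ
  s : I → ℝ
  L : I → Lin m
  F : I → Rhs m
  X : I → Unknown m

/-- The standing assumptions for a family of solutions: `M` bounds the right-hand side, `N` the
free constants. -/
structure Family.Ok {I : Type} (P : Family m I) (ω : Fin m → ℝ) (A K C : ℝ)
    (S₀ : Fin m → Fin m → ℂ) (t : Fin m → ℂ) (κ : ℝ) : Prop where
  dioph : Dioph ω A
  κ_pos : 0 < κ
  C_one : 1 ≤ C
  k_re : ∀ i, 0 ≤ (P.k i).re
  k_le : ∀ i, ‖P.k i‖ ≤ K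
  θ_one : ∀ i, 1 ≤ P.θ i
  -- Three losses of width suffice: one for ψ₀, one for λ, and one shared by χ and Γ, which do not
  -- enter each other's equations.
  r_lt : ∀ i, 3 * (κ / P.θ i ^ 2) < P.r i
  η_nonneg : ∀ i, 0 ≤ P.η i
  η_le : ∀ i, P.η i ≤ 1 / 2
  L : ∀ i, (P.L i).Bd (P.r i) C S₀ t (P.η i)
  F : ∀ i, (P.F i).Bd (P.r i) (P.M i)
  sol : ∀ i, (P.L i).Sol ω (P.k i) (P.F i) (P.X i)
  δβ : ∀ i j, ‖(P.X i).δβ j‖ ≤ P.N i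
  p : ∀ i, ‖(P.X i).p‖ ≤ P.N i
  δM : ∀ i, ‖(P.X i).δM‖ ≤ P.N i
  a : ∀ i, ‖mean ((P.X i).lam 0)‖ ≤ P.N i
  -- The scale s controls the data and the products of free constants with η-small coefficients, but
  -- not the free constants themselves. The bounds by s alone are what the absorption argument
  -- needs.
  M_le : ∀ i, P.M i ≤ P.s i
  N_le : ∀ i, P.η i * P.N i ≤ P.s i

namespace Family.Ok

variable {I : Type} {P : Family m I} {ω : Fin m → ℝ} {A K C : ℝ}
    {S₀ : Fin m → Fin m → ℂ} {t : Fin m → ℂ} {κ : ℝ}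

section Basic

variable (h : P.Ok ω A K C S₀ t κ)
include h

lemma δ_pos (i : I) : 0 < κ / P.θ i ^ 2 := by
  have := h.κ_pos
  have := h.θ_one i
  positivity

lemma r_pos (i : I) : 0 < P.r i := by linarith [h.δ_pos i, h.r_lt i]

lemma M_nonneg (i : I) : 0 ≤ P.M i := (h.F i).F₁.nonneg (h.r_pos i)

lemma N_nonneg (i : I) : 0 ≤ P.N i := (norm_nonneg _).trans (h.p i)

lemma s_nonneg (i : I) : 0 ≤ P.s i := (h.M_nonneg i).trans (h.M_le i)

end Basic

end Family.Ok

end LowDimTori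

end

noncomputable section

namespace LowDimTori

open MeasureTheory Set Filter Topology

variable {m : ℕ}

/-! ## The steps of the linear problem for families -/

section Families

variable {I : Type}

/-- The scale `θ^e s`. -/
def sc (θ : I → ℝ) (e : ℕ) (s : I → ℝ) : I → ℝ := fun i => θ i ^ e * s i

/-- The half-widths `r - jκ/θ²`. -/
def rd (κ : ℝ) (θ : I → ℝ) (j : ℕ) (r : I → ℝ) : I → ℝ := fun i => r i - j * (κ / θ i ^ 2)

variable {θ r s : I → ℝ} {κ : ℝ}

lemma sc_mono (hθ : ∀ i, 1 ≤ θ i) (hs : ∀ i, 0 ≤ s i) {e e' : ℕ} (h : e ≤ e') (i : I) :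
    sc θ e s i ≤ sc θ e' s i :=
  mul_le_mul_of_nonneg_right (pow_le_pow_right₀ (hθ i) h) (hs i)

lemma le_sc (hθ : ∀ i, 1 ≤ θ i) (hs : ∀ i, 0 ≤ s i) {e : ℕ} (i : I) : s i ≤ sc θ e s i :=
  le_mul_of_one_le_left (hs i) (one_le_pow₀ (hθ i))

lemma sc_nonneg (hθ : ∀ i, 1 ≤ θ i) (hs : ∀ i, 0 ≤ s i) {e : ℕ} (i : I) : 0 ≤ sc θ e s i :=
  (hs i).trans (le_sc hθ hs i)

lemma rd_le (hκ : 0 < κ) (hθ : ∀ i, 1 ≤ θ i) (j : ℕ) (i : I) : rd κ θ j r i ≤ r i := by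
  have := hθ i
  have : 0 ≤ (j : ℝ) * (κ / θ i ^ 2) := by positivity
  unfold rd; linarith

lemma rd_succ_le (hκ : 0 < κ) (hθ : ∀ i, 1 ≤ θ i) (j : ℕ) (i : I) :
    rd κ θ (j + 1) r i ≤ rd κ θ j r i := by
  have := hθ i
  have : 0 ≤ κ / θ i ^ 2 := by positivity
  unfold rd; push_cast; linarith

variable {ω : Fin m → ℝ} {A : ℝ}

/-- The added exponents are 2a + m with a = m + 1, and two more for the gradient. -/
lemma UB.primitive (hω : Dioph ω A) (hκ : 0 < κ) (hθ : ∀ i, 1 ≤ θ i) {j e : ℕ}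
    (hr : ∀ i, 0 < rd κ θ (j + 1) r i) {G : I → CFun m} (hG : UB (rd κ θ j r) (sc θ e s) G) :
    ∃ ψ : I → CFun m, UB (rd κ θ (j + 1) r) (sc θ (e + (3 * m + 2)) s) ψ ∧
      (∀ l, UB (rd κ θ (j + 1) r) (sc θ (e + (3 * m + 4)) s) fun i => pd l (ψ i)) ∧
      (∀ i, LowDimTori.mean (ψ i) = 0) ∧
      ∀ i, ∀ ξ ∈ strip m 0, dirD ω (ψ i) ξ = G i ξ - LowDimTori.mean (G i) := by
  obtain ⟨C, hC, h⟩ := exists_primitive hω hκ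
  obtain ⟨B, hB, hG⟩ := hG
  have e0 : ∀ i, rd κ θ (j + 1) r i = rd κ θ j r i - κ / θ i ^ 2 := fun i => by
    unfold rd; push_cast; ring
  choose ψ h1 h2 h3 h4 using fun i =>
    h (θ i) (hθ i) (rd κ θ j r i) (by have := hr i; rw [e0] at this; linarith) (G i) _ (hG i)
  refine ⟨ψ, ⟨C * B, by positivity, fun i => ?_⟩, fun l => ⟨C * B, by positivity, fun i => ?_⟩, h3, h4⟩
  · rw [e0]; refine (h1 i).mono_bound (le_of_eq ?_); simp only [sc]; ring
  · rw [e0]; refine (h2 i l).mono_bound (le_of_eq ?_); simp only [sc]; ring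

/-- Here a = 2(m + 1), so 2a + m = 5m + 4. -/
lemma UB.lambda (hω : Dioph ω A) (hκ : 0 < κ) (hθ : ∀ i, 1 ≤ θ i) (hs : ∀ i, 0 ≤ s i) {j e : ℕ}
    (hr : ∀ i, 0 < rd κ θ (j + 1) r i) {K : ℝ} {k : I → ℂ} (hk : ∀ i, 0 ≤ (k i).re)
    (hK : ∀ i, ‖k i‖ ≤ K) {G : Fin 2 → I → CFun m}
    (hG : ∀ p, UB (rd κ θ j r) (sc θ e s) (G p)) :
    ∃ l : Fin 2 → I → CFun m, (∀ p, UB (rd κ θ (j + 1) r) (sc θ (e + (5 * m + 4)) s) (l p)) ∧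
      (∀ p q, UB (rd κ θ (j + 1) r) (sc θ (e + (5 * m + 6)) s) fun i => pd q (l p i)) ∧
      (∀ i, LowDimTori.mean (l 0 i) = 0) ∧
      (∀ i, ∀ ξ ∈ strip m 0, dirD ω (l 1 i) ξ - k i * l 0 i ξ = G 0 i ξ - LowDimTori.mean (G 0 i)) ∧
      ∀ i, ∀ ξ ∈ strip m 0, -dirD ω (l 0 i) ξ + l 1 i ξ = G 1 i ξ := by
  obtain ⟨C, hC, h⟩ := exists_lambda hω hκ K
  choose B hB hG using hG
  have e0 : ∀ i, rd κ θ (j + 1) r i = rd κ θ j r i - κ / θ i ^ 2 := fun i => by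
    unfold rd; push_cast; ring
  choose l h1 h2 h3 h4 h5 using fun i =>
    h (k i) (hk i) (hK i) (θ i) (hθ i) (rd κ θ j r i) (by have := hr i; rw [e0] at this; linarith)
      (fun p => G p i) ((B 0 + B 1) * sc θ e s i) (fun p => (hG p i).mono_bound (by
        have := sc_nonneg hθ hs (e := e) i
        have := hB 0
        have := hB 1
        fin_cases p <;> simp <;> nlinarith))
  have h0 := hB 0
  have h01 := hB 1
  refine ⟨fun p i => l i p, fun p => ⟨C * (B 0 + B 1), by positivity, fun i => ?_⟩,
    fun p q => ⟨C * (B 0 + B 1), by positivity, fun i => ?_⟩, h3, h4, h5⟩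
  · rw [e0]; refine (h1 i p).mono_bound (le_of_eq ?_); simp only [sc]; ring
  · rw [e0]; refine (h2 i p q).mono_bound (le_of_eq ?_); simp only [sc]; ring

/-- Here a = 3(m + 1), so 2a + m = 7m + 6. -/
lemma UB.gamma (hω : Dioph ω A) (hκ : 0 < κ) (hθ : ∀ i, 1 ≤ θ i) (hs : ∀ i, 0 ≤ s i) {j e : ℕ}
    (hr : ∀ i, 0 < rd κ θ (j + 1) r i) {K : ℝ} {k : I → ℂ} (hk : ∀ i, 0 ≤ (k i).re)
    (hK : ∀ i, ‖k i‖ ≤ K) {g : Fin 3 → I → CFun m}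
    (hg : ∀ p, UB (rd κ θ j r) (sc θ e s) (g p)) :
    ∃ a b c : I → CFun m, UB (rd κ θ (j + 1) r) (sc θ (e + (7 * m + 6)) s) a ∧
      UB (rd κ θ (j + 1) r) (sc θ (e + (7 * m + 6)) s) b ∧
      UB (rd κ θ (j + 1) r) (sc θ (e + (7 * m + 6)) s) c ∧ (∀ i, LowDimTori.mean (b i) = 0) ∧
      (∀ i, ∀ ξ ∈ strip m 0, dirD ω (c i) ξ - 2 * k i * a i ξ =
        g 0 i ξ - (LowDimTori.mean (g 0 i) - k i * LowDimTori.mean (g 2 i))) ∧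
      (∀ i, ∀ ξ ∈ strip m 0, -dirD ω (a i) ξ - k i * b i ξ + c i ξ = g 1 i ξ) ∧
      ∀ i, ∀ ξ ∈ strip m 0, -dirD ω (b i) ξ - 2 * a i ξ = g 2 i ξ := by
  obtain ⟨C, hC, h⟩ := exists_gamma hω hκ K
  choose B hB hg using hg
  have e0 : ∀ i, rd κ θ (j + 1) r i = rd κ θ j r i - κ / θ i ^ 2 := fun i => by
    unfold rd; push_cast; ring
  have h0 := hB 0
  have h01 := hB 1
  have h02 := hB 2
  choose a b c h1 h2 h3 h4 h5 h6 h7 using fun i =>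
    h (k i) (hk i) (hK i) (θ i) (hθ i) (rd κ θ j r i) (by have := hr i; rw [e0] at this; linarith)
      (fun p => g p i) ((B 0 + B 1 + B 2) * sc θ e s i) (fun p => (hg p i).mono_bound (by
        have := sc_nonneg hθ hs (e := e) i
        refine mul_le_mul_of_nonneg_right ?_ this
        fin_cases p <;> simp <;> linarith))
  have hb : 0 ≤ C * (B 0 + B 1 + B 2) := by positivity
  refine ⟨a, b, c, ⟨_, hb, fun i => ?_⟩, ⟨_, hb, fun i => ?_⟩, ⟨_, hb, fun i => ?_⟩, h4, h5, h6, h7⟩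
  · rw [e0]; refine (h1 i).mono_bound (le_of_eq ?_); simp only [sc]; ring
  · rw [e0]; refine (h2 i).mono_bound (le_of_eq ?_); simp only [sc]; ring
  · rw [e0]; refine (h3 i).mono_bound (le_of_eq ?_); simp only [sc]; ring

lemma UB.lift {t : I → ℝ} {G : I → CFun m} (hG : UB r s G) (hκ : 0 < κ) (hθ : ∀ i, 1 ≤ θ i) (j : ℕ)
    (hs : ∀ i, s i ≤ t i) (ht : ∀ i, 0 ≤ t i) (e : ℕ) : UB (rd κ θ j r) (sc θ e t) G :=
  (hG.shrink (rd_le hκ hθ j)).mono fun i => (hs i).trans (le_sc hθ ht i)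

lemma UB.next {j e e' : ℕ} {G : I → CFun m} (hG : UB (rd κ θ j r) (sc θ e s) G) (hκ : 0 < κ)
    (hθ : ∀ i, 1 ≤ θ i) (hs : ∀ i, 0 ≤ s i) (he : e ≤ e') :
    UB (rd κ θ (j + 1) r) (sc θ e' s) G :=
  (hG.shrink (rd_succ_le hκ hθ j)).mono (sc_mono hθ hs he)

lemma UB.up {e e' : ℕ} {G : I → CFun m} (hG : UB r (sc θ e s) G) (hθ : ∀ i, 1 ≤ θ i)
    (hs : ∀ i, 0 ≤ s i) (he : e ≤ e') : UB r (sc θ e' s) G :=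
  hG.mono (sc_mono hθ hs he)

lemma CB.up {e e' : ℕ} {c : I → ℂ} (hc : CB (sc θ e s) c) (hθ : ∀ i, 1 ≤ θ i)
    (hs : ∀ i, 0 ≤ s i) (he : e ≤ e') : CB (sc θ e' s) c :=
  hc.mono (sc_mono hθ hs he)

end Families

end LowDimTori

end

/-! ### A priori estimates: the equations for ψ₀ and λ -/

noncomputable section

namespace LowDimTori

open MeasureTheory Set Filter Topology

variable {m : ℕ}

lemma UB.of_const {I : Type} {r : I → ℝ} {f : I → CFun m} {C : ℝ} (hC : 0 ≤ C)
    (h : ∀ i, HPB (r i) (f i) C) : UB r (fun _ => 1) f :=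
  ⟨C, hC, fun i => by rw [mul_one]; exact h i⟩

lemma UB.congr {I : Type} {r s : I → ℝ} {f g : I → CFun m} (hf : UB r s f)
    (h : ∀ i, ∀ ξ, g i ξ = f i ξ) : UB r s g := by
  have : g = f := funext fun i => funext (h i)
  rwa [this]

lemma CB.congr {I : Type} {s : I → ℝ} {c d : I → ℂ} (hc : CB s c) (h : ∀ i, d i = c i) : CB s d := by
  have : d = c := funext h
  rwa [this]

lemma UB.scale {I : Type} {r s t : I → ℝ} {f : I → CFun m} {b : ℝ} (hb : 0 ≤ b) (hf : UB r s f)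
    (h : ∀ i, s i ≤ b * t i) : UB r t f := by
  obtain ⟨B, hB, hf⟩ := hf
  refine ⟨B * b, by positivity, fun i => (hf i).mono_bound ?_⟩
  rw [mul_assoc]
  exact mul_le_mul_of_nonneg_left (h i) hB

/-- The solutions of the first two equations, up to constants. -/
structure Family.Red {I : Type} (P : Family m I) (t : Fin m → ℂ) (κ : ℝ) (ψ : I → CFun m)
    (l : Fin 2 → I → CFun m) : Prop where
  ub_ψ : UB (rd κ P.θ 2 P.r) (sc P.θ (3 * m + 2) P.s) ψ
  ub_dψ : ∀ j, UB (rd κ P.θ 2 P.r) (sc P.θ (3 * m + 4) P.s) fun i => pd j (ψ i)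
  eq_ψ : ∀ i, ∀ ξ ∈ strip m 0, (P.X i).ψ₀ ξ = ψ i ξ + mean (P.X i).ψ₀
  eq_μ : ∀ i, ∀ ξ ∈ strip m 0, ∀ j, (P.X i).μ ξ j = pd j (ψ i) ξ + (P.X i).δβ j
  q : CB P.s fun i => (P.X i).q
  ub_l : ∀ p, UB (rd κ P.θ 2 P.r) (sc P.θ (8 * m + 8) P.s) (l p)
  ub_dl : ∀ p j, UB (rd κ P.θ 2 P.r) (sc P.θ (8 * m + 10) P.s) fun i => pd j (l p i)
  eq_l₀ : ∀ i, ∀ ξ ∈ strip m 0, (P.X i).lam 0 ξ = l 0 i ξ + mean ((P.X i).lam 0)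
  eq_l₁ : ∀ i, ∀ ξ ∈ strip m 0, (P.X i).lam 1 ξ = l 1 i ξ - ∑ j, t j * (P.X i).δβ j
  eq_dl : ∀ i p, ∀ j, ∀ ξ ∈ strip m 0, pd j ((P.X i).lam p) ξ = pd j (l p i) ξ
  p : CB (sc P.θ (3 * m + 4) P.s) fun i => (P.X i).p - P.k i * mean ((P.X i).lam 0)

namespace Family.Ok

variable {I : Type} {P : Family m I} {ω : Fin m → ℝ} {A K C : ℝ}
    {S₀ : Fin m → Fin m → ℂ} {t : Fin m → ℂ} {κ : ℝ}

section Stages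

variable (h : P.Ok ω A K C S₀ t κ)
include h

lemma rd_pos {j : ℕ} (hj : j ≤ 3) (i : I) : 0 < rd κ P.θ j P.r i := by
  have h1 := h.r_lt i
  have h2 := h.δ_pos i
  have h3 : (j : ℝ) ≤ 3 := by exact_mod_cast hj
  have : (j : ℝ) * (κ / P.θ i ^ 2) ≤ 3 * (κ / P.θ i ^ 2) := mul_le_mul_of_nonneg_right h3 h2.le
  unfold rd; linarith

lemma C_nonneg : 0 ≤ C := zero_le_one.trans h.C_one

lemma η_mul (i : I) : P.η i * P.η i ≤ P.η i := by nlinarith [h.η_nonneg i, h.η_le i]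

lemma Nη (i : I) : P.N i * P.η i ≤ P.s i := by rw [mul_comm]; exact h.N_le i

lemma wη : UB P.r P.η fun i => (P.L i).w := UB.of_le fun i => (h.L i).w

lemma W_bd (p : Fin 2) : UB P.r (fun _ => 1) fun i => (P.L i).W p :=
  UB.of_const h.C_nonneg fun i => (h.L i).W p

lemma δβN (j : Fin m) : CB P.N fun i => (P.X i).δβ j := CB.of_le fun i => h.δβ i j
lemma pN : CB P.N fun i => (P.X i).p := CB.of_le h.p
lemma δMN : CB P.N fun i => (P.X i).δM := CB.of_le h.δM
lemma aN : CB P.N fun i => mean ((P.X i).lam 0) := CB.of_le h.a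

lemma tδβN : CB P.N fun i => ∑ j, t j * (P.X i).δβ j :=
  CB.sum _ fun j _ => (h.δβN j).const_mul (t j)

/-- The terms with p and δM carry a factor w₁ − α of size η, so after moving them to the right
everything is of size s. The solution differs from the mean-zero primitive by a constant, and q is
the mean of the right-hand side. -/
lemma exists_ψ : ∃ ψ : I → CFun m, UB (rd κ P.θ 1 P.r) (sc P.θ (3 * m + 2) P.s) ψ ∧
    (∀ j, UB (rd κ P.θ 1 P.r) (sc P.θ (3 * m + 4) P.s) fun i => pd j (ψ i)) ∧
    (∀ i, ∀ ξ ∈ strip m 0, (P.X i).ψ₀ ξ = ψ i ξ + mean (P.X i).ψ₀) ∧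
    (∀ i, ∀ ξ ∈ strip m 0, ∀ j, (P.X i).μ ξ j = pd j (ψ i) ξ + (P.X i).δβ j) ∧
    CB P.s fun i => (P.X i).q := by
  have hF : UB P.r P.s fun i => (P.F i).F₁ := (UB.of_le fun i => (h.F i).F₁).mono h.M_le
  have hG : UB P.r P.s fun i ξ => (P.F i).F₁ ξ - (P.X i).p * (P.L i).w ξ
      - (1 / 2 * (P.X i).δM) * ((P.L i).w ξ * (P.L i).w ξ) :=
    (hF.sub (UB.const_mul h.pN h.wη h.Nη)).sub
      (UB.const_mul (h.δMN.const_mul _) (h.wη.mul h.wη h.η_mul) h.Nη)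
  obtain ⟨ψ, h1, h2, h3, h4⟩ := UB.primitive (j := 0) (e := 0) h.dioph h.κ_pos h.θ_one
    (fun i => h.rd_pos (by norm_num) i) (hG.lift h.κ_pos h.θ_one 0 (fun _ => le_rfl) h.s_nonneg 0)
  simp only [zero_add] at h1 h2
  have hψ := h1.torusC1 (h.rd_pos (by norm_num))
  have key : ∀ i, (P.X i).q - mean (fun ξ => (P.F i).F₁ ξ - (P.X i).p * (P.L i).w ξ
      - (1 / 2 * (P.X i).δM) * ((P.L i).w ξ * (P.L i).w ξ)) = 0 ∧
      ∀ ξ ∈ strip m 0, (P.X i).ψ₀ ξ = ψ i ξ + mean (P.X i).ψ₀ := by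
    intro i
    have hX := (h.sol i).ψ₀
    obtain ⟨e1, e2⟩ := eq_mean_of_dirD_eq_zero h.dioph (hX.sub (hψ i)).1 (c := (P.X i).q -
      mean (fun ξ => (P.F i).F₁ ξ - (P.X i).p * (P.L i).w ξ
      - (1 / 2 * (P.X i).δM) * ((P.L i).w ξ * (P.L i).w ξ))) (fun ξ hξ => by
        rw [dirD_sub hX (hψ i) hξ, h4 i ξ hξ]
        linear_combination (h.sol i).eq₁ ξ hξ)
    refine ⟨e1, fun ξ hξ => ?_⟩
    have := e2 ξ hξ
    rw [mean_sub hX.toCont (hψ i).toCont, h3, sub_zero] at this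
    linear_combination this
  refine ⟨ψ, h1, h2, fun i => (key i).2, fun i ξ hξ j => ?_, ?_⟩
  · have := pd_congr (key i).2 j ξ hξ
    rw [((hψ i).add (TorusC1.const (mean (P.X i).ψ₀)).1).2 j ξ hξ, (TorusC1.const _).2, add_zero] at this
    rw [Unknown.μ, this]
  · exact (hG.mean h.r_pos).congr fun i => by linear_combination (key i).1

/-- T and W are replaced by their unperturbed values (rows 0 and t of T, first row (1, 0) of W); the
differences are η-small and go to the right-hand side. What remains is the constant coefficient
system with the constants p and t·δβ. -/
lemma exists_red : ∃ ψ l, P.Red t κ ψ l := by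
  obtain ⟨ψ, h1, h2, h3, h4, h5⟩ := h.exists_ψ
  have hθ := h.θ_one
  have hs := h.s_nonneg
  have hκ := h.κ_pos
  have up : ∀ {G : I → CFun m}, UB P.r P.s G → UB (rd κ P.θ 1 P.r) (sc P.θ (3 * m + 4) P.s) G :=
    fun hG => hG.lift hκ hθ 1 (fun _ => le_rfl) hs _
  have hF : ∀ p, UB P.r P.s fun i => (P.F i).F₂ p := fun p => (UB.of_le fun i => (h.F i).F₂ p).mono h.M_le
  have hT : ∀ p j, UB (rd κ P.θ 1 P.r) (fun _ => 1) fun i => (P.L i).T p j := fun p j =>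
    (UB.of_const h.C_nonneg fun i => (h.L i).T p j).shrink (rd_le hκ hθ 1)
  have hwW : ∀ p, UB P.r P.s fun i ξ => (P.X i).δM * ((P.L i).W p ξ * (P.L i).w ξ) := fun p =>
    UB.const_mul h.δMN (UB.mul_coef (h.W_bd p) h.wη) h.Nη
  -- Of p W₁₁ only p (W₁₁ − 1) is small; p itself stays behind as the constant in `lambda_unique`,
  -- which yields p − k a = mean of this function.
  have hG0 : UB (rd κ P.θ 1 P.r) (sc P.θ (3 * m + 4) P.s) fun i ξ => (P.F i).F₂ 0 ξ
      - (∑ j, (P.L i).T 0 j ξ * pd j (ψ i) ξ) - (∑ j, (P.X i).δβ j * (P.L i).T 0 j ξ)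
      - (P.X i).p * ((P.L i).W 0 ξ - 1) - (P.X i).δM * ((P.L i).W 0 ξ * (P.L i).w ξ) := by
    refine ((((up (hF 0)).sub (UB.sum _ fun j _ => UB.mul_coef (hT 0 j) (h2 j))).sub
      (UB.sum _ fun j _ => up ?_)).sub (up ?_)).sub (up (hwW 0))
    · exact UB.const_mul (h.δβN j) (UB.of_le fun i => (h.L i).T₀ j) h.Nη
    · exact UB.const_mul h.pN (UB.of_le fun i => (h.L i).W₀) h.Nη
  have hG1 : UB (rd κ P.θ 1 P.r) (sc P.θ (3 * m + 4) P.s) fun i ξ => (P.F i).F₂ 1 ξ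
      - (∑ j, (P.L i).T 1 j ξ * pd j (ψ i) ξ) - (∑ j, (P.X i).δβ j * ((P.L i).T 1 j ξ - t j))
      - (P.X i).p * (P.L i).W 1 ξ - (P.X i).δM * ((P.L i).W 1 ξ * (P.L i).w ξ) := by
    refine ((((up (hF 1)).sub (UB.sum _ fun j _ => UB.mul_coef (hT 1 j) (h2 j))).sub
      (UB.sum _ fun j _ => up ?_)).sub (up ?_)).sub (up (hwW 1))
    · exact UB.const_mul (h.δβN j) (UB.of_le fun i => (h.L i).T₁ j) h.Nη
    · exact UB.const_mul h.pN (UB.of_le fun i => (h.L i).W₁) h.Nη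
  obtain ⟨l, l1, l2, l3, l4, l5⟩ := UB.lambda (j := 1) h.dioph hκ hθ hs
    (fun i => h.rd_pos (by norm_num) i) h.k_re h.k_le
    (G := ![fun i ξ => (P.F i).F₂ 0 ξ
      - (∑ j, (P.L i).T 0 j ξ * pd j (ψ i) ξ) - (∑ j, (P.X i).δβ j * (P.L i).T 0 j ξ)
      - (P.X i).p * ((P.L i).W 0 ξ - 1) - (P.X i).δM * ((P.L i).W 0 ξ * (P.L i).w ξ),
      fun i ξ => (P.F i).F₂ 1 ξ
      - (∑ j, (P.L i).T 1 j ξ * pd j (ψ i) ξ) - (∑ j, (P.X i).δβ j * ((P.L i).T 1 j ξ - t j))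
      - (P.X i).p * (P.L i).W 1 ξ - (P.X i).δM * ((P.L i).W 1 ξ * (P.L i).w ξ)])
    (fun p => by
      fin_cases p
      · exact hG0
      · exact hG1)
  simp only [Matrix.cons_val_zero, Matrix.cons_val_one] at l4 l5
  have lC := fun p => (l1 p).torusC1 (h.rd_pos (by norm_num))
  have key : ∀ i, (P.X i).p - mean (fun ξ => (P.F i).F₂ 0 ξ
      - (∑ j, (P.L i).T 0 j ξ * pd j (ψ i) ξ) - (∑ j, (P.X i).δβ j * (P.L i).T 0 j ξ)
      - (P.X i).p * ((P.L i).W 0 ξ - 1) - (P.X i).δM * ((P.L i).W 0 ξ * (P.L i).w ξ))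
        = P.k i * mean ((P.X i).lam 0) ∧
      (∀ ξ ∈ strip m 0, (P.X i).lam 0 ξ = l 0 i ξ + mean ((P.X i).lam 0)) ∧
      (∀ ξ ∈ strip m 0, (P.X i).lam 1 ξ = l 1 i ξ - ∑ j, t j * (P.X i).δβ j) := by
    intro i
    have hX0 := (h.sol i).lam 0
    have hX1 := (h.sol i).lam 1
    -- The unperturbed part t·δβ of the second component is a constant, and shifting λ₂ by it turns
    -- the system into the homogeneous one for the difference.
    have hc := (TorusC1.const (m := m) (∑ j, t j * (P.X i).δβ j)).1
    have hX1c := (hX1.add hc).1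
    obtain ⟨e1, e2, e3⟩ := lambda_unique h.dioph (h.k_re i) (hX0.sub (lC 0 i)).1 (hX1c.sub (lC 1 i)).1
      (c := (P.X i).p - mean (fun ξ => (P.F i).F₂ 0 ξ
      - (∑ j, (P.L i).T 0 j ξ * pd j (ψ i) ξ) - (∑ j, (P.X i).δβ j * (P.L i).T 0 j ξ)
      - (P.X i).p * ((P.L i).W 0 ξ - 1) - (P.X i).δM * ((P.L i).W 0 ξ * (P.L i).w ξ)))
      (fun ξ hξ => by
        rw [dirD_sub hX1c (lC 1 i) hξ, dirD_add_const hX1 _ hξ]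
        have e := (h.sol i).eq₂ ξ hξ
        simp only [h4 i ξ hξ, mul_add, Finset.sum_add_distrib] at e
        have e' : ∑ j, (P.X i).δβ j * (P.L i).T 0 j ξ = ∑ j, (P.L i).T 0 j ξ * (P.X i).δβ j :=
          Finset.sum_congr rfl fun j _ => mul_comm _ _
        linear_combination e - l4 i ξ hξ + e')
      (fun ξ hξ => by
        rw [dirD_sub hX0 (lC 0 i) hξ]
        have e := (h.sol i).eq₂' ξ hξ
        simp only [h4 i ξ hξ, mul_add, Finset.sum_add_distrib] at e
        have e' : ∑ j, (P.X i).δβ j * ((P.L i).T 1 j ξ - t j)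
            = ∑ j, (P.L i).T 1 j ξ * (P.X i).δβ j - ∑ j, t j * (P.X i).δβ j := by
          rw [← Finset.sum_sub_distrib]
          exact Finset.sum_congr rfl fun j _ => by ring
        linear_combination e - l5 i ξ hξ + e')
    rw [mean_sub hX0.toCont (lC 0 i).toCont, l3, sub_zero] at e1 e2
    exact ⟨e1, fun ξ hξ => by linear_combination e2 ξ hξ, fun ξ hξ => by linear_combination e3 ξ hξ⟩
  refine ⟨ψ, l, h1.shrink (rd_succ_le hκ hθ 1), fun j => (h2 j).shrink (rd_succ_le hκ hθ 1), h3, h4, h5,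
    fun p => (l1 p).up hθ hs (by omega), fun p j => (l2 p j).up hθ hs (by omega),
    fun i => (key i).2.1, fun i => (key i).2.2, ?_, ?_⟩
  · intro i p j ξ hξ
    fin_cases p
    · have := pd_congr (key i).2.1 j ξ hξ
      rw [((lC 0 i).add (TorusC1.const _).1).2 j ξ hξ, (TorusC1.const _).2, add_zero] at this
      exact this
    · have := pd_congr (key i).2.2 j ξ hξ
      rw [((lC 1 i).sub (TorusC1.const _).1).2 j ξ hξ, (TorusC1.const _).2, sub_zero] at this
      exact this
  · exact (hG0.mean (h.rd_pos (by norm_num))).congr fun i => by linear_combination (key i).1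

end Stages

end Family.Ok

end LowDimTori

end

/-! ### A priori estimates: the equation for χ and the constants δβ, a, p -/

noncomputable section

namespace LowDimTori

open MeasureTheory Set Filter Topology

variable {m : ℕ}

lemma mean_sum {ι : Type*} (F : Finset ι) {f : ι → CFun m} (hf : ∀ i ∈ F, TorusCont (f i)) :
    mean (fun ξ => ∑ i ∈ F, f i ξ) = ∑ i ∈ F, mean (f i) := by
  simpa only [fc_zero_index] using fc_sum F hf 0

/-- Smallness in terms of the free constants for the solutions of the third equation. -/
structure Family.Red₃ {I : Type} (P : Family m I) (κ : ℝ) (χ : Fin m → I → CFun m) : Prop where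
  ub_χ : ∀ j, UB (rd κ P.θ 3 P.r) (sc P.θ (11 * m + 10) (fun i => P.s i + P.N i)) (χ j)
  eq_χ : ∀ i j, ∀ ξ ∈ strip m 0, (P.X i).χ j ξ = χ j i ξ
  δβ : ∀ j, CB (sc P.θ (11 * m + 10) P.s) fun i => (P.X i).δβ j
  a : CB (sc P.θ (11 * m + 10) P.s) fun i => mean ((P.X i).lam 0)
  p : CB (sc P.θ (11 * m + 10) P.s) fun i => (P.X i).p

namespace Family.Ok

variable {I : Type} {P : Family m I} {ω : Fin m → ℝ} {A K C : ℝ}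
    {S₀ : Fin m → Fin m → ℂ} {t : Fin m → ℂ} {κ : ℝ}

section Stages

variable (h : P.Ok ω A K C S₀ t κ) {ψ : I → CFun m} {l : Fin 2 → I → CFun m}
include h

/-- Averaging the χ equation determines δβ, the condition with f₅ then determines a, and the
relation for p − k a determines p. All three are bounded by s, whereas χ itself is at first bounded
only by s + N. -/
lemma exists_χ (hR : P.Red t κ ψ l) {CK : ℝ} (hCK : 0 ≤ CK)
    (hK₀ : ∀ (v : Fin m → ℂ) (M : ℝ), (∀ i, ‖∑ j, (S₀ i j - t i * t j) * v j‖ ≤ M) →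
      ∀ j, ‖v j‖ ≤ CK * M) : ∃ χ, P.Red₃ κ χ := by
  have hθ := h.θ_one
  have hs := h.s_nonneg
  have hκ := h.κ_pos
  have hN : ∀ i, 0 ≤ P.s i + P.N i := fun i => add_nonneg (hs i) (h.N_nonneg i)
  have r2 := h.rd_pos (j := 2) (by norm_num)
  have r3 := h.rd_pos (j := 3) (by norm_num)
  have hF : ∀ j, UB P.r P.s fun i => (P.F i).F₃ j := fun j => (UB.of_le fun i => (h.F i).F₃ j).mono h.M_le
  have hT : ∀ p j, UB (rd κ P.θ 2 P.r) (fun _ => 1) fun i => (P.L i).T p j := fun p j =>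
    (UB.of_const h.C_nonneg fun i => (h.L i).T p j).shrink (rd_le hκ hθ 2)
  have hS : ∀ p j, UB (rd κ P.θ 2 P.r) (fun _ => 1) fun i => (P.L i).S p j := fun p j =>
    (UB.of_const h.C_nonneg fun i => (h.L i).S p j).shrink (rd_le hκ hθ 2)
  have up : ∀ {G : I → CFun m}, UB P.r P.s G → UB (rd κ P.θ 2 P.r) (sc P.θ (8 * m + 8) P.s) G :=
    fun hG => hG.lift hκ hθ 2 (fun _ => le_rfl) hs _
  let c : I → ℂ := fun i => ∑ j, t j * (P.X i).δβ j
  let a : I → ℂ := fun i => mean ((P.X i).lam 0)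
  let G : Fin m → I → CFun m := fun q i ξ => (∑ j, (P.L i).S q j ξ * pd j (ψ i) ξ)
    + (P.L i).T 0 q ξ * l 0 i ξ + (P.L i).T 1 q ξ * l 1 i ξ - (P.F i).F₃ q ξ
    + (∑ j, (P.X i).δβ j * ((P.L i).S q j ξ - S₀ q j))
    + a i * (P.L i).T 0 q ξ - c i * ((P.L i).T 1 q ξ - t q)
  have hG : ∀ q, UB (rd κ P.θ 2 P.r) (sc P.θ (8 * m + 8) P.s) (G q) := by
    intro q
    refine ((((((UB.sum _ fun j _ => UB.mul_coef (hS q j) ((hR.ub_dψ j).up hθ hs (by omega))).add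
      (UB.mul_coef (hT 0 q) (hR.ub_l 0))).add
      (UB.mul_coef (hT 1 q) (hR.ub_l 1))).sub (up (hF q))).add
      (UB.sum _ fun j _ => up ?_)).add (up ?_)).sub (up ?_)
    · exact UB.const_mul (h.δβN j) (UB.of_le fun i => (h.L i).S₀ q j) h.Nη
    · exact UB.const_mul h.aN (UB.of_le fun i => (h.L i).T₀ q) h.Nη
    · exact UB.const_mul h.tδβN (UB.of_le fun i => (h.L i).T₁ q) h.Nη
  -- The unperturbed contributions of δβ: S₀ δβ directly, and −t (t·δβ) through λ₂. Together they
  -- form K₀ δβ.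
  let k₀ : Fin m → I → ℂ := fun q i => ∑ j, (S₀ q j - t q * t j) * (P.X i).δβ j
  have hk₀ : ∀ q, CB P.N (k₀ q) := fun q => CB.sum _ fun j _ => (h.δβN j).const_mul _
  -- K₀ δβ has no small factor, so as a right-hand side for χ it is measured by N.
  have hG' : ∀ q, UB (rd κ P.θ 2 P.r) (sc P.θ (8 * m + 8) fun i => P.s i + P.N i)
      fun i ξ => G q i ξ + k₀ q i := by
    intro q
    refine ((hG q).mono fun i => ?_).add ((UB.const (hk₀ q)).mono fun i => ?_)
    · exact mul_le_mul_of_nonneg_left (by linarith [h.N_nonneg i]) (by have := hθ i; positivity)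
    · exact (by linarith [hs i] : P.N i ≤ P.s i + P.N i).trans
        (le_sc hθ (s := fun i => P.s i + P.N i) hN i)
  have eqG : ∀ i q, ∀ ξ ∈ strip m 0, dirD ω ((P.X i).χ q) ξ = G q i ξ + k₀ q i := by
    intro i q ξ hξ
    have e := (h.sol i).eq₃ ξ hξ q
    have e1 : ∑ j, (P.L i).S q j ξ * (P.X i).μ ξ j = (∑ j, (P.L i).S q j ξ * pd j (ψ i) ξ)
        + ∑ j, (P.L i).S q j ξ * (P.X i).δβ j := by
      rw [← Finset.sum_add_distrib]
      exact Finset.sum_congr rfl fun j _ => by rw [hR.eq_μ i ξ hξ]; ring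
    have e2 : ∑ j, (P.X i).δβ j * ((P.L i).S q j ξ - S₀ q j) + k₀ q i + t q * c i
        = ∑ j, (P.L i).S q j ξ * (P.X i).δβ j := by
      simp only [k₀, c, Finset.mul_sum]
      rw [← Finset.sum_add_distrib, ← Finset.sum_add_distrib]
      exact Finset.sum_congr rfl fun j _ => by ring
    rw [Fin.sum_univ_two, hR.eq_l₀ i ξ hξ, hR.eq_l₁ i ξ hξ, e1] at e
    simp only [G, a, c]
    simp only [c] at e2
    linear_combination -e - e2
  choose χ x1 x2 x3 x4 using fun q => UB.primitive (j := 2) h.dioph hκ hθ r3 (hG' q)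
  have x1' : ∀ q, UB (rd κ P.θ 3 P.r) (sc P.θ (11 * m + 10) fun i => P.s i + P.N i) (χ q) :=
    fun q => (x1 q).up hθ hN (by omega)
  have hχ := fun q => (x1' q).torusC1 r3
  have hGc := fun q => (hG q).torusCont r2
  have key : ∀ i q, mean (G q i) + k₀ q i = 0 ∧
      ∀ ξ ∈ strip m 0, (P.X i).χ q ξ = χ q i ξ + mean ((P.X i).χ q) := by
    intro i q
    have hX := (h.sol i).χ q
    obtain ⟨e1, e2⟩ := eq_mean_of_dirD_eq_zero h.dioph (hX.sub (hχ q i)).1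
      (c := -(mean (G q i) + k₀ q i)) (fun ξ hξ => by
        rw [dirD_sub hX (hχ q i) hξ, eqG i q ξ hξ, x4 q i ξ hξ,
          mean_add (hGc q i) (TorusCont.const _), mean_const]
        ring)
    refine ⟨neg_eq_zero.mp e1, fun ξ hξ => ?_⟩
    have := e2 ξ hξ
    rw [mean_sub hX.toCont (hχ q i).toCont, x3, sub_zero] at this
    linear_combination this
  have hr := h.r_pos
  -- In the normalization of χ the constant part of χ meets derivatives of u, which have mean zero,
  -- so the condition determines the mean explicitly.
  have hcc : ∀ i q, mean ((P.X i).χ q) = -mean (fun ξ => ∑ j, pd j ((P.L i).u q) ξ * χ j i ξ) := by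
    intro i q
    have hu : TorusC1 ((P.L i).u q) := ((h.L i).u q).torusC1 (hr i)
    have e := (h.sol i).mean_χ q
    have c1 : TorusCont fun ξ => ∑ j, pd j ((P.L i).u q) ξ * χ j i ξ :=
      TorusCont.sum fun j _ => (hu.pd j).mul (hχ j i).toCont
    have c2 : TorusCont fun ξ => ∑ j, mean ((P.X i).χ j) * pd j ((P.L i).u q) ξ :=
      TorusCont.sum fun j _ => (hu.pd j).const_mul _
    rw [mean_congr (g := fun ξ => (P.X i).χ q ξ + ((∑ j, pd j ((P.L i).u q) ξ * χ j i ξ)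
        + ∑ j, mean ((P.X i).χ j) * pd j ((P.L i).u q) ξ)) (fun ξ hξ => by
          rw [← Finset.sum_add_distrib]
          congr 1
          exact Finset.sum_congr rfl fun j _ => by rw [(key i j).2 ξ hξ]; ring),
      mean_add ((h.sol i).χ q).toCont (c1.add c2), mean_add c1 c2,
      mean_sum _ (fun j _ => (hu.pd j).const_mul _)] at e
    simp only [mean_const_mul, hu.mean_pd, mul_zero, Finset.sum_const_zero] at e
    linear_combination e
  have hχc : ∀ q, CB (sc P.θ (11 * m + 10) fun i => P.s i + P.N i) fun i => mean ((P.X i).χ q) := by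
    intro q
    refine (UB.mean (UB.sum Finset.univ fun j _ => UB.mul_coef ?_ (x1' j)) r3).neg.congr fun i => hcc i q
    exact (UB.of_const h.C_nonneg fun i => (h.L i).du q j).shrink (rd_le hκ hθ 3)
  have ubχ := fun q => (x1' q).add (UB.const (hχc q))
  -- The average of the equation is K₀ δβ = −mean G with G of size s; the inverse of K₀ is used
  -- here.
  have hδβ : ∀ j, CB (sc P.θ (11 * m + 10) P.s) fun i => (P.X i).δβ j := by
    choose B hB hb using fun q => (hG q).mean r2
    intro j
    refine ⟨CK * ∑ q, B q, mul_nonneg hCK (Finset.sum_nonneg fun q _ => hB q), fun i => ?_⟩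
    refine (hK₀ (P.X i).δβ ((∑ q, B q) * sc P.θ (8 * m + 8) P.s i) (fun q => ?_) j).trans ?_
    · have e := (key i q).1
      have e' : ∑ j, (S₀ q j - t q * t j) * (P.X i).δβ j = -mean (G q i) := by
        simp only [k₀] at e; linear_combination e
      rw [e', norm_neg]
      exact (hb q i).trans (mul_le_mul_of_nonneg_right
        (Finset.single_le_sum (f := B) (fun q _ => hB q) (Finset.mem_univ q)) (sc_nonneg hθ hs i))
    · rw [mul_assoc]
      refine mul_le_mul_of_nonneg_left (mul_le_mul_of_nonneg_left
        (sc_mono hθ hs (by omega) i) (Finset.sum_nonneg fun q _ => hB q)) hCK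
  have hW : ∀ p, UB (rd κ P.θ 3 P.r) (fun _ => 1) fun i => (P.L i).W p := fun p =>
    (h.W_bd p).shrink (rd_le hκ hθ 3)
  have up3 : ∀ {G : I → CFun m}, UB P.r P.s G → UB (rd κ P.θ 3 P.r) (sc P.θ (11 * m + 10) P.s) G :=
    fun hG => hG.lift hκ hθ 3 (fun _ => le_rfl) hs _
  let E : I → CFun m := fun i ξ => (P.L i).W 0 ξ * l 0 i ξ + (P.L i).W 1 ξ * l 1 i ξ
    + a i * ((P.L i).W 0 ξ - 1) - c i * (P.L i).W 1 ξ
    + ∑ q, pd q (P.L i).w ξ * (χ q i ξ + mean ((P.X i).χ q))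
  have hE : UB (rd κ P.θ 3 P.r) (sc P.θ (11 * m + 10) P.s) E := by
    refine ((((UB.mul_coef (hW 0) ((hR.ub_l 0).next hκ hθ hs (by omega))).add
      (UB.mul_coef (hW 1) ((hR.ub_l 1).next hκ hθ hs (by omega)))).add (up3 ?_)).sub
        (up3 ?_)).add (UB.sum _ fun q _ => ?_)
    · exact UB.const_mul h.aN (UB.of_le fun i => (h.L i).W₀) h.Nη
    · exact UB.const_mul h.tδβN (UB.of_le fun i => (h.L i).W₁) h.Nη
    -- The factor ∂w₁ is of size η and repairs the weak bound on χ, because η(s + N) ≤ 2s.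
    · refine UB.scale (b := 2) zero_le_two (((UB.of_le fun i => (h.L i).dw q).shrink
        (rd_le hκ hθ 3)).mul (ubχ q) fun i => le_rfl) fun i => ?_
      have h1 := h.N_le i
      have h2 : P.η i * P.s i ≤ P.s i := by nlinarith [h.η_le i, hs i, h.η_nonneg i]
      have h3 : 0 ≤ P.θ i ^ (11 * m + 10) := by have := hθ i; positivity
      calc P.η i * sc P.θ (11 * m + 10) (fun i => P.s i + P.N i) i
          = P.θ i ^ (11 * m + 10) * (P.η i * P.s i + P.η i * P.N i) := by simp only [sc]; ring
        _ ≤ P.θ i ^ (11 * m + 10) * (2 * P.s i) := mul_le_mul_of_nonneg_left (by linarith) h3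
        _ = _ := by simp only [sc]; ring
  -- Since W₁₁ is close to 1, the mean of (Wλ)₁ contains a with coefficient 1; the remainder E
  -- collects terms of size s.
  have ha : ∀ i, a i = (P.F i).f₅ - mean (E i) := by
    intro i
    have e := (h.sol i).mean_w
    rw [mean_congr (g := fun ξ => E i ξ + a i) (fun ξ hξ => by
      have e' : ∑ q, (P.X i).χ q ξ * pd q (P.L i).w ξ
          = ∑ q, pd q (P.L i).w ξ * (χ q i ξ + mean ((P.X i).χ q)) :=
        Finset.sum_congr rfl fun q _ => by rw [(key i q).2 ξ hξ, mul_comm]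
      simp only [E, a, c]
      rw [hR.eq_l₀ i ξ hξ, hR.eq_l₁ i ξ hξ, e']
      ring), mean_add (hE.torusCont r3 i) (TorusCont.const _), mean_const] at e
    linear_combination e
  have haC : CB (sc P.θ (11 * m + 10) P.s) a := by
    refine CB.congr (CB.sub (c := fun i => (P.F i).f₅) ?_ (hE.mean r3)) ha
    exact (CB.of_le fun i => (h.F i).f₅).mono fun i => (h.M_le i).trans (le_sc hθ hs i)
  refine ⟨fun q i ξ => χ q i ξ + mean ((P.X i).χ q), ubχ, fun i q => (key i q).2, hδβ, haC, ?_⟩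
  have hka : CB (sc P.θ (11 * m + 10) P.s) fun i => P.k i * a i := by
    obtain ⟨B, hB, hb⟩ := haC
    refine ⟨|K| * B, by positivity, fun i => ?_⟩
    rw [norm_mul, mul_assoc]
    exact mul_le_mul ((h.k_le i).trans (le_abs_self K)) (hb i) (norm_nonneg _) (abs_nonneg K)
  exact ((hR.p.up hθ hs (by omega)).add hka).congr fun i => by ring

end Stages

end Family.Ok

end LowDimTori

end

/-! ### A priori estimates: ψ₀, Γ and δM once δβ and a are controlled -/

noncomputable section

namespace LowDimTori

open MeasureTheory Set Filter Topology

variable {m : ℕ}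

namespace Family.Ok

variable {I : Type} {P : Family m I} {ω : Fin m → ℝ} {A K C : ℝ}
    {S₀ : Fin m → Fin m → ℂ} {t : Fin m → ℂ} {κ : ℝ}

section Stages

variable (h : P.Ok ω A K C S₀ t κ) {ψ : I → CFun m} {l : Fin 2 → I → CFun m}
include h

lemma exists_lam (hR : P.Red t κ ψ l) (hδβ : ∀ j, CB P.s fun i => (P.X i).δβ j)
    (ha : CB P.s fun i => mean ((P.X i).lam 0)) : ∃ l' : Fin 2 → I → CFun m,
    (∀ p, UB (rd κ P.θ 2 P.r) (sc P.θ (8 * m + 8) P.s) (l' p)) ∧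
    (∀ i p, ∀ ξ ∈ strip m 0, (P.X i).lam p ξ = l' p i ξ) := by
  have hθ := h.θ_one
  have hs := h.s_nonneg
  refine ⟨![fun i ξ => l 0 i ξ + mean ((P.X i).lam 0),
    fun i ξ => l 1 i ξ - ∑ j, t j * (P.X i).δβ j], fun p => ?_, fun i p => ?_⟩
  · fin_cases p
    · exact (hR.ub_l 0).add (UB.const (ha.mono (le_sc hθ hs)))
    · exact (hR.ub_l 1).sub (UB.const
        ((CB.sum Finset.univ fun j _ => (hδβ j).const_mul (t j)).mono (le_sc hθ hs)))
  · fin_cases p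
    · exact hR.eq_l₀ i
    · exact hR.eq_l₁ i

lemma mean_ψ₀ (hR : P.Red t κ ψ l) (hδβ : ∀ j, CB P.s fun i => (P.X i).δβ j)
    (ha : CB P.s fun i => mean ((P.X i).lam 0)) :
    CB (sc P.θ (8 * m + 8) P.s) fun i => mean (P.X i).ψ₀ := by
  obtain ⟨l', hl, el⟩ := h.exists_lam hR hδβ ha
  have hθ := h.θ_one
  have hs := h.s_nonneg
  have hκ := h.κ_pos
  have r2 := h.rd_pos (j := 2) (by norm_num)
  have co : ∀ {f : I → CFun m}, (∀ i, HPB (P.r i) (f i) C) → UB (rd κ P.θ 2 P.r) (fun _ => 1) f :=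
    fun hf => (UB.of_const h.C_nonneg hf).shrink (rd_le hκ hθ 2)
  have hE : UB (rd κ P.θ 2 P.r) (sc P.θ (8 * m + 8) P.s) fun i ξ =>
      (∑ j, (P.X i).δβ j * (P.L i).u j ξ)
        - (P.L i).w₂ ξ * ((P.L i).W 0 ξ * l' 0 i ξ + (P.L i).W 1 ξ * l' 1 i ξ) := by
    refine (UB.sum _ fun j _ => ?_).sub (UB.mul_coef (co fun i => (h.L i).w₂)
      ((UB.mul_coef (co fun i => (h.L i).W 0) (hl 0)).add (UB.mul_coef (co fun i => (h.L i).W 1) (hl 1))))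
    exact UB.const_mul (hδβ j) (co fun i => (h.L i).u j) fun i => by
      rw [mul_one]; exact le_sc hθ hs i
  refine (hE.mean r2).congr fun i => ?_
  have e := (h.sol i).mean_ψ
  have c := hE.torusCont r2 i
  rw [mean_congr (g := fun ξ => (P.X i).ψ₀ ξ - ((∑ j, (P.X i).δβ j * (P.L i).u j ξ)
        - (P.L i).w₂ ξ * ((P.L i).W 0 ξ * l' 0 i ξ + (P.L i).W 1 ξ * l' 1 i ξ))) (fun ξ hξ => by
          rw [el i 0 ξ hξ, el i 1 ξ hξ]; ring), mean_sub (h.sol i).ψ₀.toCont c] at e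
  linear_combination e

/-- The equation contains ∇λ, of exponent 8m + 10, and solving it adds 7m + 6. The zero mode yields
δM, and the normalization of WΓ yields the remaining mean of Γ₁₂. -/
lemma exists_Γ (hR : P.Red t κ ψ l) (hδβ : ∀ j, CB P.s fun i => (P.X i).δβ j)
    (ha : CB P.s fun i => mean ((P.X i).lam 0)) :
    (∃ Γ : Fin 2 → Fin 2 → I → CFun m,
      (∀ a b, UB (rd κ P.θ 3 P.r) (sc P.θ (15 * m + 16) P.s) (Γ a b)) ∧
      ∀ i a b, ∀ ξ ∈ strip m 0, (P.X i).Γ a b ξ = Γ a b i ξ) ∧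
    CB (sc P.θ (15 * m + 16) P.s) fun i => (P.X i).δM := by
  obtain ⟨l', hl, el⟩ := h.exists_lam hR hδβ ha
  have hθ := h.θ_one
  have hs := h.s_nonneg
  have hκ := h.κ_pos
  have r2 := h.rd_pos (j := 2) (by norm_num)
  have r3 := h.rd_pos (j := 3) (by norm_num)
  have co : ∀ {f : I → CFun m}, (∀ i, HPB (P.r i) (f i) C) → UB (rd κ P.θ 2 P.r) (fun _ => 1) f :=
    fun hf => (UB.of_const h.C_nonneg hf).shrink (rd_le hκ hθ 2)
  have up : ∀ {G : I → CFun m}, UB P.r P.s G → UB (rd κ P.θ 2 P.r) (sc P.θ (8 * m + 10) P.s) G :=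
    fun hG => hG.lift hκ hθ 2 (fun _ => le_rfl) hs _
  let Q : Fin 3 → I → CFun m := fun c i => (P.L i).Q (fun p j => pd j (l p i))
    (fun j ξ => pd j (ψ i) ξ + (P.X i).δβ j) (fun p => l' p i) c
  have hQ : ∀ c, UB (rd κ P.θ 2 P.r) (sc P.θ (8 * m + 10) P.s) (Q c) := by
    intro c
    refine UB.congr ((((UB.sum Finset.univ fun p _ => UB.sum Finset.univ fun j _ =>
      UB.mul_coef (co fun i => (h.L i).U p j c) (hR.ub_dl p j)).add
      (UB.sum Finset.univ fun j _ => UB.mul_coef (co fun i => (h.L i).E j c)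
        (((hR.ub_dψ j).up hθ hs (by omega)).add
          (UB.const (r := rd κ P.θ 2 P.r) ((hδβ j).mono (le_sc hθ hs)))))).add
      (UB.sum Finset.univ fun p _ => UB.mul_coef (co fun i => (h.L i).K p c)
        ((hl p).up hθ hs (by omega))))) fun i ξ => ?_
    simp only [Q, Lin.Q, mul_comm]
  have eQ : ∀ i c, ∀ ξ ∈ strip m 0, (P.L i).Q (fun p j => pd j ((P.X i).lam p))
      (fun j ξ => (P.X i).μ ξ j) (P.X i).lam c ξ = Q c i ξ := by
    intro i c ξ hξ
    simp only [Q, Lin.Q, el i _ ξ hξ, hR.eq_μ i ξ hξ, hR.eq_dl i _ _ ξ hξ]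
  have hF : ∀ a b, UB P.r P.s fun i => (P.F i).F₄ a b := fun a b =>
    (UB.of_le fun i => (h.F i).F₄ a b).mono h.M_le
  -- In the first entry δM W₁₁² is split as δM + δM (W₁₁ + 1)(W₁₁ − 1). The first summand is the
  -- unknown constant; the second, like the other two entries, is η-small.
  let g : Fin 3 → I → CFun m := ![fun i ξ => (P.F i).F₄ 0 0 ξ - Q 0 i ξ
      - (P.X i).δM * (((P.L i).W 0 ξ + 1) * ((P.L i).W 0 ξ - 1)),
    fun i ξ => (P.F i).F₄ 0 1 ξ - Q 1 i ξ - (P.X i).δM * ((P.L i).W 0 ξ * (P.L i).W 1 ξ),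
    fun i ξ => (P.F i).F₄ 1 1 ξ - Q 2 i ξ - (P.X i).δM * ((P.L i).W 1 ξ * (P.L i).W 1 ξ)]
  have hg : ∀ c, UB (rd κ P.θ 2 P.r) (sc P.θ (8 * m + 10) P.s) (g c) := by
    have hW₁ : UB P.r P.η fun i => (P.L i).W 1 := UB.of_le fun i => (h.L i).W₁
    intro c
    fin_cases c
    · refine ((up (hF 0 0)).sub (hQ 0)).sub (up (UB.const_mul h.δMN (UB.mul_coef ?_
        (UB.of_le fun i => (h.L i).W₀)) h.Nη))
      exact (h.W_bd 0).add (UB.of_const (C := ‖(1 : ℂ)‖) (norm_nonneg _) fun i => HPB.const 1)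
    · exact ((up (hF 0 1)).sub (hQ 1)).sub (up (UB.const_mul h.δMN (UB.mul_coef (h.W_bd 0) hW₁) h.Nη))
    · exact ((up (hF 1 1)).sub (hQ 2)).sub (up (UB.const_mul h.δMN (UB.mul_coef (h.W_bd 1) hW₁) h.Nη))
  obtain ⟨a, b, c, a1, b1, c1, b2, f0, f1, f2⟩ :=
    UB.gamma (j := 2) h.dioph hκ hθ hs r3 h.k_re h.k_le hg
  have a1 := a1.up (e' := 15 * m + 16) hθ hs (by omega)
  have b1 := b1.up (e' := 15 * m + 16) hθ hs (by omega)
  have c1 := c1.up (e' := 15 * m + 16) hθ hs (by omega)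
  have ha := a1.torusC1 r3
  have hb := b1.torusC1 r3
  have hc := c1.torusC1 r3
  have key : ∀ i, (P.X i).δM - (mean (g 0 i) - P.k i * mean (g 2 i)) = 0 ∧
      (∀ ξ ∈ strip m 0, (P.X i).Γ 0 0 ξ = a i ξ) ∧
      (∀ ξ ∈ strip m 0, (P.X i).Γ 0 1 ξ = b i ξ + mean ((P.X i).Γ 0 1)) ∧
      (∀ ξ ∈ strip m 0, (P.X i).Γ 1 0 ξ = c i ξ + P.k i * mean ((P.X i).Γ 0 1)) := by
    intro i
    have X00 := (h.sol i).Γ 0 0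
    have X01 := (h.sol i).Γ 0 1
    have X10 := (h.sol i).Γ 1 0
    obtain ⟨e1, e2, e3, e4⟩ := gamma_unique h.dioph (h.k_re i) (X00.sub (ha i)).1 (X01.sub (hb i)).1
      (X10.sub (hc i)).1 (d := (P.X i).δM - (mean (g 0 i) - P.k i * mean (g 2 i)))
      (fun ξ hξ => by
        have e := (h.sol i).eq₄ ξ hξ
        have e' := f0 i ξ hξ
        rw [eQ i 0 ξ hξ] at e
        rw [dirD_sub X10 (hc i) hξ]
        simp only [g, Matrix.cons_val_zero] at e' ⊢
        linear_combination e - e')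
      (fun ξ hξ => by
        have e := (h.sol i).eq₄' ξ hξ
        have e' := f1 i ξ hξ
        rw [eQ i 1 ξ hξ] at e
        rw [dirD_sub X00 (ha i) hξ]
        simp only [g, Matrix.cons_val] at e' ⊢
        linear_combination e - e')
      (fun ξ hξ => by
        have e := (h.sol i).eq₄'' ξ hξ
        have e' := f2 i ξ hξ
        rw [eQ i 2 ξ hξ] at e
        rw [dirD_sub X01 (hb i) hξ]
        simp only [g, Matrix.cons_val] at e' ⊢
        linear_combination e - e')
    rw [mean_sub X01.toCont (hb i).toCont, b2, sub_zero] at e3 e4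
    exact ⟨e1, fun ξ hξ => by linear_combination e2 ξ hξ, fun ξ hξ => by linear_combination e3 ξ hξ,
      fun ξ hξ => by linear_combination e4 ξ hξ⟩
  have hk : ∀ {s : I → ℝ} {c : I → ℂ}, CB s c → CB s fun i => P.k i * c i := by
    rintro s c ⟨B, hB, hb⟩
    refine ⟨|K| * B, by positivity, fun i => ?_⟩
    rw [norm_mul, mul_assoc]
    exact mul_le_mul ((h.k_le i).trans (le_abs_self K)) (hb i) (norm_nonneg _) (abs_nonneg K)
  -- In the condition on (WΓ)₁₂ the unknown mean is multiplied by the mean of W₁₁, which is within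
  -- 1/2 of 1; the deviation is absorbed at the price of a factor 2.
  have hB : CB (sc P.θ (15 * m + 16) P.s) fun i => mean ((P.X i).Γ 0 1) := by
    have hE : UB (rd κ P.θ 3 P.r) (sc P.θ (15 * m + 16) P.s) fun i ξ =>
        (P.L i).W 0 ξ * b i ξ - (P.L i).W 1 ξ * a i ξ :=
      (UB.mul_coef ((h.W_bd 0).shrink (rd_le hκ hθ 3)) b1).sub
        (UB.mul_coef ((h.W_bd 1).shrink (rd_le hκ hθ 3)) a1)
    obtain ⟨B, hB, hb⟩ := hE.mean r3
    refine ⟨2 * B, by positivity, fun i => ?_⟩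
    have hW₀ := ((h.L i).W₀).torusCont (h.r_pos i)
    have e := (h.sol i).mean_Γ
    rw [mean_congr (g := fun ξ => ((P.L i).W 0 ξ * b i ξ - (P.L i).W 1 ξ * a i ξ) +
        (mean ((P.X i).Γ 0 1) * ((P.L i).W 0 ξ - 1) + mean ((P.X i).Γ 0 1))) (fun ξ hξ => by
        rw [(h.sol i).trace ξ hξ, (key i).2.1 ξ hξ, (key i).2.2.1 ξ hξ]; ring),
      mean_add (hE.torusCont r3 i) ((hW₀.const_mul _).add (TorusCont.const _)),
      mean_add (hW₀.const_mul _) (TorusCont.const _), mean_const, mean_const_mul] at e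
    have h1 : ‖mean fun ξ => (P.L i).W 0 ξ - 1‖ ≤ 1 / 2 :=
      (norm_mean_le hW₀ fun ξ hξ =>
        (h.L i).W₀.bound ξ (strip_subset_openStrip (h.r_pos i) hξ)).trans (h.η_le i)
    have h2 := hb i
    set x := mean ((P.X i).Γ 0 1)
    have h3 : x = -(mean fun ξ => (P.L i).W 0 ξ * b i ξ - (P.L i).W 1 ξ * a i ξ)
        - x * mean fun ξ => (P.L i).W 0 ξ - 1 := by linear_combination e
    have h4 : ‖x‖ ≤ B * sc P.θ (15 * m + 16) P.s i + ‖x‖ * (1 / 2) := by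
      calc ‖x‖ = ‖-(mean fun ξ => (P.L i).W 0 ξ * b i ξ - (P.L i).W 1 ξ * a i ξ)
        - x * mean fun ξ => (P.L i).W 0 ξ - 1‖ := congrArg _ h3
        _ ≤ ‖-(mean fun ξ => (P.L i).W 0 ξ * b i ξ - (P.L i).W 1 ξ * a i ξ)‖
          + ‖x * mean fun ξ => (P.L i).W 0 ξ - 1‖ := norm_sub_le _ _
        _ ≤ _ := by
          rw [norm_neg, norm_mul]
          exact add_le_add h2 (mul_le_mul_of_nonneg_left h1 (norm_nonneg _))
    linarith
  refine ⟨⟨![![a, fun i ξ => b i ξ + mean ((P.X i).Γ 0 1)],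
    ![fun i ξ => c i ξ + P.k i * mean ((P.X i).Γ 0 1), fun i ξ => -a i ξ]], ?_, ?_⟩, ?_⟩
  · intro x y
    fin_cases x <;> fin_cases y
    · exact a1
    · exact b1.add (UB.const hB)
    · exact c1.add (UB.const (hk hB))
    · exact a1.neg
  · intro i x y
    fin_cases x <;> fin_cases y
    · exact (key i).2.1
    · exact (key i).2.2.1
    · exact (key i).2.2.2
    · intro ξ hξ
      exact ((h.sol i).trace ξ hξ).trans (congrArg _ ((key i).2.1 ξ hξ))
  -- Solvability of the zero mode means δM = mean g₀ − k mean g₂.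
  · refine (((hg 0).mean r2).sub (hk ((hg 2).mean r2))).mono (sc_mono hθ hs (by omega)) |>.congr
      fun i => ?_
    linear_combination (key i).1

end Stages

end Family.Ok

/-- Estimates for a family of solutions. -/
structure Family.Est {I : Type} (P : Family m I) (r s : I → ℝ) : Prop where
  ψ₀ : ∃ ψ, UB r s ψ ∧ ∀ i, ∀ ξ ∈ strip m 0, (P.X i).ψ₀ ξ = ψ i ξ
  lam : ∀ p, ∃ l, UB r s l ∧ ∀ i, ∀ ξ ∈ strip m 0, (P.X i).lam p ξ = l i ξ
  χ : ∀ j, ∃ χ, UB r s χ ∧ ∀ i, ∀ ξ ∈ strip m 0, (P.X i).χ j ξ = χ i ξ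
  Γ : ∀ a b, ∃ Γ, UB r s Γ ∧ ∀ i, ∀ ξ ∈ strip m 0, (P.X i).Γ a b ξ = Γ i ξ
  q : CB s fun i => (P.X i).q

/-- The free constants are bounded by the right-hand side. -/
lemma Family.Ok.const_bound {I : Type} {P : Family m I} {ω : Fin m → ℝ} {A K C : ℝ}
    {S₀ : Fin m → Fin m → ℂ} {t : Fin m → ℂ} {κ : ℝ} (h : P.Ok ω A K C S₀ t κ)
    {CK : ℝ} (hCK : 0 ≤ CK)
    (hK₀ : ∀ (v : Fin m → ℂ) (M : ℝ), (∀ i, ‖∑ j, (S₀ i j - t i * t j) * v j‖ ≤ M) →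
      ∀ j, ‖v j‖ ≤ CK * M) (hθ : P.θ = fun _ => 1) :
    (∀ j, CB P.s fun i => (P.X i).δβ j) ∧ CB P.s (fun i => mean ((P.X i).lam 0)) ∧
      CB P.s (fun i => (P.X i).p) ∧ CB P.s fun i => (P.X i).δM := by
  -- With θ = 1 all powers of θ collapse; the loss of width is the fixed κ, and its cost is part of
  -- the constants.
  have e : ∀ n, sc P.θ n P.s = P.s := fun n => by funext i; simp [sc, hθ]
  obtain ⟨ψ, l, hR⟩ := h.exists_red
  obtain ⟨χ, hχ⟩ := h.exists_χ hR hCK hK₀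
  have h1 := hχ.δβ
  have h2 := hχ.a
  have h3 := hχ.p
  simp only [e] at h1 h2 h3
  have h4 := (h.exists_Γ hR h1 h2).2
  rw [e] at h4
  exact ⟨h1, h2, h3, h4⟩

/-- All components of the solutions are bounded by the right-hand side and the free constants. -/
lemma Family.Ok.est {I : Type} {P : Family m I} {ω : Fin m → ℝ} {A K C : ℝ}
    {S₀ : Fin m → Fin m → ℂ} {t : Fin m → ℂ} {κ : ℝ} (h : P.Ok ω A K C S₀ t κ)
    {CK : ℝ} (hCK : 0 ≤ CK)
    (hK₀ : ∀ (v : Fin m → ℂ) (M : ℝ), (∀ i, ‖∑ j, (S₀ i j - t i * t j) * v j‖ ≤ M) →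
      ∀ j, ‖v j‖ ≤ CK * M) (hN : ∀ i, P.N i ≤ P.s i) :
    P.Est (rd κ P.θ 3 P.r) (sc P.θ (15 * m + 16) P.s) := by
  have hθ := h.θ_one
  have hs := h.s_nonneg
  have hκ := h.κ_pos
  have h1 : ∀ j, CB P.s fun i => (P.X i).δβ j := fun j => (h.δβN j).mono hN
  have h2 : CB P.s fun i => mean ((P.X i).lam 0) := h.aN.mono hN
  obtain ⟨ψ, l, hR⟩ := h.exists_red
  obtain ⟨χ, hχ⟩ := h.exists_χ hR hCK hK₀
  obtain ⟨l', hl, el⟩ := h.exists_lam hR h1 h2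
  obtain ⟨⟨Γ, hΓ, eΓ⟩, -⟩ := h.exists_Γ hR h1 h2
  refine ⟨⟨fun i ξ => ψ i ξ + mean (P.X i).ψ₀, ?_, hR.eq_ψ⟩, fun p => ⟨l' p, ?_, fun i => el i p⟩,
    fun j => ⟨χ j, ?_, fun i => hχ.eq_χ i j⟩, fun a b => ⟨Γ a b, hΓ a b, fun i => eΓ i a b⟩,
    hR.q.mono (le_sc hθ hs)⟩
  · exact (hR.ub_ψ.next hκ hθ hs (by omega)).add
      (UB.const ((h.mean_ψ₀ hR h1 h2).mono (sc_mono hθ hs (by omega))))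
  · exact (hl p).next hκ hθ hs (by omega)
  · refine UB.scale (b := 2) zero_le_two (hχ.ub_χ j) fun i => ?_
    have h3 : 0 ≤ P.θ i ^ (11 * m + 10) := by have := hθ i; positivity
    calc sc P.θ (11 * m + 10) (fun i => P.s i + P.N i) i
        ≤ P.θ i ^ (11 * m + 10) * (2 * P.s i) :=
          mul_le_mul_of_nonneg_left (by linarith [hN i]) h3
      _ = 2 * sc P.θ (11 * m + 10) P.s i := by simp only [sc]; ring
      _ ≤ _ := mul_le_mul_of_nonneg_left (sc_mono hθ hs (by omega) i) zero_le_two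

end LowDimTori

end

noncomputable section

namespace LowDimTori

open MeasureTheory Set Filter Topology

variable {m : ℕ}

/-! ## Linear structure of the problem -/

/-- `F + c G`. -/
def Rhs.comb (c : ℂ) (F G : Rhs m) : Rhs m where
  F₁ := fun ξ => F.F₁ ξ + c * G.F₁ ξ
  F₂ := fun p ξ => F.F₂ p ξ + c * G.F₂ p ξ
  F₃ := fun i ξ => F.F₃ i ξ + c * G.F₃ i ξ
  F₄ := fun a b ξ => F.F₄ a b ξ + c * G.F₄ a b ξ
  f₅ := F.f₅ + c * G.f₅

/-- `X + c Y`. -/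
def Unknown.comb (c : ℂ) (X Y : Unknown m) : Unknown m where
  ψ₀ := fun ξ => X.ψ₀ ξ + c * Y.ψ₀ ξ
  lam := fun p ξ => X.lam p ξ + c * Y.lam p ξ
  χ := fun i ξ => X.χ i ξ + c * Y.χ i ξ
  Γ := fun a b ξ => X.Γ a b ξ + c * Y.Γ a b ξ
  δβ := fun i => X.δβ i + c * Y.δβ i
  q := X.q + c * Y.q
  p := X.p + c * Y.p
  δM := X.δM + c * Y.δM

lemma TorusC1.comb {f g : CFun m} (hf : TorusC1 f) (hg : TorusC1 g) (c : ℂ) :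
    TorusC1 (fun ξ => f ξ + c * g ξ) ∧ ∀ j, ∀ ξ ∈ strip m 0,
      LowDimTori.pd j (fun ξ => f ξ + c * g ξ) ξ = LowDimTori.pd j f ξ + c * LowDimTori.pd j g ξ :=
  ⟨(hf.add (hg.const_mul c).1).1, fun j ξ hξ => by
    rw [(hf.add (hg.const_mul c).1).2 j ξ hξ, (hg.const_mul c).2 j ξ hξ]⟩

lemma dirD_comb {ω : Fin m → ℝ} {f g : CFun m} (hf : TorusC1 f) (hg : TorusC1 g) (c : ℂ)
    {ξ : Fin m → ℂ} (hξ : ξ ∈ strip m 0) :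
    dirD ω (fun ξ => f ξ + c * g ξ) ξ = dirD ω f ξ + c * dirD ω g ξ := by
  rw [dirD_add hf (hg.const_mul c).1 hξ, dirD_const_mul hg c hξ]

lemma mean_comb {f g : CFun m} (hf : TorusCont f) (hg : TorusCont g) (c : ℂ) :
    mean (fun ξ => f ξ + c * g ξ) = mean f + c * mean g := by
  rw [mean_add hf (hg.const_mul c), mean_const_mul]

lemma sum_mul_comb {ι : Type*} (s : Finset ι) (a x y : ι → ℂ) (c : ℂ) :
    ∑ i ∈ s, a i * (x i + c * y i) = (∑ i ∈ s, a i * x i) + c * ∑ i ∈ s, a i * y i := by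
  rw [Finset.mul_sum, ← Finset.sum_add_distrib]
  exact Finset.sum_congr rfl fun i _ => by ring

lemma sum_comb_mul {ι : Type*} (s : Finset ι) (a x y : ι → ℂ) (c : ℂ) :
    ∑ i ∈ s, (x i + c * y i) * a i = (∑ i ∈ s, x i * a i) + c * ∑ i ∈ s, y i * a i := by
  rw [Finset.mul_sum, ← Finset.sum_add_distrib]
  exact Finset.sum_congr rfl fun i _ => by ring

lemma Lin.Q_comb (L : Lin m) {dl dl₁ dl₂ : Fin 2 → Fin m → CFun m} {μ μ₁ μ₂ : Fin m → CFun m}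
    {l l₁ l₂ : Fin 2 → CFun m} (c : ℂ) {ξ : Fin m → ℂ} (h₁ : ∀ i j, dl i j ξ = dl₁ i j ξ + c * dl₂ i j ξ)
    (h₂ : ∀ i, μ i ξ = μ₁ i ξ + c * μ₂ i ξ) (h₃ : ∀ i, l i ξ = l₁ i ξ + c * l₂ i ξ) (e : Fin 3) :
    L.Q dl μ l e ξ = L.Q dl₁ μ₁ l₁ e ξ + c * L.Q dl₂ μ₂ l₂ e ξ := by
  simp only [Lin.Q, h₁, h₂, h₃, sum_comb_mul, Finset.sum_add_distrib, ← Finset.mul_sum]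
  ring

lemma Unknown.μ_comb (c : ℂ) {X Y : Unknown m} (hX : TorusC1 X.ψ₀) (hY : TorusC1 Y.ψ₀)
    {ξ : Fin m → ℂ} (hξ : ξ ∈ strip m 0) (j : Fin m) :
    (X.comb c Y).μ ξ j = X.μ ξ j + c * Y.μ ξ j := by
  simp only [Unknown.μ, Unknown.comb, (hX.comb hY c).2 j ξ hξ]; ring

/-- Continuity on the torus of the coefficients in the normalization conditions. -/
structure Lin.Reg (L : Lin m) : Prop where
  W : ∀ p, TorusCont (L.W p)
  dw : ∀ i, TorusCont (pd i L.w)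
  w₂ : TorusCont L.w₂
  u : ∀ i, TorusC1 (L.u i)

lemma Lin.Bd.reg {L : Lin m} {r C : ℝ} {S₀ : Fin m → Fin m → ℂ} {t : Fin m → ℂ} {η : ℝ}
    (hL : L.Bd r C S₀ t η) (hr : 0 < r) : L.Reg :=
  ⟨fun p => (hL.W p).torusCont hr, fun i => (hL.dw i).torusCont hr, hL.w₂.torusCont hr,
    fun i => (hL.u i).torusC1 hr⟩

/-- Linearity serves twice: with c = −1 for uniqueness, and with general c to make the pairs of free
and residual constants a subspace. -/
lemma Lin.Sol.comb {L : Lin m} (hL : L.Reg) {ω : Fin m → ℝ} {k : ℂ} {F G : Rhs m} {X Y : Unknown m}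
    (hX : L.Sol ω k F X) (hY : L.Sol ω k G Y) (c : ℂ) : L.Sol ω k (F.comb c G) (X.comb c Y) := by
  have hQ : ∀ ξ ∈ strip m 0, ∀ e, L.Q (fun i j => pd j ((X.comb c Y).lam i))
      (fun i ξ => (X.comb c Y).μ ξ i) (X.comb c Y).lam e ξ =
      L.Q (fun i j => pd j (X.lam i)) (fun i ξ => X.μ ξ i) X.lam e ξ
      + c * L.Q (fun i j => pd j (Y.lam i)) (fun i ξ => Y.μ ξ i) Y.lam e ξ := fun ξ hξ e =>
    L.Q_comb c (fun i j => ((hX.lam i).comb (hY.lam i) c).2 j ξ hξ)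
      (fun i => Unknown.μ_comb c hX.ψ₀ hY.ψ₀ hξ i) (fun i => rfl) e
  have hW := fun (Z : Unknown m) (hZ : ∀ i, TorusC1 (Z.lam i)) =>
    ((hL.W 0).mul (hZ 0).toCont).add ((hL.W 1).mul (hZ 1).toCont)
  refine ⟨(hX.ψ₀.comb hY.ψ₀ c).1, fun i => ((hX.lam i).comb (hY.lam i) c).1,
    fun i => ((hX.χ i).comb (hY.χ i) c).1, fun a b => ((hX.Γ a b).comb (hY.Γ a b) c).1,
    ?_, ?_, ?_, ?_, ?_, ?_, ?_, ?_, ?_, ?_, ?_, ?_⟩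
  · intro ξ hξ
    have e1 := hX.eq₁ ξ hξ
    have e2 := hY.eq₁ ξ hξ
    have d := dirD_comb (ω := ω) hX.ψ₀ hY.ψ₀ c hξ
    simp only [Unknown.comb, Rhs.comb] at d ⊢
    linear_combination e1 + c * e2 + d
  · intro ξ hξ
    have e1 := hX.eq₂ ξ hξ
    have e2 := hY.eq₂ ξ hξ
    have d := dirD_comb (ω := ω) (hX.lam 1) (hY.lam 1) c hξ
    simp only [Unknown.μ_comb c hX.ψ₀ hY.ψ₀ hξ, sum_mul_comb]
    simp only [Unknown.comb, Rhs.comb] at d ⊢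
    linear_combination e1 + c * e2 + d
  · intro ξ hξ
    have e1 := hX.eq₂' ξ hξ
    have e2 := hY.eq₂' ξ hξ
    have d := dirD_comb (ω := ω) (hX.lam 0) (hY.lam 0) c hξ
    simp only [Unknown.μ_comb c hX.ψ₀ hY.ψ₀ hξ, sum_mul_comb]
    simp only [Unknown.comb, Rhs.comb] at d ⊢
    linear_combination e1 + c * e2 - d
  · intro ξ hξ i
    have e1 := hX.eq₃ ξ hξ i
    have e2 := hY.eq₃ ξ hξ i
    have d := dirD_comb (ω := ω) (hX.χ i) (hY.χ i) c hξ
    simp only [Unknown.μ_comb c hX.ψ₀ hY.ψ₀ hξ, sum_mul_comb]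
    simp only [Unknown.comb, Rhs.comb, sum_mul_comb] at d ⊢
    linear_combination e1 + c * e2 - d
  · intro ξ hξ
    have e1 := hX.eq₄ ξ hξ
    have e2 := hY.eq₄ ξ hξ
    have d := dirD_comb (ω := ω) (hX.Γ 1 0) (hY.Γ 1 0) c hξ
    rw [hQ ξ hξ]
    simp only [Unknown.comb, Rhs.comb] at d ⊢
    linear_combination e1 + c * e2 + d
  · intro ξ hξ
    have e1 := hX.eq₄' ξ hξ
    have e2 := hY.eq₄' ξ hξ
    have d := dirD_comb (ω := ω) (hX.Γ 0 0) (hY.Γ 0 0) c hξ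
    rw [hQ ξ hξ]
    simp only [Unknown.comb, Rhs.comb] at d ⊢
    linear_combination e1 + c * e2 - d
  · intro ξ hξ
    have e1 := hX.eq₄'' ξ hξ
    have e2 := hY.eq₄'' ξ hξ
    have d := dirD_comb (ω := ω) (hX.Γ 0 1) (hY.Γ 0 1) c hξ
    rw [hQ ξ hξ]
    simp only [Unknown.comb, Rhs.comb] at d ⊢
    linear_combination e1 + c * e2 - d
  · intro ξ hξ
    have e1 := hX.trace ξ hξ
    have e2 := hY.trace ξ hξ
    simp only [Unknown.comb]
    linear_combination e1 + c * e2
  · have h : ∀ (Z : Unknown m), (∀ i, TorusC1 (Z.lam i)) → (∀ i, TorusC1 (Z.χ i)) →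
        TorusCont fun ξ => L.W 0 ξ * Z.lam 0 ξ + L.W 1 ξ * Z.lam 1 ξ + ∑ i, Z.χ i ξ * pd i L.w ξ :=
      fun Z h1 h2 => (hW Z h1).add (TorusCont.sum fun i _ => (h2 i).toCont.mul (hL.dw i))
    simp only [Rhs.comb]
    rw [← hX.mean_w, ← hY.mean_w, ← mean_comb (h X hX.lam hX.χ) (h Y hY.lam hY.χ)]
    congr 1; funext ξ
    simp only [Unknown.comb, sum_comb_mul]; ring
  · have h : ∀ (Z : Unknown m), TorusC1 Z.ψ₀ → (∀ i, TorusC1 (Z.lam i)) →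
        TorusCont fun ξ => Z.ψ₀ ξ - (∑ i, Z.δβ i * L.u i ξ)
          + L.w₂ ξ * (L.W 0 ξ * Z.lam 0 ξ + L.W 1 ξ * Z.lam 1 ξ) :=
      fun Z h1 h2 => (h1.toCont.sub (TorusCont.sum fun i _ => (hL.u i).toCont.const_mul _)).add
        (hL.w₂.mul (hW Z h2))
    refine Eq.trans ?_ ((mean_comb (h X hX.ψ₀ hX.lam) (h Y hY.ψ₀ hY.lam) c).trans ?_)
    · congr 1; funext ξ
      simp only [Unknown.comb, sum_comb_mul]; ring
    · rw [hX.mean_ψ, hY.mean_ψ]; simp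
  · intro i
    have h : ∀ (Z : Unknown m), (∀ i, TorusC1 (Z.χ i)) →
        TorusCont fun ξ => Z.χ i ξ + ∑ j, pd j (L.u i) ξ * Z.χ j ξ :=
      fun Z h1 => (h1 i).toCont.add (TorusCont.sum fun j _ => ((hL.u i).pd j).mul (h1 j).toCont)
    refine Eq.trans ?_ ((mean_comb (h X hX.χ) (h Y hY.χ) c).trans ?_)
    · congr 1; funext ξ
      simp only [Unknown.comb, sum_mul_comb]; ring
    · rw [hX.mean_χ, hY.mean_χ]; simp
  · have h : ∀ (Z : Unknown m), (∀ a b, TorusC1 (Z.Γ a b)) →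
        TorusCont fun ξ => L.W 0 ξ * Z.Γ 0 1 ξ + L.W 1 ξ * Z.Γ 1 1 ξ :=
      fun Z h1 => ((hL.W 0).mul (h1 0 1).toCont).add ((hL.W 1).mul (h1 1 1).toCont)
    refine Eq.trans ?_ ((mean_comb (h X hX.Γ) (h Y hY.Γ) c).trans ?_)
    · congr 1; funext ξ
      simp only [Unknown.comb]; ring
    · rw [hX.mean_Γ, hY.mean_Γ]; simp

/-- The notion of solution depends only on the values of the unknowns on the real torus. -/
lemma Lin.Sol.congr {L : Lin m} {ω : Fin m → ℝ} {k : ℂ} {F : Rhs m} {X Y : Unknown m}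
    (hX : L.Sol ω k F X) (h : Y.EqOn 0 X) : L.Sol ω k F Y := by
  have hψ := fun ξ hξ => (h.ψ₀ (x := ξ) hξ).symm
  have hl := fun p ξ hξ => (h.lam p (x := ξ) hξ).symm
  have hχ := fun p ξ hξ => (h.χ p (x := ξ) hξ).symm
  have hΓ := fun a b ξ hξ => (h.Γ a b (x := ξ) hξ).symm
  have hμ : ∀ ξ ∈ strip m 0, ∀ j, Y.μ ξ j = X.μ ξ j := fun ξ hξ j => by
    simp only [Unknown.μ, h.δβ, pd_congr hψ j ξ hξ]
  have hQ : ∀ ξ ∈ strip m 0, ∀ e, L.Q (fun i j => pd j (Y.lam i)) (fun i ξ => Y.μ ξ i) Y.lam e ξ =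
      L.Q (fun i j => pd j (X.lam i)) (fun i ξ => X.μ ξ i) X.lam e ξ := fun ξ hξ e => by
    simp only [Lin.Q, hμ ξ hξ, hl _ ξ hξ, fun i j => pd_congr (hl i) j ξ hξ]
  refine ⟨hX.ψ₀.congr hψ, fun i => (hX.lam i).congr (hl i), fun i => (hX.χ i).congr (hχ i),
    fun a b => (hX.Γ a b).congr (hΓ a b), fun ξ hξ => ?_, fun ξ hξ => ?_, fun ξ hξ => ?_,
    fun ξ hξ i => ?_, fun ξ hξ => ?_, fun ξ hξ => ?_, fun ξ hξ => ?_, fun ξ hξ => ?_, ?_, ?_,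
    fun i => ?_, ?_⟩
  · rw [← hX.eq₁ ξ hξ, dirD_congr hψ hξ, h.q, h.p, h.δM]
  · simp only [← hX.eq₂ ξ hξ, dirD_congr (hl 1) hξ, ← hl _ ξ hξ, h.p, h.δM, hμ ξ hξ]
  · simp only [← hX.eq₂' ξ hξ, dirD_congr (hl 0) hξ, ← hl _ ξ hξ, h.p, h.δM, hμ ξ hξ]
  · simp only [← hX.eq₃ ξ hξ, dirD_congr (hχ i) hξ, ← hl _ ξ hξ, hμ ξ hξ]
  · rw [← hX.eq₄ ξ hξ, dirD_congr (hΓ 1 0) hξ, ← hΓ 0 0 ξ hξ, hQ ξ hξ, h.δM]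
  · rw [← hX.eq₄' ξ hξ, dirD_congr (hΓ 0 0) hξ, ← hΓ 0 1 ξ hξ, ← hΓ 1 0 ξ hξ, hQ ξ hξ, h.δM]
  · rw [← hX.eq₄'' ξ hξ, dirD_congr (hΓ 0 1) hξ, ← hΓ 0 0 ξ hξ, hQ ξ hξ, h.δM]
  · rw [← hΓ 0 0 ξ hξ, ← hΓ 1 1 ξ hξ, hX.trace ξ hξ]
  · rw [← hX.mean_w]
    exact mean_congr fun ξ hξ => by simp only [hl _ ξ hξ, hχ _ ξ hξ]
  · rw [← hX.mean_ψ, h.δβ]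
    exact mean_congr fun ξ hξ => by simp only [hl _ ξ hξ, hψ ξ hξ]
  · rw [← hX.mean_χ i]
    exact mean_congr fun ξ hξ => by simp only [hχ _ ξ hξ]
  · rw [← hX.mean_Γ]
    exact mean_congr fun ξ hξ => by simp only [hΓ _ _ ξ hξ]

end LowDimTori

end

noncomputable section

namespace LowDimTori

open MeasureTheory Set Filter Topology

variable {m : ℕ}

/-! ## Solutions up to residual constants -/

/-- Bounded periodic holomorphic functions on the open strip. -/
def HP (r : ℝ) (f : CFun m) : Prop := ∃ M, HPB r f M

lemma HPB.hp {r : ℝ} {f : CFun m} {M : ℝ} (hf : HPB r f M) : HP r f := ⟨M, hf⟩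

namespace HP

variable {r : ℝ} {f g : CFun m}

lemma const (c : ℂ) : HP r (fun _ : Fin m → ℂ => c) := ⟨_, HPB.const c⟩
lemma add (hf : HP r f) (hg : HP r g) : HP r fun ξ => f ξ + g ξ := ⟨_, hf.choose_spec.add hg.choose_spec⟩
lemma sub (hf : HP r f) (hg : HP r g) : HP r fun ξ => f ξ - g ξ := ⟨_, hf.choose_spec.sub hg.choose_spec⟩
lemma mul (hf : HP r f) (hg : HP r g) : HP r fun ξ => f ξ * g ξ := ⟨_, hf.choose_spec.mul hg.choose_spec⟩
lemma const_mul (c : ℂ) (hf : HP r f) : HP r fun ξ => c * f ξ := (const c).mul hf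

lemma sum {ι : Type*} {s : Finset ι} {f : ι → CFun m} (hf : ∀ i ∈ s, HP r (f i)) :
    HP r fun ξ => ∑ i ∈ s, f i ξ := by
  classical
  choose! M hM using hf
  exact ⟨_, HPB.sum hM⟩

lemma mono (hf : HP r f) {r' : ℝ} (h : r' ≤ r) : HP r' f := ⟨_, hf.choose_spec.mono h⟩

lemma torusCont (hf : HP r f) (hr : 0 < r) : TorusCont f := hf.choose_spec.torusCont hr

lemma torusC1 (hf : HP r f) (hr : 0 < r) : TorusC1 f := hf.choose_spec.torusC1 hr

end HP

section Solve

variable {ω : Fin m → ℝ} {A : ℝ} {r r' : ℝ}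

/-- For existence no uniformity is needed, so the quantitative result is used with θ = 1 and κ = r −
r'. -/
lemma HP.primitive (hω : Dioph ω A) (h0 : 0 < r') (hr : r' < r) {G : CFun m} (hG : HP r G) :
    ∃ ψ : CFun m, HP r' ψ ∧ (∀ j, HP r' (pd j ψ)) ∧ mean ψ = 0 ∧
      ∀ ξ ∈ strip m 0, dirD ω ψ ξ = G ξ - mean G := by
  obtain ⟨C, -, h⟩ := exists_primitive hω (sub_pos.mpr hr)
  obtain ⟨ψ, h1, h2, h3, h4⟩ := h 1 le_rfl r (by simpa using h0) G _ hG.choose_spec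
  have e : r - (r - r') / 1 ^ 2 = r' := by ring
  rw [e] at h1 h2
  exact ⟨ψ, ⟨_, h1⟩, fun j => ⟨_, h2 j⟩, h3, h4⟩

lemma HP.lambda (hω : Dioph ω A) (h0 : 0 < r') (hr : r' < r) {k : ℂ} (hk : 0 ≤ k.re)
    {G₀ G₁ : CFun m} (hG₀ : HP r G₀) (hG₁ : HP r G₁) :
    ∃ l₀ l₁ : CFun m, HP r' l₀ ∧ HP r' l₁ ∧ (∀ j, HP r' (pd j l₀)) ∧ (∀ j, HP r' (pd j l₁)) ∧
      mean l₀ = 0 ∧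
      (∀ ξ ∈ strip m 0, dirD ω l₁ ξ - k * l₀ ξ = G₀ ξ - mean G₀) ∧
      ∀ ξ ∈ strip m 0, -dirD ω l₀ ξ + l₁ ξ = G₁ ξ := by
  obtain ⟨C, -, h⟩ := exists_lambda hω (sub_pos.mpr hr) ‖k‖
  obtain ⟨M₀, hG₀⟩ := hG₀
  obtain ⟨M₁, hG₁⟩ := hG₁
  obtain ⟨l, h1, h2, h3, h4, h5⟩ := h k hk le_rfl 1 le_rfl r (by simpa using h0) ![G₀, G₁]
    (max M₀ M₁) (fun p => by
      fin_cases p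
      · exact hG₀.mono_bound (le_max_left _ _)
      · exact hG₁.mono_bound (le_max_right _ _))
  have e : r - (r - r') / 1 ^ 2 = r' := by ring
  rw [e] at h1 h2
  exact ⟨l 0, l 1, ⟨_, h1 0⟩, ⟨_, h1 1⟩, fun j => ⟨_, h2 0 j⟩, fun j => ⟨_, h2 1 j⟩, h3, h4, h5⟩

lemma HP.gamma (hω : Dioph ω A) (h0 : 0 < r') (hr : r' < r) {k : ℂ} (hk : 0 ≤ k.re)
    {g₀ g₁ g₂ : CFun m} (hg₀ : HP r g₀) (hg₁ : HP r g₁) (hg₂ : HP r g₂) :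
    ∃ a b c : CFun m, ∃ d : ℂ, HP r' a ∧ HP r' b ∧ HP r' c ∧
      (∀ ξ ∈ strip m 0, dirD ω c ξ - 2 * k * a ξ = g₀ ξ + d) ∧
      (∀ ξ ∈ strip m 0, -dirD ω a ξ - k * b ξ + c ξ = g₁ ξ) ∧
      ∀ ξ ∈ strip m 0, -dirD ω b ξ - 2 * a ξ = g₂ ξ := by
  obtain ⟨C, -, h⟩ := exists_gamma hω (sub_pos.mpr hr) ‖k‖
  obtain ⟨M₀, hg₀⟩ := hg₀
  obtain ⟨M₁, hg₁⟩ := hg₁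
  obtain ⟨M₂, hg₂⟩ := hg₂
  obtain ⟨a, b, c, h1, h2, h3, h4, h5, h6, h7⟩ := h k hk le_rfl 1 le_rfl r (by simpa using h0)
    ![g₀, g₁, g₂] (max M₀ (max M₁ M₂)) (fun p => by
      fin_cases p
      · exact hg₀.mono_bound (le_max_left _ _)
      · exact hg₁.mono_bound ((le_max_left _ _).trans (le_max_right _ _))
      · exact hg₂.mono_bound ((le_max_right _ _).trans (le_max_right _ _)))
  have e : r - (r - r') / 1 ^ 2 = r' := by ring
  rw [e] at h1 h2 h3
  exact ⟨a, b, c, _, ⟨_, h1⟩, ⟨_, h2⟩, ⟨_, h3⟩,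
    fun ξ hξ => (h5 ξ hξ).trans (sub_eq_add_neg _ _), h6, h7⟩

end Solve

/-- The space of the free constants, and of the residual constants. -/
abbrev Consts (m : ℕ) := (Fin m → ℂ) × ℂ × ℂ × ℂ

/-- The free constants of an unknown. -/
def Unknown.consts (X : Unknown m) : Consts m := (X.δβ, X.p, X.δM, mean (X.lam 0))

/-- The right-hand side with residual constants. -/
def Rhs.res (x : Consts m) : Rhs m where
  F₁ := fun _ => 0
  F₂ := ![fun _ => x.2.1, fun _ => 0]
  F₃ := fun i _ => x.1 i
  F₄ := ![![fun _ => x.2.2.1, fun _ => 0], ![fun _ => 0, fun _ => 0]]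
  f₅ := x.2.2.2

/-- With all free constants prescribed the triangular system is solved from top to bottom. The
solvability conditions not met are the averages of the χ equation, of the first λ equation and of
the (1,1) entry of the Γ equation, and the condition with f₅. They number exactly as many as the
free constants and are moved into the right-hand side. -/
lemma Lin.Bd.exists_residual {L : Lin m} {ω : Fin m → ℝ} {A r C η M : ℝ}
    {S₀ : Fin m → Fin m → ℂ} {t : Fin m → ℂ} (hL : L.Bd r C S₀ t η) (hω : Dioph ω A) (hr : 0 < r)
    (hη : η ≤ 1 / 2) {k : ℂ} (hk : 0 ≤ k.re) {F : Rhs m} (hF : F.Bd r M) (x : Consts m) :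
    ∃ X ρ, L.Sol ω k (F.comb 1 (Rhs.res ρ)) X ∧ X.consts = x := by
  obtain ⟨δβ, p, δM, a⟩ := x
  -- Half-widths r, 3r/4, r/2, r/4 for the data, ψ₀, λ, and for χ together with Γ.
  have h1 : 0 < r / 4 := by linarith
  have h12 : r / 4 < r / 2 := by linarith
  have h2 : 0 < r / 2 := by linarith
  have h23 : r / 2 < 3 / 4 * r := by linarith
  have h3 : 0 < 3 / 4 * r := by linarith
  have h3r : 3 / 4 * r < r := by linarith
  have hw : HP r L.w := ⟨_, hL.w⟩
  have hW : ∀ p, HP r (L.W p) := fun p => ⟨_, hL.W p⟩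
  have hT : ∀ p j, HP r (L.T p j) := fun p j => ⟨_, hL.T p j⟩
  have hS : ∀ i j, HP r (L.S i j) := fun i j => ⟨_, hL.S i j⟩
  have hu := fun i => (hL.u i).torusC1 hr
  -- the function `ψ₀`
  let G : CFun m := fun ξ => F.F₁ ξ - p * L.w ξ - 1 / 2 * δM * (L.w ξ * L.w ξ)
  have hG : HP r G := ((hF.F₁).hp.sub (hw.const_mul p)).sub ((hw.mul hw).const_mul _)
  obtain ⟨ψ, ψ1, ψ2, -, ψ4⟩ := hG.primitive hω h3 h3r
  let μ : Fin m → CFun m := fun j ξ => pd j ψ ξ + δβ j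
  have hμ : ∀ j, HP (3 / 4 * r) (μ j) := fun j => (ψ2 j).add (HP.const _)
  -- the function `λ`
  have hG' : ∀ q, HP (3 / 4 * r) fun ξ => F.F₂ q ξ - (∑ j, L.T q j ξ * μ j ξ) - p * L.W q ξ
      - δM * L.w ξ * L.W q ξ := fun q =>
    ((((hF.F₂ q).hp.mono h3r.le).sub (HP.sum fun j _ =>
      ((hT q j).mono h3r.le).mul (hμ j))).sub (((hW q).const_mul p).mono h3r.le)).sub
      (((hw.const_mul _).mul (hW q)).mono h3r.le)
  obtain ⟨l₀, l₁, l1, l2, l3, l4, l5, l6, l7⟩ := (hG' 0).lambda hω h2 h23 hk (hG' 1)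
  have hl₀ : HP (r / 2) fun ξ => l₀ ξ + a := l1.add (HP.const a)
  let l : Fin 2 → CFun m := ![fun ξ => l₀ ξ + a, l₁]
  have hl : ∀ q, HP (r / 2) (l q) := fun q => by
    fin_cases q
    · exact hl₀
    · exact l2
  have hlC := fun q => (hl q).torusC1 h2
  have hdl : ∀ q j, ∀ ξ ∈ strip m 0, pd j (l q) ξ = pd j (![l₀, l₁] q) ξ := fun q j ξ hξ => by
    fin_cases q
    · exact (((l1.torusC1 h2).add (TorusC1.const a).1).2 j ξ hξ).trans (by
        rw [(TorusC1.const _).2, add_zero]; rfl)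
    · rfl
  -- the function `χ`
  have hG₃ : ∀ i, HP (r / 2) fun ξ => (∑ j, L.S i j ξ * μ j ξ) + (∑ q, L.T q i ξ * l q ξ) - F.F₃ i ξ :=
    fun i => ((HP.sum fun j _ => ((hS i j).mono (by linarith)).mul ((hμ j).mono h23.le)).add
      (HP.sum fun q _ => ((hT q i).mono (by linarith)).mul (hl q))).sub
      ((hF.F₃ i).hp.mono (by linarith))
  choose χ' χ1 _ _ χ4 using fun i => (hG₃ i).primitive hω h1 h12
  have hχ' := fun i => (χ1 i).torusC1 h1
  let c : Fin m → ℂ := fun i => -mean (fun ξ => χ' i ξ + ∑ j, pd j (L.u i) ξ * χ' j ξ)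
  let χ : Fin m → CFun m := fun i ξ => χ' i ξ + c i
  have hχ := fun i => ((hχ' i).add (TorusC1.const (c i)).1).1
  -- the matrix `Γ`
  let Q : Fin 3 → CFun m := L.Q (fun q j => pd j (![l₀, l₁] q)) μ l
  have hdl' : ∀ q j, HP (r / 2) (pd j ((![l₀, l₁] : Fin 2 → CFun m) q)) := fun q j => by
    fin_cases q
    · exact l3 j
    · exact l4 j
  have hQ : ∀ e, HP (r / 2) (Q e) := fun e =>
    ((HP.sum fun q _ => HP.sum fun j _ => (hdl' q j).mul
      ((hL.U q j e).hp.mono (by linarith))).add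
      (HP.sum fun j _ => ((hμ j).mono h23.le).mul ((hL.E j e).hp.mono (by linarith)))).add
      (HP.sum fun q _ => (hl q).mul ((hL.K q e).hp.mono (by linarith)))
  have hg : ∀ (x y : Fin 2) e (x' y' : Fin 2), HP (r / 2) fun ξ => F.F₄ x y ξ - Q e ξ
      - δM * (L.W x' ξ * L.W y' ξ) := fun x y e x' y' =>
    (((hF.F₄ x y).hp.mono (by linarith)).sub (hQ e)).sub
      ((((hW x').mul (hW y')).const_mul δM).mono (by linarith))
  obtain ⟨a', b', c', d, a1, b1, c1, f0, f1, f2⟩ :=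
    (hg 0 0 0 0 0).gamma hω h1 h12 hk (hg 0 1 1 0 1) (hg 1 1 2 1 1)
  have ha := a1.torusC1 h1
  have hb := b1.torusC1 h1
  have hc := c1.torusC1 h1
  have hWc := fun q => (hW q).torusCont hr
  have hm : mean (L.W 0) ≠ 0 := by
    have hW₀ := (hL.W₀).torusCont hr
    have h1 : ‖mean fun ξ => L.W 0 ξ - 1‖ ≤ 1 / 2 :=
      (norm_mean_le hW₀ fun ξ hξ => hL.W₀.bound ξ (strip_subset_openStrip hr hξ)).trans hη
    rw [mean_sub (hWc 0) (TorusCont.const 1), mean_const] at h1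
    intro h0
    rw [h0] at h1
    norm_num at h1
  -- Adding B to Γ₁₂ and k B to Γ₂₁ solves the homogeneous equations, so B is free to meet the
  -- normalization of WΓ; the division is allowed because W₁₁ is within 1/2 of 1.
  let B : ℂ := -mean (fun ξ => L.W 0 ξ * b' ξ - L.W 1 ξ * a' ξ) / mean (L.W 0)
  let Γ : Fin 2 → Fin 2 → CFun m := ![![a', fun ξ => b' ξ + B], ![fun ξ => c' ξ + k * B, fun ξ => -a' ξ]]
  -- the mean of `ψ₀`
  have hc₀ : TorusCont fun ξ => ψ ξ - (∑ i, δβ i * L.u i ξ)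
      + L.w₂ ξ * (L.W 0 ξ * l 0 ξ + L.W 1 ξ * l 1 ξ) :=
    ((ψ1.torusCont h3).sub (TorusCont.sum fun i _ => (hu i).toCont.const_mul _)).add
      ((hL.w₂.torusCont hr).mul (((hWc 0).mul (hlC 0).toCont).add ((hWc 1).mul (hlC 1).toCont)))
  let cψ : ℂ := -mean (fun ξ => ψ ξ - (∑ i, δβ i * L.u i ξ)
      + L.w₂ ξ * (L.W 0 ξ * l 0 ξ + L.W 1 ξ * l 1 ξ))
  have hψC := ψ1.torusC1 h3
  have hψ := hψC.add (TorusC1.const cψ).1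
  let X : Unknown m := ⟨fun ξ => ψ ξ + cψ, l, χ, Γ, δβ, mean G, p, δM⟩
  have hXμ : ∀ ξ ∈ strip m 0, ∀ j, X.μ ξ j = μ j ξ := fun ξ hξ j => by
    simp only [Unknown.μ, X, μ, hψ.2 j ξ hξ, (TorusC1.const _).2, add_zero]
  have hXQ : ∀ ξ ∈ strip m 0, ∀ e, L.Q (fun i j => pd j (X.lam i)) (fun i ξ => X.μ ξ i) X.lam e ξ
      = Q e ξ := fun ξ hξ e => by
    simp only [Q, Lin.Q, hXμ ξ hξ, X, hdl _ _ ξ hξ]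
  refine ⟨X, (fun i => mean (fun ξ => (∑ j, L.S i j ξ * μ j ξ) + (∑ q, L.T q i ξ * l q ξ) - F.F₃ i ξ),
    -mean (fun ξ => F.F₂ 0 ξ - (∑ j, L.T 0 j ξ * μ j ξ) - p * L.W 0 ξ - δM * L.w ξ * L.W 0 ξ) - k * a, d,
    mean (fun ξ => L.W 0 ξ * l 0 ξ + L.W 1 ξ * l 1 ξ + ∑ i, χ i ξ * pd i L.w ξ) - F.f₅), ⟨hψ.1, hlC, hχ,
    fun x y => ?_, fun ξ hξ => ?_, fun ξ hξ => ?_, fun ξ hξ => ?_, fun ξ hξ i => ?_, fun ξ hξ => ?_,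
    fun ξ hξ => ?_, fun ξ hξ => ?_, fun ξ hξ => ?_, ?_, ?_, fun i => ?_, ?_⟩, ?_⟩
  · fin_cases x <;> fin_cases y
    · exact ha
    · exact (hb.add (TorusC1.const _).1).1
    · exact (hc.add (TorusC1.const _).1).1
    · exact (ha.const_mul (-1)).1.congr fun ξ _ => neg_one_mul _
  · simp only [Rhs.comb, Rhs.res, X, dirD_add_const hψC _ hξ, ψ4 ξ hξ, G]; ring
  · have e := l6 ξ hξ
    simp only [Rhs.comb, Rhs.res, hXμ ξ hξ]
    simp only [X, l, Matrix.cons_val]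
    linear_combination e
  · have e := l7 ξ hξ
    simp only [Rhs.comb, Rhs.res, hXμ ξ hξ]
    simp only [X, l, Matrix.cons_val, dirD_add_const (l1.torusC1 h2) _ hξ]
    linear_combination e
  · have e := χ4 i ξ hξ
    simp only [Rhs.comb, Rhs.res, hXμ ξ hξ]
    simp only [X, χ, dirD_add_const (hχ' i) _ hξ]
    linear_combination -e
  · have e := f0 ξ hξ
    rw [hXQ ξ hξ]
    simp only [Rhs.comb, Rhs.res, X, Γ, Matrix.cons_val, dirD_add_const hc _ hξ]
    linear_combination e
  · have e := f1 ξ hξ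
    rw [hXQ ξ hξ]
    simp only [Rhs.comb, Rhs.res, X, Γ, Matrix.cons_val]
    linear_combination e
  · have e := f2 ξ hξ
    rw [hXQ ξ hξ]
    simp only [Rhs.comb, Rhs.res, X, Γ, Matrix.cons_val, dirD_add_const hb _ hξ]
    linear_combination e
  · simp only [X, Γ, Matrix.cons_val]
  · simp only [Rhs.comb, Rhs.res, X]; ring
  · rw [mean_congr (g := fun ξ => (ψ ξ - (∑ i, δβ i * L.u i ξ)
      + L.w₂ ξ * (L.W 0 ξ * l 0 ξ + L.W 1 ξ * l 1 ξ)) + cψ) (fun ξ hξ => by simp only [X]; ring),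
      mean_add hc₀ (TorusCont.const _), mean_const]
    simp only [cψ]; ring
  · have e1 : TorusCont fun ξ => χ' i ξ + ∑ j, pd j (L.u i) ξ * χ' j ξ :=
      (hχ' i).toCont.add (TorusCont.sum fun j _ => ((hu i).pd j).mul (hχ' j).toCont)
    have e2 : ∀ j ∈ Finset.univ, TorusCont fun ξ => c j * pd j (L.u i) ξ :=
      fun j _ => ((hu i).pd j).const_mul _
    rw [mean_congr (g := fun ξ => ((χ' i ξ + ∑ j, pd j (L.u i) ξ * χ' j ξ)
      + ∑ j, c j * pd j (L.u i) ξ) + c i) (fun ξ hξ => by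
        have : ∑ j, pd j (L.u i) ξ * (χ' j ξ + c j) = (∑ j, pd j (L.u i) ξ * χ' j ξ)
            + ∑ j, c j * pd j (L.u i) ξ := by
          rw [← Finset.sum_add_distrib]
          exact Finset.sum_congr rfl fun j _ => by ring
        simp only [X, χ, this]; ring),
      mean_add (e1.add (TorusCont.sum e2)) (TorusCont.const _), mean_add e1 (TorusCont.sum e2),
      mean_const, mean_sum _ e2]
    simp only [mean_const_mul, (hu i).mean_pd, mul_zero, Finset.sum_const_zero, c]
    ring
  · have e1 : TorusCont fun ξ => L.W 0 ξ * b' ξ - L.W 1 ξ * a' ξ :=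
      ((hWc 0).mul hb.toCont).sub ((hWc 1).mul ha.toCont)
    rw [mean_congr (g := fun ξ => (L.W 0 ξ * b' ξ - L.W 1 ξ * a' ξ) + B * L.W 0 ξ) (fun ξ hξ => by
      simp only [X, Γ, Matrix.cons_val]; ring), mean_add e1 ((hWc 0).const_mul B), mean_const_mul]
    simp only [B]
    field_simp
    ring
  · have : mean (fun ξ => l₀ ξ + a) = a := by
      rw [mean_add (l1.torusCont h2) (TorusCont.const _), l5, mean_const, zero_add]
    simp only [Unknown.consts, X, l, Matrix.cons_val, this]

end LowDimTori

end

/-! ### Existence by a dimension count, uniqueness and uniform bounds -/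

noncomputable section

namespace LowDimTori

open MeasureTheory Set Filter Topology

variable {m : ℕ}

lemma Rhs.res_comb (c : ℂ) (x y : Consts m) : (Rhs.res x).comb c (Rhs.res y) = Rhs.res (x + c • y) := by
  simp only [Rhs.comb, Rhs.res, Rhs.mk.injEq]
  refine ⟨by simp, ?_, ?_, ?_, ?_⟩
  · funext p ξ; fin_cases p <;> simp
  · funext i ξ; simp
  · funext a b ξ; fin_cases a <;> fin_cases b <;> simp
  · simp

lemma Rhs.bd_res_zero (r : ℝ) : (Rhs.res (0 : Consts m)).Bd r 0 := by
  have h : HPB r (fun _ : Fin m → ℂ => (0 : ℂ)) 0 := (HPB.const 0).mono_bound (by simp)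
  refine ⟨h, fun p => ?_, fun i => h, fun a b => ?_, by simp [Rhs.res]⟩
  · fin_cases p <;> exact h
  · fin_cases a <;> fin_cases b <;> exact h

lemma Unknown.consts_comb (c : ℂ) {X Y : Unknown m} (hX : TorusC1 (X.lam 0)) (hY : TorusC1 (Y.lam 0)) :
    (X.comb c Y).consts = X.consts + c • Y.consts := by
  simp only [Unknown.consts, Unknown.comb, mean_comb hX.toCont hY.toCont c]
  rfl

/-- The residual constants can be removed if the free constants vanish for the homogeneous
problem. -/
lemma Lin.Bd.exists_sol {L : Lin m} {ω : Fin m → ℝ} {A r C η M : ℝ}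
    {S₀ : Fin m → Fin m → ℂ} {t : Fin m → ℂ} (hL : L.Bd r C S₀ t η) (hω : Dioph ω A) (hr : 0 < r)
    (hη : η ≤ 1 / 2) {k : ℂ} (hk : 0 ≤ k.re)
    (hinj : ∀ F X, F.Bd r 0 → L.Sol ω k F X → X.consts = 0) {F : Rhs m} (hF : F.Bd r M) :
    ∃ X, L.Sol ω k F X := by
  have hR := hL.reg hr
  have ex : ∀ x, ∃ X ρ, L.Sol ω k (Rhs.res ρ) X ∧ X.consts = x := fun x => by
    obtain ⟨X, ρ, h1, h2⟩ := hL.exists_residual hω hr hη hk (Rhs.bd_res_zero r) x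
    rw [Rhs.res_comb, zero_add, one_smul] at h1
    exact ⟨X, ρ, h1, h2⟩
  -- The residual obtained for x = 0 is unknown, but X − X is a solution with zero data and zero
  -- constants.
  have zero : ∃ X, L.Sol ω k (Rhs.res 0) X ∧ X.consts = 0 := by
    obtain ⟨X, ρ, h1, h2⟩ := ex 0
    refine ⟨X.comb (-1) X, ?_, ?_⟩
    · have := h1.comb hR h1 (-1)
      rwa [Rhs.res_comb, neg_one_smul, add_neg_cancel] at this
    · rw [Unknown.consts_comb _ (h1.lam 0) (h1.lam 0), h2]; simp
  -- A linear relation rather than a map: the residual is not claimed to be determined by the free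
  -- constants.
  let S : Submodule ℂ (Consts m × Consts m) :=
    { carrier := {z | ∃ X, L.Sol ω k (Rhs.res z.2) X ∧ X.consts = z.1}
      zero_mem' := zero
      add_mem' := by
        rintro x y ⟨X, hX, eX⟩ ⟨Y, hY, eY⟩
        refine ⟨X.comb 1 Y, ?_, ?_⟩
        · have := hX.comb hR hY 1
          rwa [Rhs.res_comb, one_smul] at this
        · rw [Unknown.consts_comb _ (hX.lam 0) (hY.lam 0), eX, eY, one_smul]; rfl
      smul_mem' := by
        rintro c x ⟨X, hX, eX⟩
        obtain ⟨Z, hZ, eZ⟩ := zero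
        refine ⟨Z.comb c X, ?_, ?_⟩
        · have := hZ.comb hR hX c
          rwa [Rhs.res_comb, zero_add] at this
        · rw [Unknown.consts_comb _ (hZ.lam 0) (hX.lam 0), eX, eZ, zero_add]; rfl }
  let f₁ : S →ₗ[ℂ] Consts m := (LinearMap.fst ℂ _ _).comp S.subtype
  let f₂ : S →ₗ[ℂ] Consts m := (LinearMap.snd ℂ _ _).comp S.subtype
  have h₁ : Function.Surjective f₁ := fun x => by
    obtain ⟨X, ρ, hX, eX⟩ := ex x
    exact ⟨⟨(x, ρ), X, hX, eX⟩, rfl⟩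
  have h₂ : Function.Injective f₂ := by
    rw [← LinearMap.ker_eq_bot, LinearMap.ker_eq_bot']
    rintro ⟨⟨x, ρ⟩, X, hX, eX⟩ h0
    have h0 : ρ = 0 := h0
    subst h0
    have : x = 0 := by rw [← hinj _ X (Rhs.bd_res_zero r) hX]; exact eX.symm
    subst this
    rfl
  -- The relation projects onto the free constants and injects into the residuals, two spaces of
  -- equal dimension; hence every residual occurs.
  have hd : Module.finrank ℂ S = Module.finrank ℂ (Consts m) :=
    le_antisymm (LinearMap.finrank_le_finrank_of_injective h₂)
      (LinearMap.finrank_le_finrank_of_surjective h₁)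
  have h₃ : Function.Surjective f₂ := (LinearMap.injective_iff_surjective_of_finrank_eq_finrank hd).mp h₂
  obtain ⟨X, ρ, hX, -⟩ := hL.exists_residual hω hr hη hk hF 0
  obtain ⟨⟨⟨x, ρ'⟩, Y, hY, _⟩, e⟩ := h₃ (-ρ)
  have e : ρ' = -ρ := e
  subst e
  refine ⟨X.comb 1 Y, ?_⟩
  have := hX.comb hR hY 1
  have e : ((F.comb 1 (Rhs.res ρ)).comb 1 (Rhs.res (-ρ))) = F := by
    obtain ⟨F₁, F₂, F₃, F₄, f₅⟩ := F
    simp only [Rhs.comb, Rhs.res, Rhs.mk.injEq]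
    refine ⟨by funext ξ; ring, ?_, ?_, ?_, ?_⟩
    · funext p ξ; fin_cases p <;> simp
    · funext i ξ; simp
    · funext a b ξ; fin_cases a <;> fin_cases b <;> simp
    · simp
  rwa [e] at this

/-- All the components of the unknown are bounded by `N`. -/
structure Unknown.Bd (X : Unknown m) (r N : ℝ) : Prop where
  ψ₀ : HPB r X.ψ₀ N
  lam : ∀ p, HPB r (X.lam p) N
  χ : ∀ j, HPB r (X.χ j) N
  Γ : ∀ a b, HPB r (X.Γ a b) N
  δβ : ∀ j, ‖X.δβ j‖ ≤ N
  q : ‖X.q‖ ≤ N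
  p : ‖X.p‖ ≤ N
  δM : ‖X.δM‖ ≤ N

/-- The free constants are bounded by `N`. -/
structure Unknown.ConstBd (X : Unknown m) (N : ℝ) : Prop where
  δβ : ∀ j, ‖X.δβ j‖ ≤ N
  p : ‖X.p‖ ≤ N
  δM : ‖X.δM‖ ≤ N
  a : ‖mean (X.lam 0)‖ ≤ N

/-- A linear problem together with a solution. -/
structure Case (m : ℕ) where
  k : ℂ
  θ : ℝ
  r : ℝ
  η : ℝ
  M : ℝ
  L : Lin m
  F : Rhs m
  X : Unknown m

/-- Assumptions on a linear problem. -/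
structure Case.Good (c : Case m) (ω : Fin m → ℝ) (K C : ℝ) (S₀ : Fin m → Fin m → ℂ) (t : Fin m → ℂ)
    (κ : ℝ) : Prop where
  k_re : 0 ≤ c.k.re
  k_le : ‖c.k‖ ≤ K
  θ_one : 1 ≤ c.θ
  r_lt : 3 * (κ / c.θ ^ 2) < c.r
  η_le : c.η ≤ 1 / 2
  L : c.L.Bd c.r C S₀ t c.η
  F : c.F.Bd c.r c.M
  sol : c.L.Sol ω c.k c.F c.X

section Main

variable {ω : Fin m → ℝ} {A K C : ℝ} {S₀ : Fin m → Fin m → ℂ} {t : Fin m → ℂ} {κ CK : ℝ}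

lemma Case.Good.r_pos {c : Case m} (hc : c.Good ω K C S₀ t κ) (hκ : 0 < κ) : 0 < c.r := by
  have := hc.θ_one
  have : 0 < κ / c.θ ^ 2 := by positivity
  linarith [hc.r_lt]

/-- Solutions satisfy the estimate, if it holds for their free constants. -/
lemma exists_bound (hω : Dioph ω A) (hκ : 0 < κ) (hC : 1 ≤ C) (hCK : 0 ≤ CK)
    (hK₀ : ∀ (v : Fin m → ℂ) (M : ℝ), (∀ i, ‖∑ j, (S₀ i j - t i * t j) * v j‖ ≤ M) →
      ∀ j, ‖v j‖ ≤ CK * M) {B₁ : ℝ} (hB₁ : 0 ≤ B₁) :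
    ∃ B : ℝ, 0 ≤ B ∧ ∀ c : Case m, c.Good ω K C S₀ t κ → c.X.ConstBd (B₁ * c.M) →
      ∃ X : Unknown m, X.EqOn 0 c.X ∧ X.Bd (c.r - 3 * (κ / c.θ ^ 2)) (B * (c.θ ^ (15 * m + 16) * c.M)) := by
  -- The index set is the totality of admissible problems with their solutions, so one application
  -- of the family estimates gives a bound uniform in all data.
  let I := {c : Case m // c.Good ω K C S₀ t κ ∧ c.X.ConstBd (B₁ * c.M)}
  let P : Family m I := ⟨fun i => i.1.k, fun i => i.1.θ, fun i => i.1.r, fun i => i.1.η, fun i => i.1.M,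
    fun i => B₁ * i.1.M, fun i => (1 + B₁) * i.1.M, fun i => i.1.L, fun i => i.1.F, fun i => i.1.X⟩
  have hM : ∀ i : I, 0 ≤ i.1.M := fun i => i.2.1.F.F₁.nonneg (i.2.1.r_pos hκ)
  have hBM : ∀ i : I, 0 ≤ B₁ * i.1.M := fun i => mul_nonneg hB₁ (hM i)
  have hP : P.Ok ω A K C S₀ t κ :=
    ⟨hω, hκ, hC, fun i => i.2.1.k_re, fun i => i.2.1.k_le, fun i => i.2.1.θ_one, fun i => i.2.1.r_lt,
      fun i => i.2.1.L.w.nonneg (i.2.1.r_pos hκ), fun i => i.2.1.η_le, fun i => i.2.1.L, fun i => i.2.1.F,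
      fun i => i.2.1.sol, fun i => i.2.2.δβ, fun i => i.2.2.p, fun i => i.2.2.δM, fun i => i.2.2.a,
      fun i => by have := hBM i; simp only [P]; linarith, fun i => by
        have h1 := hBM i
        have h2 := hM i
        have h3 := i.2.1.η_le
        simp only [P]
        nlinarith⟩
  have hE := hP.est hCK hK₀ (fun i => by have := hM i; simp only [P]; linarith)
  obtain ⟨ψ, ⟨Bψ, hBψ, ψ1⟩, ψ2⟩ := hE.ψ₀
  choose l l1 l2 using hE.lam
  choose Bl hBl l1 using l1
  choose χ χ1 χ2 using hE.χ
  choose Bχ hBχ χ1 using χ1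
  choose Γ Γ1 Γ2 using hE.Γ
  choose BΓ hBΓ Γ1 using Γ1
  obtain ⟨Bq, hBq, q1⟩ := hE.q
  let B₀ : ℝ := Bψ + (∑ p, Bl p) + (∑ j, Bχ j) + (∑ a, ∑ b, BΓ a b) + Bq + 1
  have s1 : 0 ≤ ∑ p, Bl p := Finset.sum_nonneg fun p _ => hBl p
  have s2 : 0 ≤ ∑ j, Bχ j := Finset.sum_nonneg fun p _ => hBχ p
  have s3 : 0 ≤ ∑ a, ∑ b, BΓ a b := Finset.sum_nonneg fun p _ => Finset.sum_nonneg fun q _ => hBΓ p q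
  refine ⟨B₀ * (1 + B₁), by positivity, fun c hc hX => ?_⟩
  let i : I := ⟨c, hc, hX⟩
  have hs : 0 ≤ sc P.θ (15 * m + 16) P.s i := sc_nonneg hP.θ_one hP.s_nonneg i
  have up : ∀ {b}, b ≤ B₀ → b * sc P.θ (15 * m + 16) P.s i
      ≤ B₀ * (1 + B₁) * (c.θ ^ (15 * m + 16) * c.M) := fun hb => by
    refine (mul_le_mul_of_nonneg_right hb hs).trans (le_of_eq ?_)
    simp only [sc, P, i]; ring
  have upc : B₁ * c.M ≤ B₀ * (1 + B₁) * (c.θ ^ (15 * m + 16) * c.M) := by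
    have h1 := le_sc hP.θ_one hP.s_nonneg (e := 15 * m + 16) i
    have h2 := hM i
    refine le_trans ?_ (up (b := 1) (by linarith))
    rw [one_mul]
    refine le_trans ?_ h1
    simp only [P, i] at h2 ⊢; linarith
  have er : rd κ P.θ 3 P.r i = c.r - 3 * (κ / c.θ ^ 2) := by simp [rd, P, i]
  rw [← er]
  refine ⟨⟨ψ i, fun p => l p i, fun j => χ j i, fun a b => Γ a b i, c.X.δβ, c.X.q, c.X.p, c.X.δM⟩,
    ⟨fun ξ hξ => (ψ2 i ξ hξ).symm, fun p ξ hξ => (l2 p i ξ hξ).symm, fun j ξ hξ => (χ2 j i ξ hξ).symm,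
      fun a b ξ hξ => (Γ2 a b i ξ hξ).symm, rfl, rfl, rfl, rfl⟩,
    ⟨(ψ1 i).mono_bound (up (by simp only [B₀]; linarith)), fun p => (l1 p i).mono_bound (up ?_),
      fun j => (χ1 j i).mono_bound (up ?_), fun a b => (Γ1 a b i).mono_bound (up ?_),
      fun j => (hX.δβ j).trans upc, (q1 i).trans (up (by simp only [B₀]; linarith)),
      hX.p.trans upc, hX.δM.trans upc⟩⟩
  · have := Finset.single_le_sum (f := Bl) (fun p _ => hBl p) (Finset.mem_univ p)
    simp only [B₀]; linarith
  · have := Finset.single_le_sum (f := Bχ) (fun p _ => hBχ p) (Finset.mem_univ j)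
    simp only [B₀]; linarith
  · have h1 := Finset.single_le_sum (f := fun b => BΓ a b) (fun p _ => hBΓ a p) (Finset.mem_univ b)
    have h2 := Finset.single_le_sum (f := fun a => ∑ b, BΓ a b)
      (fun p _ => Finset.sum_nonneg fun q _ => hBΓ p q) (Finset.mem_univ a)
    simp only [B₀]; linarith

/-- A priori estimate of the free constants. -/
lemma exists_const_bound (hω : Dioph ω A) (hC : 1 ≤ C) (hCK : 0 ≤ CK)
    (hK₀ : ∀ (v : Fin m → ℂ) (M : ℝ), (∀ i, ‖∑ j, (S₀ i j - t i * t j) * v j‖ ≤ M) →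
      ∀ j, ‖v j‖ ≤ CK * M) {r : ℝ} (hr : 0 < r) (K : ℝ) :
    ∃ B : ℝ, 0 ≤ B ∧ ∃ η₀ : ℝ, 0 < η₀ ∧ η₀ ≤ 1 / 2 ∧ ∀ (k : ℂ) (L : Lin m) (F : Rhs m) (X : Unknown m) (η M : ℝ),
      0 ≤ k.re → ‖k‖ ≤ K → η ≤ η₀ → L.Bd r C S₀ t η → F.Bd r M → L.Sol ω k F X →
      X.ConstBd (B * M) := by
  have hκ : 0 < r / 4 := by linarith
  -- Here the three losses are r/4 each with θ = 1, so 3r/4 < r and nothing depends on the loss of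
  -- width asked for later.
  let I := {c : Case m // c.Good ω K C S₀ t (r / 4) ∧ c.θ = 1}
  let N : I → ℝ := fun i => (∑ j, ‖i.1.X.δβ j‖) + ‖i.1.X.p‖ + ‖i.1.X.δM‖ + ‖mean (i.1.X.lam 0)‖
  -- N is the actual size of the free constants and s = M + ηN, the smallest convenient scale
  -- allowed by `Family.Ok`.
  let P : Family m I := ⟨fun i => i.1.k, fun _ => 1, fun i => i.1.r, fun i => i.1.η, fun i => i.1.M,
    N, fun i => i.1.M + i.1.η * N i, fun i => i.1.L, fun i => i.1.F, fun i => i.1.X⟩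
  have hM : ∀ i : I, 0 ≤ i.1.M := fun i => i.2.1.F.F₁.nonneg (i.2.1.r_pos hκ)
  have hη : ∀ i : I, 0 ≤ i.1.η := fun i => i.2.1.L.w.nonneg (i.2.1.r_pos hκ)
  have hs : ∀ X : Unknown m, 0 ≤ ∑ j, ‖X.δβ j‖ := fun X => Finset.sum_nonneg fun j _ => norm_nonneg _
  have hj : ∀ (X : Unknown m) j, ‖X.δβ j‖ ≤ ∑ j, ‖X.δβ j‖ := fun X j =>
    Finset.single_le_sum (f := fun j => ‖X.δβ j‖) (fun j _ => norm_nonneg _) (Finset.mem_univ j)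
  have hN : ∀ i : I, i.1.X.ConstBd (N i) := fun i => by
    have h1 := hs i.1.X
    have h2 := norm_nonneg i.1.X.p
    have h3 := norm_nonneg i.1.X.δM
    have h4 := norm_nonneg (mean (i.1.X.lam 0))
    refine ⟨fun j => ?_, ?_, ?_, ?_⟩
    · have := hj i.1.X j; simp only [N]; linarith
    all_goals simp only [N]; linarith
  have hN0 : ∀ i : I, 0 ≤ N i := fun i => (norm_nonneg _).trans (hN i).p
  have hP : P.Ok ω A K C S₀ t (r / 4) :=
    ⟨hω, hκ, hC, fun i => i.2.1.k_re, fun i => i.2.1.k_le, fun i => le_rfl,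
      fun i => by have := i.2.1.r_lt; rw [i.2.2] at this; exact this,
      hη, fun i => i.2.1.η_le, fun i => i.2.1.L, fun i => i.2.1.F,
      fun i => i.2.1.sol, fun i => (hN i).δβ, fun i => (hN i).p, fun i => (hN i).δM, fun i => (hN i).a,
      fun i => by have := mul_nonneg (hη i) (hN0 i); simp only [P]; linarith,
      fun i => by have := hM i; simp only [P]; linarith⟩
  obtain ⟨h1, ⟨Ba, hBa, h2⟩, ⟨Bp, hBp, h3⟩, ⟨BM, hBM, h4⟩⟩ := hP.const_bound hCK hK₀ rfl
  choose Bβ hBβ h1 using h1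
  have s1 : 0 ≤ ∑ p, Bβ p := Finset.sum_nonneg fun p _ => hBβ p
  let B : ℝ := (∑ j, Bβ j) + Bp + BM + Ba
  have hB : 0 ≤ B := by positivity
  -- From N ≤ B(M + ηN) and Bη ≤ 1/2 follows N ≤ 2BM. The bound 1/2 on η is the one required in
  -- `Case.Good`.
  refine ⟨2 * B, by positivity, min (1 / 2) (1 / (2 * (B + 1))), lt_min (by norm_num) (by positivity),
    min_le_left _ _, fun k L F X η M hk hkK hηη hL hF hX => ?_⟩
  let i : I := ⟨⟨k, 1, r, η, M, L, F, X⟩, ⟨hk, hkK, le_rfl, by norm_num; linarith,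
    hηη.trans (min_le_left _ _), hL, hF, hX⟩, rfl⟩
  have key : N i ≤ B * (M + η * N i) := by
    have e1 : ∑ j, ‖X.δβ j‖ ≤ (∑ j, Bβ j) * (M + η * N i) := by
      rw [Finset.sum_mul]; exact Finset.sum_le_sum fun j _ => h1 j i
    have e2 := h2 i
    have e3 := h3 i
    have e4 := h4 i
    simp only [P, i] at e2 e3 e4
    calc N i = (∑ j, ‖X.δβ j‖) + ‖X.p‖ + ‖X.δM‖ + ‖mean (X.lam 0)‖ := rfl
      _ ≤ _ := by simp only [B]; linarith
  have h5 : B * η ≤ 1 / 2 := by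
    have : η ≤ 1 / (2 * (B + 1)) := hηη.trans (min_le_right _ _)
    rw [le_div_iff₀ (by positivity)] at this
    have h6 : 0 ≤ η := hη i
    nlinarith
  have h7 : N i ≤ 2 * B * M := by
    have := mul_le_mul_of_nonneg_right h5 (hN0 i)
    nlinarith
  have h8 := hN i
  exact ⟨fun j => (h8.δβ j).trans h7, h8.p.trans h7, h8.δM.trans h7, h8.a.trans h7⟩

lemma Lin.Bd.mono {L : Lin m} {r η : ℝ} (hL : L.Bd r C S₀ t η) {r' : ℝ} (h : r' ≤ r) :
    L.Bd r' C S₀ t η :=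
  ⟨fun p j => (hL.T p j).mono h, fun j => (hL.T₀ j).mono h, fun j => (hL.T₁ j).mono h,
    fun i j => (hL.S i j).mono h, fun i j => (hL.S₀ i j).mono h, fun i j c => (hL.U i j c).mono h,
    fun i c => (hL.E i c).mono h, fun i c => (hL.K i c).mono h, fun p => (hL.W p).mono h,
    hL.W₀.mono h, hL.W₁.mono h, hL.w.mono h, fun i => (hL.dw i).mono h, hL.w₂.mono h,
    fun i => (hL.u i).mono h, fun i j => (hL.du i j).mono h⟩

lemma Rhs.Bd.mono {F : Rhs m} {r M : ℝ} (hF : F.Bd r M) {r' : ℝ} (h : r' ≤ r) : F.Bd r' M :=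
  ⟨hF.F₁.mono h, fun p => (hF.F₂ p).mono h, fun i => (hF.F₃ i).mono h, fun a b => (hF.F₄ a b).mono h, hF.f₅⟩

lemma Rhs.Bd.comb_neg {F : Rhs m} {r M : ℝ} (hF : F.Bd r M) : (F.comb (-1) F).Bd r 0 := by
  have h : ∀ {f : CFun m}, HPB r f M → HPB r (fun ξ => f ξ + -1 * f ξ) 0 := fun _ =>
    ((HPB.const 0).mono_bound (by simp)).congr fun ξ _ => by ring
  exact ⟨h hF.F₁, fun p => h (hF.F₂ p), fun i => h (hF.F₃ i), fun a b => h (hF.F₄ a b),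
    by simp [Rhs.comb]⟩

/-- Existence, uniqueness and estimates for the linear problem. -/
theorem exists_unique_bound (hω : Dioph ω A) (hκ : 0 < κ) (hC : 1 ≤ C) (hCK : 0 ≤ CK)
    (hK₀ : ∀ (v : Fin m → ℂ) (M : ℝ), (∀ i, ‖∑ j, (S₀ i j - t i * t j) * v j‖ ≤ M) →
      ∀ j, ‖v j‖ ≤ CK * M) {r₀ : ℝ} (hr₀ : 0 < r₀) (K : ℝ) :
    ∃ B : ℝ, 0 ≤ B ∧ ∃ η₀ : ℝ, 0 < η₀ ∧ ∀ (k : ℂ) (L : Lin m) (F : Rhs m) (θ r η M : ℝ),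
      0 ≤ k.re → ‖k‖ ≤ K → 1 ≤ θ → r₀ ≤ r → 3 * (κ / θ ^ 2) < r → η ≤ η₀ →
      L.Bd r C S₀ t η → F.Bd r M →
      ∃ X, L.Sol ω k F X ∧ X.Bd (r - 3 * (κ / θ ^ 2)) (B * (θ ^ (15 * m + 16) * M)) ∧
        ∀ Y, L.Sol ω k F Y → Y.EqOn 0 X := by
  obtain ⟨B₁, hB₁, η₀, hη₀, hη₁, h1⟩ := exists_const_bound hω hC hCK hK₀ hr₀ K
  obtain ⟨B, hB, h2⟩ := exists_bound (K := K) hω hκ hC hCK hK₀ hB₁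
  refine ⟨B, hB, η₀, hη₀, fun k L F θ r η M hk hkK hθ hr hκr hη hL hF => ?_⟩
  have hr' : 0 < r := hr₀.trans_le hr
  -- The free constants are estimated on the fixed strip r₀ ≤ r, so η₀ is independent of r and θ;
  -- only the functions are estimated with the true loss.
  have bd : ∀ F X M, F.Bd r M → L.Sol ω k F X → ∃ X' : Unknown m, X'.EqOn 0 X ∧
      X'.Bd (r - 3 * (κ / θ ^ 2)) (B * (θ ^ (15 * m + 16) * M)) := fun F X M hF hX =>
    h2 ⟨k, θ, r, η, M, L, F, X⟩ ⟨hk, hkK, hθ, hκr, hη.trans hη₁, hL, hF, hX⟩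
      (h1 k L F X η M hk hkK hη (hL.mono hr) (hF.mono hr) hX)
  obtain ⟨X, hX⟩ := hL.exists_sol hω hr' (hη.trans hη₁) hk (fun F X hF hX => by
    have := h1 k L F X η 0 hk hkK hη (hL.mono hr) (hF.mono hr) hX
    rw [mul_zero] at this
    refine Prod.ext (funext fun j => norm_le_zero_iff.mp (this.δβ j))
      (Prod.ext (norm_le_zero_iff.mp this.p) (Prod.ext (norm_le_zero_iff.mp this.δM)
        (norm_le_zero_iff.mp this.a)))) hF
  obtain ⟨X', e, hb⟩ := bd F X M hF hX
  refine ⟨X', hX.congr e, hb, fun Y hY => ?_⟩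
  -- The difference of two solutions has data bounded by 0, so the estimate itself says that it
  -- vanishes.
  obtain ⟨Z, eZ, hZ⟩ := bd _ _ 0 hF.comb_neg (hY.comb (hL.reg hr') (hX.congr e) (-1))
  simp only [mul_zero] at hZ
  have h0 : ∀ {f g z : CFun m}, Set.EqOn z (fun ξ => f ξ + -1 * g ξ) (strip m 0) →
      HPB (r - 3 * (κ / θ ^ 2)) z 0 → Set.EqOn f g (strip m 0) := fun {f g z} h1 h2 ξ hξ => by
    have e1 : z ξ = f ξ + -1 * g ξ := h1 hξ
    have e2 := norm_le_zero_iff.mp (h2.bound ξ (strip_subset_openStrip (sub_pos.mpr hκr) hξ))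
    rw [e2] at e1
    linear_combination -e1
  have h0' : ∀ {x y z : ℂ}, z = x + -1 * y → ‖z‖ ≤ 0 → x = y := fun {x y z} h1 h2 => by
    have e2 := norm_le_zero_iff.mp h2
    rw [e2] at h1
    linear_combination -h1
  exact ⟨h0 eZ.ψ₀ hZ.ψ₀, fun p => h0 (eZ.lam p) (hZ.lam p), fun p => h0 (eZ.χ p) (hZ.χ p),
    fun a b => h0 (eZ.Γ a b) (hZ.Γ a b), funext fun j => h0' (congrFun eZ.δβ j) (hZ.δβ j),
    h0' eZ.q hZ.q, h0' eZ.p hZ.p, h0' eZ.δM hZ.δM⟩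

end Main

end LowDimTori

end

noncomputable section

namespace LowDimTori

open MeasureTheory Set Filter Topology

variable {m : ℕ}

/-! ## Families of functions converging uniformly to constants -/

section Lim

variable {I : Type} {l : Filter I} {R : ℝ}

/-- Along the filter `l`, the functions `f i` are eventually periodic and holomorphic on the strip
and converge uniformly to the constant `c`. -/
def Lim (l : Filter I) (R : ℝ) (f : I → CFun m) (c : ℂ) : Prop :=
  ∀ η > 0, ∀ᶠ i in l, HPB R (fun ξ => f i ξ - c) η

namespace Lim

variable {f g : I → CFun m} {c d : ℂ}

lemma congr (hf : Lim l R f c) (h : ∀ᶠ i in l, ∀ ξ ∈ openStrip m R, g i ξ = f i ξ) : Lim l R g c :=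
  fun η hη => by
    filter_upwards [hf η hη, h] with i h1 h2
    exact h1.congr fun ξ hξ => by rw [h2 ξ hξ]

lemma hpb (hf : Lim l R f c) {η : ℝ} (hη : 0 < η) : ∀ᶠ i in l, HPB R (f i) (‖c‖ + η) := by
  filter_upwards [hf η hη] with i h
  exact ((HPB.const c).add h).congr fun ξ _ => by ring

lemma const (c : ℂ) : Lim l R (fun _ (_ : Fin m → ℂ) => c) c := fun η hη =>
  Eventually.of_forall fun _ => ((HPB.const 0).mono_bound (by simpa using hη.le)).congr
    fun ξ _ => by simp

lemma add (hf : Lim l R f c) (hg : Lim l R g d) : Lim l R (fun i ξ => f i ξ + g i ξ) (c + d) :=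
  fun η hη => by
    filter_upwards [hf (η / 2) (by positivity), hg (η / 2) (by positivity)] with i h1 h2
    exact ((h1.add h2).mono_bound (by linarith)).congr fun ξ _ => by ring

lemma mul (hf : Lim l R f c) (hg : Lim l R g d) : Lim l R (fun i ξ => f i ξ * g i ξ) (c * d) :=
  fun η hη => by
    obtain ⟨δ, hδ, h⟩ : ∃ δ > 0, δ * (‖d‖ + 1) + ‖c‖ * δ ≤ η ∧ δ ≤ 1 := by
      refine ⟨min 1 (η / (‖c‖ + ‖d‖ + 1)), lt_min one_pos (by positivity), ?_, min_le_left _ _⟩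
      have := min_le_right 1 (η / (‖c‖ + ‖d‖ + 1))
      rw [le_div_iff₀ (by positivity)] at this
      linarith
    filter_upwards [hf δ hδ, hg δ hδ, hg.hpb hδ] with i h1 h2 h3
    refine (((h1.mul h3).add ((HPB.const c).mul h2)).mono_bound ?_).congr fun ξ _ => by ring
    have : δ * (‖d‖ + δ) ≤ δ * (‖d‖ + 1) := mul_le_mul_of_nonneg_left (by linarith) hδ.le
    linarith

lemma const_mul (c : ℂ) (hg : Lim l R g d) : Lim l R (fun i ξ => c * g i ξ) (c * d) := (const c).mul hg

lemma neg (hf : Lim l R f c) : Lim l R (fun i ξ => -f i ξ) (-c) := by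
  simpa only [neg_one_mul] using hf.const_mul (-1)

lemma sub (hf : Lim l R f c) (hg : Lim l R g d) : Lim l R (fun i ξ => f i ξ - g i ξ) (c - d) := by
  simpa only [sub_eq_add_neg] using hf.add hg.neg

lemma sum {ι : Type*} (s : Finset ι) {f : ι → I → CFun m} {c : ι → ℂ}
    (hf : ∀ j ∈ s, Lim l R (f j) (c j)) : Lim l R (fun i ξ => ∑ j ∈ s, f j i ξ) (∑ j ∈ s, c j) := by
  classical
  induction s using Finset.induction_on with
  | empty => simpa using const 0
  | insert a s ha ih =>
    simp only [Finset.sum_insert ha]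
    exact (hf a (Finset.mem_insert_self a s)).add (ih fun j hj => hf j (Finset.mem_insert_of_mem hj))

lemma prod {ι : Type*} (s : Finset ι) {f : ι → I → CFun m} {c : ι → ℂ}
    (hf : ∀ j ∈ s, Lim l R (f j) (c j)) : Lim l R (fun i ξ => ∏ j ∈ s, f j i ξ) (∏ j ∈ s, c j) := by
  classical
  induction s using Finset.induction_on with
  | empty => simpa using const 1
  | insert a s ha ih =>
    simp only [Finset.prod_insert ha]
    exact (hf a (Finset.mem_insert_self a s)).mul (ih fun j hj => hf j (Finset.mem_insert_of_mem hj))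

lemma ne_zero (hf : Lim l R f c) (hc : c ≠ 0) :
    ∀ᶠ i in l, ∀ ξ ∈ openStrip m R, ‖c‖ / 2 ≤ ‖f i ξ‖ := by
  have hc' : 0 < ‖c‖ := norm_pos_iff.mpr hc
  filter_upwards [hf (‖c‖ / 2) (by positivity)] with i h ξ hξ
  have h1 := h.bound ξ hξ
  have h2 := norm_sub_norm_le c (c - f i ξ)
  rw [norm_sub_rev c (f i ξ), sub_sub_cancel] at h2
  linarith

lemma inv (hf : Lim l R f c) (hc : c ≠ 0) : Lim l R (fun i ξ => (f i ξ)⁻¹) c⁻¹ := fun η hη => by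
  have hc' : 0 < ‖c‖ := norm_pos_iff.mpr hc
  filter_upwards [hf (η * (‖c‖ ^ 2 / 2)) (by positivity), hf.ne_zero hc] with i h1 h2
  have h0 : ∀ ξ ∈ openStrip m R, f i ξ ≠ 0 := fun ξ hξ => by
    have := h2 ξ hξ
    exact norm_pos_iff.mp (by linarith)
  have hd : DifferentiableOn ℂ (f i) (openStrip m R) := by
    have := h1.diff.add (differentiableOn_const c)
    exact this.congr fun ξ _ => by simp
  refine ⟨fun ξ hξ j => ?_, (hd.inv h0).sub (differentiableOn_const _), fun ξ hξ => ?_⟩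
  · have := h1.periodic ξ hξ j
    rw [sub_left_inj] at this
    rw [this]
  · have e : (f i ξ)⁻¹ - c⁻¹ = -(f i ξ - c) * ((f i ξ)⁻¹ * c⁻¹) := by
      field_simp [h0 ξ hξ]; ring
    have h3 : ‖f i ξ‖⁻¹ ≤ (‖c‖ / 2)⁻¹ := inv_anti₀ (by positivity) (h2 ξ hξ)
    rw [e, norm_mul, norm_neg, norm_mul, norm_inv, norm_inv]
    calc ‖f i ξ - c‖ * (‖f i ξ‖⁻¹ * ‖c‖⁻¹)
        ≤ (η * (‖c‖ ^ 2 / 2)) * ((‖c‖ / 2)⁻¹ * ‖c‖⁻¹) := by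
          gcongr
          exact h1.bound ξ hξ
      _ = η := by field_simp

end Lim

/-- Convergence together with the first derivatives. -/
def Lim₁ (l : Filter I) (R : ℝ) (f : I → CFun m) (c : ℂ) : Prop :=
  Lim l R f c ∧ ∀ j, Lim l R (fun i => pd j (f i)) 0

namespace Lim₁

variable {f g : I → CFun m} {c d : ℂ}

lemma const (c : ℂ) : Lim₁ l R (fun _ (_ : Fin m → ℂ) => c) c := by
  refine ⟨Lim.const c, fun j => (Lim.const 0).congr (Eventually.of_forall fun i ξ _ => ?_)⟩
  exact (TorusC1.const (m := m) c).2 j ξ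

lemma hasLineDerivAt (hf : Lim₁ l R f c) : ∀ᶠ i in l, ∀ ξ ∈ openStrip m R, ∀ j,
    HasLineDerivAt ℝ (f i) (pd j (f i) ξ) ξ (Pi.single j 1) := by
  filter_upwards [hf.1.hpb one_pos] with i h ξ hξ j
  exact (h.hasLineDerivAt hξ j).lineDifferentiableAt.hasLineDerivAt

lemma add (hf : Lim₁ l R f c) (hg : Lim₁ l R g d) : Lim₁ l R (fun i ξ => f i ξ + g i ξ) (c + d) := by
  refine ⟨hf.1.add hg.1, fun j => ?_⟩
  have := (hf.2 j).add (hg.2 j)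
  rw [add_zero] at this
  refine this.congr ?_
  filter_upwards [hf.hasLineDerivAt, hg.hasLineDerivAt] with i h1 h2 ξ hξ
  exact HasLineDerivAt.lineDeriv (HasDerivAt.add (h1 ξ hξ j) (h2 ξ hξ j))

lemma mul (hf : Lim₁ l R f c) (hg : Lim₁ l R g d) : Lim₁ l R (fun i ξ => f i ξ * g i ξ) (c * d) := by
  refine ⟨hf.1.mul hg.1, fun j => ?_⟩
  have := ((hf.2 j).mul hg.1).add (hf.1.mul (hg.2 j))
  rw [zero_mul, mul_zero, add_zero] at this
  refine this.congr ?_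
  filter_upwards [hf.hasLineDerivAt, hg.hasLineDerivAt] with i h1 h2 ξ hξ
  have := HasDerivAt.mul (h1 ξ hξ j) (h2 ξ hξ j)
  simp only [zero_smul, add_zero] at this
  exact HasLineDerivAt.lineDeriv this

lemma inv (hf : Lim₁ l R f c) (hc : c ≠ 0) : Lim₁ l R (fun i ξ => (f i ξ)⁻¹) c⁻¹ := by
  refine ⟨hf.1.inv hc, fun j => ?_⟩
  have := (hf.2 j).neg.mul ((hf.1.inv hc).mul (hf.1.inv hc))
  rw [neg_zero, zero_mul] at this
  refine this.congr ?_
  have hc' : 0 < ‖c‖ := norm_pos_iff.mpr hc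
  filter_upwards [hf.hasLineDerivAt, hf.1.ne_zero hc] with i h1 h2 ξ hξ
  have h0 : f i ξ ≠ 0 := norm_pos_iff.mp (by have := h2 ξ hξ; linarith)
  have h3 := h1 ξ hξ j
  have : HasDerivAt (fun t : ℝ => (f i (ξ + t • (Pi.single j (1 : ℂ) : Fin m → ℂ)))⁻¹)
      (-pd j (f i) ξ / (f i (ξ + (0 : ℝ) • (Pi.single j (1 : ℂ) : Fin m → ℂ))) ^ 2) 0 := by
    refine HasDerivAt.inv h3 ?_
    simpa using h0
  refine (this.deriv : pd j (fun ξ => (f i ξ)⁻¹) ξ = _).trans ?_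
  rw [zero_smul, add_zero]
  field_simp

end Lim₁

/-- Entrywise convergence of matrices. -/
def MLim {a b : Type*} (l : Filter I) (R : ℝ) (f : I → (Fin m → ℂ) → Matrix a b ℂ) (c : Matrix a b ℂ) : Prop :=
  ∀ x y, Lim l R (fun i ξ => f i ξ x y) (c x y)

namespace MLim

variable {a b e : Type*} {f g : I → (Fin m → ℂ) → Matrix a b ℂ} {c d : Matrix a b ℂ}

lemma const (c : Matrix a b ℂ) : MLim l R (fun _ (_ : Fin m → ℂ) => c) c := fun _ _ => Lim.const _

lemma add (hf : MLim l R f c) (hg : MLim l R g d) : MLim l R (fun i ξ => f i ξ + g i ξ) (c + d) :=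
  fun x y => (hf x y).add (hg x y)

lemma neg (hf : MLim l R f c) : MLim l R (fun i ξ => -f i ξ) (-c) := fun x y => (hf x y).neg

lemma transpose (hf : MLim l R f c) : MLim l R (fun i ξ => (f i ξ)ᵀ) cᵀ := fun x y => hf y x

lemma smul {s : I → CFun m} {s₀ : ℂ} (hs : Lim l R s s₀) (hf : MLim l R f c) :
    MLim l R (fun i ξ => s i ξ • f i ξ) (s₀ • c) := fun x y => hs.mul (hf x y)

lemma sum {ι : Type*} (s : Finset ι) {f : ι → I → (Fin m → ℂ) → Matrix a b ℂ} {c : ι → Matrix a b ℂ}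
    (hf : ∀ j ∈ s, MLim l R (f j) (c j)) : MLim l R (fun i ξ => ∑ j ∈ s, f j i ξ) (∑ j ∈ s, c j) :=
  fun x y => by
    simp only [Matrix.sum_apply]
    exact Lim.sum s fun j hj => hf j hj x y

lemma mul [Fintype b] {g : I → (Fin m → ℂ) → Matrix b e ℂ} {d : Matrix b e ℂ} (hf : MLim l R f c)
    (hg : MLim l R g d) : MLim l R (fun i ξ => f i ξ * g i ξ) (c * d) := fun x y => by
  simp only [Matrix.mul_apply]
  exact Lim.sum _ fun j _ => (hf x j).mul (hg j y)

lemma det [Fintype a] [DecidableEq a] {f : I → (Fin m → ℂ) → Matrix a a ℂ} {c : Matrix a a ℂ}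
    (hf : MLim l R f c) : Lim l R (fun i ξ => (f i ξ).det) c.det := by
  simp only [Matrix.det_apply']
  exact Lim.sum _ fun σ _ => (Lim.prod _ fun j _ => hf _ _).const_mul _

/-- Cramer's formula: the adjugate is polynomial in the entries and the determinant stays away from
zero. -/
lemma inv [Fintype a] [DecidableEq a] {f : I → (Fin m → ℂ) → Matrix a a ℂ} {c : Matrix a a ℂ}
    (hf : MLim l R f c) (hc : c.det ≠ 0) : MLim l R (fun i ξ => (f i ξ)⁻¹) c⁻¹ := by
  simp only [Matrix.inv_def, Ring.inverse_eq_inv']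
  refine MLim.smul (hf.det.inv hc) fun x y => ?_
  simp only [Matrix.adjugate_apply]
  refine MLim.det fun p q => ?_
  simp only [Matrix.updateRow_apply]
  split_ifs
  · exact Lim.const _
  · exact hf p q

end MLim

end Lim

end LowDimTori

end

noncomputable section

namespace LowDimTori

open MeasureTheory Set Filter Topology

variable {m : ℕ}

/-! ## Coordinates close to the flat ones -/

/-- The parameters of the linear problem. -/
structure Idx (m : ℕ) where
  ε : ℝ
  α : ℂ
  φ : Coord m

/-- Parameters at distance at most `δ` from the unperturbed ones. -/
structure Idx.Adm (ρ R : ℝ) (d : ℕ) (δ : ℝ) (i : Idx m) : Prop where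
  ε : |i.ε| ≤ δ
  α : |i.α.im| ≤ ρ
  mem : i.φ.Mem R d
  norm : (i.φ.sub (Coord.flat i.α)).norm R d ≤ ENNReal.ofReal δ

/-- The filter of parameters approaching the unperturbed ones. -/
def small (m : ℕ) (ρ R : ℝ) (d : ℕ) : Filter (Idx m) where
  -- One δ bounds both ε and the distance of φ from the flat coordinates; it later serves as ε₀ and
  -- as r₀. The parameter k is absent because no coefficient depends on it.
  sets := {s | ∃ δ > 0, ∀ i, i.Adm ρ R d δ → i ∈ s}
  univ_sets := ⟨1, one_pos, fun _ _ => trivial⟩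
  sets_of_superset := fun ⟨δ, hδ, h⟩ hst => ⟨δ, hδ, fun i hi => hst (h i hi)⟩
  inter_sets := fun ⟨δ, hδ, h⟩ ⟨δ', hδ', h'⟩ => ⟨min δ δ', lt_min hδ hδ', fun i hi =>
    ⟨h i ⟨hi.ε.trans (min_le_left _ _), hi.α, hi.mem,
      hi.norm.trans (ENNReal.ofReal_le_ofReal (min_le_left _ _))⟩,
     h' i ⟨hi.ε.trans (min_le_right _ _), hi.α, hi.mem,
      hi.norm.trans (ENNReal.ofReal_le_ofReal (min_le_right _ _))⟩⟩⟩

lemma eventually_small {ρ R : ℝ} {d : ℕ} {p : Idx m → Prop} :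
    (∀ᶠ i in small m ρ R d, p i) ↔ ∃ δ > 0, ∀ i, i.Adm ρ R d δ → p i := Iff.rfl

lemma enorm_iterPd_le_normA {r : ℝ} {d : ℕ} (f : CFun m) {l : List (Fin m)} (hl : l.length ≤ d)
    {ξ : Fin m → ℂ} (hξ : ξ ∈ strip m r) : ‖iterPd l f ξ‖ₑ ≤ normA r d f :=
  le_iSup₂_of_le l hl (le_iSup₂_of_le ξ hξ le_rfl)

lemma openStrip_subset_strip (r : ℝ) : openStrip m r ⊆ strip m r := fun _ hξ j => (hξ j).le

lemma norm_le_of_enorm_le {z : ℂ} {δ : ℝ} (hδ : 0 ≤ δ) (h : ‖z‖ₑ ≤ ENNReal.ofReal δ) : ‖z‖ ≤ δ := by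
  rwa [← ofReal_norm, ENNReal.ofReal_le_ofReal_iff hδ] at h

/-- One derivative is enough, since V, v, Λ and R contain only first derivatives of the coordinates.
-/
lemma MemA.hpb_sub_const {r : ℝ} {d : ℕ} (hd : 1 ≤ d) {f : CFun m} {c : ℂ} (hf : MemA r d f) {δ : ℝ}
    (hδ : 0 ≤ δ) (h : normA r d (f - fun _ => c) ≤ ENNReal.ofReal δ) :
    HPB r (fun ξ => f ξ - c) δ ∧ ∀ j, HPB r (pd j f) δ := by
  have hp : ∀ ξ ∈ openStrip m r, ∀ j, f (ξ + Pi.single j ((2 * Real.pi : ℝ) : ℂ)) = f ξ :=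
    fun ξ hξ => hf.periodic ξ (openStrip_subset_strip r hξ)
  have h0 : ∀ ξ ∈ openStrip m r, ‖f ξ - c‖ ≤ δ := fun ξ hξ => norm_le_of_enorm_le hδ
    ((enorm_iterPd_le_normA (l := []) (f - fun _ => c) (by simp) (openStrip_subset_strip r hξ)).trans h)
  have hb : HPB r f (δ + ‖c‖) := ⟨hp, hf.holomorphic, fun ξ hξ => by
    have := norm_add_le (f ξ - c) c
    rw [sub_add_cancel] at this
    linarith [h0 ξ hξ]⟩
  refine ⟨⟨fun ξ hξ j => by rw [hp ξ hξ], hf.holomorphic.sub_const c, h0⟩, fun j => hb.pd j fun ξ hξ => ?_⟩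
  have h1 := norm_le_of_enorm_le hδ ((enorm_iterPd_le_normA (l := [j]) (f - fun _ => c)
    (by simpa using hd) (openStrip_subset_strip r hξ)).trans h)
  have e : iterPd [j] (f - fun _ => c) ξ = pd j f ξ := by
    simp [iterPd, LowDimTori.pd, lineDeriv]
  rwa [e] at h1

section Coords

variable {ρ R : ℝ} {d : ℕ}

/-- The reference constant may vary with the parameters: w₁ is compared with α, which does not
converge. -/
lemma lim_of_norm (hd : 1 ≤ d) {f : Idx m → CFun m} {c : Idx m → ℂ}
    (h : ∀ δ i, i.Adm ρ R d δ → MemA R d (f i) ∧ normA R d (f i - fun _ => c i) ≤ ENNReal.ofReal δ) :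
    Lim (small m ρ R d) R (fun i ξ => f i ξ - c i) 0 ∧
      ∀ j, Lim (small m ρ R d) R (fun i => pd j (f i)) 0 := by
  refine ⟨fun η hη => ⟨η, hη, fun i hi => ?_⟩, fun j η hη => ⟨η, hη, fun i hi => ?_⟩⟩
  · exact (((h η i hi).1.hpb_sub_const hd hη.le (h η i hi).2).1).congr fun ξ _ => sub_zero _
  · exact (((h η i hi).1.hpb_sub_const hd hη.le (h η i hi).2).2 j).congr fun ξ _ => sub_zero _

lemma lim₁_of_norm (hd : 1 ≤ d) {f : Idx m → CFun m} {c : ℂ}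
    (h : ∀ δ i, i.Adm ρ R d δ → MemA R d (f i) ∧ normA R d (f i - fun _ => c) ≤ ENNReal.ofReal δ) :
    Lim₁ (small m ρ R d) R f c := by
  have h1 := lim_of_norm hd h
  have h2 := (h1.1.add (Lim.const c)).congr (g := f) (Eventually.of_forall fun i ξ _ => by ring)
  rw [zero_add] at h2
  exact ⟨h2, h1.2⟩

lemma norm_w_le {δ : ℝ} {i : Idx m} (hi : i.Adm ρ R d δ) (p : Fin 2) :
    normA R d ((i.φ.sub (Coord.flat i.α)).w p) ≤ ENNReal.ofReal δ :=
  le_trans (le_sup_of_le_left (le_sup_of_le_left (le_sup_of_le_left (le_sup_of_le_right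
      (le_iSup (fun j => normA R d ((i.φ.sub (Coord.flat i.α)).w j)) p))))) hi.norm

lemma lim_β (j : Fin m) : Lim (small m ρ R d) R (fun i (_ : Fin m → ℂ) => i.φ.β j) 0 := fun η hη =>
  ⟨η, hη, fun i hi => (HPB.const _).mono_bound (by
    rw [sub_zero]
    refine norm_le_of_enorm_le hη.le (le_trans ?_ hi.norm)
    refine le_sup_of_le_left (le_sup_of_le_left (le_sup_of_le_left (le_sup_of_le_left
      (le_sup_of_le_left (le_sup_of_le_left ?_)))))
    refine le_trans (le_of_eq ?_) (le_iSup (fun j => ‖(i.φ.sub (Coord.flat i.α)).β j‖ₑ) j)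
    simp [Coord.sub, Coord.flat])⟩

variable (hd : 1 ≤ d)
include hd

lemma lim₁_φ₀ : Lim₁ (small m ρ R d) R (fun i => i.φ.φ₀) 0 :=
  lim₁_of_norm hd fun _ _ hi => ⟨hi.mem.φ₀, le_trans (le_sup_of_le_left (le_sup_of_le_left
    (le_sup_of_le_left (le_sup_of_le_left (le_sup_of_le_left le_sup_right))))) hi.norm⟩

lemma lim₁_u (j : Fin m) : Lim₁ (small m ρ R d) R (fun i => i.φ.u j) 0 :=
  lim₁_of_norm hd fun _ i hi => ⟨hi.mem.u j, le_trans (le_sup_of_le_left (le_sup_of_le_left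
    (le_sup_of_le_left (le_sup_of_le_left (le_sup_of_le_right
      (le_iSup (fun j => normA R d ((i.φ.sub (Coord.flat i.α)).u j)) j)))))) hi.norm⟩

lemma lim₁_w₂ : Lim₁ (small m ρ R d) R (fun i => i.φ.w 1) 0 :=
  lim₁_of_norm hd fun _ _ hi => ⟨hi.mem.w 1, norm_w_le hi 1⟩

lemma lim_w₁ : Lim (small m ρ R d) R (fun i ξ => i.φ.w 0 ξ - i.α) 0 ∧
    ∀ j, Lim (small m ρ R d) R (fun i => pd j (i.φ.w 0)) 0 :=
  lim_of_norm hd fun _ _ hi => ⟨hi.mem.w 0, norm_w_le hi 0⟩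

lemma lim_dw (p : Fin 2) (j : Fin m) : Lim (small m ρ R d) R (fun i => pd j (i.φ.w p)) 0 := by
  fin_cases p
  · exact (lim_w₁ hd).2 j
  · exact (lim₁_w₂ hd).2 j

lemma lim₁_W (a b : Fin 2) :
    Lim₁ (small m ρ R d) R (fun i ξ => i.φ.W ξ a b) ((1 : Matrix (Fin 2) (Fin 2) ℂ) a b) := by
  have h11 : Lim₁ (small m ρ R d) R (fun i => i.φ.W₁₁) 1 := lim₁_of_norm hd fun _ _ hi =>
    ⟨hi.mem.W₁₁, le_trans (le_sup_of_le_left (le_sup_of_le_left le_sup_right)) hi.norm⟩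
  have h12 : Lim₁ (small m ρ R d) R (fun i => i.φ.W₁₂) 0 := lim₁_of_norm hd fun _ _ hi =>
    ⟨hi.mem.W₁₂, le_trans (le_sup_of_le_left le_sup_right) hi.norm⟩
  have h21 : Lim₁ (small m ρ R d) R (fun i => i.φ.W₂₁) 0 := lim₁_of_norm hd fun _ _ hi =>
    ⟨hi.mem.W₂₁, le_trans le_sup_right hi.norm⟩
  fin_cases a <;> fin_cases b
  · exact h11
  · exact h12
  · exact h21
  · have := ((Lim₁.const (l := small m ρ R d) (R := R) 1).add (h12.mul h21)).mul (h11.inv one_ne_zero)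
    simp only [mul_zero, add_zero, inv_one, mul_one] at this
    exact this

lemma mlim_W : MLim (small m ρ R d) R (fun i ξ => i.φ.W ξ) 1 := fun a b => (lim₁_W hd a b).1

lemma mlim_one_add_jacU : MLim (small m ρ R d) R (fun i ξ => 1 + i.φ.jacU ξ) 1 := by
  have h : MLim (small m ρ R d) R (fun i ξ => i.φ.jacU ξ) 0 := fun a b => (lim₁_u hd a).2 b
  simpa using (MLim.const (l := small m ρ R d) (R := R) (1 : Matrix (Fin m) (Fin m) ℂ)).add h

lemma mlim_V : MLim (small m ρ R d) R (fun i ξ => i.φ.V ξ) 1 := by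
  have := ((mlim_one_add_jacU (m := m) (ρ := ρ) (R := R) hd).inv (by simp)).transpose
  rw [inv_one, Matrix.transpose_one] at this
  exact this

lemma lim_v (j : Fin m) : Lim (small m ρ R d) R (fun i ξ => i.φ.v ξ j) 0 := by
  have h := (lim_β (m := m) (ρ := ρ) (R := R) (d := d) j).add (Lim.sum Finset.univ fun k _ => (mlim_V hd j k).mul
    (((lim₁_φ₀ hd).2 k).sub ((lim₁_w₂ hd).1.mul (lim_dw hd 0 k))))
  simpa [Coord.v, Matrix.mulVec, dotProduct] using h

lemma mlim_Lam : MLim (small m ρ R d) R (fun i ξ => i.φ.Lam ξ) 0 := by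
  have h : MLim (small m ρ R d) R
      (fun i ξ => (Matrix.of fun k p => pd k (i.φ.w p) ξ : Matrix (Fin m) (Fin 2) ℂ)) 0 :=
    fun k p => lim_dw hd p k
  simpa [Coord.Lam] using ((((mlim_V hd).mul h).mul (MLim.const J)).mul (mlim_W hd)).neg

lemma mlim_R (j : Fin m) : MLim (small m ρ R d) R (fun i ξ => i.φ.R j ξ) 0 := by
  have h : ∀ k, MLim (small m ρ R d) R
      (fun i ξ => (Matrix.of fun a b => pd k (fun η => i.φ.W η b a) ξ : Matrix (Fin 2) (Fin 2) ℂ)) 0 :=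
    fun k a b => (lim₁_W hd b a).2 k
  simpa [Coord.R] using (MLim.sum Finset.univ fun k _ =>
    MLim.smul (mlim_V hd j k) (((h k).mul (MLim.const J)).mul (mlim_W hd))).neg

/-- Eventually the matrix `W` has determinant one, and `1 + u'` is invertible. -/
lemma eventually_W₁₁_ne : ∀ᶠ i in small m ρ R d, ∀ ξ ∈ openStrip m R, i.φ.W₁₁ ξ ≠ 0 ∧
    (1 + i.φ.jacU ξ).det ≠ 0 := by
  filter_upwards [(lim₁_W (m := m) (ρ := ρ) (R := R) hd 0 0).1.ne_zero (by simp),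
    (mlim_one_add_jacU (m := m) (ρ := ρ) (R := R) hd).det.ne_zero (by simp)] with i h1 h2 ξ hξ
  have h3 := h1 ξ hξ
  have h4 := h2 ξ hξ
  simp only [Matrix.one_apply_eq, Matrix.det_one, norm_one] at h3 h4
  exact ⟨norm_pos_iff.mp (lt_of_lt_of_le (by norm_num) h3), norm_pos_iff.mp (lt_of_lt_of_le (by norm_num) h4)⟩

end Coords

end LowDimTori

end

noncomputable section

namespace LowDimTori

open MeasureTheory Set Filter Topology

variable {m : ℕ}

/-! ## Derivatives of the Hamiltonian along the embedded torus -/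

/-- A neighbourhood of the unperturbed tori in the phase space. -/
def dom (m : ℕ) (ρ a : ℝ) : Set (Phase m) :=
  {P | (∀ j, |(P.1 j).im| < ρ + a) ∧ |(P.2.2 0).im| < ρ + a ∧ (∀ i, ‖P.2.1 i‖ < a) ∧ ‖P.2.2 1‖ < a}

lemma isOpen_dom (ρ a : ℝ) : IsOpen (dom m ρ a) := by
  have : dom m ρ a = (⋂ j, {P : Phase m | |(P.1 j).im| < ρ + a}) ∩ ({P | |(P.2.2 0).im| < ρ + a} ∩
      ((⋂ i, {P : Phase m | ‖P.2.1 i‖ < a}) ∩ {P | ‖P.2.2 1‖ < a})) := by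
    ext P; simp [dom]
  rw [this]
  refine (isOpen_iInter_of_finite fun j => isOpen_lt ?_ continuous_const).inter
    ((isOpen_lt ?_ continuous_const).inter
      ((isOpen_iInter_of_finite fun i => isOpen_lt ?_ continuous_const).inter
        (isOpen_lt ?_ continuous_const))) <;> fun_prop

lemma add_smul_mem_dom {ρ a s : ℝ} {P e : Phase m} (hP : P ∈ dom m ρ a) (he : ‖e‖ ≤ 1) {t : ℂ}
    (ht : ‖t‖ ≤ s) : P + t • e ∈ dom m ρ (a + s) := by
  have n1 : ∀ j, ‖t * e.1 j‖ ≤ s := fun j => by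
    rw [norm_mul]
    have : ‖e.1 j‖ ≤ 1 := (norm_le_pi_norm e.1 j).trans ((norm_fst_le e).trans he)
    nlinarith [norm_nonneg t, norm_nonneg (e.1 j)]
  have n2 : ∀ j, ‖t * e.2.1 j‖ ≤ s := fun j => by
    rw [norm_mul]
    have : ‖e.2.1 j‖ ≤ 1 :=
      (norm_le_pi_norm e.2.1 j).trans ((norm_fst_le e.2).trans ((norm_snd_le e).trans he))
    nlinarith [norm_nonneg t, norm_nonneg (e.2.1 j)]
  have n3 : ∀ j, ‖t * e.2.2 j‖ ≤ s := fun j => by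
    rw [norm_mul]
    have : ‖e.2.2 j‖ ≤ 1 :=
      (norm_le_pi_norm e.2.2 j).trans ((norm_snd_le e.2).trans ((norm_snd_le e).trans he))
    nlinarith [norm_nonneg t, norm_nonneg (e.2.2 j)]
  refine ⟨fun j => ?_, ?_, fun i => ?_, ?_⟩
  · have h1 := (Complex.abs_im_le_norm _).trans (n1 j)
    have h2 : ((P + t • e).1 j).im = (P.1 j).im + (t * e.1 j).im := rfl
    rw [h2]
    linarith [abs_add_le (P.1 j).im (t * e.1 j).im, hP.1 j]
  · have h1 := (Complex.abs_im_le_norm _).trans (n3 0)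
    have h2 : ((P + t • e).2.2 0).im = (P.2.2 0).im + (t * e.2.2 0).im := rfl
    rw [h2]
    linarith [abs_add_le (P.2.2 0).im (t * e.2.2 0).im, hP.2.1]
  · have h2 : (P + t • e).2.1 i = P.2.1 i + t * e.2.1 i := rfl
    rw [h2]
    linarith [norm_add_le (P.2.1 i) (t * e.2.1 i), hP.2.2.1 i, n2 i]
  · have h2 : (P + t • e).2.2 1 = P.2.2 1 + t * e.2.2 1 := rfl
    rw [h2]
    linarith [norm_add_le (P.2.2 1) (t * e.2.2 1), hP.2.2.2, n3 1]

lemma norm_eY_le (i : Fin m) : ‖(eY i : Phase m)‖ ≤ 1 := by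
  simp only [eY, Prod.norm_def, norm_zero, Pi.norm_single, norm_one]
  simp

lemma norm_eZ_le (p : Fin 2) : ‖(eZ p : Phase m)‖ ≤ 1 := by
  simp only [eZ, Prod.norm_def, norm_zero, Pi.norm_single, norm_one]
  simp

/-- Bounded analytic functions on `dom`, periodic in `x`. -/
structure JD (ρ a : ℝ) (G : Phase m → ℂ) : Prop where
  analytic : AnalyticOnNhd ℂ G (dom m ρ a)
  bounded : ∃ c, ∀ P ∈ dom m ρ a, ‖G P‖ ≤ c
  periodic : ∀ P ∈ dom m ρ a, ∀ j, G (P.1 + Pi.single j ((2 * Real.pi : ℝ) : ℂ), P.2) = G P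

lemma dom_mono {ρ a b : ℝ} (h : a ≤ b) : dom m ρ a ⊆ dom m ρ b := fun _ hP =>
  ⟨fun j => (hP.1 j).trans_le (by linarith), hP.2.1.trans_le (by linarith),
    fun i => (hP.2.2.1 i).trans_le h, hP.2.2.2.trans_le h⟩

lemma JD.phD_eq {ρ a : ℝ} {G : Phase m → ℂ} (hG : JD ρ a G) (e : Phase m) {P : Phase m}
    (hP : P ∈ dom m ρ a) : phD G e P = fderiv ℂ G P e :=
  (hG.analytic P hP).differentiableAt.lineDeriv_eq_fderiv

/-- The bound is the Cauchy estimate on the disc of radius a/2 in direction e. Halving a is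
harmless, since only finitely many derivatives are taken: three at most, in the coefficients E and
K. -/
lemma JD.phD {ρ a : ℝ} (ha : 0 < a) {G : Phase m → ℂ} (hG : JD ρ a G) {e : Phase m} (he : ‖e‖ ≤ 1) :
    JD ρ (a / 2) (phD G e) := by
  have hsub : dom m ρ (a / 2) ⊆ dom m ρ a := dom_mono (by linarith)
  obtain ⟨c, hc⟩ := hG.bounded
  have hmem : ∀ P ∈ dom m ρ (a / 2), ∀ t : ℂ, ‖t‖ ≤ a / 2 → P + t • e ∈ dom m ρ a := fun P hP t ht => by
    have := add_smul_mem_dom hP he ht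
    rwa [add_halves] at this
  refine ⟨?_, ⟨c / (a / 2), fun P hP => ?_⟩, fun P hP j => ?_⟩
  · have h1 : AnalyticOnNhd ℂ (fun P => fderiv ℂ G P e) (dom m ρ (a / 2)) :=
      (ContinuousLinearMap.apply ℂ ℂ e).comp_analyticOnNhd (hG.analytic.fderiv.mono hsub)
    exact h1.congr (isOpen_dom ρ _) fun P hP => (hG.phD_eq e (hsub hP)).symm
  · refine Complex.norm_deriv_le_of_forall_mem_sphere_norm_le (f := fun t : ℂ => G (P + t • e))
      (c := 0) (by positivity) ?_ fun t ht => ?_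
    · refine DifferentiableOn.diffContOnCl fun t ht => ?_
      have ht : ‖t‖ ≤ a / 2 := by
        have := Metric.closure_ball_subset_closedBall ht
        simpa using this
      have h1 : DifferentiableAt ℂ (fun t : ℂ => P + t • e) t := by fun_prop
      exact ((hG.analytic _ (hmem P hP t ht)).differentiableAt.comp t h1).differentiableWithinAt
    · exact hc _ (hmem P hP t (by simpa using (mem_sphere_iff_norm.mp ht).le))
  · refine Filter.EventuallyEq.deriv_eq ?_
    have : ∀ᶠ t : ℂ in 𝓝 0, ‖t‖ < a / 2 := by
      have := Metric.ball_mem_nhds (0 : ℂ) (by positivity : 0 < a / 2)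
      filter_upwards [this] with t ht using by simpa using ht
    filter_upwards [this] with t ht
    have h1 := hG.periodic _ (hmem P hP t ht.le) j
    rw [← h1]
    congr 1
    refine Prod.ext ?_ rfl
    simp only [Prod.fst_add]
    abel

/-- The family `G ε` is an `O(ε)` perturbation of the function `G₀` of `y` and `z₂`. -/
def Jet (ρ : ℝ) (G : ℝ → Phase m → ℂ) (G₀ : Phase m → ℂ) : Prop :=
  ∃ a > 0, ∃ G₁, JD ρ a G₀ ∧ JD ρ a G₁ ∧
    -- Independence of x and z₁ is what makes limits uniform although Re α is unbounded.
    (∀ P ∈ dom m ρ a, ∀ Q ∈ dom m ρ a, P.2.1 = Q.2.1 → P.2.2 1 = Q.2.2 1 → G₀ P = G₀ Q) ∧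
    ∀ ε, ∀ P ∈ dom m ρ a, G ε P = G₀ P + (ε : ℂ) * G₁ P

lemma Jet.phD {ρ : ℝ} {G : ℝ → Phase m → ℂ} {G₀ : Phase m → ℂ} (h : Jet ρ G G₀) {e : Phase m}
    (he : ‖e‖ ≤ 1) : Jet ρ (fun ε => phD (G ε) e) (phD G₀ e) := by
  obtain ⟨a, ha, G₁, h0, h1, h2, h3⟩ := h
  have hsub : dom m ρ (a / 2) ⊆ dom m ρ a := dom_mono (by linarith)
  refine ⟨a / 2, by positivity, LowDimTori.phD G₁ e, h0.phD ha he, h1.phD ha he,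
    fun P hP Q hQ e1 e2 => ?_, fun ε P hP => ?_⟩
  · refine Filter.EventuallyEq.deriv_eq ?_
    have : ∀ᶠ t : ℂ in 𝓝 0, ‖t‖ < a / 2 := by
      have := Metric.ball_mem_nhds (0 : ℂ) (by positivity : 0 < a / 2)
      filter_upwards [this] with t ht using by simpa using ht
    filter_upwards [this] with t ht
    have hP' := add_smul_mem_dom hP he ht.le
    have hQ' := add_smul_mem_dom hQ he ht.le
    rw [add_halves] at hP' hQ'
    refine h2 _ hP' _ hQ' ?_ ?_
    · simp only [Prod.snd_add, Prod.fst_add, e1]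
    · simp only [Prod.snd_add, Pi.add_apply, e2]
  · have d0 := (h0.analytic P (hsub hP)).differentiableAt.hasFDerivAt
    have d1 := (h1.analytic P (hsub hP)).differentiableAt.hasFDerivAt
    have d : HasFDerivAt (G ε) (fderiv ℂ G₀ P + (ε : ℂ) • fderiv ℂ G₁ P) P := by
      refine (d0.add (d1.const_mul (ε : ℂ))).congr_of_eventuallyEq ?_
      filter_upwards [(isOpen_dom ρ a).mem_nhds (hsub hP)] with Q hQ using h3 ε Q hQ
    rw [h0.phD_eq e (hsub hP), h1.phD_eq e (hsub hP)]
    exact (d.hasLineDerivAt e).lineDeriv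

/-- Hessians are symmetric. -/
lemma Jet.phD_comm {ρ : ℝ} {G : ℝ → Phase m → ℂ} {G₀ : Phase m → ℂ} (h : Jet ρ G G₀) :
    ∃ a > 0, ∀ ε, ∀ P ∈ dom m ρ a, ∀ e e', LowDimTori.phD (LowDimTori.phD (G ε) e) e' P
      = LowDimTori.phD (LowDimTori.phD (G ε) e') e P := by
  obtain ⟨a, ha, G₁, h0, h1, h2, h3⟩ := h
  refine ⟨a, ha, fun ε P hP => ?_⟩
  have hA : AnalyticOnNhd ℂ (G ε) (dom m ρ a) :=
    (h0.analytic.add ((analyticOnNhd_const (v := (ε : ℂ))).mul h1.analytic)).congr (isOpen_dom ρ a)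
      fun P hP => (h3 ε P hP).symm
  have hs : IsSymmSndFDerivAt ℂ (G ε) P := (hA P hP).contDiffAt.isSymmSndFDerivAt (n := 2) (by simp)
  have key : ∀ e e', LowDimTori.phD (LowDimTori.phD (G ε) e) e' P = fderiv ℂ (fderiv ℂ (G ε)) P e' e := by
    intro e e'
    have hd := (hA.fderiv P hP).differentiableAt.hasFDerivAt
    have h4 : HasFDerivAt (fun Q => fderiv ℂ (G ε) Q e)
        ((ContinuousLinearMap.apply ℂ ℂ e).comp (fderiv ℂ (fderiv ℂ (G ε)) P)) P :=
      (ContinuousLinearMap.apply ℂ ℂ e).hasFDerivAt.comp P hd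
    have h5 : HasFDerivAt (LowDimTori.phD (G ε) e)
        ((ContinuousLinearMap.apply ℂ ℂ e).comp (fderiv ℂ (fderiv ℂ (G ε)) P)) P := by
      refine h4.congr_of_eventuallyEq ?_
      filter_upwards [(isOpen_dom ρ a).mem_nhds hP] with Q hQ
      exact (hA Q hQ).differentiableAt.lineDeriv_eq_fderiv
    exact (h5.hasLineDerivAt e').lineDeriv
  intro e e'
  rw [key, key]
  exact hs.eq e' e

section Point

variable {ρ R : ℝ} {d : ℕ}

/-- Close to the unperturbed torus the embedding is periodic, holomorphic and takes values in
`dom`. -/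
structure Coord.PointOk (φ : Coord m) (ρ R a : ℝ) : Prop where
  mem : ∀ ξ ∈ openStrip m R, φ.point ξ ∈ dom m ρ a
  diff : DifferentiableOn ℂ φ.point (openStrip m R)
  periodic : ∀ ξ ∈ openStrip m R, ∀ j, φ.point (ξ + Pi.single j ((2 * Real.pi : ℝ) : ℂ)) =
    ((φ.point ξ).1 + Pi.single j ((2 * Real.pi : ℝ) : ℂ), (φ.point ξ).2)

lemma eventually_pointOk (hd : 1 ≤ d) (hR : R ≤ ρ) {a : ℝ} (ha : 0 < a) :
    ∀ᶠ i in small m ρ R d, i.φ.PointOk ρ R a ∧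
      ∀ ξ ∈ openStrip m R, (∀ j, ‖i.φ.v ξ j‖ < a) ∧ ‖i.φ.w 1 ξ‖ < a := by
  have ha2 : 0 < a / 2 := by positivity
  have hu : ∀ᶠ i in small m ρ R d, ∀ j, HPB R (fun ξ => i.φ.u j ξ - 0) (a / 2) :=
    eventually_all.mpr fun j => (lim₁_u hd j).1 _ ha2
  have hv : ∀ᶠ i in small m ρ R d, ∀ j, HPB R (fun ξ => i.φ.v ξ j - 0) (a / 2) :=
    eventually_all.mpr fun j => lim_v hd j _ ha2
  have hα : ∀ᶠ i in small m ρ R d, |i.α.im| ≤ ρ := ⟨1, one_pos, fun i hi => hi.α⟩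
  filter_upwards [hu, hv, (lim_w₁ hd).1 _ ha2, (lim₁_w₂ hd).1 _ ha2, hα] with i hu hv hw hw₂ hα
  simp only [sub_zero] at hu hv hw hw₂
  have hw' : HPB R (i.φ.w 0) (a / 2 + ‖i.α‖) := (hw.add (HPB.const i.α)).congr fun ξ _ => by ring
  refine ⟨⟨fun ξ hξ => ⟨fun j => ?_, ?_, fun j => ?_, ?_⟩, ?_, fun ξ hξ j => ?_⟩, fun ξ hξ =>
    ⟨fun j => ((hv j).bound ξ hξ).trans_lt (by linarith), (hw₂.bound ξ hξ).trans_lt (by linarith)⟩⟩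
  · have h1 := (Complex.abs_im_le_norm _).trans ((hu j).bound ξ hξ)
    have h2 : ((i.φ.point ξ).1 j).im = (ξ j).im + (i.φ.u j ξ).im := rfl
    rw [h2]
    linarith [abs_add_le (ξ j).im (i.φ.u j ξ).im, hξ j]
  · have h1 := (Complex.abs_im_le_norm _).trans (hw.bound ξ hξ)
    have h2 : ((i.φ.point ξ).2.2 0).im = i.α.im + (i.φ.w 0 ξ - i.α).im := by simp [Coord.point]
    rw [h2]
    linarith [abs_add_le i.α.im (i.φ.w 0 ξ - i.α).im]
  · exact ((hv j).bound ξ hξ).trans_lt (by linarith)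
  · exact (hw₂.bound ξ hξ).trans_lt (by linarith)
  · refine DifferentiableOn.prodMk ?_ (DifferentiableOn.prodMk ?_ ?_)
    · rw [differentiableOn_pi]
      exact fun j => DifferentiableOn.add (by fun_prop) (hu j).diff
    · rw [differentiableOn_pi]
      exact fun j => (hv j).diff
    · rw [differentiableOn_pi]
      intro p
      fin_cases p
      · exact hw'.diff
      · exact hw₂.diff
  · refine Prod.ext ?_ (Prod.ext ?_ ?_)
    · funext k
      simp only [Coord.point, Pi.add_apply, (hu k).periodic ξ hξ j]; ring
    · funext k
      exact (hv k).periodic ξ hξ j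
    · funext p
      fin_cases p
      · exact hw'.periodic ξ hξ j
      · exact hw₂.periodic ξ hξ j

lemma JD.hpb_comp {a : ℝ} {G : Phase m → ℂ} (hG : JD ρ a G) {φ : Coord m} (hφ : φ.PointOk ρ R a) {c : ℝ}
    (hc : ∀ P ∈ dom m ρ a, ‖G P‖ ≤ c) : HPB R (fun ξ => G (φ.point ξ)) c :=
  ⟨fun ξ hξ j => by rw [hφ.periodic ξ hξ, hG.periodic _ (hφ.mem ξ hξ)],
    hG.analytic.differentiableOn.comp hφ.diff hφ.mem, fun ξ hξ => hc _ (hφ.mem ξ hξ)⟩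

/-- The perturbation is ε times a bounded function. The function G₀ sees only (y, z₂) = (v, w₂),
which tends to 0, so its value may be computed at a point with x = z₁ = 0 and continuity at the
origin suffices. -/
lemma Jet.lim (hd : 1 ≤ d) (hρ : 0 ≤ ρ) (hR : R ≤ ρ) {G : ℝ → Phase m → ℂ} {G₀ : Phase m → ℂ} (h : Jet ρ G G₀) :
    Lim (small m ρ R d) R (fun i ξ => G i.ε (i.φ.point ξ)) (G₀ 0) := by
  obtain ⟨a, ha, G₁, h0, h1, h2, h3⟩ := h
  obtain ⟨c₀, hc₀⟩ := h0.bounded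
  obtain ⟨c₁, hc₁⟩ := h1.bounded
  have z : ∀ b > 0, (0 : Phase m) ∈ dom m ρ b := fun b hb =>
    ⟨fun j => by simp; linarith, by simp; linarith, fun i => by simpa using hb, by simpa using hb⟩
  have l0 : Lim (small m ρ R d) R (fun i ξ => G₀ (i.φ.point ξ)) (G₀ 0) := by
    intro η hη
    have hcont := (h0.analytic 0 (z a ha)).continuousAt
    obtain ⟨δ, hδ, hb⟩ := Metric.continuousAt_iff.mp hcont η hη
    have hmin : 0 < min a δ := lt_min ha hδ
    filter_upwards [eventually_pointOk hd hR hmin, eventually_pointOk hd hR ha] with i hi hi'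
    refine ((h0.hpb_comp hi'.1 hc₀).sub (HPB.const (G₀ 0))).of_bound fun ξ hξ => ?_
    obtain ⟨b1, b2⟩ := hi.2 ξ hξ
    let Q : Phase m := (0, i.φ.v ξ, ![0, i.φ.w 1 ξ])
    have hQ : Q ∈ dom m ρ a := ⟨fun j => by simp [Q]; linarith, by simp [Q]; linarith,
      fun j => (b1 j).trans_le (min_le_left _ _), b2.trans_le (min_le_left _ _)⟩
    rw [h2 _ (hi'.1.mem ξ hξ) Q hQ rfl rfl, ← dist_eq_norm]
    refine (hb ?_).le
    rw [dist_zero_right]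
    refine max_lt (by simpa [Q] using hδ) (max_lt ?_ ?_)
    · exact (pi_norm_lt_iff hδ).mpr fun j => (b1 j).trans_le (min_le_right _ _)
    · refine (pi_norm_lt_iff hδ).mpr fun p => ?_
      fin_cases p
      · simpa [Q] using hδ
      · exact b2.trans_le (min_le_right _ _)
  have l1 : Lim (small m ρ R d) R (fun i ξ => (i.ε : ℂ) * G₁ (i.φ.point ξ)) 0 := by
    intro η hη
    have hc : 0 ≤ c₁ := (norm_nonneg _).trans (hc₁ _ (z a ha))
    have hε : ∀ᶠ i in small m ρ R d, |i.ε| ≤ η / (c₁ + 1) :=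
      ⟨η / (c₁ + 1), by positivity, fun i hi => hi.ε⟩
    filter_upwards [hε, eventually_pointOk hd hR ha] with i hi hi'
    refine (((h1.hpb_comp hi'.1 hc₁).const_mul (i.ε : ℂ)).mono_bound ?_).congr fun ξ _ => sub_zero _
    rw [Complex.norm_real, Real.norm_eq_abs]
    rw [le_div_iff₀ (by positivity)] at hi
    nlinarith [abs_nonneg i.ε]
  have := l0.add l1
  rw [add_zero] at this
  refine this.congr ?_
  filter_upwards [eventually_pointOk hd hR ha] with i hi ξ hξ
  exact h3 _ _ (hi.1.mem ξ hξ)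

end Point

/-- The projection to the variables `(y, z₂)`. -/
def projYZ : Phase m →L[ℂ] (Fin m → ℂ) × ℂ :=
  ((ContinuousLinearMap.fst ℂ _ _).comp (ContinuousLinearMap.snd ℂ _ _)).prod
    ((ContinuousLinearMap.proj 1).comp ((ContinuousLinearMap.snd ℂ _ _).comp (ContinuousLinearMap.snd ℂ _ _)))

lemma phD_comp_projYZ (f : (Fin m → ℂ) × ℂ → ℂ) (e : Phase m) :
    phD (fun P => f (projYZ P)) e = fun P => lineDeriv ℂ f (projYZ P) (projYZ e) := by
  funext P
  simp only [phD, lineDeriv, map_add, map_smul]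

lemma CondH1.jet {ρ : ℝ} (hρ : 0 < ρ) {H₀ : (Fin m → ℂ) × ℂ → ℂ} {H₁ : Phase m → ℂ}
    (h : CondH1 ρ H₀ H₁) : Jet ρ (hamiltonian H₀ H₁) (fun P => H₀ (projYZ P)) := by
  obtain ⟨c, hc₀, hc₁⟩ := h.bounded
  -- With m + 1 coordinates below ρ/(m + 1), the Euclidean norm in `ballB` stays below ρ.
  have ha : 0 < ρ / (m + 1) := by positivity
  have ha' : ρ / (m + 1) ≤ ρ := div_le_self hρ.le (by linarith [(Nat.cast_nonneg m : (0 : ℝ) ≤ m)])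
  have hball : ∀ P ∈ dom m ρ (ρ / (m + 1)), projYZ P ∈ ballB m (3 * ρ) := by
    intro P hP
    refine ⟨?_, fun i => ?_, ?_⟩
    · have h1 : ∀ i, (P.2.1 i).re ^ 2 ≤ (ρ / (m + 1)) ^ 2 := fun i => by
        rw [← sq_abs]
        exact pow_le_pow_left₀ (abs_nonneg _) ((Complex.abs_re_le_norm _).trans (hP.2.2.1 i).le) 2
      have h2 : (P.2.2 1).re ^ 2 ≤ (ρ / (m + 1)) ^ 2 := by
        rw [← sq_abs]
        exact pow_le_pow_left₀ (abs_nonneg _) ((Complex.abs_re_le_norm _).trans hP.2.2.2.le) 2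
      have h3 : (∑ i, (P.2.1 i).re ^ 2) ≤ m * (ρ / (m + 1)) ^ 2 :=
        (Finset.sum_le_card_nsmul _ _ _ fun i _ => h1 i).trans (by simp)
      refine Real.sqrt_le_iff.mpr ⟨by positivity, ?_⟩
      have h4 : (m + 1 : ℝ) * (ρ / (m + 1)) ^ 2 ≤ ρ * ρ := by
        calc (m + 1 : ℝ) * (ρ / (m + 1)) ^ 2 = ρ * (ρ / (m + 1)) := by field_simp
          _ ≤ ρ * ρ := mul_le_mul_of_nonneg_left ha' hρ.le
      change (∑ i, (P.2.1 i).re ^ 2) + (P.2.2 1).re ^ 2 ≤ _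
      nlinarith
    · exact (Complex.abs_im_le_norm _).trans ((hP.2.2.1 i).le.trans (by linarith))
    · exact (Complex.abs_im_le_norm _).trans (hP.2.2.2.le.trans (by linarith))
  have hph : dom m ρ (ρ / (m + 1)) ⊆ phaseDomain m (3 * ρ) := fun P hP =>
    ⟨fun j => (hP.1 j).le.trans (by linarith), hP.2.1.le.trans (by linarith), hball P hP⟩
  refine ⟨ρ / (m + 1), ha, H₁, ⟨?_, ⟨c, fun P hP => hc₀ _ (hball P hP)⟩, fun P hP j => rfl⟩,
    ⟨h.analytic₁.mono hph, ⟨c, fun P hP => hc₁ _ (hph hP)⟩, fun P hP => h.periodic_x P (hph hP)⟩,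
    fun P _ Q _ e1 e2 => congrArg H₀ (Prod.ext e1 e2), fun ε P _ => rfl⟩
  exact h.analytic₀.comp (projYZ.analyticOnNhd _) hball

end LowDimTori

end

noncomputable section

namespace LowDimTori

open MeasureTheory Set Filter Topology

variable {m : ℕ}

/-! ## The coefficients of the linear problem -/

/-- The linear problem with the coefficients generated by a Hamiltonian and a coordinate vector. -/
def linOf (H : Phase m → ℂ) (φ : Coord m) (α : ℂ) : Lin m where
  T := fun p j ξ => coefT H φ ξ p j
  S := fun i j ξ => coefS H φ ξ i j
  -- The two vectors list the row and the column of the entries 11, 12, 22.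
  U := fun i j c ξ => coefU H φ ξ i j (![0, 0, 1] c) (![0, 1, 1] c)
  E := fun i c ξ => coefE H φ ξ i (![0, 0, 1] c) (![0, 1, 1] c)
  K := fun i c ξ => coefK H φ ξ i (![0, 0, 1] c) (![0, 1, 1] c)
  W := fun p ξ => φ.W ξ 0 p
  w := fun ξ => φ.w 0 ξ - α
  w₂ := φ.w 1
  u := φ.u

lemma pd_sub_const (f : CFun m) (c : ℂ) (j : Fin m) : pd j (fun ξ => f ξ - c) = pd j f := by
  funext ξ
  simp [pd, lineDeriv]

lemma Lim.eventually_bound {I : Type} {l : Filter I} {R : ℝ} {f : I → CFun m} {c : ℂ} (h : Lim l R f c) :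
    ∀ᶠ C in atTop, ∀ᶠ i in l, HPB R (f i) C := by
  filter_upwards [eventually_ge_atTop (‖c‖ + 1)] with C hC
  filter_upwards [h.hpb one_pos] with i hi
  exact hi.mono_bound hC

section Coefs

variable {ρ R : ℝ} {d : ℕ} (hd : 1 ≤ d) (hρ : 0 ≤ ρ) (hR : R ≤ ρ)
include hd hρ hR

section Jets

variable {G : ℝ → Phase m → ℂ} {G₀ : Phase m → ℂ} (h : Jet ρ G G₀)
include h

lemma Jet.mlim_YY : MLim (small m ρ R d) R (fun i ξ => hessYY (G i.ε) (i.φ.point ξ)) (hessYY G₀ 0) :=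
  fun i j => ((h.phD (norm_eY_le j)).phD (norm_eY_le i)).lim hd hρ hR

lemma Jet.mlim_ZY : MLim (small m ρ R d) R (fun i ξ => hessZY (G i.ε) (i.φ.point ξ)) (hessZY G₀ 0) :=
  fun i j => ((h.phD (norm_eY_le j)).phD (norm_eZ_le i)).lim hd hρ hR

lemma Jet.mlim_ZZ : MLim (small m ρ R d) R (fun i ξ => hessZZ (G i.ε) (i.φ.point ξ)) (hessZZ G₀ 0) :=
  fun i j => ((h.phD (norm_eZ_le j)).phD (norm_eZ_le i)).lim hd hρ hR

/-- The value of the limit is irrelevant: U, E and K only need to be bounded, and convergence gives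
that. -/
lemma Jet.mlim_quadForm : ∃ c, MLim (small m ρ R d) R (fun i ξ => quadForm i.φ ξ (G i.ε)) c := by
  have W := mlim_W (m := m) (ρ := ρ) (R := R) hd
  have Λ := mlim_Lam (m := m) (ρ := ρ) (R := R) hd
  have ZY := (W.transpose.mul (h.mlim_ZY hd hρ hR)).mul Λ
  exact ⟨_, ((((MLim.sum Finset.univ fun j _ => MLim.smul ((h.phD (norm_eY_le j)).lim hd hρ hR)
    (mlim_R hd j)).add ((Λ.transpose.mul (h.mlim_YY hd hρ hR)).mul Λ)).add ZY).add ZY.transpose).add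
    ((W.transpose.mul (h.mlim_ZZ hd hρ hR)).mul W)⟩

lemma Jet.mlim_coefS : MLim (small m ρ R d) R (fun i ξ => coefS (G i.ε) i.φ ξ) (hessYY G₀ 0) := by
  have V := mlim_V (m := m) (ρ := ρ) (R := R) hd
  have := (V.transpose.mul (h.mlim_YY hd hρ hR)).mul V
  rwa [Matrix.transpose_one, one_mul, mul_one] at this

lemma Jet.mlim_coefZ : MLim (small m ρ R d) R (fun i ξ => coefZ (G i.ε) i.φ ξ) (hessZY G₀ 0) := by
  have := ((mlim_W hd).transpose.mul (h.mlim_ZY hd hρ hR)).add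
    ((mlim_Lam hd).transpose.mul (h.mlim_YY hd hρ hR))
  rwa [Matrix.transpose_one, Matrix.one_mul, Matrix.transpose_zero, Matrix.zero_mul, add_zero] at this

lemma Jet.mlim_coefT : MLim (small m ρ R d) R (fun i ξ => coefT (G i.ε) i.φ ξ) (hessZY G₀ 0) := by
  have := (h.mlim_coefZ hd hρ hR).mul (mlim_V hd)
  rwa [Matrix.mul_one] at this

lemma Jet.mlim_coefU (i : Fin 2) (j : Fin m) :
    ∃ c, MLim (small m ρ R d) R (fun x ξ => coefU (G x.ε) x.φ ξ i j) c := by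
  have : MLim (small m ρ R d) R (fun x ξ => (Matrix.of fun a b => coefT (G x.ε) x.φ ξ a j * J b i :
      Matrix (Fin 2) (Fin 2) ℂ)) (Matrix.of fun a b => hessZY G₀ 0 a j * J b i) :=
    fun a b => (h.mlim_coefT hd hρ hR a j).mul (Lim.const _)
  exact ⟨_, this.add this.transpose⟩

lemma Jet.mlim_coefE (i : Fin m) :
    ∃ c, MLim (small m ρ R d) R (fun x ξ => coefE (G x.ε) x.φ ξ i) c := by
  choose c hc using fun l => (h.phD (norm_eY_le l)).mlim_quadForm hd hρ hR
  exact ⟨_, MLim.sum Finset.univ fun l _ => MLim.smul (mlim_V hd l i) (hc l)⟩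

lemma Jet.mlim_coefK (i : Fin 2) :
    ∃ c, MLim (small m ρ R d) R (fun x ξ => coefK (G x.ε) x.φ ξ i) c := by
  choose c hc using fun l => (h.phD (norm_eY_le l)).mlim_quadForm hd hρ hR
  choose c' hc' using fun l => (h.phD (norm_eZ_le l)).mlim_quadForm hd hρ hR
  have hr : MLim (small m ρ R d) R (fun x ξ => (Matrix.of fun l q => x.φ.R l ξ i q :
      Matrix (Fin m) (Fin 2) ℂ)) 0 := fun l q => mlim_R hd l i q
  have h1 := (h.mlim_coefZ hd hρ hR).mul hr
  exact ⟨_, ((h1.add h1.transpose).add (MLim.sum Finset.univ fun l _ =>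
    MLim.smul (mlim_Lam hd l i) (hc l))).add (MLim.sum Finset.univ fun p _ =>
      MLim.smul (mlim_W hd p i) (hc' p))⟩

end Jets

/-- The bounds for the coefficients, for parameters close to the unperturbed ones. -/
lemma Jet.eventually_bd {G : ℝ → Phase m → ℂ} {G₀ : Phase m → ℂ} (h : Jet ρ G G₀) :
    ∃ C, 1 ≤ C ∧ ∀ η > 0, ∀ᶠ i in small m ρ R d, ∀ t : Fin m → ℂ, (∀ j, hessZY G₀ 0 0 j = 0) →
      (∀ j, hessZY G₀ 0 1 j = t j) →
      (linOf (G i.ε) i.φ i.α).Bd R C (fun i j => hessYY G₀ 0 i j) t η := by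
  choose cU hU using fun i j => h.mlim_coefU hd hρ hR i j
  choose cE hE using fun i => h.mlim_coefE hd hρ hR i
  choose cK hK using fun i => h.mlim_coefK hd hρ hR i
  have hT := h.mlim_coefT hd hρ hR
  have hS := h.mlim_coefS hd hρ hR
  have bT := eventually_all.mpr fun p => eventually_all.mpr fun j => (hT p j).eventually_bound
  have bS := eventually_all.mpr fun p => eventually_all.mpr fun j => (hS p j).eventually_bound
  have bU := eventually_all.mpr fun i => eventually_all.mpr fun j => eventually_all.mpr fun c : Fin 3 =>
    (hU i j (![0, 0, 1] c) (![0, 1, 1] c)).eventually_bound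
  have bE := eventually_all.mpr fun j => eventually_all.mpr fun c : Fin 3 =>
    (hE j (![0, 0, 1] c) (![0, 1, 1] c)).eventually_bound
  have bK := eventually_all.mpr fun j => eventually_all.mpr fun c : Fin 3 =>
    (hK j (![0, 0, 1] c) (![0, 1, 1] c)).eventually_bound
  have bW := eventually_all.mpr fun p => (mlim_W (m := m) (ρ := ρ) (R := R) hd 0 p).eventually_bound
  have bw := (lim₁_w₂ (m := m) (ρ := ρ) (R := R) hd).1.eventually_bound
  have bu := eventually_all.mpr fun j => (lim₁_u (m := m) (ρ := ρ) (R := R) hd j).1.eventually_bound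
  have bdu := eventually_all.mpr fun i => eventually_all.mpr fun j =>
    ((lim₁_u (m := m) (ρ := ρ) (R := R) hd i).2 j).eventually_bound
  -- C comes from the limits alone and is fixed before η; this order matters because η₀ is later
  -- chosen in terms of C.
  obtain ⟨C, hC, bT, bS, bU, bE, bK, bW, bw, bu, bdu⟩ := ((eventually_ge_atTop (1 : ℝ)).and (bT.and
    (bS.and (bU.and (bE.and (bK.and (bW.and (bw.and (bu.and bdu))))))))).exists
  refine ⟨C, hC, fun η hη => ?_⟩
  have sT := eventually_all.mpr fun p => eventually_all.mpr fun j => hT p j η hη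
  have sS := eventually_all.mpr fun p => eventually_all.mpr fun j => hS p j η hη
  have sW := eventually_all.mpr fun p => mlim_W (m := m) (ρ := ρ) (R := R) hd 0 p η hη
  have sdw := eventually_all.mpr fun j => (lim_w₁ (m := m) (ρ := ρ) (R := R) hd).2 j η hη
  filter_upwards [eventually_all.mpr fun p => eventually_all.mpr fun j => bT p j,
    eventually_all.mpr fun p => eventually_all.mpr fun j => bS p j,
    eventually_all.mpr fun i => eventually_all.mpr fun j => eventually_all.mpr fun c => bU i j c,
    eventually_all.mpr fun i => eventually_all.mpr fun c => bE i c,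
    eventually_all.mpr fun i => eventually_all.mpr fun c => bK i c,
    eventually_all.mpr bW, bw, eventually_all.mpr bu,
    eventually_all.mpr fun i => eventually_all.mpr fun j => bdu i j, sT, sS, sW, sdw,
    (lim_w₁ (m := m) (ρ := ρ) (R := R) hd).1 η hη]
    with i bT bS bU bE bK bW bw bu bdu sT sS sW sdw sw t ht₀ ht₁
  simp only [sub_zero] at sdw sw
  refine ⟨bT, fun j => ?_, fun j => ?_, bS, sS, bU, bE, bK, bW, sW 0, ?_, sw, fun j => ?_, bw, bu, bdu⟩
  · have := sT 0 j
    simp only [ht₀, sub_zero] at this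
    exact this
  · have := sT 1 j
    simp only [ht₁] at this
    exact this
  · have := sW 1
    simp only [ne_eq, zero_ne_one, not_false_eq_true, Matrix.one_apply_ne, sub_zero] at this
    exact this
  · have := sdw j
    simp only [linOf, pd_sub_const]
    exact this

end Coefs

/-- The hypothesis is the derivative of det W in the direction D. It equals, up to sign, the
difference of the off-diagonal entries of DᵀJW. -/
lemma transpose_mul_J_mul_symm {D W : Matrix (Fin 2) (Fin 2) ℂ}
    (h : D 0 0 * W 1 1 + W 0 0 * D 1 1 - (D 0 1 * W 1 0 + W 0 1 * D 1 0) = 0) :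
    (Dᵀ * J * W)ᵀ = Dᵀ * J * W := by
  ext a b
  fin_cases a <;> fin_cases b <;>
    simp [Matrix.mul_apply, Fin.sum_univ_two, J] <;>
    first | ring1 | linear_combination h | linear_combination -h

lemma quadForm_symm {φ : Coord m} {ξ : Fin m → ℂ} (hφ : ∀ j, (φ.R j ξ)ᵀ = φ.R j ξ) {G : Phase m → ℂ}
    (hG : ∀ e e', phD (phD G e) e' (φ.point ξ) = phD (phD G e') e (φ.point ξ)) :
    (quadForm φ ξ G)ᵀ = quadForm φ ξ G := by
  have hYY : (hessYY G (φ.point ξ))ᵀ = hessYY G (φ.point ξ) := Matrix.ext fun i j => hG _ _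
  have hZZ : (hessZZ G (φ.point ξ))ᵀ = hessZZ G (φ.point ξ) := Matrix.ext fun i j => hG _ _
  simp only [quadForm, Matrix.transpose_add, Matrix.transpose_sum, Matrix.transpose_smul, hφ,
    Matrix.transpose_mul, hYY, hZZ, Matrix.transpose_transpose, Matrix.mul_assoc]
  abel

section Symm

variable {ρ R : ℝ} {d : ℕ} (hd : 1 ≤ d)
include hd

/-- Differentiate det W = 1, an identity valid wherever W₁₁ ≠ 0. -/
lemma eventually_R_symm : ∀ᶠ i in small m ρ R d, ∀ ξ ∈ openStrip m R, ∀ j, (i.φ.R j ξ)ᵀ = i.φ.R j ξ := by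
  have hW := eventually_all.mpr fun a => eventually_all.mpr fun b =>
    (lim₁_W (m := m) (ρ := ρ) (R := R) hd a b).hasLineDerivAt
  filter_upwards [hW, eventually_W₁₁_ne hd] with i hW h11 ξ hξ j
  simp only [Coord.R, Matrix.transpose_neg, Matrix.transpose_sum, Matrix.transpose_smul]
  congr 1
  refine Finset.sum_congr rfl fun k _ => ?_
  congr 1
  refine transpose_mul_J_mul_symm (D := Matrix.of fun a b => pd k (fun η => i.φ.W η a b) ξ) ?_
  have h1 := HasDerivAt.sub (HasDerivAt.mul (hW 0 0 ξ hξ k) (hW 1 1 ξ hξ k))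
    (HasDerivAt.mul (hW 0 1 ξ hξ k) (hW 1 0 ξ hξ k))
  have h2 : (((fun t : ℝ => i.φ.W (ξ + t • (Pi.single k (1 : ℂ) : Fin m → ℂ)) 0 0) *
      fun t : ℝ => i.φ.W (ξ + t • (Pi.single k (1 : ℂ) : Fin m → ℂ)) 1 1) -
      (fun t : ℝ => i.φ.W (ξ + t • (Pi.single k (1 : ℂ) : Fin m → ℂ)) 0 1) *
      fun t : ℝ => i.φ.W (ξ + t • (Pi.single k (1 : ℂ) : Fin m → ℂ)) 1 0) = fun _ => 1 := by
    funext t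
    have hm : ξ + t • (Pi.single k (1 : ℂ) : Fin m → ℂ) ∈ openStrip m R := by
      have := add_mem_openStrip hξ (Pi.single k t)
      rw [ofR_single] at this
      convert! this using 2
      rw [← Pi.single_smul]
      simp
    have h0 := (h11 _ hm).1
    simp only [Coord.W, Pi.sub_apply, Pi.mul_apply, Matrix.of_apply, Matrix.cons_val]
    field_simp
    ring
  rw [h2] at h1
  have h3 := h1.unique (hasDerivAt_const (0 : ℝ) (1 : ℂ))
  simp only [zero_smul, add_zero] at h3
  exact h3

/-- The coefficients of the equation for `Γ` are symmetric matrices. -/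
lemma Jet.eventually_symm (hR : R ≤ ρ) {G : ℝ → Phase m → ℂ} {G₀ : Phase m → ℂ} (h : Jet ρ G G₀) :
    ∀ᶠ i in small m ρ R d, ∀ ξ ∈ openStrip m R,
      (∀ a b, (coefU (G i.ε) i.φ ξ a b)ᵀ = coefU (G i.ε) i.φ ξ a b) ∧
      (∀ a, (coefE (G i.ε) i.φ ξ a)ᵀ = coefE (G i.ε) i.φ ξ a) ∧
      (∀ a, (coefK (G i.ε) i.φ ξ a)ᵀ = coefK (G i.ε) i.φ ξ a) := by
  choose a ha hY using fun l => (h.phD (norm_eY_le l)).phD_comm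
  choose b hb hZ using fun l => (h.phD (norm_eZ_le l)).phD_comm
  filter_upwards [eventually_R_symm hd, eventually_all.mpr fun l => eventually_pointOk hd hR (ha l),
    eventually_all.mpr fun l => eventually_pointOk hd hR (hb l)] with i hRs pY pZ ξ hξ
  have qY : ∀ l, (quadForm i.φ ξ (LowDimTori.phD (G i.ε) (eY l)))ᵀ
      = quadForm i.φ ξ (LowDimTori.phD (G i.ε) (eY l)) := fun l =>
    quadForm_symm (hRs ξ hξ) (hY l i.ε _ ((pY l).1.mem ξ hξ))
  have qZ : ∀ l, (quadForm i.φ ξ (LowDimTori.phD (G i.ε) (eZ l)))ᵀ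
      = quadForm i.φ ξ (LowDimTori.phD (G i.ε) (eZ l)) := fun l =>
    quadForm_symm (hRs ξ hξ) (hZ l i.ε _ ((pZ l).1.mem ξ hξ))
  refine ⟨fun a b => ?_, fun a => ?_, fun a => ?_⟩
  · simp only [coefU, Matrix.transpose_add, Matrix.transpose_transpose]
    exact add_comm _ _
  · simp only [coefE, Matrix.transpose_sum, Matrix.transpose_smul, qY]
  · simp only [coefK, Matrix.transpose_add, Matrix.transpose_sum, Matrix.transpose_smul, qY, qZ,
      Matrix.transpose_transpose]
    abel

end Symm

/-! ### Hessians of the unperturbed Hamiltonian at the origin -/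

section Unperturbed

variable {ρ : ℝ} {H₀ : (Fin m → ℂ) × ℂ → ℂ} {H₁ : Phase m → ℂ}

lemma projYZ_eY (i : Fin m) : projYZ (eY i : Phase m) = (Pi.single i 1, 0) := by simp [projYZ, eY]

lemma projYZ_eZ_one : projYZ (eZ 1 : Phase m) = (0, 1) := by simp [projYZ, eZ]

lemma projYZ_eZ_zero : projYZ (eZ 0 : Phase m) = 0 := by
  have : projYZ (eZ 0 : Phase m) = ((0 : Fin m → ℂ), (0 : ℂ)) := by simp [projYZ, eZ]
  exact this

lemma hessYY_unperturbed (i j : Fin m) :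
    hessYY (fun P => H₀ (projYZ P)) 0 i j = S₀ H₀ i j := by
  simp only [hessYY, Matrix.of_apply, phD_comp_projYZ H₀]
  refine (congrFun (phD_comp_projYZ (fun p => lineDeriv ℂ H₀ p (projYZ (eY j))) (eY i)) 0).trans ?_
  simp only [projYZ_eY, map_zero]
  rfl

lemma hessZY_unperturbed_zero (j : Fin m) : hessZY (fun P => H₀ (projYZ P)) 0 0 j = 0 := by
  simp only [hessZY, Matrix.of_apply, phD_comp_projYZ H₀]
  refine (congrFun (phD_comp_projYZ (fun p => lineDeriv ℂ H₀ p (projYZ (eY j))) (eZ 0)) 0).trans ?_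
  simp only [projYZ_eZ_zero, lineDeriv_zero]

/-- `t₀` takes the two derivatives in the opposite order, so the symmetry of the Hessian is applied
at ε = 0. -/
lemma CondH1.hessZY_unperturbed_one (hρ : 0 < ρ) (h : CondH1 ρ H₀ H₁) (j : Fin m) :
    hessZY (fun P => H₀ (projYZ P)) 0 1 j = t₀ H₀ j := by
  obtain ⟨a, ha, hc⟩ := (h.jet hρ).phD_comm
  have e : hamiltonian H₀ H₁ 0 = fun P => H₀ (projYZ P) := by
    funext P
    simp only [hamiltonian, Complex.ofReal_zero, zero_mul, add_zero]
    rfl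
  have := hc 0 0 ⟨fun j => by simp; linarith, by simp; linarith, fun i => by simpa using ha,
    by simpa using ha⟩ (eY j) (eZ 1)
  rw [e] at this
  simp only [hessZY, Matrix.of_apply]
  rw [this]
  simp only [phD_comp_projYZ H₀]
  refine (congrFun (phD_comp_projYZ (fun p => lineDeriv ℂ H₀ p (projYZ (eZ 1))) (eY j)) 0).trans ?_
  simp only [projYZ_eY, projYZ_eZ_one, map_zero]
  rfl

end Unperturbed

end LowDimTori

end

noncomputable section

namespace LowDimTori

open MeasureTheory Set Filter Topology

variable {m : ℕ}

/-! ## The function spaces -/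

lemma strip_subset_closure {r : ℝ} (hr : 0 < r) : strip m r ⊆ closure (openStrip m r) := by
  intro ξ hξ
  have hc : Tendsto (fun t : ℝ => fun j => ((ξ j).re : ℂ) + t * ((ξ j).im * Complex.I))
      (𝓝[<] 1) (𝓝 ξ) := by
    have h : Continuous fun t : ℝ => fun j => ((ξ j).re : ℂ) + t * ((ξ j).im * Complex.I) := by fun_prop
    have := h.tendsto 1
    simp only [Complex.ofReal_one, one_mul, Complex.re_add_im] at this
    exact this.mono_left nhdsWithin_le_nhds
  refine mem_closure_of_tendsto hc ?_
  filter_upwards [Ioo_mem_nhdsLT (zero_lt_one' ℝ)] with t ht j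
  have h1 : (((ξ j).re : ℂ) + t * ((ξ j).im * Complex.I)).im = t * (ξ j).im := by simp
  rw [h1, abs_mul, abs_of_pos ht.1]
  have := hξ j
  nlinarith [ht.1, ht.2, abs_nonneg (ξ j).im]

lemma eqOn_strip_of_torus {f g : CFun m} {r : ℝ} (hr : 0 ≤ r) (hf : DifferentiableOn ℂ f (openStrip m r))
    (hf' : ContinuousOn f (strip m r)) (hg : DifferentiableOn ℂ g (openStrip m r))
    (hg' : ContinuousOn g (strip m r)) (h : EqOn f g (strip m 0)) : EqOn f g (strip m r) := by
  rcases hr.eq_or_lt with rfl | hr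
  · exact h
  · exact EqOn.of_subset_closure (fun ξ hξ => eqOn_openStrip hf hg h ξ hξ) hf' hg'
      (openStrip_subset_strip r) (strip_subset_closure hr)

/-- The real parts are reduced modulo 2π at fixed imaginary part, so the supremum is taken over a
compact set. -/
lemma MemA.exists_bound {r : ℝ} {d : ℕ} {f : CFun m} (hf : MemA r d f) :
    ∃ M, ∀ ξ ∈ strip m r, ‖f ξ‖ ≤ M := by
  let D : Set ((Fin m → ℝ) × (Fin m → ℝ)) :=
    Icc 0 (fun _ => 2 * Real.pi) ×ˢ Icc (fun _ => -r) (fun _ => r)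
  let Φ : (Fin m → ℝ) × (Fin m → ℝ) → Fin m → ℂ := fun p => ofR p.1 + Complex.I • ofR p.2
  have hI : Continuous fun p : (Fin m → ℝ) × (Fin m → ℝ) => ofR p.2 := continuous_ofR.comp continuous_snd
  have hΦ : Continuous Φ := (continuous_ofR.comp continuous_fst).add (hI.const_smul Complex.I)
  have him : ∀ p j, (Φ p j).im = p.2 j := fun p j => by simp [Φ, ofR]
  have hD : MapsTo Φ D (strip m r) := fun p hp j => by
    rw [him]
    exact abs_le.mpr ⟨hp.2.1 j, hp.2.2 j⟩
  obtain ⟨M, hM⟩ := (isCompact_Icc.prod isCompact_Icc).exists_bound_of_continuousOn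
    ((hf.continuous [] (by simp)).comp hΦ.continuousOn hD)
  refine ⟨M, fun ξ hξ => ?_⟩
  have hp : 0 < 2 * Real.pi := Real.two_pi_pos
  let y : Fin m → ℝ := fun j => (ξ j).im
  let k : Fin m → ℤ := fun j => ⌊(ξ j).re / (2 * Real.pi)⌋
  let x : Fin m → ℝ := fun j => (ξ j).re - k j * (2 * Real.pi)
  have hs : ∀ x, ofR x + Complex.I • ofR y ∈ strip m r := fun x j => by
    have : ((ofR x + Complex.I • ofR y) j).im = (ξ j).im := by simp [ofR, y]
    rw [this]
    exact hξ j
  have hc : TorusCont fun η => f (η + Complex.I • ofR y) := by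
    refine ⟨fun x j => ?_, (hf.continuous [] (by simp)).comp_continuous
      (continuous_ofR.add continuous_const) hs⟩
    rw [ofR_add, ofR_single, add_right_comm]
    exact hf.periodic _ (hs x) j
  have h1 := hc.periodic_int x k
  have h2 : (ofR fun j => x j + k j * (2 * Real.pi)) + Complex.I • ofR y = ξ := by
    ext j
    simp only [x, y, ofR, sub_add_cancel, Pi.add_apply, Pi.smul_apply, smul_eq_mul]
    rw [mul_comm, Complex.re_add_im]
  rw [h2] at h1
  rw [h1]
  refine hM (x, y) ⟨⟨fun j => ?_, fun j => ?_⟩, fun j => (abs_le.mp (hξ j)).1, fun j => (abs_le.mp (hξ j)).2⟩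
  · have := Int.floor_le ((ξ j).re / (2 * Real.pi))
    rw [le_div_iff₀ hp] at this
    simpa [x, k] using this
  · have := (Int.lt_floor_add_one ((ξ j).re / (2 * Real.pi))).le
    rw [div_le_iff₀ hp] at this
    simp only [x, k]
    linarith

lemma normA_zero_le {r N : ℝ} {f : CFun m} (h : ∀ ξ ∈ strip m r, ‖f ξ‖ ≤ N) :
    normA r 0 f ≤ ENNReal.ofReal N := by
  refine iSup₂_le fun l hl => iSup₂_le fun ξ hξ => ?_
  obtain rfl := List.length_eq_zero_iff.mp (Nat.le_zero.mp hl)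
  rw [← ofReal_norm]
  exact ENNReal.ofReal_le_ofReal (h ξ hξ)

lemma MemA.hpb {r M : ℝ} {d : ℕ} {f : CFun m} (hf : MemA r d f) (hM : 0 ≤ M)
    (h : normA r 0 f ≤ ENNReal.ofReal M) : HPB r f M :=
  ⟨fun ξ hξ => hf.periodic ξ (openStrip_subset_strip r hξ), hf.holomorphic, fun _ hξ =>
    norm_le_of_enorm_le hM ((enorm_iterPd_le_normA (l := []) f le_rfl (openStrip_subset_strip r hξ)).trans h)⟩

lemma HPB.normA_le {r R N : ℝ} {f : CFun m} (hf : HPB R f N) (h : r < R) :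
    normA r 0 f ≤ ENNReal.ofReal N :=
  normA_zero_le fun ξ hξ => hf.bound ξ (strip_subset_openStrip h hξ)

lemma HPB.memA_one {r R N : ℝ} {f : CFun m} (hf : HPB R f N) (h : r < R) : MemA r 1 f := by
  have hs := strip_subset_openStrip (m := m) h
  refine ⟨fun ξ hξ => hf.periodic ξ (hs hξ), hf.diff.mono (openStrip_mono h.le), fun l hl ξ hξ j => ?_,
    fun l hl => ?_⟩
  · obtain rfl := List.length_eq_zero_iff.mp (Nat.lt_one_iff.mp hl)
    exact (hf.hasLineDerivAt (hs hξ) j).lineDifferentiableAt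
  · match l, hl with
    | [], _ => exact hf.diff.continuousOn.mono hs
    | [j], _ => exact (hf.differentiableOn_pd j).continuousOn.mono hs

lemma MemA.of_le {r : ℝ} {d d' : ℕ} {f : CFun m} (hf : MemA r d f) (h : d' ≤ d) : MemA r d' f :=
  ⟨hf.periodic, hf.holomorphic, fun l hl => hf.differentiable l (hl.trans_le h),
    fun l hl => hf.continuous l (hl.trans h)⟩

lemma MemA.torusC1 {f : CFun m} (hf : MemA 0 1 f) : TorusC1 f := by
  have hp : ∀ x j, f (ofR (x + Pi.single j (2 * Real.pi))) = f (ofR x) := fun x j => by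
    rw [ofR_add, ofR_single]
    exact hf.periodic _ (ofR_mem_strip x) j
  refine ⟨⟨hp, (hf.continuous [] (by simp)).comp_continuous continuous_ofR ofR_mem_strip⟩,
    fun x j => hf.differentiable [] (by simp) _ (ofR_mem_strip x) j,
    fun j => ⟨fun x i => ?_, (hf.continuous [j] (by simp)).comp_continuous continuous_ofR ofR_mem_strip⟩⟩
  unfold LowDimTori.pd lineDeriv
  congr 1
  funext t
  have e : ∀ x : Fin m → ℝ, ofR x + t • (Pi.single j 1 : Fin m → ℂ) = ofR (x + Pi.single j t) := fun x => by
    rw [ofR_add, ofR_single, ← Pi.single_smul]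
    simp
  rw [e, e, add_right_comm, hp]

/-- The norm is finite by compactness, and M is the norm itself, so a bound by M is a bound by the
norm. -/
lemma Rhs.Mem.exists_bd {F : Rhs m} {r : ℝ} {d : ℕ} (hF : F.Mem r d) :
    ∃ M, 0 ≤ M ∧ F.Bd r M ∧ F.norm r 0 = ENNReal.ofReal M := by
  have key : ∀ {f : CFun m}, MemA r d f → ∀ᶠ M in atTop, normA r 0 f ≤ ENNReal.ofReal M := fun hf => by
    obtain ⟨M, hM⟩ := hf.exists_bound
    filter_upwards [eventually_ge_atTop M] with N hN using normA_zero_le fun ξ hξ => (hM ξ hξ).trans hN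
  have h2 := eventually_all.mpr fun p => key (hF.F₂ p)
  have h3 := eventually_all.mpr fun p => key (hF.F₃ p)
  have h4 := eventually_all.mpr fun a => eventually_all.mpr fun b => key (hF.F₄ a b)
  obtain ⟨N, h1, h2, h3, h4, h5⟩ := ((key hF.F₁).and (h2.and (h3.and (h4.and
    (eventually_ge_atTop ‖F.f₅‖))))).exists
  have hfin : F.norm r 0 ≠ ∞ := ne_top_of_le_ne_top (b := ENNReal.ofReal N) ENNReal.ofReal_ne_top
    (sup_le (sup_le (sup_le (sup_le h1 (iSup_le h2)) (iSup_le h3)) (iSup₂_le h4)) (by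
      rw [← ofReal_norm]
      exact ENNReal.ofReal_le_ofReal h5))
  have e := ENNReal.ofReal_toReal hfin
  have h0 : 0 ≤ (F.norm r 0).toReal := ENNReal.toReal_nonneg
  refine ⟨_, h0, ⟨hF.F₁.hpb h0 ?_, fun p => (hF.F₂ p).hpb h0 ?_, fun i => (hF.F₃ i).hpb h0 ?_,
    fun a b => (hF.F₄ a b).hpb h0 ?_, norm_le_of_enorm_le h0 ?_⟩, e.symm⟩ <;> rw [e]
  · exact le_sup_of_le_left (le_sup_of_le_left (le_sup_of_le_left le_sup_left))
  · exact le_sup_of_le_left (le_sup_of_le_left (le_sup_of_le_left (le_sup_of_le_right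
      (le_iSup (fun p => normA r 0 (F.F₂ p)) p))))
  · exact le_sup_of_le_left (le_sup_of_le_left (le_sup_of_le_right (le_iSup (fun p => normA r 0 (F.F₃ p)) i)))
  · exact le_sup_of_le_left (le_sup_of_le_right (le_iSup₂ (f := fun a b => normA r 0 (F.F₄ a b)) a b))
  · exact le_sup_right

lemma Unknown.Bd.mem {X : Unknown m} {R N : ℝ} (hX : X.Bd R N) {r : ℝ} (h : r < R) : X.Mem r 1 :=
  ⟨hX.ψ₀.memA_one h, fun i => (hX.lam i).memA_one h, fun i => (hX.χ i).memA_one h,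
    fun a b => (hX.Γ a b).memA_one h⟩

lemma Unknown.Mem.of_le {X : Unknown m} {r : ℝ} {d d' : ℕ} (hX : X.Mem r d) (h : d' ≤ d) : X.Mem r d' :=
  ⟨hX.ψ₀.of_le h, fun i => (hX.lam i).of_le h, fun i => (hX.χ i).of_le h, fun a b => (hX.Γ a b).of_le h⟩

lemma Unknown.Bd.funNorm_le {X : Unknown m} {R N : ℝ} (hX : X.Bd R N) {r : ℝ} (h : r < R) :
    X.funNorm r 0 ≤ ENNReal.ofReal N :=
  sup_le (sup_le (sup_le (hX.ψ₀.normA_le h) (iSup_le fun i => (hX.lam i).normA_le h))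
    (iSup_le fun i => (hX.χ i).normA_le h)) (iSup₂_le fun a b => (hX.Γ a b).normA_le h)

lemma Unknown.Bd.constNorm_le {X : Unknown m} {R N : ℝ} (hX : X.Bd R N) :
    X.constNorm ≤ ENNReal.ofReal N := by
  have h : ∀ {z : ℂ}, ‖z‖ ≤ N → ‖z‖ₑ ≤ ENNReal.ofReal N := fun hz => by
    rw [← ofReal_norm]
    exact ENNReal.ofReal_le_ofReal hz
  exact sup_le (sup_le (sup_le (iSup_le fun i => h (hX.δβ i)) (h hX.q)) (h hX.p)) (h hX.δM)

lemma Unknown.EqOn.extend {X Y : Unknown m} {r : ℝ} {d d' : ℕ} (hr : 0 ≤ r) (hX : X.Mem r d)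
    (hY : Y.Mem r d') (h : Y.EqOn 0 X) : Y.EqOn r X := by
  have key : ∀ {f g : CFun m}, MemA r d f → MemA r d' g → Set.EqOn g f (strip m 0) →
      Set.EqOn g f (strip m r) := fun hf hg =>
    eqOn_strip_of_torus hr hg.holomorphic (hg.continuous [] (by simp)) hf.holomorphic
      (hf.continuous [] (by simp))
  exact ⟨key hX.ψ₀ hY.ψ₀ h.ψ₀, fun i => key (hX.lam i) (hY.lam i) (h.lam i),
    fun i => key (hX.χ i) (hY.χ i) (h.χ i), fun a b => key (hX.Γ a b) (hY.Γ a b) (h.Γ a b),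
    h.δβ, h.q, h.p, h.δM⟩

end LowDimTori

end

noncomputable section

namespace LowDimTori

open MeasureTheory Set Filter Topology

variable {m : ℕ}

/-! ## The equations in matrix form and in components -/

section Pointwise

variable {H : Phase m → ℂ} {ω : Fin m → ℝ} {α k : ℂ} {φ : Coord m} {F : Rhs m} {X : Unknown m}
  {ξ : Fin m → ℂ}

lemma eq_b_iff :
    (J *ᵥ (fun i => dirD ω (X.lam i) ξ) + Om k *ᵥ X.lamAt ξ + coefT H φ ξ *ᵥ X.μ ξ
      + X.p • ((φ.W ξ)ᵀ *ᵥ e₁) + (X.δM * (φ.w 0 ξ - α)) • ((φ.W ξ)ᵀ *ᵥ e₁) = fun i => F.F₂ i ξ) ↔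
    dirD ω (X.lam 1) ξ - k * X.lam 0 ξ + ∑ j, (linOf H φ α).T 0 j ξ * X.μ ξ j
      + X.p * (linOf H φ α).W 0 ξ + X.δM * (linOf H φ α).w ξ * (linOf H φ α).W 0 ξ = F.F₂ 0 ξ ∧
    -dirD ω (X.lam 0) ξ + X.lam 1 ξ + ∑ j, (linOf H φ α).T 1 j ξ * X.μ ξ j
      + X.p * (linOf H φ α).W 1 ξ + X.δM * (linOf H φ α).w ξ * (linOf H φ α).W 1 ξ = F.F₂ 1 ξ := by
  rw [funext_iff, Fin.forall_fin_two]
  simp [J, Om, e₁, linOf, Unknown.lamAt, dotProduct, Fin.sum_univ_two, sub_eq_add_neg]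
  rfl

lemma eq_c_iff :
    (-(fun i => dirD ω (X.χ i) ξ) + coefS H φ ξ *ᵥ X.μ ξ + (coefT H φ ξ)ᵀ *ᵥ X.lamAt ξ
      = fun i => F.F₃ i ξ) ↔
    ∀ i, -dirD ω (X.χ i) ξ + ∑ j, (linOf H φ α).S i j ξ * X.μ ξ j
      + ∑ p, (linOf H φ α).T p i ξ * X.lam p ξ = F.F₃ i ξ := by
  rw [funext_iff]
  simp [linOf, Unknown.lamAt, Matrix.mulVec, dotProduct]

lemma dirD_neg (f : CFun m) : dirD ω (fun η => -f η) ξ = -dirD ω f ξ := by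
  simp only [dirD, ← Finset.sum_neg_distrib]
  refine Finset.sum_congr rfl fun j _ => ?_
  have : pd j (fun η => -f η) ξ = -pd j f ξ := by
    unfold pd lineDeriv
    exact deriv.fun_neg
  rw [this, mul_neg]

lemma ext_fin_two_symm {A B : Matrix (Fin 2) (Fin 2) ℂ} (hA : A 0 1 = A 1 0) (hB : B 0 1 = B 1 0) :
    A = B ↔ A 0 0 = B 0 0 ∧ A 0 1 = B 0 1 ∧ A 1 1 = B 1 1 := by
  refine ⟨fun h => by simp [h], fun ⟨h1, h2, h3⟩ => ?_⟩
  ext a b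
  fin_cases a <;> fin_cases b
  · exact h1
  · exact h2
  · exact hA.symm.trans (h2.trans hB)
  · exact h3

/-- Both sides are symmetric matrices, so three entries suffice. The symmetry of J∂Γ is the trace
condition, that of the other terms the symmetry of U, E and K. -/
lemma eq_d_iff (hU : ∀ a b, (coefU H φ ξ a b)ᵀ = coefU H φ ξ a b)
    (hE : ∀ a, (coefE H φ ξ a)ᵀ = coefE H φ ξ a) (hK : ∀ a, (coefK H φ ξ a)ᵀ = coefK H φ ξ a)
    (hF : F.F₄ 0 1 ξ = F.F₄ 1 0 ξ) (hΓ : X.Γ 1 1 ξ = -X.Γ 0 0 ξ)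
    (hdΓ : dirD ω (X.Γ 1 1) ξ = -dirD ω (X.Γ 0 0) ξ) :
    ((Matrix.of fun a b => dirD ω (fun η => (J * X.ΓAt η) a b) ξ)
      + Om k * X.ΓAt ξ + (Om k * X.ΓAt ξ)ᵀ
      + (∑ i, ∑ j, pd j (X.lam i) ξ • coefU H φ ξ i j)
      + (∑ i, X.μ ξ i • coefE H φ ξ i) + (∑ i, X.lam i ξ • coefK H φ ξ i)
      + (φ.W ξ)ᵀ * !![X.δM, 0; 0, 0] * φ.W ξ
      = Matrix.of fun a b => F.F₄ a b ξ) ↔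
    (dirD ω (X.Γ 1 0) ξ - 2 * k * X.Γ 0 0 ξ
      + (linOf H φ α).Q (fun i j => pd j (X.lam i)) (fun i ξ => X.μ ξ i) X.lam 0 ξ
      + X.δM * (linOf H φ α).W 0 ξ ^ 2 = F.F₄ 0 0 ξ) ∧
    (-dirD ω (X.Γ 0 0) ξ - k * X.Γ 0 1 ξ + X.Γ 1 0 ξ
      + (linOf H φ α).Q (fun i j => pd j (X.lam i)) (fun i ξ => X.μ ξ i) X.lam 1 ξ
      + X.δM * ((linOf H φ α).W 0 ξ * (linOf H φ α).W 1 ξ) = F.F₄ 0 1 ξ) ∧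
    (-dirD ω (X.Γ 0 1) ξ - 2 * X.Γ 0 0 ξ
      + (linOf H φ α).Q (fun i j => pd j (X.lam i)) (fun i ξ => X.μ ξ i) X.lam 2 ξ
      + X.δM * (linOf H φ α).W 1 ξ ^ 2 = F.F₄ 1 1 ξ) := by
  have e0 : ∀ b, (fun η => (J * X.ΓAt η) 0 b) = X.Γ 1 b := fun b => by
    funext η
    simp [J, Unknown.ΓAt, Matrix.mul_apply, Fin.sum_univ_two]
  have e1 : ∀ b, (fun η => (J * X.ΓAt η) 1 b) = fun η => -X.Γ 0 b η := fun b => by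
    funext η
    simp [J, Unknown.ΓAt, Matrix.mul_apply, Fin.sum_univ_two]
  have hQ : ∀ a b : Fin 2, ∀ c, ![0, 0, 1] c = a → ![0, 1, 1] c = b →
      (∑ i, ∑ j, pd j (X.lam i) ξ • coefU H φ ξ i j) a b + (∑ i, X.μ ξ i • coefE H φ ξ i) a b
        + (∑ i, X.lam i ξ • coefK H φ ξ i) a b =
      (linOf H φ α).Q (fun i j => pd j (X.lam i)) (fun i ξ => X.μ ξ i) X.lam c ξ := by
    rintro a b c rfl rfl
    simp only [Lin.Q, linOf, Matrix.sum_apply, Matrix.smul_apply, smul_eq_mul]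
  have hS : ∀ {A : Matrix (Fin 2) (Fin 2) ℂ}, Aᵀ = A → A 0 1 = A 1 0 := fun h => congrFun (congrFun h 1) 0
  have sU : (∑ i, ∑ j, pd j (X.lam i) ξ • coefU H φ ξ i j)ᵀ = ∑ i, ∑ j, pd j (X.lam i) ξ • coefU H φ ξ i j := by
    simp only [Matrix.transpose_sum, Matrix.transpose_smul, hU]
  have sE : (∑ i, X.μ ξ i • coefE H φ ξ i)ᵀ = ∑ i, X.μ ξ i • coefE H φ ξ i := by
    simp only [Matrix.transpose_sum, Matrix.transpose_smul, hE]
  have sK : (∑ i, X.lam i ξ • coefK H φ ξ i)ᵀ = ∑ i, X.lam i ξ • coefK H φ ξ i := by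
    simp only [Matrix.transpose_sum, Matrix.transpose_smul, hK]
  have hW : ∀ a b, ((φ.W ξ)ᵀ * !![X.δM, 0; 0, 0] * φ.W ξ) a b = X.δM * (φ.W ξ 0 a * φ.W ξ 0 b) := fun a b => by
    simp [Matrix.mul_apply, Fin.sum_univ_two]
    ring
  have hOm : ∀ a b, (Om k * X.ΓAt ξ) a b = ![-k * X.Γ 0 b ξ, X.Γ 1 b ξ] a := fun a b => by
    fin_cases a <;> simp [Om, Unknown.ΓAt, Matrix.mul_apply, Fin.sum_univ_two]
  have q0 := hQ 0 0 0 rfl rfl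
  have q1 := hQ 0 1 1 rfl rfl
  have q2 := hQ 1 1 2 rfl rfl
  have s1 := hS sU
  have s2 := hS sE
  have s3 := hS sK
  have w0 : ∀ p, (linOf H φ α).W p ξ = φ.W ξ 0 p := fun _ => rfl
  rw [ext_fin_two_symm]
  · simp only [Matrix.add_apply, Matrix.of_apply, e0, e1, Matrix.transpose_apply, dirD_neg, hOm, hW,
      w0, Matrix.cons_val, hdΓ, hΓ]
    refine and_congr ?_ (and_congr ?_ ?_)
    · rw [← q0]
      constructor <;> intro h <;> linear_combination h
    · rw [← q1]
      constructor <;> intro h <;> linear_combination h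
    · rw [← q2]
      constructor <;> intro h <;> linear_combination h
  · simp only [Matrix.add_apply, Matrix.of_apply, e0, e1, Matrix.transpose_apply, dirD_neg, hOm, hW,
      Matrix.cons_val, hdΓ, s1, s2, s3]
    ring
  · exact hF

end Pointwise

section Solutions

variable {H : Phase m → ℂ} {ω : Fin m → ℝ} {α k : ℂ} {φ : Coord m} {F : Rhs m} {X : Unknown m}
  {R C M N η : ℝ} {S₀ : Fin m → Fin m → ℂ} {t : Fin m → ℂ}

lemma differentiableOn_dirD {f : CFun m} (hf : HPB R f N) :
    DifferentiableOn ℂ (dirD ω f) (openStrip m R) :=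
  DifferentiableOn.fun_sum fun j _ => (hf.differentiableOn_pd j).const_mul _

lemma Unknown.Bd.differentiableOn_μ (hX : X.Bd R N) (i : Fin m) :
    DifferentiableOn ℂ (fun ξ => X.μ ξ i) (openStrip m R) :=
  (hX.ψ₀.differentiableOn_pd i).add_const _

lemma Unknown.Bd.differentiableOn_Q {L : Lin m} (hL : L.Bd R C S₀ t η) (hX : X.Bd R N) (c : Fin 3) :
    DifferentiableOn ℂ (L.Q (fun i j => pd j (X.lam i)) (fun i ξ => X.μ ξ i) X.lam c) (openStrip m R) :=
  ((DifferentiableOn.fun_sum fun i _ => DifferentiableOn.fun_sum fun j _ =>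
    ((hX.lam i).differentiableOn_pd j).mul (hL.U i j c).diff).add
    (DifferentiableOn.fun_sum fun i _ => (hX.differentiableOn_μ i).mul (hL.E i c).diff)).add
    (DifferentiableOn.fun_sum fun i _ => (hX.lam i).diff.mul (hL.K i c).diff)

lemma Coord.inv_V_transpose {ξ : Fin m → ℂ} (h : (1 + φ.jacU ξ).det ≠ 0) :
    ((φ.V ξ)⁻¹)ᵀ = 1 + φ.jacU ξ := by
  rw [Coord.V, Matrix.transpose_nonsing_inv, Matrix.transpose_transpose]
  exact Matrix.nonsing_inv_nonsing_inv _ (isUnit_iff_ne_zero.mpr h)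

lemma mean_w_eq : mean (fun ξ => (φ.W ξ *ᵥ X.lamAt ξ) 0 + ∑ i, X.χ i ξ * pd i (φ.w 0) ξ) =
    mean (fun ξ => (linOf H φ α).W 0 ξ * X.lam 0 ξ + (linOf H φ α).W 1 ξ * X.lam 1 ξ
      + ∑ i, X.χ i ξ * pd i (linOf H φ α).w ξ) := by
  simp only [linOf, pd_sub_const, Matrix.mulVec, dotProduct, Fin.sum_univ_two, Unknown.lamAt]

lemma mean_ψ_eq : mean (fun ξ =>
      X.ψ₀ ξ - (∑ i, X.δβ i * φ.u i ξ) + φ.w 1 ξ * (φ.W ξ *ᵥ X.lamAt ξ) 0) =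
    mean (fun ξ => X.ψ₀ ξ - (∑ i, X.δβ i * (linOf H φ α).u i ξ) + (linOf H φ α).w₂ ξ *
      ((linOf H φ α).W 0 ξ * X.lam 0 ξ + (linOf H φ α).W 1 ξ * X.lam 1 ξ)) := by
  simp only [linOf, Matrix.mulVec, dotProduct, Fin.sum_univ_two, Unknown.lamAt]

lemma mean_χ_eq (hdet : ∀ ξ ∈ strip m 0, (1 + φ.jacU ξ).det ≠ 0) (i : Fin m) :
    mean (fun ξ => (((φ.V ξ)⁻¹)ᵀ *ᵥ X.χAt ξ) i) =
      mean (fun ξ => X.χ i ξ + ∑ j, pd j ((linOf H φ α).u i) ξ * X.χ j ξ) := by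
  refine mean_congr fun ξ hξ => ?_
  rw [Coord.inv_V_transpose (hdet ξ hξ), Matrix.add_mulVec, Matrix.one_mulVec]
  rfl

lemma mean_Γ_eq : mean (fun ξ => (φ.W ξ * X.ΓAt ξ) 0 1) =
    mean (fun ξ => (linOf H φ α).W 0 ξ * X.Γ 0 1 ξ + (linOf H φ α).W 1 ξ * X.Γ 1 1 ξ) := by
  simp only [linOf, Matrix.mul_apply, Fin.sum_univ_two, Unknown.ΓAt, Matrix.of_apply]

/-- The coefficients of the equation for `Γ` are symmetric on the set `s`, and `1 + u'` is invertible. -/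
def Regular (H : Phase m → ℂ) (φ : Coord m) (s : Set (Fin m → ℂ)) : Prop :=
  ∀ ξ ∈ s, ((∀ a b, (coefU H φ ξ a b)ᵀ = coefU H φ ξ a b) ∧
      (∀ a, (coefE H φ ξ a)ᵀ = coefE H φ ξ a) ∧ (∀ a, (coefK H φ ξ a)ᵀ = coefK H φ ξ a)) ∧
    (1 + φ.jacU ξ).det ≠ 0

/-- Both sides of each differential equation and of the trace condition are holomorphic on a wider
open strip, so equality on the real torus propagates. -/
theorem Lin.Sol.isSolution (hs : (linOf H φ α).Sol ω k F X) (hL : (linOf H φ α).Bd R C S₀ t η)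
    (hF : F.Bd R M) (hX : X.Bd R N) (hR : 0 < R) {r : ℝ} (hr : r < R)
    (hreg : Regular H φ (openStrip m R)) (hsymm : ∀ ξ ∈ strip m 0, F.F₄ 0 1 ξ = F.F₄ 1 0 ξ) :
    IsSolution H ω α k φ F r X := by
  have hsub : openStrip m r ∪ strip m 0 ⊆ openStrip m R :=
    union_subset (openStrip_mono hr.le) (strip_subset_openStrip hR)
  have h0 : ∀ ξ ∈ strip m 0, ξ ∈ openStrip m R := fun ξ hξ => strip_subset_openStrip hR hξ
  have dl := fun i => differentiableOn_dirD (ω := ω) (hX.lam i)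
  have dG := fun a b => differentiableOn_dirD (ω := ω) (hX.Γ a b)
  have q := fun i => (hL.W i).diff
  have hΓ := eqOn_openStrip (hX.Γ 1 1).diff (hX.Γ 0 0).diff.neg hs.trace
  have hdΓ := eqOn_openStrip (dG 1 1) (dG 0 0).neg fun ξ hξ =>
    (dirD_congr (g := fun η => -X.Γ 0 0 η) hs.trace hξ).trans (dirD_neg _)
  refine ⟨(hX.mem hr).of_le zero_le_one, hX.mem hR, fun ξ hξ => ?_, fun ξ hξ => ?_, fun ξ hξ => ?_,
    fun ξ hξ => ?_, fun ξ hξ => ?_, ?_, ?_, fun i => ?_, ?_⟩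
  · refine eqOn_openStrip ?_ hF.F₁.diff hs.eq₁ ξ (hsub hξ)
    exact (((differentiableOn_dirD hX.ψ₀).add_const _).add (hL.w.diff.const_mul _)).add
      ((hL.w.diff.pow 2).const_mul _)
  · refine eq_b_iff.mpr ⟨eqOn_openStrip ?_ (hF.F₂ 0).diff hs.eq₂ ξ (hsub hξ),
      eqOn_openStrip ?_ (hF.F₂ 1).diff hs.eq₂' ξ (hsub hξ)⟩
    · exact ((((dl 1).sub ((hX.lam 0).diff.const_mul _)).add (DifferentiableOn.fun_sum fun j _ =>
        (hL.T 0 j).diff.mul (hX.differentiableOn_μ j))).add ((q 0).const_mul _)).add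
        ((hL.w.diff.const_mul _).mul (q 0))
    · exact ((((dl 0).neg.add (hX.lam 1).diff).add (DifferentiableOn.fun_sum fun j _ =>
        (hL.T 1 j).diff.mul (hX.differentiableOn_μ j))).add ((q 1).const_mul _)).add
        ((hL.w.diff.const_mul _).mul (q 1))
  · refine (eq_c_iff (α := α)).mpr fun i =>
      eqOn_openStrip ?_ (hF.F₃ i).diff (fun ξ hξ => hs.eq₃ ξ hξ i) ξ (hsub hξ)
    exact ((differentiableOn_dirD (hX.χ i)).neg.add (DifferentiableOn.fun_sum fun j _ =>
        (hL.S i j).diff.mul (hX.differentiableOn_μ j))).add (DifferentiableOn.fun_sum fun p _ =>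
        (hL.T p i).diff.mul (hX.lam p).diff)
  · obtain ⟨⟨hU, hE, hK⟩, -⟩ := hreg ξ (hsub hξ)
    refine (eq_d_iff (α := α) hU hE hK (eqOn_openStrip (hF.F₄ 0 1).diff (hF.F₄ 1 0).diff hsymm ξ (hsub hξ))
      (hΓ ξ (hsub hξ)) (hdΓ ξ (hsub hξ))).mpr ⟨eqOn_openStrip ?_ (hF.F₄ 0 0).diff hs.eq₄ ξ (hsub hξ),
        eqOn_openStrip ?_ (hF.F₄ 0 1).diff hs.eq₄' ξ (hsub hξ),
        eqOn_openStrip ?_ (hF.F₄ 1 1).diff hs.eq₄'' ξ (hsub hξ)⟩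
    · exact (((dG 1 0).sub ((hX.Γ 0 0).diff.const_mul _)).add (hX.differentiableOn_Q hL 0)).add
        (((q 0).pow 2).const_mul _)
    · exact ((((dG 0 0).neg.sub ((hX.Γ 0 1).diff.const_mul _)).add (hX.Γ 1 0).diff).add
        (hX.differentiableOn_Q hL 1)).add (((q 0).mul (q 1)).const_mul _)
    · exact (((dG 0 1).neg.sub ((hX.Γ 0 0).diff.const_mul _)).add (hX.differentiableOn_Q hL 2)).add
        (((q 1).pow 2).const_mul _)
  · have := hΓ ξ (strip_subset_openStrip hr hξ)
    simp only [Pi.neg_apply] at this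
    rw [this, neg_neg]
  · exact (mean_w_eq (H := H) (α := α)).trans hs.mean_w
  · exact (mean_ψ_eq (H := H) (α := α)).trans hs.mean_ψ
  · exact (mean_χ_eq (H := H) (α := α) (fun ξ hξ => (hreg ξ (h0 ξ hξ)).2) i).trans (hs.mean_χ i)
  · exact (mean_Γ_eq (H := H) (α := α)).trans hs.mean_Γ

theorem IsSolution.sol {r : ℝ} (hr : 0 ≤ r) (hX : IsSolution H ω α k φ F r X)
    (hreg : Regular H φ (strip m 0)) (hsymm : ∀ ξ ∈ strip m 0, F.F₄ 0 1 ξ = F.F₄ 1 0 ξ) :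
    (linOf H φ α).Sol ω k F X := by
  have hΓ : ∀ ξ ∈ strip m 0, X.Γ 1 1 ξ = -X.Γ 0 0 ξ := fun ξ hξ => by
    rw [hX.trace ξ fun j => (hξ j).trans hr, neg_neg]
  have hdΓ : ∀ ξ ∈ strip m 0, dirD ω (X.Γ 1 1) ξ = -dirD ω (X.Γ 0 0) ξ := fun ξ hξ =>
    (dirD_congr (g := fun η => -X.Γ 0 0 η) hΓ hξ).trans (dirD_neg _)
  have hb := fun ξ hξ => eq_b_iff.mp (hX.eq_b ξ (Or.inr hξ))
  have hd := fun ξ hξ => (eq_d_iff (α := α) (hreg ξ hξ).1.1 (hreg ξ hξ).1.2.1 (hreg ξ hξ).1.2.2 (hsymm ξ hξ)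
    (hΓ ξ hξ) (hdΓ ξ hξ)).mp (hX.eq_d ξ (Or.inr hξ))
  exact ⟨hX.mem_C1.ψ₀.torusC1, fun i => (hX.mem_C1.lam i).torusC1, fun i => (hX.mem_C1.χ i).torusC1,
    fun a b => (hX.mem_C1.Γ a b).torusC1, fun ξ hξ => hX.eq_a ξ (Or.inr hξ), fun ξ hξ => (hb ξ hξ).1,
    fun ξ hξ => (hb ξ hξ).2, fun ξ hξ => eq_c_iff.mp (hX.eq_c ξ (Or.inr hξ)), fun ξ hξ => (hd ξ hξ).1,
    fun ξ hξ => (hd ξ hξ).2.1, fun ξ hξ => (hd ξ hξ).2.2, hΓ, mean_w_eq.symm.trans hX.mean_w,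
    mean_ψ_eq.symm.trans hX.mean_ψ,
    fun i => (mean_χ_eq (fun ξ hξ => (hreg ξ hξ).2) i).symm.trans (hX.mean_χ i),
    mean_Γ_eq.symm.trans hX.mean_Γ⟩

end Solutions

end LowDimTori

end

noncomputable section

namespace LowDimTori

open MeasureTheory Set Filter Topology

variable {m : ℕ}

/-! ## Solution of the approximate linear problem -/

lemma exists_inverse_bound {A : Matrix (Fin m) (Fin m) ℂ} (hA : A.det ≠ 0) :
    ∃ CK : ℝ, 0 ≤ CK ∧ ∀ (v : Fin m → ℂ) (M : ℝ), (∀ i, ‖∑ j, A i j * v j‖ ≤ M) → ∀ j, ‖v j‖ ≤ CK * M := by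
  refine ⟨∑ j, ∑ i, ‖A⁻¹ j i‖, by positivity, fun v M h j => ?_⟩
  have hM : 0 ≤ M := (norm_nonneg _).trans (h j)
  have h1 : A⁻¹ *ᵥ (A *ᵥ v) = v := by
    rw [Matrix.mulVec_mulVec, Matrix.nonsing_inv_mul _ (isUnit_iff_ne_zero.mpr hA), Matrix.one_mulVec]
  calc ‖v j‖ = ‖∑ i, A⁻¹ j i * (A *ᵥ v) i‖ := by rw [← congrFun h1 j]; rfl
    _ ≤ ∑ i, ‖A⁻¹ j i‖ * M := (norm_sum_le _ _).trans (Finset.sum_le_sum fun i _ => by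
        rw [norm_mul]
        exact mul_le_mul_of_nonneg_left (h i) (norm_nonneg _))
    _ = (∑ i, ‖A⁻¹ j i‖) * M := by rw [Finset.sum_mul]
    _ ≤ _ := mul_le_mul_of_nonneg_right (Finset.single_le_sum
        (f := fun j => ∑ i, ‖A⁻¹ j i‖) (fun _ _ => by positivity) (Finset.mem_univ j)) hM

/-- Uniform solvability of the approximate linear problem near the unperturbed torus; the loss of
analyticity is measured by `θ = (σ₁ - σ₀)^{-1/2}`. -/
theorem exists_solution {ρ : ℝ} (hρ : 0 < ρ) {H₀ : (Fin m → ℂ) × ℂ → ℂ} {H₁ : Phase m → ℂ}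
    {ω : Fin m → ℝ} (h1 : CondH1 ρ H₀ H₁) (h2 : CondH2 ω H₀) (hK : (K₀ H₀).det ≠ 0)
    {σ : ℝ} (hσ : σ ≤ 1) {d : ℕ} (hd : 1 ≤ d) :
    ∃ B : ℝ, 0 ≤ B ∧ ∀ᶠ i in small m ρ (σ * ρ) d, ∀ k : ℂ, k.re ∈ Icc (0 : ℝ) 1 → |k.im| ≤ ρ →
      ∀ σ₀ σ₁ θ : ℝ, 0 ≤ σ₀ → σ₀ < σ₁ → σ₁ ≤ σ → 1 / 4 ≤ σ₁ → 1 ≤ θ → 1 / θ ^ 2 = σ₁ - σ₀ →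
      ∀ F : Rhs m, F.Mem (σ₁ * ρ) 0 → ∃ X : Unknown m,
        IsSolution (hamiltonian H₀ H₁ i.ε) ω i.α k i.φ F (σ₀ * ρ) X ∧
        (∀ Y : Unknown m, IsSolution (hamiltonian H₀ H₁ i.ε) ω i.α k i.φ F (σ₀ * ρ) Y →
          Y.EqOn (σ₀ * ρ) X) ∧
        X.funNorm (σ₀ * ρ) 0 + X.constNorm ≤
          ENNReal.ofReal (2 * (B * θ ^ (15 * m + 16))) * F.norm (σ₁ * ρ) 0 := by
  have hσρ : σ * ρ ≤ ρ := mul_le_of_le_one_left hρ.le hσ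
  obtain ⟨c₀, hc₀⟩ := h2.diophantine
  obtain ⟨A, hA⟩ := exists_dioph hc₀
  obtain ⟨CK, hCK, hK₀⟩ := exists_inverse_bound hK
  obtain ⟨C, hC, hbd⟩ := (h1.jet hρ).eventually_bd hd hρ.le hσρ
  -- With κ = ρ/4 and 1/θ² = σ₁ − σ₀ the three losses use 3/4 of (σ₁ − σ₀)ρ, so the closed strip σ₀ρ
  -- lies inside the open strip that remains. The width r₀ = ρ/4 is available since σ₁ ≥ 1/4, and 1
  -- + ρ bounds |k|.
  obtain ⟨B, hB, η, hη, h⟩ := exists_unique_bound hA (κ := ρ / 4) (by positivity) hC hCK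
    (S₀ := fun i j => S₀ H₀ i j) (t := t₀ H₀) hK₀ (r₀ := ρ / 4) (by positivity) (1 + ρ)
  refine ⟨B, hB, ?_⟩
  filter_upwards [hbd η hη, (h1.jet hρ).eventually_symm hd hσρ, eventually_W₁₁_ne hd]
    with i hL hs hne k hk hk' σ₀ σ₁ θ hσ₀ hlt hσ₁ hσ₁' hθ hθ' F hF
  have hreg : Regular (hamiltonian H₀ H₁ i.ε) i.φ (openStrip m (σ * ρ)) :=
    fun ξ hξ => ⟨hs ξ hξ, (hne ξ hξ).2⟩
  have hL := hL (t₀ H₀) hessZY_unperturbed_zero (h1.hessZY_unperturbed_one hρ)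
  simp only [hessYY_unperturbed] at hL
  obtain ⟨M, hM, hFM, hFn⟩ := hF.exists_bd
  have hκ : ρ / 4 / θ ^ 2 = ρ / 4 * (σ₁ - σ₀) := by rw [← hθ']; ring
  have hle : σ₁ * ρ ≤ σ * ρ := mul_le_mul_of_nonneg_right hσ₁ hρ.le
  have hr : 3 * (ρ / 4 / θ ^ 2) < σ₁ * ρ - σ₀ * ρ := by
    rw [hκ]
    nlinarith
  have hr0 : 0 ≤ σ₀ * ρ := by positivity
  have hkn : ‖k‖ ≤ 1 + ρ := by
    refine (Complex.norm_le_abs_re_add_abs_im k).trans (add_le_add ?_ hk')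
    rw [abs_of_nonneg hk.1]
    exact hk.2
  obtain ⟨X, hX, hXb, hXu⟩ := h k (linOf (hamiltonian H₀ H₁ i.ε) i.φ i.α) F θ (σ₁ * ρ) η M hk.1 hkn hθ
    (by nlinarith) (by linarith) le_rfl (hL.mono hle) hFM
  have hR : σ₀ * ρ < σ₁ * ρ - 3 * (ρ / 4 / θ ^ 2) := by linarith
  have hR' : σ₁ * ρ - 3 * (ρ / 4 / θ ^ 2) ≤ σ₁ * ρ := by
    have : 0 ≤ ρ / 4 / θ ^ 2 := by positivity
    linarith
  have hsymm : ∀ ξ ∈ strip m 0, F.F₄ 0 1 ξ = F.F₄ 1 0 ξ := fun ξ hξ =>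
    hF.symm ξ (fun j => (hξ j).trans (by linarith)) 0 1
  refine ⟨X, hX.isSolution ((hL.mono hle).mono hR') (hFM.mono hR') hXb (by linarith) hR
    (fun ξ hξ => hreg ξ (openStrip_mono (by linarith) hξ)) hsymm, fun Y hY => ?_, ?_⟩
  · have hYs := hY.sol hr0 (fun ξ hξ => hreg ξ (strip_subset_openStrip (by linarith) hξ)) hsymm
    exact (hXu Y hYs).extend hr0 (hXb.mem hR) hY.mem
  · refine (add_le_add (hXb.funNorm_le hR) hXb.constNorm_le).trans (le_of_eq ?_)
    have hN : 0 ≤ B * (θ ^ (15 * m + 16) * M) := by positivity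
    rw [hFn, ← ENNReal.ofReal_add hN hN, ← ENNReal.ofReal_mul (by positivity)]
    congr 1
    ring

end LowDimTori

end

theorem mainTheorem8 (n : ℕ) (hn : 2 ≤ n) (ρ : ℝ) (hρ : 0 < ρ)
    (H₀ : (Fin (n - 1) → ℂ) × ℂ → ℂ) (H₁ : LowDimTori.Phase (n - 1) → ℂ) (ω : Fin (n - 1) → ℝ)
    (hH1 : LowDimTori.CondH1 ρ H₀ H₁) (hH2 : LowDimTori.CondH2 ω H₀)
    (hK : (LowDimTori.K₀ H₀).det ≠ 0)
    (σ : ℝ) (hσ : σ ∈ Set.Icc (1 / 4 : ℝ) 1) (d : ℕ) (hd : 2 ≤ d) :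
    ∃ c : ℝ, 0 < c ∧ ∃ ε₀ : ℝ, 0 < ε₀ ∧ ∃ r₀ : ℝ, 0 < r₀ ∧
      ∀ ε : ℝ, |ε| ≤ ε₀ → ∀ α k : ℂ, (α, k) ∈ LowDimTori.slab ρ →
      ∀ φ : LowDimTori.Coord (n - 1), φ.Mem (σ * ρ) d →
        (φ.sub (LowDimTori.Coord.flat α)).norm (σ * ρ) d ≤ ENNReal.ofReal r₀ →
      ∀ σ₀ σ₁ : ℝ, 0 ≤ σ₀ → σ₀ < σ₁ → σ₁ ≤ σ → 1 / 4 ≤ σ₁ →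
      ∀ F : LowDimTori.Rhs (n - 1), F.Mem (σ₁ * ρ) 0 →
        ∃ X : LowDimTori.Unknown (n - 1),
          LowDimTori.IsSolution (LowDimTori.hamiltonian H₀ H₁ ε) ω α k φ F (σ₀ * ρ) X ∧
          (∀ Y : LowDimTori.Unknown (n - 1),
            LowDimTori.IsSolution (LowDimTori.hamiltonian H₀ H₁ ε) ω α k φ F (σ₀ * ρ) Y →
            Y.EqOn (σ₀ * ρ) X) ∧
          X.funNorm (σ₀ * ρ) 0 + X.constNorm ≤
            ENNReal.ofReal (c * (σ₁ - σ₀) ^ (-8 * (n : ℤ) - 12)) * F.norm (σ₁ * ρ) 0 := by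
  obtain ⟨B, hB, hsmall⟩ := LowDimTori.exists_solution hρ hH1 hH2 hK hσ.2 (one_le_two.trans hd)
  obtain ⟨δ, hδ, h⟩ := LowDimTori.eventually_small.mp hsmall
  -- The factor 2 adds the bounds for functions and constants; the 1 only makes c positive.
  refine ⟨2 * B + 1, by positivity, δ, hδ, δ, hδ, fun ε hε α k hk φ hφ hφn σ₀ σ₁ h0 hlt h1 h1' F hF => ?_⟩
  have hx : 0 < σ₁ - σ₀ := sub_pos.mpr hlt
  have hx1 : σ₁ - σ₀ ≤ 1 := by linarith [hσ.2]
  set θ : ℝ := (Real.sqrt (σ₁ - σ₀))⁻¹ with hθdef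
  have hθ2 : θ ^ 2 = (σ₁ - σ₀)⁻¹ := by rw [hθdef, inv_pow, Real.sq_sqrt hx.le]
  have hθ : 1 ≤ θ := (one_le_inv₀ (Real.sqrt_pos.mpr hx)).mpr (Real.sqrt_le_one.mpr hx1)
  obtain ⟨X, hX, hu, hb⟩ := h ⟨ε, α, φ⟩ ⟨hε, hk.1, hφ, hφn⟩ k hk.2.1 hk.2.2 σ₀ σ₁ θ h0 hlt h1 h1' hθ
    (by rw [hθ2, one_div, inv_inv]) F hF
  refine ⟨X, hX, hu, hb.trans ?_⟩
  gcongr ENNReal.ofReal ?_ * _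
  have hpow : (σ₁ - σ₀) ^ (-8 * (n : ℤ) - 12) = θ ^ (2 * (8 * n + 12)) := by
    rw [pow_mul, hθ2, ← zpow_natCast, inv_zpow', Nat.cast_add, Nat.cast_mul]
    congr 1
    push_cast
    ring
  rw [hpow]
  -- The chain of estimates gives the exponent 15n + 1, below the 16n + 24 allowed, and θ ≥ 1.
  have h2 : θ ^ (15 * (n - 1) + 16) ≤ θ ^ (2 * (8 * n + 12)) := pow_le_pow_right₀ hθ (by lia)
  have h3 : 0 ≤ θ ^ (2 * (8 * n + 12)) := by positivity
  nlinarith
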